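/- Let $k\ge 1$ and let $\mathcal P=\langle x_1,\dots,x_k\mid r\rangle$ be a one-relator presentation, where $r$ is a (not necessarily reduced) word in the letters $x_1^{\pm1},\dots,x_k^{\pm1}$ and every generator $x_i$ occurs in $r$, with exponent $1$ or $-1$. Let $K_{\mathcal P}$ be the presentation complex of $\mathcal P$, that is, the space obtained from a wedge of $k$ circles, one for each generator, by attaching a $2$-cell along the closed path spelled out by $r$. It is regarded as a compact polyhedron with its standard piecewise linear structure: the circles are subdivided into edges, the $2$-cell is a triangulated disc attached along a simplicial closed path, and the resulting finite simplicial complex is realized linearly in a real vector space, with triangulations of polyhedra understood to be finite rectilinear ones. A subset $Q$ of a polyhedron $P$ is a subpolyhedron if it is the underlying space of a subcomplex of some triangulation of $P$. An elementary collapse of a finite simplicial complex removes two simplices $\sigma\subsetneq\tau$ such that $\tau$ is the only simplex of the complex that properly contains $\sigma$. A polyhedron is PL collapsible if it has a triangulation that can be reduced to a single vertex by a finite sequence of elementary collapses. Then there are PL collapsible subpolyhedra $Q_1,Q_2$ of $K_{\mathcal P}$ with $K_{\mathcal P}=Q_1\cup Q_2$ if and only if at least one of the following holds: 1. $r$ admits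 an algebraic collapse, that is, some generator occurs exactly once in $r$ (counting occurrences with exponent $1$ and with exponent $-1$ together); 2. $k=1$ and $r$ is the word $xx^{-1}$ or the word $x^{-1}x$, where $x=x_1$. -/

import Mathlib

/-! ### Collapses, polyhedra and subpolyhedra -/

section PL

variable {E : Type*} [AddCommGroup E] [Module ℝ E]

/-- Elementary collapse `K ↘ L`: `K` has a face `σ` that is properly contained in exactly one
face `τ` of `K` (a free face), and `L` is obtained from `K` by removing `σ` and `τ`. -/
def ElementaryCollapse (K L : Geometry.SimplicialComplex ℝ E) : Prop :=
  ∃ σ ∈ K.faces, ∃ τ ∈ K.faces, σ ⊂ τ ∧ (∀ ρ ∈ K.faces, σ ⊂ ρ → ρ = τ) ∧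
    L.faces = K.faces \ {σ, τ}

/-- `K` collapses to `L` through a finite (possibly empty) sequence of elementary collapses. -/
def Collapses (K L : Geometry.SimplicialComplex ℝ E) : Prop :=
  Relation.ReflTransGen ElementaryCollapse K L

/-- A finite simplicial complex is collapsible if it collapses to a complex that consists of
a single vertex. -/
def Collapsible (K : Geometry.SimplicialComplex ℝ E) : Prop :=
  K.faces.Finite ∧ ∃ (v : E) (L : Geometry.SimplicialComplex ℝ E), L.faces = {{v}} ∧ Collapses K L

/-- `K` is a triangulation of the set `P`: a finite (rectilinear) simplicial complex with
underlying space `P`. -/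
def Triangulates (K : Geometry.SimplicialComplex ℝ E) (P : Set E) : Prop :=
  K.faces.Finite ∧ K.space = P

/-- `Q` is a subpolyhedron of `P`: the underlying space of a subcomplex of some triangulation
of `P`. -/
def IsSubpolyhedron (Q P : Set E) : Prop :=
  ∃ K L : Geometry.SimplicialComplex ℝ E, Triangulates K P ∧ L ≤ K ∧ L.space = Q

/-- A polyhedron is PL collapsible if some triangulation of it collapses to a vertex. -/
def PLCollapsible (Q : Set E) : Prop :=
  ∃ K : Geometry.SimplicialComplex ℝ E, Triangulates K Q ∧ Collapsible K

/-- `P` is the union of two PL collapsible subpolyhedra. -/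
def CoveredByTwoPLCollapsibles (P : Set E) : Prop :=
  ∃ Q₁ Q₂ : Set E, IsSubpolyhedron Q₁ P ∧ IsSubpolyhedron Q₂ P ∧
    PLCollapsible Q₁ ∧ PLCollapsible Q₂ ∧ Q₁ ∪ Q₂ = P

end PL

/-! ### The presentation complex of a one-relator presentation

A word in the generators `x₁, …, x_k` and their formal inverses is a list of letters
`(i, b) : Fin k × Bool`, where `(i, true)` stands for `x_i` and `(i, false)` for `x_i⁻¹`
(the convention of `FreeGroup`). Words are not assumed to be reduced. -/

/-- The simplicial complex generated by a set `G` of simplices: all nonempty subsets of members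
of `G`. -/
def generatedComplex {ι : Type*} (G : Set (Finset ι)) : PreAbstractSimplicialComplex ι where
  faces := {s | s.Nonempty ∧ ∃ t ∈ G, s ⊆ t}
  isRelLowerSet_faces := fun _ hs =>
    ⟨hs.1, fun _ hbs hb => ⟨hb, hs.2.imp fun _ ht => ⟨ht.1, hbs.trans ht.2⟩⟩⟩

/-- Vertices of a triangulated disc whose boundary circle has `n` edges. -/
inductive DiscVertex (n : ℕ) : Type
  | boundary (i : ZMod n)
  | collar (i : ZMod n)
  | centre
  deriving DecidableEq

/-- For `n ≥ 3`, a triangulated disc: an annulus between the boundary `n`-gon and an inner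
`n`-gon, together with the cone over the inner `n`-gon. -/
def discComplex (n : ℕ) : PreAbstractSimplicialComplex (DiscVertex n) :=
  generatedComplex {t | ∃ i : ZMod n,
    t = {.boundary i, .boundary (i + 1), .collar i} ∨
    t = {.boundary (i + 1), .collar i, .collar (i + 1)} ∨
    t = {.collar i, .collar (i + 1), .centre}}

/-- Vertices of the triangulated presentation complex of a presentation with `k` generators and
one relator: the wedge point, two subdivision points on each of the `k` loops, and the interior
vertices of the disc attached along the relator. -/
inductive PresVertex (k n : ℕ) : Type
  | base
  | loop (x : Fin k) (j : Fin 2)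
  | collar (i : ZMod n)
  | centre
  deriving DecidableEq

/-- The wedge of `k` circles; the loop of the generator `x`, run through in its positive
direction, is `base, loop x 0, loop x 1, base`. -/
def wedgeOfCircles (k n : ℕ) : PreAbstractSimplicialComplex (PresVertex k n) :=
  generatedComplex {t | ∃ x : Fin k,
    t = {.base, .loop x 0} ∨ t = {.loop x 0, .loop x 1} ∨ t = {.loop x 1, .base}}

/-- The vertex at position `j` (for `j = 0, 1, 2`) of the closed edge path spelled out by a
letter: the loop of the generator if the exponent is `+1`, the reversed loop if it is `-1`. -/
def letterVertex {k : ℕ} (n : ℕ) (l : Fin k × Bool) (j : ℕ) : PresVertex k n :=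
  if j = 0 then .base
  else if j = 1 then .loop l.1 (if l.2 then 0 else 1)
  else .loop l.1 (if l.2 then 1 else 0)

/-- The `i`-th vertex of the closed edge path of length `3 * r.length`, based at the wedge
point, that is spelled out by the word `r`. -/
def wordVertex {k : ℕ} (n : ℕ) (r : List (Fin k × Bool)) (i : ℕ) : PresVertex k n :=
  match r[i / 3]? with
  | some l => letterVertex n l (i % 3)
  | none => .base

/-- The characteristic map of the 2-cell: on the boundary of the disc it is the loop spelled out
by `r`, and it is injective on the other vertices. -/
def characteristicMap {k : ℕ} (r : List (Fin k × Bool)) :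
    DiscVertex (3 * r.length) → PresVertex k (3 * r.length)
  | .boundary i => wordVertex _ r i.val
  | .collar i => .collar i
  | .centre => .centre

/-- The presentation complex of `⟨x₁, …, x_k | r⟩` for a nonempty word `r`, as a simplicial
complex: the wedge of `k` circles with a disc attached along the loop spelled out by `r`. The
circles are subdivided into three edges each, so that the attaching map is injective on every
edge and the identifications on the boundary of the disc give a simplicial complex. -/
def presentationComplex {k : ℕ} (r : List (Fin k × Bool)) :
    PreAbstractSimplicialComplex (PresVertex k (3 * r.length)) :=
  wedgeOfCircles k _ ⊔ (discComplex (3 * r.length)).map (characteristicMap r)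

/-- The presentation complex as a polyhedron: the geometric realization in the real vector space
with basis the set of vertices. -/
noncomputable def presentationPolyhedron {k : ℕ} (r : List (Fin k × Bool)) :
    Set (PresVertex k (3 * r.length) →₀ ℝ) :=
  (Geometry.SimplicialComplex.onFinsupp (𝕜 := ℝ) (presentationComplex r)).space

/-- `r` admits an algebraic collapse: some generator occurs exactly once in `r`, where
occurrences with exponent `1` and with exponent `-1` both count. -/
def AdmitsAlgebraicCollapse {k : ℕ} (r : List (Fin k × Bool)) : Prop :=
  ∃ x : Fin k, (r.map Prod.fst).count x = 1

/-- The presentation has a single generator `x`, and the relator is the word `x x⁻¹` or the word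
`x⁻¹ x`. -/
def IsExceptionalPresentation {k : ℕ} (r : List (Fin k × Bool)) : Prop :=
  k = 1 ∧ ∃ (x : Fin k) (b : Bool), r = [(x, b), (x, !b)]

/-! Sufficiency. Being a union of two collapsible polyhedra is preserved by elementary expansions.
When a triangle is attached along two edges, these edges may already be subdivided and coloured by
the two members of the cover. The triangle can be cut into pieces so that each piece, coloured like
the old edge it touches, is an expansion of its own colour class (`Colored.fill`, `Good.triangle`).
If `x` occurs exactly once in `r`, the presentation complex arises by such expansions from the wedge
of circles with one edge of the circle of `x` removed, and this graph is a union of two trees. For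
`x x⁻¹` the complex is a sphere with two points identified, and two collapsible halves are written
down.

Necessity. Collapsibility of the two members is used in two ways. First, in the absence of an
algebraic collapse the complex has no free face. This is visible in the local cones of directions,
hence independent of the triangulation, so the whole complex is not PL collapsible and both members
of the cover are proper (`not_plCollapsible_presentation`). Second, on a collapsible set every
nowhere vanishing continuous complex function has a continuous logarithm (`HasLogs`), which plays
the role of vanishing first cohomology. A proper closed subset with logarithms misses a point of the
open 2-cell. Retracting the punctured disc to its boundary shows that it cannot contain the whole
loop of a generator (`exists_loopPoint_notMem`). So the loop of `x` splits into `M x ≥ 2` arcs of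
alternating colours.

Pull these arcs back to the boundary circle of the disc. Let `S` be the number of colour changes
around the circle. Give arcs the same label when they come from the same interior arc of a loop, or
when they come from end arcs of loops (which contain the wedge point) and have the same colour; let
`L` be the number of labels. Then `S + 2 ≤ 2 * L` (`CircleData.card_switches_le`). The proof is
linear algebra over `ZMod 2`. Functions on arcs that change only together with the colour form a
space of dimension at least `S`. Logarithms on the two members split each of them into a function of
the label and a function that lifts to locally constant functions on the two parts of the disc. The
jumps of liftable functions form an isotropic space for the dot product, because logarithms exist on
the disc; so its dimension is at most `S / 2`. The kernel of the jump map consists of constants, and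
the two colour indicators are both liftable and functions of the label.

Since every generator occurs at least twice, comparing `S` and `L` forces one generator, two
letters, equal colours at both junctions and both colours among the end arcs. Letters of equal sign
would make the two end colours equal, so the word is `x x⁻¹` or `x⁻¹ x` (`isExceptional_of_count`).
-/

namespace PLCover

open Geometry

/-! ### Attaching simplices to a complex covered by two collapsible subcomplexes. -/

section Attach

variable {E : Type*} [AddCommGroup E] [Module ℝ E]

/-- The subcomplex of `M` with a prescribed set of faces. -/
def restrict (M : SimplicialComplex ℝ E) (S : Set (Finset E)) (h : S ⊆ M.faces)
    (hl : ∀ s ∈ S, ∀ t ⊆ s, t.Nonempty → t ∈ S) : SimplicialComplex ℝ E where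
  faces := S
  isRelLowerSet_faces := fun s hs => ⟨M.nonempty_of_mem_faces (h hs), fun t hts ht => hl s hs t hts ht⟩
  indep := fun hs => M.indep (h hs)
  inter_subset_convexHull := fun hs ht => M.inter_subset_convexHull (h hs) (h ht)

/-- As `L` is closed under passing to faces, no face of `L` contains `σ`. Freeness of `σ` is
therefore automatic. -/
theorem elementaryCollapse_of_faces_eq {K L : SimplicialComplex ℝ E} {σ τ : Finset E}
    (h : K.faces = L.faces ∪ {σ, τ}) (hστ : σ ⊂ τ) (hσn : σ.Nonempty) (hσ : σ ∉ L.faces) :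
    ElementaryCollapse K L := by
  have hup : ∀ ρ ∈ L.faces, ¬ σ ⊆ ρ := fun ρ hρ hs => hσ (L.down_closed hρ hs hσn)
  refine ⟨σ, by simp [h], τ, by simp [h], hστ, ?_, ?_⟩
  · intro ρ hρ hσρ
    rw [h] at hρ
    rcases hρ with hρ | hρ | hρ
    · exact absurd hσρ.1 (hup ρ hρ)
    · exact absurd (hρ ▸ hσρ) (fun h => h.2 (Finset.Subset.refl _))
    · exact hρ
  · rw [h]
    ext ρ
    simp only [Set.mem_sdiff, Set.mem_union, Set.mem_insert_iff, Set.mem_singleton_iff]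
    constructor
    · intro hρ
      refine ⟨Or.inl hρ, ?_⟩
      rintro (rfl | rfl)
      · exact hσ hρ
      · exact hup _ hρ hστ.1
    · rintro ⟨h1 | h1, h2⟩
      · exact h1
      · exact absurd h1 h2

/-- A simplex all of whose proper faces belong to a complex `M`, and which meets `M` only in
these faces, can be added to `M`. -/
theorem exists_attach (M : SimplicialComplex ℝ E) (τ : Finset E) (hτ : τ.Nonempty)
    (hind : AffineIndependent ℝ ((↑) : τ → E))
    (hbd : ∀ ρ ⊆ τ, ρ.Nonempty → ρ ≠ τ → ρ ∈ M.faces)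
    (hint : ∀ x ∈ convexHull ℝ (τ : Set E), x ∈ M.space →
      ∃ ρ ∈ M.faces, ρ ⊆ τ ∧ x ∈ convexHull ℝ (ρ : Set E)) :
    ∃ M' : SimplicialComplex ℝ E, M'.faces = insert τ M.faces := by
  -- A point common to `τ` and `m` already lies in a face `ρ ⊆ τ` of `M`, so the intersection
  -- property of `M` applies to `ρ` and `m`.
  have key : ∀ m ∈ M.faces, ∀ x ∈ convexHull ℝ (τ : Set E), x ∈ convexHull ℝ (m : Set E) →
      x ∈ convexHull ℝ (τ ∩ m : Set E) := by
    intro m hm x hx hxm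
    obtain ⟨ρ, hρ, hρτ, hxρ⟩ := hint x hx (SimplicialComplex.mem_space_iff.2 ⟨m, hm, hxm⟩)
    refine convexHull_mono ?_ (M.inter_subset_convexHull hρ hm ⟨hxρ, hxm⟩)
    exact Set.inter_subset_inter_left _ (by exact_mod_cast hρτ)
  refine ⟨{ faces := insert τ M.faces, isRelLowerSet_faces := ?_, indep := ?_,
            inter_subset_convexHull := ?_ }, rfl⟩
  · rintro s (rfl | hs)
    · refine ⟨hτ, fun t hts ht => ?_⟩
      by_cases h : t = s
      · exact Or.inl h
      · exact Or.inr (hbd t hts ht h)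
    · exact ⟨M.nonempty_of_mem_faces hs, fun t hts ht => Or.inr (M.down_closed hs hts ht)⟩
  · rintro s (rfl | hs)
    · exact hind
    · exact M.indep hs
  · rintro s t (rfl | hs) (rfl | ht)
    · rintro x ⟨hx, -⟩; simpa using hx
    · rintro x ⟨hx, hx'⟩; exact key t ht x hx hx'
    · rintro x ⟨hx, hx'⟩
      rw [Set.inter_comm]
      exact key s hs x hx' hx
    · exact M.inter_subset_convexHull hs ht

/-- A finite simplicial complex written as the union of two subcomplexes, indexed by `Bool`, each
of which collapses to a vertex. -/
structure Colored (E : Type*) [AddCommGroup E] [Module ℝ E] where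
  M : SimplicialComplex ℝ E
  c : Bool → SimplicialComplex ℝ E
  fin : M.faces.Finite
  le : ∀ b, (c b).faces ⊆ M.faces
  cover : ∀ m ∈ M.faces, ∃ b, m ∈ (c b).faces
  collapse : ∀ b, ∃ (v : E) (L : SimplicialComplex ℝ E), L.faces = {{v}} ∧ Collapses (c b) L

/-- All growth goes through this lemma: one class is replaced by a complex that collapses onto it,
and the other class is untouched. -/
theorem Colored.extend (C : Colored E) (M' D : SimplicialComplex ℝ E) (b : Bool)
    (hM : C.M.faces ⊆ M'.faces) (hfin : M'.faces.Finite) (hD : D.faces ⊆ M'.faces)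
    (hcov : ∀ m ∈ M'.faces, m ∈ C.M.faces ∨ m ∈ D.faces) (hle : (C.c b).faces ⊆ D.faces)
    (hcoll : Collapses D (C.c b)) :
    ∃ C' : Colored E, C'.M = M' ∧ C'.c b = D ∧ C'.c (!b) = C.c (!b) := by
  refine ⟨⟨M', Function.update C.c b D, hfin, ?_, ?_, ?_⟩, rfl, by simp, by simp⟩
  · intro b'
    by_cases h : b' = b
    · subst h; simpa using hD
    · rw [Function.update_of_ne h]; exact (C.le b').trans hM
  · intro m hm
    rcases hcov m hm with h | h
    · obtain ⟨b', hb'⟩ := C.cover m h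
      by_cases hb : b' = b
      · subst hb; exact ⟨b', by simpa using hle hb'⟩
      · exact ⟨b', by simpa [Function.update_of_ne hb] using hb'⟩
    · exact ⟨b, by simpa using h⟩
  · intro b'
    by_cases h : b' = b
    · subst h
      obtain ⟨v, L, hL, hcl⟩ := C.collapse b'
      exact ⟨v, L, hL, by rw [Function.update_self]; exact hcoll.trans hcl⟩
    · rw [Function.update_of_ne h]; exact C.collapse b'

theorem singleton_mem_of_mem {M : SimplicialComplex ℝ E} {s : Finset E} (hs : s ∈ M.faces) {x : E}
    (hx : x ∈ s) : {x} ∈ M.faces :=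
  M.down_closed hs (by simpa using hx) (by simp)

theorem space_insert {M M' : SimplicialComplex ℝ E} {τ : Finset E}
    (h : M'.faces = insert τ M.faces) : M'.space = M.space ∪ convexHull ℝ (τ : Set E) := by
  simp only [SimplicialComplex.space, h, Set.biUnion_insert]
  rw [Set.union_comm]

variable [DecidableEq E]

theorem affineIndependent_pair {q s : E} (h : q ≠ s) :
    AffineIndependent ℝ ((↑) : ({q, s} : Finset E) → E) := by
  have := (affineIndependent_of_ne ℝ h).range
  have hr : Set.range ![q, s] = (({q, s} : Finset E) : Set E) := by
    ext x; simp only [Matrix.range_cons, Matrix.range_empty, Finset.coe_insert, Finset.coe_singleton]; simp [or_comm]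
  rw [hr] at this
  exact this

theorem subset_pair_cases {α : Type*} [DecidableEq α] {q s : α} {ρ : Finset α} (h : ρ ⊆ {q, s})
    (hn : ρ.Nonempty) : ρ = {q} ∨ ρ = {s} ∨ ρ = {q, s} := by
  by_cases hq : q ∈ ρ <;> by_cases hs : s ∈ ρ
  · right; right; exact Finset.Subset.antisymm h (by simp [Finset.insert_subset_iff, hq, hs])
  · left; ext x; constructor
    · intro hx; rcases Finset.mem_insert.1 (h hx) with rfl | h'
      · simp
      · rw [Finset.mem_singleton.1 h'] at hx; exact absurd hx hs
    · intro hx; rwa [Finset.mem_singleton.1 hx]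
  · right; left; ext x; constructor
    · intro hx; rcases Finset.mem_insert.1 (h hx) with rfl | h'
      · exact absurd hx hq
      · exact h'
    · intro hx; rwa [Finset.mem_singleton.1 hx]
  · exfalso; obtain ⟨x, hx⟩ := hn
    rcases Finset.mem_insert.1 (h hx) with rfl | h'
    · exact hq hx
    · rw [Finset.mem_singleton.1 h'] at hx; exact hs hx

theorem subset_triple_cases {α : Type*} [DecidableEq α] {p q s : α} {ρ : Finset α}
    (h : ρ ⊆ {p, q, s}) (hn : ρ.Nonempty) :
    ρ = {p} ∨ ρ = {q} ∨ ρ = {s} ∨ ρ = {p, q} ∨ ρ = {q, s} ∨ ρ = {p, s} ∨ ρ = {p, q, s} := by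
  by_cases hp : p ∈ ρ
  · have h' : ρ.erase p ⊆ {q, s} := by
      intro x hx
      have := h (Finset.mem_of_mem_erase hx)
      rcases Finset.mem_insert.1 this with rfl | h2
      · simp at hx
      · exact h2
    have hρ : insert p (ρ.erase p) = ρ := Finset.insert_erase hp
    rcases (ρ.erase p).eq_empty_or_nonempty with h0 | h0
    · left; rw [← hρ, h0]; rfl
    · rcases subset_pair_cases h' h0 with h1 | h1 | h1 <;> rw [h1] at hρ <;> simp [← hρ]
  · have h' : ρ ⊆ {q, s} := by
      intro x hx
      rcases Finset.mem_insert.1 (h hx) with rfl | h2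
      · exact absurd hx hp
      · exact h2
    rcases subset_pair_cases h' hn with h1 | h1 | h1 <;> simp [h1]

/-- Attach a whisker `{q, s}` with new end point `s`. -/
theorem Colored.attach_whisker (C : Colored E) (b : Bool) {q s : E} (hqs : q ≠ s)
    (hq : {q} ∈ (C.c b).faces)
    (hint : ∀ x ∈ segment ℝ q s, x ∈ C.M.space → x = q) :
    ∃ C' : Colored E, C'.M.faces = C.M.faces ∪ {{s}, {q, s}} ∧
      C'.M.space = C.M.space ∪ segment ℝ q s ∧
      (C'.c b).faces = (C.c b).faces ∪ {{s}, {q, s}} ∧ C'.c (!b) = C.c (!b) := by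
  have hs : s ∉ C.M.space := fun h => hqs (hint s (right_mem_segment ℝ q s) h).symm
  have hs' : {s} ∉ C.M.faces := fun h =>
    hs (C.M.subset_space h (by simp))
  obtain ⟨M1, hM1⟩ := exists_attach C.M {s} (by simp)
    (by
      have : Subsingleton ({s} : Finset E) := ⟨fun a b => by
        have := Finset.mem_singleton.1 a.2; have := Finset.mem_singleton.1 b.2; ext; simp_all⟩
      exact affineIndependent_of_subsingleton ℝ _)
    (by
      intro ρ hρ hn hne
      exact absurd ((Finset.subset_singleton_iff.1 hρ).resolve_left hn.ne_empty) hne)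
    (by
      intro x hx hxM
      simp only [Finset.coe_singleton, convexHull_singleton, Set.mem_singleton_iff] at hx
      subst hx; exact absurd hxM hs)
  have hqM : {q} ∈ C.M.faces := C.le b hq
  obtain ⟨M2, hM2⟩ := exists_attach M1 {q, s} (by simp) (affineIndependent_pair hqs)
    (by
      intro ρ hρ hn hne
      rw [hM1]
      rcases subset_pair_cases hρ hn with rfl | rfl | rfl
      · exact Or.inr hqM
      · exact Or.inl rfl
      · exact absurd rfl hne)
    (by
      intro x hx hxM
      rw [space_insert hM1] at hxM
      simp only [Finset.coe_insert, Finset.coe_singleton, convexHull_pair] at hx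
      rcases hxM with h | h
      · rw [hint x hx h]
        exact ⟨{q}, by rw [hM1]; exact Or.inr hqM, by simp, by simp⟩
      · exact ⟨{s}, by rw [hM1]; exact Or.inl rfl, by simp, h⟩)
  have hfaces : M2.faces = C.M.faces ∪ {{s}, {q, s}} := by
    rw [hM2, hM1]; ext; simp; tauto
  have hsub : (C.c b).faces ∪ {{s}, {q, s}} ⊆ M2.faces := by
    rw [hfaces]; exact Set.union_subset_union_left _ (C.le b)
  let D := restrict M2 ((C.c b).faces ∪ {{s}, {q, s}}) hsub (by
    rintro t (ht | rfl | rfl) u hu hn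
    · exact Or.inl ((C.c b).down_closed ht hu hn)
    · rw [(Finset.subset_singleton_iff.1 hu).resolve_left hn.ne_empty]; simp
    · rcases subset_pair_cases hu hn with rfl | rfl | rfl
      · exact Or.inl hq
      · simp
      · simp)
  have hcoll : ElementaryCollapse D (C.c b) := by
    refine elementaryCollapse_of_faces_eq (σ := {s}) (τ := {q, s}) rfl ?_ (by simp)
      (fun h => hs' (C.le b h))
    rw [Finset.ssubset_iff_of_subset (by simp)]
    exact ⟨q, by simp, by simpa using hqs⟩
  obtain ⟨C', h1, h2, h3⟩ := C.extend M2 D b (by rw [hfaces]; exact Set.subset_union_left)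
    (by rw [hfaces]; exact C.fin.union (by simp)) hsub
    (by
      intro m hm
      rw [hfaces] at hm
      rcases hm with h | h
      · exact Or.inl h
      · exact Or.inr (Or.inr h))
    Set.subset_union_left (Relation.ReflTransGen.single hcoll)
  refine ⟨C', by rw [h1, hfaces], ?_, by rw [h2]; rfl, h3⟩
  rw [h1, space_insert hM2, space_insert hM1, Set.union_assoc]
  congr 1
  simp only [Finset.coe_insert, Finset.coe_singleton, convexHull_pair, convexHull_singleton]
  rw [Set.union_eq_right, Set.singleton_subset_iff]
  exact right_mem_segment ℝ q s

/-- Attach a new edge to two vertices, one of which does not belong to the subcomplex that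
receives the edge. -/
theorem Colored.attach_edge (C : Colored E) (b : Bool) {q s : E} (hqs : q ≠ s)
    (hq : {q} ∈ (C.c b).faces) (hsM : {s} ∈ C.M.faces) (hs : {s} ∉ (C.c b).faces)
    (hint : ∀ x ∈ segment ℝ q s, x ∈ C.M.space → x = q ∨ x = s) :
    ∃ C' : Colored E, C'.M.faces = C.M.faces ∪ {{q, s}} ∧
      (C'.c b).faces = (C.c b).faces ∪ {{s}, {q, s}} ∧ C'.c (!b) = C.c (!b) := by
  have hqM : {q} ∈ C.M.faces := C.le b hq
  obtain ⟨M2, hM2⟩ := exists_attach C.M {q, s} (by simp) (affineIndependent_pair hqs)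
    (by
      intro ρ hρ hn hne
      rcases subset_pair_cases hρ hn with rfl | rfl | rfl
      · exact hqM
      · exact hsM
      · exact absurd rfl hne)
    (by
      intro x hx hxM
      simp only [Finset.coe_insert, Finset.coe_singleton, convexHull_pair] at hx
      rcases hint x hx hxM with rfl | rfl
      · exact ⟨{x}, hqM, by simp, by simp⟩
      · exact ⟨{x}, hsM, by simp, by simp⟩)
  have hfaces : M2.faces = C.M.faces ∪ {{q, s}} := by
    rw [hM2]; ext; simp
  have hsub : (C.c b).faces ∪ {{s}, {q, s}} ⊆ M2.faces := by
    rw [hfaces]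
    rintro m (hm | rfl | rfl)
    · exact Or.inl (C.le b hm)
    · exact Or.inl hsM
    · exact Or.inr rfl
  let D := restrict M2 ((C.c b).faces ∪ {{s}, {q, s}}) hsub (by
    rintro t (ht | rfl | rfl) u hu hn
    · exact Or.inl ((C.c b).down_closed ht hu hn)
    · rw [(Finset.subset_singleton_iff.1 hu).resolve_left hn.ne_empty]; simp
    · rcases subset_pair_cases hu hn with rfl | rfl | rfl
      · exact Or.inl hq
      · simp
      · simp)
  have hcoll : ElementaryCollapse D (C.c b) := by
    refine elementaryCollapse_of_faces_eq (σ := {s}) (τ := {q, s}) rfl ?_ (by simp) hs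
    rw [Finset.ssubset_iff_of_subset (by simp)]
    exact ⟨q, by simp, by simpa using hqs⟩
  obtain ⟨C', h1, h2, h3⟩ := C.extend M2 D b (by rw [hfaces]; exact Set.subset_union_left)
    (by rw [hfaces]; exact C.fin.union (by simp)) hsub
    (by
      intro m hm
      rw [hfaces] at hm
      rcases hm with h | rfl
      · exact Or.inl h
      · exact Or.inr (Or.inr (Or.inr rfl)))
    Set.subset_union_left (Relation.ReflTransGen.single hcoll)
  exact ⟨C', by rw [h1, hfaces], by rw [h2]; rfl, h3⟩

/-- Attach a triangle along two of its edges. -/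
theorem Colored.attach_triangle (C : Colored E) (b : Bool) {p q s : E}
    (hind : AffineIndependent ℝ ((↑) : ({p, q, s} : Finset E) → E))
    (hpq' : p ≠ q) (hqs' : q ≠ s) (hps' : p ≠ s)
    (hpq : {p, q} ∈ (C.c b).faces) (hqs : {q, s} ∈ C.M.faces)
    (hs : {s} ∈ (C.c b).faces → {q, s} ∈ (C.c b).faces) (hps : {p, s} ∉ C.M.faces)
    (hint : ∀ x ∈ convexHull ℝ {p, q, s}, x ∈ C.M.space → x ∈ segment ℝ p q ∨ x ∈ segment ℝ q s) :
    ∃ C' : Colored E, C'.M.faces = C.M.faces ∪ {{p, s}, {p, q, s}} ∧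
      C'.M.space = C.M.space ∪ convexHull ℝ {p, q, s} ∧
      (C'.c b).faces = (C.c b).faces ∪ {{s}, {q, s}, {p, s}, {p, q, s}} ∧
      C'.c (!b) = C.c (!b) := by
  have hpqM := C.le b hpq
  have hp1 : {p} ∈ C.M.faces := singleton_mem_of_mem hpqM (by simp)
  have hq1 : {q} ∈ C.M.faces := singleton_mem_of_mem hpqM (by simp)
  have hs1 : {s} ∈ C.M.faces := singleton_mem_of_mem hqs (by simp)
  have hint' : ∀ x ∈ convexHull ℝ {p, q, s}, x ∈ C.M.space →
      ∃ ρ ∈ C.M.faces, (ρ = {p, q} ∨ ρ = {q, s}) ∧ x ∈ convexHull ℝ (ρ : Set E) := by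
    intro x hx hxM
    rcases hint x hx hxM with h | h
    · exact ⟨{p, q}, hpqM, Or.inl rfl, by simpa [convexHull_pair] using h⟩
    · exact ⟨{q, s}, hqs, Or.inr rfl, by simpa [convexHull_pair] using h⟩
  have hsubps : ({p, s} : Finset E) ⊆ {p, q, s} := by
    intro x; simp; tauto
  obtain ⟨M1, hM1⟩ := exists_attach C.M {p, s} (by simp) (affineIndependent_pair hps')
    (by
      intro ρ hρ hn hne
      rcases subset_pair_cases hρ hn with rfl | rfl | rfl
      · exact hp1
      · exact hs1
      · exact absurd rfl hne)
    (by
      intro x hx hxM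
      have hxT : x ∈ convexHull ℝ ({p, q, s} : Set E) :=
        convexHull_mono (by simpa using Finset.coe_subset.2 hsubps) (by simpa using hx)
      obtain ⟨ρ, hρ, hρ', hxρ⟩ := hint' x hxT hxM
      have hρsub : ρ ⊆ {p, q, s} := by
        rcases hρ' with rfl | rfl <;> intro y <;> simp <;> tauto
      have hmem := hind.convexHull_inter (R := ℝ) hρsub hsubps
      have hx2 : x ∈ convexHull ℝ ((ρ : Set E) ∩ (({p, s} : Finset E) : Set E)) := by
        rw [hmem]; exact ⟨hxρ, hx⟩
      rw [← Finset.coe_inter] at hx2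
      have hne : (ρ ∩ {p, s}).Nonempty := by
        rw [← Finset.coe_nonempty]; exact convexHull_nonempty_iff.1 ⟨x, hx2⟩
      exact ⟨ρ ∩ {p, s}, C.M.down_closed hρ Finset.inter_subset_left hne,
        Finset.inter_subset_right, hx2⟩)
  obtain ⟨M2, hM2⟩ := exists_attach M1 {p, q, s} (by simp) hind
    (by
      intro ρ hρ hn hne
      rw [hM1]
      rcases subset_triple_cases hρ hn with rfl | rfl | rfl | rfl | rfl | rfl | rfl
      · exact Or.inr hp1
      · exact Or.inr hq1
      · exact Or.inr hs1
      · exact Or.inr hpqM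
      · exact Or.inr hqs
      · exact Or.inl rfl
      · exact absurd rfl hne)
    (by
      intro x hx hxM
      rw [space_insert hM1] at hxM
      rcases hxM with h | h
      · obtain ⟨ρ, hρ, hρ', hxρ⟩ := hint' x (by simpa using hx) h
        refine ⟨ρ, by rw [hM1]; exact Or.inr hρ, ?_, hxρ⟩
        rcases hρ' with rfl | rfl <;> intro y <;> simp <;> tauto
      · exact ⟨{p, s}, by rw [hM1]; exact Or.inl rfl, hsubps, h⟩)
  have hfaces : M2.faces = C.M.faces ∪ {{p, s}, {p, q, s}} := by
    rw [hM2, hM1]; ext; simp; tauto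
  have hsub1 : (C.c b).faces ∪ {{s}, {q, s}} ⊆ M2.faces := by
    rw [hfaces]
    rintro m (hm | rfl | rfl)
    · exact Or.inl (C.le b hm)
    · exact Or.inl hs1
    · exact Or.inl hqs
  have hq2 : {q} ∈ (C.c b).faces := singleton_mem_of_mem hpq (by simp)
  have hp2 : {p} ∈ (C.c b).faces := singleton_mem_of_mem hpq (by simp)
  -- The intermediate class contains the second edge `{q, s}` but not yet the triangle. By `hs` it
  -- is either the old class or its expansion through a new vertex `s`. The triangle then collapses
  -- onto it through the free edge `{p, s}`.
  let D1 := restrict M2 ((C.c b).faces ∪ {{s}, {q, s}}) hsub1 (by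
    rintro t (ht | rfl | rfl) u hu hn
    · exact Or.inl ((C.c b).down_closed ht hu hn)
    · rw [(Finset.subset_singleton_iff.1 hu).resolve_left hn.ne_empty]; simp
    · rcases subset_pair_cases hu hn with rfl | rfl | rfl
      · exact Or.inl hq2
      · simp
      · simp)
  have hcoll1 : Collapses D1 (C.c b) := by
    by_cases h : {s} ∈ (C.c b).faces
    · have : D1 = C.c b := by
        apply SimplicialComplex.ext
        change (C.c b).faces ∪ {{s}, {q, s}} = _
        rw [Set.union_eq_left]
        rintro m (rfl | rfl)
        · exact h
        · exact hs h
      rw [this]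
      exact Relation.ReflTransGen.refl
    · refine Relation.ReflTransGen.single
        (elementaryCollapse_of_faces_eq (σ := {s}) (τ := {q, s}) rfl ?_ (by simp) h)
      rw [Finset.ssubset_iff_of_subset (by simp)]
      exact ⟨q, by simp, by simpa using hqs'⟩
  have hsub : (C.c b).faces ∪ {{s}, {q, s}, {p, s}, {p, q, s}} ⊆ M2.faces := by
    rintro m (hm | rfl | rfl | rfl | rfl)
    · exact hsub1 (Or.inl hm)
    · exact hsub1 (Or.inr (by simp))
    · exact hsub1 (Or.inr (by simp))
    · rw [hfaces]; exact Or.inr (by simp)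
    · rw [hfaces]; exact Or.inr (by simp)
  let D := restrict M2 ((C.c b).faces ∪ {{s}, {q, s}, {p, s}, {p, q, s}}) hsub (by
    rintro t (ht | rfl | rfl | rfl | rfl) u hu hn
    · exact Or.inl ((C.c b).down_closed ht hu hn)
    · rw [(Finset.subset_singleton_iff.1 hu).resolve_left hn.ne_empty]; simp
    · rcases subset_pair_cases hu hn with rfl | rfl | rfl
      · exact Or.inl hq2
      · simp
      · simp
    · rcases subset_pair_cases hu hn with rfl | rfl | rfl
      · exact Or.inl hp2
      · simp
      · simp
    · rcases subset_triple_cases hu hn with rfl | rfl | rfl | rfl | rfl | rfl | rfl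
      · exact Or.inl hp2
      · exact Or.inl hq2
      · simp
      · exact Or.inl hpq
      · simp
      · simp
      · simp)
  have hcoll : ElementaryCollapse D D1 := by
    refine elementaryCollapse_of_faces_eq (σ := {p, s}) (τ := {p, q, s}) ?_ ?_ (by simp) ?_
    · change (C.c b).faces ∪ {{s}, {q, s}, {p, s}, {p, q, s}} =
        ((C.c b).faces ∪ {{s}, {q, s}}) ∪ {{p, s}, {p, q, s}}
      ext; simp; tauto
    · rw [Finset.ssubset_iff_of_subset hsubps]
      exact ⟨q, by simp, by simp [hpq'.symm, hqs']⟩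
    · rintro (h | h | h)
      · exact hps (C.le b h)
      · have : p ∈ ({s} : Finset E) := by rw [← h]; simp
        exact hps' (by simpa using this)
      · have : p ∈ ({q, s} : Finset E) := by rw [← (h : ({p, s} : Finset E) = {q, s})]; simp
        simp [hpq', hps'] at this
  obtain ⟨C', h1, h2, h3⟩ := C.extend M2 D b (by rw [hfaces]; exact Set.subset_union_left)
    (by rw [hfaces]; exact C.fin.union (by simp)) hsub
    (by
      intro m hm
      rw [hfaces] at hm
      rcases hm with h | rfl | rfl
      · exact Or.inl h
      · exact Or.inr (Or.inr (by simp))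
      · exact Or.inr (Or.inr (by simp)))
    Set.subset_union_left ((Relation.ReflTransGen.single hcoll).trans hcoll1)
  refine ⟨C', by rw [h1, hfaces], ?_, by rw [h2]; rfl, h3⟩
  rw [h1, space_insert hM2, space_insert hM1, Set.union_assoc]
  congr 1
  rw [Set.union_eq_right.2 (convexHull_mono (Finset.coe_subset.2 hsubps))]
  simp

end Attach

end PLCover

namespace PLCover

open Geometry

/-! ### Barycentric coordinates in a triangle and in its pieces. -/

section Plane

variable {E : Type*} [AddCommGroup E] [Module ℝ E]

theorem mem_convexHull_triple {p q s x : E} :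
    x ∈ convexHull ℝ {p, q, s} ↔ ∃ a b c : ℝ, 0 ≤ a ∧ 0 ≤ b ∧ 0 ≤ c ∧ a + b + c = 1 ∧
      a • p + b • q + c • s = x := by
  rw [convexHull_insert (by simp), convexHull_pair, mem_convexJoin]
  constructor
  · rintro ⟨y, rfl, z, ⟨b, c, hb, hc, hbc, rfl⟩, ⟨u, v, hu, hv, huv, rfl⟩⟩
    refine ⟨u, v * b, v * c, hu, by positivity, by positivity,
      by rw [add_assoc, ← mul_add, hbc, mul_one, huv], ?_⟩
    module
  · rintro ⟨a, b, c, ha, hb, hc, h, rfl⟩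
    rcases eq_or_lt_of_le (add_nonneg hb hc) with h0 | h0
    · have hb0 : b = 0 := by linarith
      have hc0 : c = 0 := by linarith
      refine ⟨p, rfl, q, left_mem_segment ℝ q s, ?_⟩
      have : a = 1 := by linarith
      subst hb0 hc0 this
      simpa using left_mem_segment ℝ p q
    · refine ⟨p, rfl, (b / (b + c)) • q + (c / (b + c)) • s,
        ⟨b / (b + c), c / (b + c), by positivity, by positivity, by field_simp, rfl⟩,
        ⟨a, b + c, ha, h0.le, by linarith, ?_⟩⟩
      rw [smul_add, smul_smul, smul_smul, mul_div_cancel₀ _ h0.ne', mul_div_cancel₀ _ h0.ne']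
      abel

/-- The points `a`, `v`, `z` are not collinear. -/
def NonCollinear (a v z : E) : Prop :=
  ∀ α β γ : ℝ, α + β + γ = 0 → α • a + β • v + γ • z = 0 → α = 0 ∧ β = 0 ∧ γ = 0

theorem NonCollinear.unique {a v z : E} (h : NonCollinear a v z) {α β γ α' β' γ' : ℝ}
    (h1 : α + β + γ = 1) (h2 : α' + β' + γ' = 1)
    (h3 : α • a + β • v + γ • z = α' • a + β' • v + γ' • z) : α = α' ∧ β = β' ∧ γ = γ' := by
  have := h (α - α') (β - β') (γ - γ') (by linarith) (by
    rw [← sub_eq_zero] at h3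
    rw [← h3]; module)
  exact ⟨by linarith [this.1], by linarith [this.2.1], by linarith [this.2.2]⟩

theorem NonCollinear.rotate {a v z : E} (h : NonCollinear a v z) : NonCollinear v z a := by
  intro α β γ h1 h2
  have := h γ α β (by linarith) (by rw [← h2]; module)
  exact ⟨this.2.1, this.2.2, this.1⟩

theorem NonCollinear.swap {a v z : E} (h : NonCollinear a v z) : NonCollinear v a z := by
  intro α β γ h1 h2
  have := h β α γ (by linarith) (by rw [← h2]; module)
  exact ⟨this.2.1, this.1, this.2.2⟩

theorem NonCollinear.ne {a v z : E} (h : NonCollinear a v z) : a ≠ v := by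
  rintro rfl
  have := h 1 (-1) 0 (by norm_num) (by module)
  norm_num at this

theorem NonCollinear.affineIndependent [DecidableEq E] {a v z : E} (h : NonCollinear a v z) :
    AffineIndependent ℝ ((↑) : ({a, v, z} : Finset E) → E) := by
  have hav := h.ne
  have hvz := h.rotate.ne
  have hza := h.rotate.rotate.ne
  have hi : AffineIndependent ℝ ![a, v, z] := by
    rw [affineIndependent_iff]
    intro s w hw hw' i hi
    have e1 : ∑ i, (if i ∈ s then w i else 0) = 0 := by
      rw [Finset.sum_ite_mem, Finset.univ_inter]; exact hw
    have e2 : ∑ i, (if i ∈ s then w i else 0) • (![a, v, z] i) = 0 := by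
      rw [← hw']
      simp only [ite_smul, zero_smul]
      rw [Finset.sum_ite_mem, Finset.univ_inter]
    rw [Fin.sum_univ_three] at e1 e2
    have := h _ _ _ e1 (by simpa using e2)
    fin_cases i
    · simpa [show (0 : Fin 3) ∈ s from hi] using this.1
    · simpa [show (1 : Fin 3) ∈ s from hi] using this.2.1
    · simpa [show (2 : Fin 3) ∈ s from hi] using this.2.2
  have := hi.range
  have hr : Set.range ![a, v, z] = (({a, v, z} : Finset E) : Set E) := by
    ext x
    simp only [Matrix.range_cons, Matrix.range_empty, Finset.coe_insert, Finset.coe_singleton]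
    simp only [Set.mem_union, Set.mem_insert_iff, Set.mem_singleton_iff, Set.mem_empty_iff_false]
    tauto
  rw [hr] at this
  exact this

variable {a v z y z' : E} {s u α β γ : ℝ}

theorem mem_triangle_iff (T : NonCollinear a v z) (h1 : α + β + γ = 1) :
    α • a + β • v + γ • z ∈ convexHull ℝ {a, v, z} ↔ 0 ≤ α ∧ 0 ≤ β ∧ 0 ≤ γ := by
  rw [mem_convexHull_triple]
  constructor
  · rintro ⟨p, q, r, hp, hq, hr, h, e⟩
    obtain ⟨rfl, rfl, rfl⟩ := T.unique h h1 e
    exact ⟨hp, hq, hr⟩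
  · rintro ⟨h2, h3, h4⟩
    exact ⟨α, β, γ, h2, h3, h4, h1, rfl⟩

theorem mem_segment_left_iff (T : NonCollinear a v z) (h1 : α + β + γ = 1) :
    α • a + β • v + γ • z ∈ segment ℝ a v ↔ 0 ≤ α ∧ 0 ≤ β ∧ γ = 0 := by
  constructor
  · rintro ⟨p, q, hp, hq, h, e⟩
    obtain ⟨rfl, rfl, rfl⟩ := T.unique (γ := 0) (by linarith) h1
      ((by module : p • a + q • v + (0 : ℝ) • z = p • a + q • v).trans e)
    exact ⟨hp, hq, rfl⟩
  · rintro ⟨h2, h3, rfl⟩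
    exact ⟨α, β, h2, h3, by linarith, by module⟩

theorem mem_segment_right_iff (T : NonCollinear a v z) (h1 : α + β + γ = 1) :
    α • a + β • v + γ • z ∈ segment ℝ v z ↔ α = 0 ∧ 0 ≤ β ∧ 0 ≤ γ := by
  constructor
  · rintro ⟨p, q, hp, hq, h, e⟩
    obtain ⟨rfl, rfl, rfl⟩ := T.unique (α := 0) (by linarith) h1
      ((by module : (0 : ℝ) • a + p • v + q • z = p • v + q • z).trans e)
    exact ⟨rfl, hp, hq⟩
  · rintro ⟨rfl, h3, h4⟩
    exact ⟨β, γ, h3, h4, by linarith, by module⟩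

/-- The line through `z` and the cut point of `[a, v]` is `s * α = (1 - s) * β`. The inequality
selects the side of `v`. -/
theorem mem_subtriangle_iff (T : NonCollinear a v z) (h1 : α + β + γ = 1)
    (hs1 : s < 1) :
    α • a + β • v + γ • z ∈ convexHull ℝ {(1 - s) • a + s • v, v, z} ↔
    0 ≤ α ∧ 0 ≤ γ ∧ s * α ≤ (1 - s) * β := by
  rw [mem_convexHull_triple]
  have hs1' : 0 < 1 - s := by linarith
  constructor
  · rintro ⟨p, q, r, hp, hq, hr, h, e⟩
    obtain ⟨rfl, rfl, rfl⟩ := T.unique (α := p * (1 - s)) (β := p * s + q) (γ := r)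
      (by linarith) h1 ((by module : _ = _).trans e)
    exact ⟨by positivity, hr, by nlinarith [mul_nonneg hq hs1'.le]⟩
  · rintro ⟨h2, h3, h4⟩
    refine ⟨α / (1 - s), ((1 - s) * β - s * α) / (1 - s), γ, by positivity,
      div_nonneg (by linarith) hs1'.le, h3, ?_, ?_⟩
    · refine Eq.trans ?_ h1; field_simp; ring
    · match_scalars <;> field_simp <;> ring

theorem mem_segment_cut_iff (T : NonCollinear a v z) (h1 : α + β + γ = 1)
    (hs1 : s < 1) :
    α • a + β • v + γ • z ∈ segment ℝ ((1 - s) • a + s • v) v ↔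
    0 ≤ α ∧ γ = 0 ∧ s * α ≤ (1 - s) * β := by
  have hs1' : 0 < 1 - s := by linarith
  constructor
  · rintro ⟨p, q, hp, hq, h, e⟩
    obtain ⟨rfl, rfl, rfl⟩ := T.unique (α := p * (1 - s)) (β := p * s + q) (γ := 0)
      (by linarith) h1 ((by module : _ = _).trans e)
    exact ⟨by positivity, rfl, by nlinarith [mul_nonneg hq hs1'.le]⟩
  · rintro ⟨h2, rfl, h4⟩
    refine ⟨α / (1 - s), ((1 - s) * β - s * α) / (1 - s), by positivity,
      div_nonneg (by linarith) hs1'.le, ?_, ?_⟩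
    · refine Eq.trans ?_ h1; field_simp; ring
    · match_scalars <;> field_simp <;> ring

theorem mem_segment_start_iff (T : NonCollinear a v z) (h1 : α + β + γ = 1)
    (hs : 0 < s) :
    α • a + β • v + γ • z ∈ segment ℝ a ((1 - s) • a + s • v) ↔
    0 ≤ β ∧ γ = 0 ∧ (1 - s) * β ≤ s * α := by
  constructor
  · rintro ⟨p, q, hp, hq, h, e⟩
    obtain ⟨rfl, rfl, rfl⟩ := T.unique (α := p + q * (1 - s)) (β := q * s) (γ := 0)
      (by linarith) h1 ((by module : _ = _).trans e)
    exact ⟨by positivity, rfl, by nlinarith [mul_nonneg hp hs.le]⟩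
  · rintro ⟨h2, rfl, h4⟩
    refine ⟨(s * α - (1 - s) * β) / s, β / s, div_nonneg (by linarith) hs.le, by positivity, ?_, ?_⟩
    · refine Eq.trans ?_ h1; field_simp; ring
    · match_scalars <;> field_simp <;> ring

theorem mem_segment_cevian_iff (T : NonCollinear a v z) (h1 : α + β + γ = 1)
    (hs : 0 < s) :
    α • a + β • v + γ • z ∈ segment ℝ z ((1 - s) • a + s • v) ↔
    0 ≤ β ∧ 0 ≤ γ ∧ (1 - s) * β = s * α := by
  constructor
  · rintro ⟨p, q, hp, hq, h, e⟩
    obtain ⟨rfl, rfl, rfl⟩ := T.unique (α := q * (1 - s)) (β := q * s) (γ := p)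
      (by linarith) h1 ((by module : _ = _).trans e)
    exact ⟨by positivity, hp, by ring⟩
  · rintro ⟨h2, h3, h4⟩
    refine ⟨γ, β / s, h3, by positivity, ?_, ?_⟩
    · refine Eq.trans ?_ h1; field_simp; linarith
    · match_scalars
      · ring
      · field_simp; linarith
      · field_simp

/-- The second condition selects the side of `a` of the cevian from `z`. The third selects the side
of `z` of the segment joining the two cut points. Reversing the third one gives the corner at `a`.
-/
theorem mem_middle_iff (T : NonCollinear a v z) (h1 : α + β + γ = 1)
    (hs : 0 < s) (hu1 : u < 1) :
    α • a + β • v + γ • z ∈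
    convexHull ℝ {z, (1 - s) • a + s • v, (1 - u) • a + u • z} ↔
    0 ≤ β ∧ (1 - s) * β ≤ s * α ∧ u * (s * α - (1 - s) * β) ≤ s * (1 - u) * γ := by
  rw [mem_convexHull_triple]
  have hu1' : 0 < 1 - u := by linarith
  constructor
  · rintro ⟨p, q, r, hp, hq, hr, h, e⟩
    obtain ⟨rfl, rfl, rfl⟩ := T.unique (α := q * (1 - s) + r * (1 - u)) (β := q * s)
      (γ := p + r * u) (by linarith) h1 ((by module : _ = _).trans e)
    refine ⟨by positivity, ?_, ?_⟩
    · have : 0 ≤ s * (r * (1 - u)) := by positivity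
      linarith
    · have : 0 ≤ s * (1 - u) * p := by positivity
      linarith
  · rintro ⟨h2, h3, h4⟩
    refine ⟨(s * (1 - u) * γ - u * (s * α - (1 - s) * β)) / (s * (1 - u)), β / s,
      (s * α - (1 - s) * β) / (s * (1 - u)), div_nonneg (by linarith) (by positivity),
      by positivity, div_nonneg (by linarith) (by positivity), ?_, ?_⟩
    · refine Eq.trans ?_ h1; field_simp; ring
    · match_scalars <;> field_simp <;> ring

theorem mem_corner_iff (T : NonCollinear a v z) (h1 : α + β + γ = 1)
    (hs : 0 < s) (hu : 0 < u) :
    α • a + β • v + γ • z ∈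
    convexHull ℝ {a, (1 - s) • a + s • v, (1 - u) • a + u • z} ↔
    0 ≤ β ∧ 0 ≤ γ ∧ s * (1 - u) * γ ≤ u * (s * α - (1 - s) * β) := by
  rw [mem_convexHull_triple]
  constructor
  · rintro ⟨p, q, r, hp, hq, hr, h, e⟩
    obtain ⟨rfl, rfl, rfl⟩ := T.unique (α := p + q * (1 - s) + r * (1 - u)) (β := q * s)
      (γ := r * u) (by linarith) h1 ((by module : _ = _).trans e)
    refine ⟨by positivity, by positivity, ?_⟩
    have : 0 ≤ u * s * p := by positivity
    linarith
  · rintro ⟨h2, h3, h4⟩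
    refine ⟨(u * (s * α - (1 - s) * β) - s * (1 - u) * γ) / (s * u), β / s, γ / u,
      div_nonneg (by linarith) (by positivity), by positivity, by positivity, ?_, ?_⟩
    · refine Eq.trans ?_ h1; field_simp; ring
    · match_scalars <;> field_simp <;> ring

theorem mem_segment_cut_cut_iff (T : NonCollinear a v z) (h1 : α + β + γ = 1)
    (hs : 0 < s) (hu : 0 < u) :
    α • a + β • v + γ • z ∈
    segment ℝ ((1 - s) • a + s • v) ((1 - u) • a + u • z) ↔
    0 ≤ β ∧ 0 ≤ γ ∧ s * (1 - u) * γ = u * (s * α - (1 - s) * β) := by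
  constructor
  · rintro ⟨q, r, hq, hr, h, e⟩
    obtain ⟨rfl, rfl, rfl⟩ := T.unique (α := q * (1 - s) + r * (1 - u)) (β := q * s)
      (γ := r * u) (by linarith) h1 ((by module : _ = _).trans e)
    exact ⟨by positivity, by positivity, by ring⟩
  · rintro ⟨h2, h3, h4⟩
    have hsu : α = β / s * (1 - s) + γ / u * (1 - u) := by
      field_simp; linarith
    refine ⟨β / s, γ / u, by positivity, by positivity, ?_, ?_⟩
    · refine Eq.trans ?_ h1; rw [hsu]; field_simp; ring
    · rw [hsu]; match_scalars <;> field_simp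

end Plane

end PLCover

namespace PLCover

open Geometry

/-! ### Filling a triangle along a subdivided edge. -/

section Fill

variable {E : Type*} [AddCommGroup E] [Module ℝ E] [DecidableEq E]

/-- The segment from `a` to `v` is subdivided into edges that belong to `S`. -/
inductive Chain (S : Set (Finset E)) (a : E) : E → Prop
  | edge {v : E} : a ≠ v → {a, v} ∈ S → Chain S a v
  | snoc {y v : E} : y ∈ openSegment ℝ a v → Chain S a y → {y, v} ∈ S → Chain S a v

theorem Chain.ne {S : Set (Finset E)} {a v : E} (h : Chain S a v) : a ≠ v := by
  induction h with
  | edge h _ => exact h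
  | snoc hy _ _ ih =>
    rintro rfl
    rw [openSegment_same] at hy
    exact ih hy.symm

theorem Chain.mono {S S' : Set (Finset E)} (hS : S ⊆ S') {a v : E} (h : Chain S a v) :
    Chain S' a v := by
  induction h with
  | edge h h' => exact Chain.edge h (hS h')
  | snoc hy _ h ih => exact Chain.snoc hy ih (hS h)

theorem Chain.concat {S : Set (Finset E)} {a z b : E} (h1 : Chain S a z) (h2 : Chain S z b)
    (hz : z ∈ openSegment ℝ a b) : Chain S a b := by
  induction h2 with
  | edge h h' => exact Chain.snoc hz h1 h'
  | @snoc y v hy h3 h ih =>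
    have hzv := hz
    obtain ⟨p, q, hp, hq, hpq, rfl⟩ := hz
    obtain ⟨p', q', hp', hq', hpq', rfl⟩ := hy
    have e1 : p = 1 - q := by linarith
    have e2 : p' = 1 - q' := by linarith
    subst e1 e2
    refine Chain.snoc ⟨(1 - q') * (1 - q), 1 - (1 - q') * (1 - q), by positivity, ?_, by ring, ?_⟩
      (ih ?_) h
    · nlinarith
    · module
    · have hD : 0 < q * (1 - q') + q' := by positivity
      -- The weight of `y` in `z` is the ratio of the coefficients of `v` in `z` and in `y`, both
      -- written in terms of `a` and `v`.
      refine ⟨1 - q / (q * (1 - q') + q'), q / (q * (1 - q') + q'), ?_, by positivity, by ring, ?_⟩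
      · rw [sub_pos, div_lt_one hD]; nlinarith
      · match_scalars <;> field_simp <;> ring

theorem Chain.symm {S : Set (Finset E)} {a v : E} (h : Chain S a v) : Chain S v a := by
  induction h with
  | edge h h' => exact Chain.edge h.symm (by rwa [Finset.pair_comm])
  | @snoc y v hy h3 h ih =>
    refine Chain.concat (Chain.edge ?_ (by rwa [Finset.pair_comm])) ih (by rwa [openSegment_symm])
    rintro rfl
    obtain ⟨p, q, hp, hq, hpq, e⟩ := hy
    apply h3.ne
    have : p • (a - v) = 0 := by
      rw [← sub_eq_zero] at e
      rw [← e, ← sub_eq_zero]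
      obtain rfl : q = 1 - p := by linarith
      module
    exact sub_eq_zero.1 ((smul_eq_zero.1 this).resolve_left hp.ne')

/-- Fill in a triangle along two of its edges, one of which is subdivided. -/
theorem Colored.fill {S : Set (Finset E)} {a v : E} (hch : Chain S a v) :
    ∀ (C : Colored E) (z : E), S ⊆ C.M.faces → NonCollinear a v z → {v, z} ∈ C.M.faces →
      (∀ b, {z} ∈ (C.c b).faces → {v, z} ∈ (C.c b).faces) →
      (∀ x ∈ convexHull ℝ {a, v, z}, x ∈ C.M.space → x ∈ segment ℝ a v ∨ x ∈ segment ℝ v z) →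
      ∃ C' : Colored E, C.M.faces ⊆ C'.M.faces ∧
        C'.M.space = C.M.space ∪ convexHull ℝ {a, v, z} ∧ Chain C'.M.faces a z ∧
        (∀ b, (C.c b).faces ⊆ (C'.c b).faces) ∧
        (∀ b, ∀ m ∈ (C'.c b).faces, m ∈ (C.c b).faces ∨
          convexHull ℝ (m : Set E) ⊆ convexHull ℝ {a, v, z}) ∧
        (∀ b, {z} ∈ (C'.c b).faces → {v, z} ∈ (C'.c b).faces) := by
  induction hch with
  | @edge v hav he =>
    intro C z hS T hvz hz hint
    -- The triangle takes the colour of the old edge `{a, v}`.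
    obtain ⟨b, hb⟩ := C.cover _ (hS he)
    have hnot : {a, z} ∉ C.M.faces := by
      intro h
      have hm : (1 / 2 : ℝ) • a + (0 : ℝ) • v + (1 / 2 : ℝ) • z ∈ convexHull ℝ {a, z} :=
        (convexHull_pair (𝕜 := ℝ) a z).symm ▸
          ⟨1 / 2, 1 / 2, by norm_num, by norm_num, by norm_num, by module⟩
      have h1 : (1 / 2 : ℝ) + 0 + 1 / 2 = 1 := by norm_num
      have := hint ((1 / 2 : ℝ) • a + (0 : ℝ) • v + (1 / 2 : ℝ) • z)
        ((mem_triangle_iff T h1).2 (by norm_num))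
        (C.M.convexHull_subset_space h (by rw [Finset.coe_insert, Finset.coe_singleton]; exact hm))
      rw [mem_segment_left_iff T h1, mem_segment_right_iff T h1] at this
      norm_num at this
    obtain ⟨C', h1, h2, h3, h4⟩ := C.attach_triangle b T.affineIndependent T.ne T.rotate.ne
      T.rotate.rotate.ne.symm hb hvz (hz b) hnot hint
    refine ⟨C', by rw [h1]; exact Set.subset_union_left, h2,
      Chain.edge T.rotate.rotate.ne.symm (by rw [h1]; exact Or.inr (by simp)), ?_, ?_, ?_⟩
    · intro b'
      rcases Bool.eq_or_eq_not b' b with rfl | rfl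
      · rw [h3]; exact Set.subset_union_left
      · rw [h4]
    · intro b' m hm
      rcases Bool.eq_or_eq_not b' b with rfl | rfl
      · rw [h3] at hm
        rcases hm with hm | rfl | rfl | rfl | rfl
        · exact Or.inl hm
        all_goals
          right
          apply convexHull_mono
          intro x
          simp
          try tauto
      · rw [h4] at hm; exact Or.inl hm
    · intro b' hb'
      rcases Bool.eq_or_eq_not b' b with rfl | rfl
      · rw [h3]; exact Or.inr (by simp)
      · rw [h4] at hb' ⊢; exact hz _ hb'
  | @snoc y v hy hch he ih =>
    intro C z hS T hvz hz hint
    obtain ⟨p, s, hp, hs, hps, hy⟩ := hy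
    obtain rfl : p = 1 - s := by linarith
    have hs1 : s < 1 := by linarith
    -- The triangle is cut into `yvz`, `zyz'` and `ayz'`. The first two get the colour `b` of the
    -- last edge `{y, v}` of the chain, and the third has a shorter chain. Recursing on `ayz`
    -- instead would fail: the opposite colour may contain `z` without containing `{y, z}`. The
    -- midpoint `z'` is new, so it belongs to colour `b` only.
    set z' := (1 - (1 / 2 : ℝ)) • a + (1 / 2 : ℝ) • z with hz'
    have hu : (0 : ℝ) < 1 / 2 := by norm_num
    have hu1 : (1 / 2 : ℝ) < 1 := by norm_num
    have T1 : NonCollinear y v z := by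
      intro α β γ e1 e2
      rw [← hy] at e2
      have := T (α * (1 - s)) (α * s + β) γ (by linarith) (by rw [← e2]; module)
      obtain ⟨f1, f2, f3⟩ := this
      have : α = 0 := (mul_eq_zero.1 f1).resolve_right hp.ne'
      subst this
      exact ⟨rfl, by linarith, f3⟩
    have T2 : NonCollinear z y z' := by
      intro α β γ e1 e2
      rw [← hy, hz'] at e2
      have := T (β * (1 - s) + γ / 2) (β * s) (α + γ / 2) (by linarith) (by rw [← e2]; module)
      obtain ⟨f1, f2, f3⟩ := this
      have : β = 0 := (mul_eq_zero.1 f2).resolve_right hs.ne'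
      subst this
      exact ⟨by linarith, rfl, by linarith⟩
    have T3 : NonCollinear a y z' := by
      intro α β γ e1 e2
      rw [← hy, hz'] at e2
      have := T (α + β * (1 - s) + γ / 2) (β * s) (γ / 2) (by linarith) (by rw [← e2]; module)
      obtain ⟨f1, f2, f3⟩ := this
      have : β = 0 := (mul_eq_zero.1 f2).resolve_right hs.ne'
      subst this
      exact ⟨by linarith, rfl, by linarith⟩
    -- coordinates
    have hcoord : ∀ x ∈ convexHull ℝ {a, v, z},
        ∃ α β γ : ℝ, α + β + γ = 1 ∧ x = α • a + β • v + γ • z := by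
      intro x hx
      obtain ⟨α, β, γ, -, -, -, h, e⟩ := mem_convexHull_triple.1 hx
      exact ⟨α, β, γ, h, e.symm⟩
    have haT : a ∈ convexHull ℝ {a, v, z} := subset_convexHull ℝ _ (by simp)
    have hvT : v ∈ convexHull ℝ {a, v, z} := subset_convexHull ℝ _ (by simp)
    have hzT : z ∈ convexHull ℝ {a, v, z} := subset_convexHull ℝ _ (by simp)
    have hcT := convex_convexHull ℝ ({a, v, z} : Set E)
    have hyT : y ∈ convexHull ℝ {a, v, z} :=
      hcT.segment_subset haT hvT ⟨1 - s, s, hp.le, hs.le, by linarith, hy⟩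
    have hz'T : z' ∈ convexHull ℝ {a, v, z} :=
      hcT.segment_subset haT hzT ⟨1 - 1 / 2, 1 / 2, by norm_num, by norm_num, by norm_num, hz'.symm⟩
    have hsub1 : convexHull ℝ {y, v, z} ⊆ convexHull ℝ {a, v, z} :=
      convexHull_min (by rintro x (rfl | rfl | rfl) <;> assumption) hcT
    have hsub2 : convexHull ℝ {z, y, z'} ⊆ convexHull ℝ {a, v, z} :=
      convexHull_min (by rintro x (rfl | rfl | rfl) <;> assumption) hcT
    have hsub3 : convexHull ℝ {a, y, z'} ⊆ convexHull ℝ {a, v, z} :=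
      convexHull_min (by rintro x (rfl | rfl | rfl) <;> assumption) hcT
    have hsegT : segment ℝ y z' ⊆ convexHull ℝ {a, v, z} := hcT.segment_subset hyT hz'T
    have hyeq : ∀ α β γ : ℝ, γ = 0 → s * α = (1 - s) * β → α + β + γ = 1 →
        α • a + β • v + γ • z = y := by
      rintro α β γ rfl h1 h2
      obtain rfl : β = s := by
        have : α = 1 - β := by linarith
        subst this; linarith
      obtain rfl : α = 1 - β := by linarith
      rw [← hy]; module
    -- the first triangle
    obtain ⟨b, hb⟩ := C.cover _ (hS he)
    have hnot : {y, z} ∉ C.M.faces := by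
      intro h
      have hm : ((1 - s) / 2) • a + (s / 2) • v + (1 / 2 : ℝ) • z ∈ convexHull ℝ {y, z} :=
        (convexHull_pair (𝕜 := ℝ) y z).symm ▸
          ⟨1 / 2, 1 / 2, by norm_num, by norm_num, by norm_num, by rw [← hy]; module⟩
      have h1 : (1 - s) / 2 + s / 2 + 1 / 2 = 1 := by ring
      have := hint _ ((mem_triangle_iff T h1).2 ⟨by positivity, by positivity, by norm_num⟩)
        (C.M.convexHull_subset_space h (by simpa using hm))
      rw [mem_segment_left_iff T h1, mem_segment_right_iff T h1] at this
      rcases this with h | h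
      · norm_num at h
      · linarith [h.1]
    obtain ⟨C1, h11, h12, h13, h14⟩ := C.attach_triangle b T1.affineIndependent T1.ne T1.rotate.ne
      T1.rotate.rotate.ne.symm hb hvz (hz b) hnot (by
        intro x hx hxM
        obtain ⟨α, β, γ, h1, rfl⟩ := hcoord x (hsub1 hx)
        refine (hint _ (hsub1 hx) hxM).imp (fun h => ?_) id
        rw [mem_segment_left_iff T h1] at h
        rw [← hy, mem_subtriangle_iff T h1 hs1] at hx
        rw [← hy, mem_segment_cut_iff T h1 hs1]
        exact ⟨hx.1, h.2.2, hx.2.2⟩)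
    -- the whisker
    have hz'C1 : z' ∉ C1.M.space := by
      rw [h12]
      have e : z' = (1 - (1 / 2 : ℝ)) • a + (0 : ℝ) • v + (1 / 2 : ℝ) • z := by rw [hz']; module
      rintro (h | h)
      · have := hint _ hz'T h
        rw [e, mem_segment_left_iff T (by norm_num), mem_segment_right_iff T (by norm_num)] at this
        norm_num at this
      · rw [← hy, e, mem_subtriangle_iff T (by norm_num) hs1] at h
        linarith [h.2.2]
    obtain ⟨C2, h21, h22, h23, h24⟩ := C1.attach_whisker b (q := y) (s := z') T3.rotate.ne
      (by rw [h13]; exact Or.inl (singleton_mem_of_mem hb (by simp))) (by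
        intro x hx hxM
        obtain ⟨α, β, γ, h1, rfl⟩ := hcoord x (hsegT hx)
        rw [← hy, hz', mem_segment_cut_cut_iff T h1 hs hu] at hx
        rw [h12] at hxM
        -- On the segment `[y, z']` the old space is met only where `γ = 0`, which is the point `y`.
        obtain ⟨k1, k2, k3⟩ := hx
        have hsγ : 0 ≤ s * γ := by positivity
        have key : s * γ ≤ 0 := by
          have hα : 0 ≤ α := by
            have := mul_nonneg hp.le k1
            have : 0 ≤ s * α := by linarith
            exact nonneg_of_mul_nonneg_right this hs
          rcases hxM with h | h
          · rcases hint _ ((mem_triangle_iff T h1).2 ⟨hα, k1, k2⟩) h with h | h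
            · rw [mem_segment_left_iff T h1] at h
              rw [h.2.2]; simp
            · rw [mem_segment_right_iff T h1] at h
              have := mul_nonneg hp.le k1
              rw [h.1] at k3; linarith
          · rw [← hy, mem_subtriangle_iff T h1 hs1] at h
            linarith [h.2.2]
        have hsγ0 : s * γ = 0 := le_antisymm key hsγ
        refine hyeq α β γ ((mul_eq_zero.1 hsγ0).resolve_left hs.ne') ?_ h1
        linarith)
    -- the second triangle
    have hzz' : {z, z'} ∉ C2.M.faces := by
      rw [h21]
      rintro (h | h | h)
      · exact hz'C1 (C1.M.subset_space h (by simp))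
      · have : z ∈ ({z'} : Finset E) := by rw [← h]; simp
        exact T2.rotate.rotate.ne.symm (by simpa using this)
      · have : z ∈ ({y, z'} : Finset E) := by
          rw [← (h : ({z, z'} : Finset E) = {y, z'})]; simp
        simp [T2.ne, T2.rotate.rotate.ne.symm] at this
    have hyz1 : {y, z} ∈ (C1.c b).faces := by rw [h13]; exact Or.inr (by simp)
    obtain ⟨C3, h31, h32, h33, h34⟩ := C2.attach_triangle b T2.affineIndependent T2.ne T2.rotate.ne
      T2.rotate.rotate.ne.symm
      (by rw [h23]; exact Or.inl (by rwa [Finset.pair_comm]))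
      (by rw [h21]; exact Or.inr (by simp))
      (fun _ => by rw [h23]; exact Or.inr (by simp)) hzz' (by
        intro x hx hxM
        rw [h22] at hxM
        rcases hxM with hxM | hxM
        swap
        · exact Or.inr hxM
        left
        have hxT := hsub2 hx
        obtain ⟨α, β, γ, h1, rfl⟩ := hcoord x hxT
        rw [mem_triangle_iff T h1] at hxT
        rw [← hy, hz', mem_middle_iff T h1 hs hu1] at hx
        rw [← hy, mem_segment_cevian_iff T h1 hs]
        obtain ⟨k1, k2, k3⟩ := hx
        refine ⟨k1, hxT.2.2, le_antisymm k2 ?_⟩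
        rw [h12] at hxM
        rcases hxM with h | h
        · rcases hint _ ((mem_triangle_iff T h1).2 hxT) h with h | h
          · rw [mem_segment_left_iff T h1] at h
            rw [h.2.2] at k3; linarith
          · rw [mem_segment_right_iff T h1] at h
            rw [h.1]; have := mul_nonneg hp.le k1; linarith
        · rw [← hy, mem_subtriangle_iff T h1 hs1] at h
          linarith [h.2.2])
    -- the remaining triangle
    have hSC3 : S ⊆ C3.M.faces := by
      intro m hm
      rw [h31, h21, h11]
      exact Or.inl (Or.inl (Or.inl (hS hm)))
    obtain ⟨C4, h41, h42, h43, h44, h45, h46⟩ := ih C3 z' hSC3 T3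
      (by rw [h31, h21]; exact Or.inl (Or.inr (by simp)))
      (by
        intro b' hb'
        -- Only colour `b` contains the new vertex `z'`, and it also contains the edge `{y, z'}`.
        rcases Bool.eq_or_eq_not b' b with rfl | rfl
        · rw [h33]; exact Or.inr (by simp)
        · rw [h34, h24] at hb'
          exact absurd (C1.M.subset_space (C1.le _ hb') (by simp)) hz'C1)
      (by
        intro x hx hxM
        rw [h32, h22, h12] at hxM
        have hxT := hsub3 hx
        obtain ⟨α, β, γ, h1, rfl⟩ := hcoord x hxT
        rw [← hy, hz', mem_corner_iff T h1 hs hu] at hx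
        obtain ⟨k1, k2, k3⟩ := hx
        rcases hxM with ((h | h) | h) | h
        · rcases hint _ hxT h with h | h
          · left
            rw [mem_segment_left_iff T h1] at h
            rw [← hy, mem_segment_start_iff T h1 hs]
            refine ⟨k1, h.2.2, ?_⟩
            rw [h.2.2] at k3; linarith
          · exfalso
            rw [mem_segment_right_iff T h1] at h
            have e1 := mul_nonneg hp.le k1
            have e2 := mul_nonneg hs.le k2
            rw [h.1] at k3 h1
            have e3 : s * γ = 0 := by linarith
            have e4 : (1 - s) * β = 0 := by linarith
            have e5 := (mul_eq_zero.1 e3).resolve_left hs.ne'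
            have e6 := (mul_eq_zero.1 e4).resolve_left hp.ne'
            linarith
        · right
          rw [← hy, mem_subtriangle_iff T h1 hs1] at h
          rw [← hy, hz', mem_segment_cut_cut_iff T h1 hs hu]
          have e2 := mul_nonneg hs.le k2
          exact ⟨k1, k2, by linarith [h.2.2]⟩
        · exact Or.inr h
        · right
          rw [← hy, hz', mem_middle_iff T h1 hs hu1] at h
          rw [← hy, hz', mem_segment_cut_cut_iff T h1 hs hu]
          exact ⟨k1, k2, by linarith [h.2.2]⟩)
    have hzC : {z} ∈ C.M.faces := singleton_mem_of_mem hvz (by simp)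
    have hc3 : ∀ b', (C.c b').faces ⊆ (C3.c b').faces := by
      intro b'
      rcases Bool.eq_or_eq_not b' b with rfl | rfl
      · rw [h33, h23, h13]
        intro m hm
        exact Or.inl (Or.inl (Or.inl hm))
      · rw [h34, h24, h14]
    refine ⟨C4, ?_, ?_, ?_, fun b' => (hc3 b').trans (h44 b'), ?_, ?_⟩
    · refine Set.Subset.trans ?_ h41
      rw [h31, h21, h11]
      intro m hm
      exact Or.inl (Or.inl (Or.inl hm))
    · rw [h42, h32, h22, h12]
      apply Set.Subset.antisymm
      · rintro x ((((h | h) | h) | h) | h)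
        · exact Or.inl h
        · exact Or.inr (hsub1 h)
        · exact Or.inr (hsegT h)
        · exact Or.inr (hsub2 h)
        · exact Or.inr (hsub3 h)
      · rintro x (h | h)
        · exact Or.inl (Or.inl (Or.inl (Or.inl h)))
        · obtain ⟨α, β, γ, h1, rfl⟩ := hcoord x h
          rw [mem_triangle_iff T h1] at h
          obtain ⟨k1, k2, k3⟩ := h
          -- The cevian `zy` and the segment `yz'` decide which of the three pieces contains the
          -- point.
          by_cases c1 : s * α ≤ (1 - s) * β
          · refine Or.inl (Or.inl (Or.inl (Or.inr ?_)))
            rw [← hy, mem_subtriangle_iff T h1 hs1]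
            exact ⟨k1, k3, c1⟩
          · by_cases c2 : 1 / 2 * (s * α - (1 - s) * β) ≤ s * (1 - 1 / 2) * γ
            · refine Or.inl (Or.inr ?_)
              rw [← hy, hz', mem_middle_iff T h1 hs hu1]
              exact ⟨k2, by linarith, c2⟩
            · right
              rw [← hy, hz', mem_corner_iff T h1 hs hu]
              exact ⟨k2, k3, by linarith⟩
    · refine Chain.snoc (y := z') ⟨1 - 1 / 2, 1 / 2, by norm_num, by norm_num, by norm_num, hz'.symm⟩
        h43 (h41 ?_)
      rw [h31, Finset.pair_comm]; exact Or.inr (by simp)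
    · intro b' m hm
      rcases h45 b' m hm with hm | hm
      swap
      · exact Or.inr (hm.trans hsub3)
      rcases Bool.eq_or_eq_not b' b with rfl | rfl
      swap
      · rw [h34, h24, h14] at hm; exact Or.inl hm
      have hpts : ∀ m : Finset E, (∀ x ∈ m, x ∈ convexHull ℝ {a, v, z}) →
          convexHull ℝ (m : Set E) ⊆ convexHull ℝ {a, v, z} :=
        fun m h => convexHull_min h hcT
      rw [h33, h23, h13] at hm
      rcases hm with ((hm | hm) | hm) | hm
      · exact Or.inl hm
      all_goals
        right
        apply hpts
        rcases hm with rfl | rfl | rfl | rfl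
        all_goals
          intro x hx
          simp only [Finset.mem_insert, Finset.mem_singleton] at hx
          rcases hx with rfl | rfl | rfl <;> assumption
    · intro b' hb'
      rcases h45 b' _ hb' with hm | hm
      · rcases Bool.eq_or_eq_not b' b with rfl | rfl
        · apply h44
          rw [h33, h23, h13]
          exact Or.inl (Or.inl (Or.inr (by simp)))
        · rw [h34, h24, h14] at hm
          exact h44 _ (hc3 _ (hz _ hm))
      · exfalso
        have : z ∈ convexHull ℝ {a, y, z'} := hm (by simp)
        have e : z = (0 : ℝ) • a + (0 : ℝ) • v + (1 : ℝ) • z := by module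
        rw [e, ← hy, hz', mem_corner_iff T (by norm_num) hs hu] at this
        linarith [this.2.2]

end Fill

end PLCover

namespace PLCover

open Geometry

/-! ### Expansions of geometric realizations of abstract complexes. -/

section Realization

variable {V : Type*}

theorem single_ne {a b : V} (h : a ≠ b) : Finsupp.single a (1 : ℝ) ≠ Finsupp.single b 1 := by
  intro e
  exact h (Finsupp.single_left_injective one_ne_zero e)

theorem nonCollinear_single {a b c : V} (hab : a ≠ b) (hbc : b ≠ c) (hac : a ≠ c) :
    NonCollinear (Finsupp.single a (1 : ℝ)) (Finsupp.single b 1) (Finsupp.single c 1) := by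
  intro α β γ _ h
  have ha := DFunLike.congr_fun h a
  have hb := DFunLike.congr_fun h b
  have hc := DFunLike.congr_fun h c
  simp [hab.symm, hac.symm, hab, hbc.symm, hbc, hac] at ha hb hc
  exact ⟨ha, hb, hc⟩

variable [DecidableEq V]

/-- The geometric simplex spanned by the standard basis vectors indexed by `F`. -/
noncomputable def hull (F : Finset V) : Set (V →₀ ℝ) :=
  convexHull ℝ ((F.image fun v => Finsupp.single v (1 : ℝ) : Finset (V →₀ ℝ)) : Set (V →₀ ℝ))

theorem single_mem_hull {F : Finset V} {v : V} (hv : v ∈ F) : Finsupp.single v (1 : ℝ) ∈ hull F :=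
  subset_convexHull ℝ _ (by simpa using ⟨v, hv, rfl⟩)

theorem mem_hull_iff {F : Finset V} {x : V →₀ ℝ} :
    x ∈ hull F ↔ (∀ v, 0 ≤ x v) ∧ x.support ⊆ F ∧ (x.sum fun _ r => r) = 1 := by
  constructor
  · intro hx
    have hconv : Convex ℝ {x : V →₀ ℝ | (∀ v, 0 ≤ x v) ∧ x.support ⊆ F ∧
        (x.sum fun _ r => r) = 1} := by
      rintro x ⟨hx, hx', hx''⟩ y ⟨hy, hy', hy''⟩ a b ha hb hab
      refine ⟨fun v => ?_, ?_, ?_⟩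
      · have := hx v; have := hy v
        simp only [Finsupp.add_apply, Finsupp.smul_apply, smul_eq_mul]; positivity
      · intro v hv
        by_contra h
        have e1 : x v = 0 := by by_contra h'; exact h (hx' (by simpa using h'))
        have e2 : y v = 0 := by by_contra h'; exact h (hy' (by simpa using h'))
        simp [e1, e2] at hv
      · rw [Finsupp.sum_add_index' (by simp) (by simp), Finsupp.sum_smul_index (by simp),
          Finsupp.sum_smul_index (by simp), ← Finsupp.mul_sum, ← Finsupp.mul_sum, hx'', hy'']
        linarith
    refine convexHull_min ?_ hconv hx
    intro y hy
    simp only [Finset.coe_image, Set.mem_image, Finset.mem_coe] at hy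
    obtain ⟨v, hv, rfl⟩ := hy
    refine ⟨fun w => ?_, ?_, by simp⟩
    · rw [Finsupp.single_apply]; split_ifs <;> norm_num
    · exact Finsupp.support_single_subset.trans (by simpa using hv)
  · rintro ⟨h1, h2, h3⟩
    have : x = ∑ v ∈ x.support, x v • Finsupp.single v (1 : ℝ) := by
      conv_lhs => rw [← Finsupp.sum_single x]
      rw [Finsupp.sum]
      simp
    rw [this]
    exact (convex_convexHull ℝ _).sum_mem (fun v _ => h1 v) h3 (fun v hv => single_mem_hull (h2 hv))

theorem hull_mono {F G : Finset V} (h : F ⊆ G) : hull F ⊆ hull G := by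
  intro x hx
  rw [mem_hull_iff] at hx ⊢
  exact ⟨hx.1, hx.2.1.trans h, hx.2.2⟩

theorem hull_inter {F G : Finset V} {x : V →₀ ℝ} (hF : x ∈ hull F) (hG : x ∈ hull G) :
    x ∈ hull (F ∩ G) := by
  rw [mem_hull_iff] at *
  exact ⟨hF.1, Finset.subset_inter hF.2.1 hG.2.1, hF.2.2⟩

theorem hull_pair (a b : V) :
    hull {a, b} = segment ℝ (Finsupp.single a (1 : ℝ)) (Finsupp.single b 1) := by
  rw [hull, ← convexHull_pair]; simp

theorem hull_triple (a b c : V) : hull {a, b, c} =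
    convexHull ℝ {Finsupp.single a (1 : ℝ), Finsupp.single b 1, Finsupp.single c 1} := by
  rw [hull]; simp

theorem hull_singleton (a : V) : hull {a} = {Finsupp.single a (1 : ℝ)} := by
  rw [hull]; simp

theorem hull_nonempty {F : Finset V} {x : V →₀ ℝ} (h : x ∈ hull F) : F.Nonempty := by
  have := convexHull_nonempty_iff.1 ⟨x, h⟩
  simpa using this

theorem onFinsupp_faces (K : PreAbstractSimplicialComplex V) :
    (SimplicialComplex.onFinsupp (𝕜 := ℝ) K).faces =
      (fun F : Finset V => F.image fun v => Finsupp.single v (1 : ℝ)) '' K.faces := rfl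

theorem mem_onFinsupp_space (K : PreAbstractSimplicialComplex V) {x : V →₀ ℝ} :
    x ∈ (SimplicialComplex.onFinsupp (𝕜 := ℝ) K).space ↔ ∃ F ∈ K.faces, x ∈ hull F := by
  rw [SimplicialComplex.mem_space_iff, onFinsupp_faces]
  simp [hull]

/-- The realization of the abstract complex with set of faces `S` has a triangulation which
subdivides the vertices and edges of `S` and which is the union of two collapsible
subcomplexes. -/
def Good (S : Set (Finset V)) : Prop :=
  ∃ C : Colored (V →₀ ℝ), C.M.space = ⋃ F ∈ S, hull F ∧
    (∀ v, {v} ∈ S → {Finsupp.single v (1 : ℝ)} ∈ C.M.faces) ∧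
    ∀ a b, a ≠ b → {a, b} ∈ S → Chain C.M.faces (Finsupp.single a (1 : ℝ)) (Finsupp.single b 1)

theorem Good.covered {K : PreAbstractSimplicialComplex V} (h : Good K.faces) :
    CoveredByTwoPLCollapsibles (SimplicialComplex.onFinsupp (𝕜 := ℝ) K).space := by
  obtain ⟨C, hC, -, -⟩ := h
  have hsp : C.M.space = (SimplicialComplex.onFinsupp (𝕜 := ℝ) K).space := by
    rw [hC]; ext x; rw [mem_onFinsupp_space]; simp
  have hsub : ∀ b, IsSubpolyhedron (C.c b).space
      (SimplicialComplex.onFinsupp (𝕜 := ℝ) K).space := fun b =>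
    ⟨C.M, C.c b, ⟨C.fin, hsp⟩, C.le b, rfl⟩
  have hcoll : ∀ b, PLCollapsible (C.c b).space := fun b =>
    ⟨C.c b, ⟨C.fin.subset (C.le b), rfl⟩, C.fin.subset (C.le b), C.collapse b⟩
  refine ⟨(C.c true).space, (C.c false).space, hsub _, hsub _, hcoll _, hcoll _, ?_⟩
  rw [← hsp]
  ext x
  simp only [Set.mem_union, SimplicialComplex.mem_space_iff]
  constructor
  · rintro (⟨s, hs, hx⟩ | ⟨s, hs, hx⟩)
    · exact ⟨s, C.le _ hs, hx⟩
    · exact ⟨s, C.le _ hs, hx⟩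
  · rintro ⟨s, hs, hx⟩
    obtain ⟨b, hb⟩ := C.cover s hs
    cases b
    · exact Or.inr ⟨s, hb, hx⟩
    · exact Or.inl ⟨s, hb, hx⟩

theorem Chain.right_mem {E : Type*} [AddCommGroup E] [Module ℝ E] [DecidableEq E]
    {M : SimplicialComplex ℝ E} {a v : E} (h : Chain M.faces a v) : {v} ∈ M.faces := by
  cases h with
  | edge _ h => exact singleton_mem_of_mem h (by simp)
  | snoc _ _ h => exact singleton_mem_of_mem h (by simp)

theorem pair_eq_pair {α : Type*} [DecidableEq α] {a b c d : α}
    (h : ({a, b} : Finset α) = {c, d}) : (a = c ∧ b = d) ∨ (a = d ∧ b = c) := by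
  have h1 : ({a, b} : Set α) = {c, d} := by
    rw [← Finset.coe_pair, ← Finset.coe_pair, h]
  exact Set.pair_eq_pair_iff.1 h1

theorem Good.whisker {S : Set (Finset V)} (h : Good S) {a b : V} (hab : a ≠ b) (ha : {a} ∈ S)
    (hb : ∀ F ∈ S, b ∉ F) : Good (S ∪ {{b}, {a, b}}) := by
  obtain ⟨C, hC, hv, he⟩ := h
  obtain ⟨c, hc⟩ := C.cover _ (hv a ha)
  obtain ⟨C1, h1, h2, h3, h4⟩ := C.attach_whisker c (single_ne hab) hc (by
    intro x hx hxM
    rw [hC] at hxM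
    simp only [Set.mem_iUnion] at hxM
    obtain ⟨F, hF, hxF⟩ := hxM
    rw [← hull_pair] at hx
    have := hull_inter hx hxF
    have hsub : ({a, b} ∩ F : Finset V) ⊆ {a} := by
      intro y hy
      simp only [Finset.mem_inter, Finset.mem_insert, Finset.mem_singleton] at hy ⊢
      rcases hy with ⟨rfl | rfl, hy⟩
      · rfl
      · exact absurd hy (hb F hF)
    have := hull_mono hsub this
    rwa [hull_singleton] at this)
  refine ⟨C1, ?_, ?_, ?_⟩
  · rw [h2, hC, Set.biUnion_union, Set.biUnion_insert, Set.biUnion_singleton, hull_pair,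
      hull_singleton]
    congr 1
    rw [Set.union_eq_right.2 (Set.singleton_subset_iff.2 (right_mem_segment ℝ _ _))]
  · rintro v (hv' | hv' | hv')
    · rw [h1]; exact Or.inl (hv v hv')
    · rw [Finset.singleton_inj.1 hv', h1]; exact Or.inr (by simp)
    · exfalso
      have : a ∈ ({v} : Finset V) := by rw [hv']; simp
      have hb' : b ∈ ({v} : Finset V) := by rw [hv']; simp
      simp only [Finset.mem_singleton] at this hb'
      exact hab (this.trans hb'.symm)
  · rintro x y hxy (h' | h' | h')
    · exact (he x y hxy h').mono (by rw [h1]; exact Set.subset_union_left)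
    · exfalso
      have h1 : x ∈ ({b} : Finset V) := by rw [← h']; simp
      have h2 : y ∈ ({b} : Finset V) := by rw [← h']; simp
      simp only [Finset.mem_singleton] at h1 h2
      exact hxy (h1.trans h2.symm)
    · have hch : Chain C1.M.faces (Finsupp.single a (1 : ℝ)) (Finsupp.single b 1) :=
        Chain.edge (single_ne hab) (by rw [h1]; exact Or.inr (by simp))
      rcases pair_eq_pair h' with ⟨rfl, rfl⟩ | ⟨rfl, rfl⟩
      · exact hch
      · exact hch.symm

/-- The elementary expansion step, for old edges that may be subdivided and coloured arbitrarily. A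
whisker from `v` to the midpoint of the new edge halves the triangle. Each half then has one old,
subdivided edge and one undivided edge on the whisker, which is the situation of `Colored.fill`. The
last conclusion of `Colored.fill` for the first half supplies its colour hypothesis for the second.
-/
theorem Good.triangle {S : Set (Finset V)} (h : Good S) {v a b : V} (hva : v ≠ a) (hvb : v ≠ b)
    (hab : a ≠ b) (h1 : {v, a} ∈ S) (h2 : {v, b} ∈ S) (hS : ∀ F ∈ S, ¬ ({a, b} ⊆ F)) :
    Good (S ∪ {{a, b}, {v, a, b}}) := by
  obtain ⟨C, hC, hver, hed⟩ := h
  have hcv := hed v a hva h1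
  have hcb := hed v b hvb h2
  have T := nonCollinear_single hab hvb.symm hva.symm
  set A := Finsupp.single a (1 : ℝ) with hA
  set B := Finsupp.single b (1 : ℝ) with hB
  set W := Finsupp.single v (1 : ℝ) with hW
  set Z := (1 - (1 / 2 : ℝ)) • A + (1 / 2 : ℝ) • B with hZ
  have hs : (0 : ℝ) < 1 / 2 := by norm_num
  have hs1 : (1 / 2 : ℝ) < 1 := by norm_num
  have hZ' : Z = (1 - (1 / 2 : ℝ)) • B + (1 / 2 : ℝ) • A := by rw [hZ]; module
  -- the previous complex meets the new triangle in two edges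
  have hmeet : ∀ α β γ : ℝ, α + β + γ = 1 → α • A + β • B + γ • W ∈ convexHull ℝ {A, B, W} →
      α • A + β • B + γ • W ∈ C.M.space → α = 0 ∨ β = 0 := by
    intro α β γ h1 hx hxM
    rw [hC] at hxM
    simp only [Set.mem_iUnion] at hxM
    obtain ⟨F, hF, hxF⟩ := hxM
    rw [hA, hB, hW, ← hull_triple] at hx
    have hx' := hull_inter hx hxF
    rw [mem_hull_iff] at hx'
    -- If both coordinates were nonzero, the face `F` carrying the point would contain `{a, b}`.
    by_contra hcon
    push Not at hcon
    apply hS F hF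
    intro y hy
    have hy' : y ∈ (α • A + β • B + γ • W).support := by
      simp only [Finset.mem_insert, Finset.mem_singleton] at hy
      rcases hy with rfl | rfl
      · simp [hA, hB, hW, hab.symm, hva, hcon.1]
      · simp [hA, hB, hW, hab, hvb, hcon.2]
    exact (Finset.mem_inter.1 (hx'.2.1 hy')).2
  have hcoord : ∀ x ∈ convexHull ℝ {A, B, W},
      ∃ α β γ : ℝ, α + β + γ = 1 ∧ x = α • A + β • B + γ • W := by
    intro x hx
    obtain ⟨α, β, γ, -, -, -, h, e⟩ := mem_convexHull_triple.1 hx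
    exact ⟨α, β, γ, h, e.symm⟩
  have hcT := convex_convexHull ℝ ({A, B, W} : Set (V →₀ ℝ))
  have hAT : A ∈ convexHull ℝ {A, B, W} := subset_convexHull ℝ _ (by simp)
  have hBT : B ∈ convexHull ℝ {A, B, W} := subset_convexHull ℝ _ (by simp)
  have hWT : W ∈ convexHull ℝ {A, B, W} := subset_convexHull ℝ _ (by simp)
  have hZT : Z ∈ convexHull ℝ {A, B, W} :=
    hcT.segment_subset hAT hBT ⟨1 - 1 / 2, 1 / 2, by norm_num, by norm_num, by norm_num, rfl⟩
  have hsubA : convexHull ℝ {A, W, Z} ⊆ convexHull ℝ {A, B, W} :=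
    convexHull_min (by rintro x (rfl | rfl | rfl) <;> assumption) hcT
  have hsubB : convexHull ℝ {B, W, Z} ⊆ convexHull ℝ {A, B, W} :=
    convexHull_min (by rintro x (rfl | rfl | rfl) <;> assumption) hcT
  have hmemA : ∀ {α β γ : ℝ}, α + β + γ = 1 → (α • A + β • B + γ • W ∈ convexHull ℝ {A, W, Z} ↔
      0 ≤ β ∧ 0 ≤ γ ∧ β ≤ α) := by
    intro α β γ h1
    have e : ({A, W, Z} : Set (V →₀ ℝ)) = {Z, A, W} := by ext; simp; tauto
    rw [e, hZ', add_comm (α • A), mem_subtriangle_iff T.swap (by linarith) hs1]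
    constructor
    · rintro ⟨h2, h3, h4⟩; exact ⟨h2, h3, by linarith⟩
    · rintro ⟨h2, h3, h4⟩; exact ⟨h2, h3, by linarith⟩
  have hmemB : ∀ {α β γ : ℝ}, α + β + γ = 1 → (α • A + β • B + γ • W ∈ convexHull ℝ {B, W, Z} ↔
      0 ≤ α ∧ 0 ≤ γ ∧ α ≤ β) := by
    intro α β γ h1
    have e : ({B, W, Z} : Set (V →₀ ℝ)) = {Z, B, W} := by ext; simp; tauto
    rw [e, hZ, mem_subtriangle_iff T h1 hs1]
    constructor
    · rintro ⟨h2, h3, h4⟩; exact ⟨h2, h3, by linarith⟩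
    · rintro ⟨h2, h3, h4⟩; exact ⟨h2, h3, by linarith⟩
  have hmemZ : ∀ {α β γ : ℝ}, α + β + γ = 1 → (α • A + β • B + γ • W ∈ segment ℝ W Z ↔
      0 ≤ β ∧ 0 ≤ γ ∧ β = α) := by
    intro α β γ h1
    rw [hZ, mem_segment_cevian_iff T h1 hs]
    constructor
    · rintro ⟨h2, h3, h4⟩; exact ⟨h2, h3, by linarith⟩
    · rintro ⟨h2, h3, h4⟩; exact ⟨h2, h3, by linarith⟩
  have hmemAW : ∀ {α β γ : ℝ}, α + β + γ = 1 → (α • A + β • B + γ • W ∈ segment ℝ A W ↔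
      β = 0 ∧ 0 ≤ α ∧ 0 ≤ γ) := by
    intro α β γ h1
    rw [add_comm (α • A), mem_segment_right_iff T.swap (by linarith)]
  have hmemBW : ∀ {α β γ : ℝ}, α + β + γ = 1 → (α • A + β • B + γ • W ∈ segment ℝ B W ↔
      α = 0 ∧ 0 ≤ β ∧ 0 ≤ γ) := by
    intro α β γ h1
    rw [mem_segment_right_iff T h1]
  have hsegZ : segment ℝ W Z ⊆ convexHull ℝ {A, B, W} := hcT.segment_subset hWT hZT
  have hWZ : W ≠ Z := by
    intro e
    have : (0 : ℝ) • A + (0 : ℝ) • B + (1 : ℝ) • W = (1 / 2 : ℝ) • A + (1 / 2 : ℝ) • B + (0 : ℝ) • W := by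
      have e1 : (0 : ℝ) • A + (0 : ℝ) • B + (1 : ℝ) • W = W := by module
      rw [e1, e, hZ]; module
    have := (T.unique (by norm_num) (by norm_num) this).1
    norm_num at this
  have hTA : NonCollinear A W Z := by
    intro α β γ e1 e2
    rw [hZ] at e2
    have := T (α + γ / 2) (γ / 2) β (by linarith) (by rw [← e2]; module)
    exact ⟨by linarith [this.1, this.2.1], this.2.2, by linarith [this.2.1]⟩
  have hTB : NonCollinear B W Z := by
    intro α β γ e1 e2
    rw [hZ] at e2
    have := T (γ / 2) (α + γ / 2) β (by linarith) (by rw [← e2]; module)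
    exact ⟨by linarith [this.1, this.2.1], this.2.2, by linarith [this.1]⟩
  -- the whisker
  obtain ⟨c, hc⟩ := C.cover _ hcv.symm.right_mem
  have hZC : Z ∉ C.M.space := by
    intro h
    have e : Z = (1 / 2 : ℝ) • A + (1 / 2 : ℝ) • B + (0 : ℝ) • W := by rw [hZ]; module
    rw [e] at h hZT
    have := hmeet _ _ _ (by norm_num) hZT h
    norm_num at this
  obtain ⟨C1, h11, h12, h13, h14⟩ := C.attach_whisker c hWZ hc (by
    intro x hx hxM
    have hxT := hsegZ hx
    obtain ⟨α, β, γ, h1, rfl⟩ := hcoord x hxT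
    rw [hmemZ h1] at hx
    have e : α = 0 ∧ β = 0 := by
      rcases hmeet α β γ h1 hxT hxM with h | h
      · exact ⟨h, by rw [hx.2.2, h]⟩
      · exact ⟨by rw [← hx.2.2, h], h⟩
    obtain ⟨rfl, rfl⟩ := e
    obtain rfl : γ = 1 := by linarith
    module)
  have hWZ1 : {W, Z} ∈ C1.M.faces := by rw [h11]; exact Or.inr (by simp)
  have hsub1 : C.M.faces ⊆ C1.M.faces := by rw [h11]; exact Set.subset_union_left
  -- the first half
  obtain ⟨C2, h21, h22, h23, h24, h25, h26⟩ := Colored.fill hcv.symm C1 Z hsub1 hTA hWZ1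
    (by
      intro b' hb'
      rcases Bool.eq_or_eq_not b' c with rfl | rfl
      · rw [h13]; exact Or.inr (by simp)
      · rw [h14] at hb'
        exact absurd (C.M.subset_space (C.le _ hb') (by simp)) hZC)
    (by
      intro x hx hxM
      have hxT := hsubA hx
      obtain ⟨α, β, γ, h1, rfl⟩ := hcoord x hxT
      rw [h12] at hxM
      rcases hxM with h | h
      · left
        rw [hmemA h1] at hx
        rw [hmemAW h1]
        rcases hmeet α β γ h1 hxT h with h' | h'
        · rw [h'] at hx; exact ⟨by linarith [hx.1, hx.2.2], by linarith, hx.2.1⟩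
        · exact ⟨h', by linarith [hx.1, hx.2.2], hx.2.1⟩
      · exact Or.inr h)
  -- the second half
  obtain ⟨C3, h31, h32, h33, h34, h35, h36⟩ := Colored.fill hcb.symm C2 Z (hsub1.trans h21) hTB
    (h21 hWZ1) h26
    (by
      intro x hx hxM
      have hxT := hsubB hx
      obtain ⟨α, β, γ, h1, rfl⟩ := hcoord x hxT
      rw [hmemB h1] at hx
      rw [h22, h12] at hxM
      rcases hxM with (h | h) | h
      · left
        rw [hmemBW h1]
        rcases hmeet α β γ h1 hxT h with h' | h'
        · exact ⟨h', by linarith [hx.1, hx.2.2], hx.2.1⟩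
        · rw [h'] at hx; exact ⟨by linarith [hx.1, hx.2.2], by linarith, hx.2.1⟩
      · exact Or.inr h
      · right
        rw [hmemA h1] at h
        rw [hmemZ h1]
        exact ⟨h.1, h.2.1, le_antisymm h.2.2 hx.2.2⟩)
  have hCC3 : C.M.faces ⊆ C3.M.faces := (hsub1.trans h21).trans h31
  have hchain : Chain C3.M.faces A B :=
    Chain.concat (h23.mono h31) h33.symm
      ⟨1 - 1 / 2, 1 / 2, by norm_num, by norm_num, by norm_num, rfl⟩
  refine ⟨C3, ?_, ?_, ?_⟩
  · rw [h32, h22, h12, hC, Set.biUnion_union, Set.biUnion_insert, Set.biUnion_singleton,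
      Set.union_eq_right.2 (hull_mono (by simp : ({a, b} : Finset V) ⊆ {v, a, b}))]
    have e : hull {v, a, b} = convexHull ℝ {A, B, W} := by
      rw [hull_triple]; congr 1; ext; simp; tauto
    rw [e]
    apply Set.Subset.antisymm
    · rintro x (((h | h) | h) | h)
      · exact Or.inl h
      · exact Or.inr (hsegZ h)
      · exact Or.inr (hsubA h)
      · exact Or.inr (hsubB h)
    · rintro x (h | h)
      · exact Or.inl (Or.inl (Or.inl h))
      · obtain ⟨α, β, γ, h1, rfl⟩ := hcoord x h
        rw [mem_triangle_iff T h1] at h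
        rcases le_total α β with h' | h'
        · right; rw [hmemB h1]; exact ⟨h.1, h.2.2, h'⟩
        · refine Or.inl (Or.inr ?_); rw [hmemA h1]; exact ⟨h.2.1, h.2.2, h'⟩
  · rintro w (hw | hw | hw)
    · exact hCC3 (hver w hw)
    · exfalso
      have h1 : a ∈ ({w} : Finset V) := by rw [hw]; simp
      have h2 : b ∈ ({w} : Finset V) := by rw [hw]; simp
      simp only [Finset.mem_singleton] at h1 h2
      exact hab (h1.trans h2.symm)
    · exfalso
      have h1 : a ∈ ({w} : Finset V) := by rw [hw]; simp
      have h2 : b ∈ ({w} : Finset V) := by rw [hw]; simp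
      simp only [Finset.mem_singleton] at h1 h2
      exact hab (h1.trans h2.symm)
  · rintro x y hxy (h' | h' | h')
    · exact (hed x y hxy h').mono hCC3
    · rcases pair_eq_pair h' with ⟨rfl, rfl⟩ | ⟨rfl, rfl⟩
      · exact hchain
      · exact hchain.symm
    · exfalso
      have h1 := congrArg Finset.card h'
      rw [Finset.card_pair hxy, Finset.card_eq_three.2 ⟨v, a, b, hva, hvb, hab, rfl⟩] at h1
      omega

/-- Attach a triangle along one of its edges. -/
theorem Good.triangle_new_vertex {S : Set (Finset V)} (h : Good S) {v a b : V} (hva : v ≠ a)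
    (hvb : v ≠ b) (hab : a ≠ b) (h0 : {v} ∈ S) (h1 : {v, a} ∈ S) (hb : ∀ F ∈ S, b ∉ F) :
    Good (S ∪ {{b}, {v, b}, {a, b}, {v, a, b}}) := by
  have h2 := h.whisker hvb h0 hb
  have h3 := h2.triangle hva hvb hab (Or.inl h1) (Or.inr (by simp)) (by
    rintro F (hF | rfl | rfl) hs
    · exact hb F hF (hs (by simp))
    · have := hs (by simp : a ∈ ({a, b} : Finset V))
      simp [hab] at this
    · have := hs (by simp : a ∈ ({a, b} : Finset V))
      simp [hab, hva.symm] at this)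
  convert h3 using 1
  ext; simp; tauto

end Realization

end PLCover

namespace PLCover

open Geometry

/-! ### Expansions of complexes given by generating simplices, and attaching a disc. -/

section Generated

variable {V : Type*}

theorem mem_generated {G : Set (Finset V)} {F : Finset V} :
    F ∈ (generatedComplex G).faces ↔ F.Nonempty ∧ ∃ t ∈ G, F ⊆ t := Iff.rfl

variable [DecidableEq V]

theorem generatedComplex_insert_triangle {G : Set (Finset V)} {v a b : V}
    (h1 : {v, a} ∈ (generatedComplex G).faces) (h2 : {v, b} ∈ (generatedComplex G).faces) :
    (generatedComplex (insert {v, a, b} G)).faces =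
      (generatedComplex G).faces ∪ {{a, b}, {v, a, b}} := by
  ext F
  simp only [mem_generated, Set.mem_insert_iff, Set.mem_union, Set.mem_singleton_iff]
  constructor
  · rintro ⟨hn, t, rfl | ht, hF⟩
    · rcases subset_triple_cases hF hn with rfl | rfl | rfl | rfl | rfl | rfl | rfl
      · exact Or.inl (((generatedComplex G).isRelLowerSet_faces h1).2 (by simp) hn)
      · exact Or.inl (((generatedComplex G).isRelLowerSet_faces h1).2 (by simp) hn)
      · exact Or.inl (((generatedComplex G).isRelLowerSet_faces h2).2 (by simp) hn)
      · exact Or.inl h1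
      · simp
      · exact Or.inl h2
      · simp
    · exact Or.inl ⟨hn, t, ht, hF⟩
  · rintro (⟨hn, t, ht, hF⟩ | rfl | rfl)
    · exact ⟨hn, t, Or.inr ht, hF⟩
    · exact ⟨by simp, _, Or.inl rfl, by simp⟩
    · exact ⟨by simp, _, Or.inl rfl, Finset.Subset.refl _⟩

theorem Good.insert_triangle {G : Set (Finset V)} (h : Good (generatedComplex G).faces)
    {v a b : V} (hva : v ≠ a) (hvb : v ≠ b) (hab : a ≠ b) (h1 : ∃ t ∈ G, v ∈ t ∧ a ∈ t)
    (h2 : ∃ t ∈ G, v ∈ t ∧ b ∈ t) (hG : ∀ t ∈ G, a ∈ t → b ∉ t) :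
    Good (generatedComplex (insert {v, a, b} G)).faces := by
  obtain ⟨t1, ht1, hv1, ha1⟩ := h1
  obtain ⟨t2, ht2, hv2, hb2⟩ := h2
  have h1' : {v, a} ∈ (generatedComplex G).faces :=
    ⟨by simp, t1, ht1, by simp [Finset.insert_subset_iff, hv1, ha1]⟩
  have h2' : {v, b} ∈ (generatedComplex G).faces :=
    ⟨by simp, t2, ht2, by simp [Finset.insert_subset_iff, hv2, hb2]⟩
  rw [generatedComplex_insert_triangle h1' h2']
  refine h.triangle hva hvb hab h1' h2' ?_
  rintro F ⟨-, t, ht, hFt⟩ hF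
  exact hG t ht (hFt (hF (by simp))) (hFt (hF (by simp)))

theorem Good.insert_triangle_new_vertex {G : Set (Finset V)}
    (h : Good (generatedComplex G).faces)
    {v a b : V} (hva : v ≠ a) (h1 : ∃ t ∈ G, v ∈ t ∧ a ∈ t) (hG : ∀ t ∈ G, b ∉ t) :
    Good (generatedComplex (insert {v, a, b} G)).faces := by
  obtain ⟨t1, ht1, hv1, ha1⟩ := h1
  have hvb : v ≠ b := by rintro rfl; exact hG t1 ht1 hv1
  have hab : a ≠ b := by rintro rfl; exact hG t1 ht1 ha1
  have h0' : {v} ∈ (generatedComplex G).faces := ⟨by simp, t1, ht1, by simpa using hv1⟩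
  have h1' : {v, a} ∈ (generatedComplex G).faces :=
    ⟨by simp, t1, ht1, by simp [Finset.insert_subset_iff, hv1, ha1]⟩
  have := h.triangle_new_vertex hva hvb hab h0' h1' (by
    rintro F ⟨-, t, ht, hFt⟩ hF
    exact hG t ht (hFt hF))
  convert this using 1
  ext F
  simp only [mem_generated, Set.mem_insert_iff, Set.mem_union, Set.mem_singleton_iff]
  constructor
  · rintro ⟨hn, t, rfl | ht, hF⟩
    · rcases subset_triple_cases hF hn with rfl | rfl | rfl | rfl | rfl | rfl | rfl
      · exact Or.inl h0'
      · exact Or.inl ⟨hn, t1, ht1, by simpa using ha1⟩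
      · simp
      · exact Or.inl h1'
      · simp
      · simp
      · simp
    · exact Or.inl ⟨hn, t, ht, hF⟩
  · rintro (⟨hn, t, ht, hF⟩ | rfl | rfl | rfl | rfl)
    · exact ⟨hn, t, Or.inr ht, hF⟩
    · exact ⟨by simp, _, Or.inl rfl, by simp⟩
    · exact ⟨by simp, _, Or.inl rfl, by intro x; simp; tauto⟩
    · exact ⟨by simp, _, Or.inl rfl, by simp⟩
    · exact ⟨by simp, _, Or.inl rfl, Finset.Subset.refl _⟩

theorem image_Iio_succ {α : Type*} (f : ℕ → α) (j : ℕ) :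
    f '' Set.Iio (j + 1) = insert (f j) (f '' Set.Iio j) := by
  rw [← Order.succ_eq_add_one, Order.Iio_succ_eq_insert, Set.image_insert_eq]

/-- The triangulated disc can be attached along its boundary path except for a free edge. -/
theorem Good.attach_disc {G : Set (Finset V)} (h0 : Good (generatedComplex G).faces) {M : ℕ}
    (P C : ℕ → V) (cen : V) (hP : ∀ j, P j ≠ P (j + 1)) (hlast : P (M + 2) ≠ P 0)
    (hC : ∀ i ≤ M + 2, ∀ j ≤ M + 2, C i = C j → i = j) (hCP : ∀ i j, C i ≠ P j)
    (hcC : ∀ i, C i ≠ cen) (hcP : ∀ j, P j ≠ cen) (hGC : ∀ t ∈ G, ∀ i, C i ∉ t)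
    (hGc : ∀ t ∈ G, cen ∉ t) (hed : ∀ j < M + 2, ∃ t ∈ G, P j ∈ t ∧ P (j + 1) ∈ t)
    (hfree : ∀ t ∈ G, P (M + 2) ∈ t → P 0 ∉ t) :
    Good (generatedComplex (insert {C (M + 2), P (M + 2), P 0} (insert {C 0, C (M + 2), P 0}
      (insert {cen, C (M + 2), C 0} (G ∪ (fun j => {P j, P (j + 1), C j}) '' Set.Iio (M + 2) ∪
        (fun j => {P (j + 1), C j, C (j + 1)}) '' Set.Iio (M + 2) ∪
        (fun j => {C j, C (j + 1), cen}) '' Set.Iio (M + 2)))))).faces := by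
  set t1 : ℕ → Finset V := fun j => {P j, P (j + 1), C j} with ht1
  set t2 : ℕ → Finset V := fun j => {P (j + 1), C j, C (j + 1)} with ht2
  set t3 : ℕ → Finset V := fun j => {C j, C (j + 1), cen} with ht3
  have hC' : ∀ i < M + 2, C i ≠ C (i + 1) := fun i hi h => by
    have := hC i hi.le (i + 1) (by omega) h; omega
  -- No earlier edge of the path joins the two ends of the missing edge.
  have hfree' : ∀ i < M + 2, ∀ x ∈ ({P (M + 2), P 0} : Finset V), ∀ y ∈ ({P (M + 2), P 0} : Finset V),
      P i = x → P (i + 1) = y → x = y := by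
    intro i hi x hx y hy h1 h2
    obtain ⟨t, ht, h3, h4⟩ := hed i hi
    rw [h1] at h3
    rw [h2] at h4
    have := hfree t ht
    simp only [Finset.mem_insert, Finset.mem_singleton] at hx hy
    rcases hx with rfl | rfl <;> rcases hy with rfl | rfl
    · rfl
    · exact absurd h4 (this h3)
    · exact absurd h3 (this h4)
    · rfl
  -- The outer strip is laid along the path: `t1 j` brings in the vertex `C j` over an edge of `G`,
  -- and `t2 j` fills the notch between the neighbouring collar vertices `C j` and `C (j + 1)`.
  have hA : ∀ j ≤ M + 1, Good (generatedComplex (G ∪ t1 '' Set.Iio (j + 1) ∪ t2 '' Set.Iio j)).faces := by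
    intro j
    induction j with
    | zero =>
      intro _
      have h1 := h0.insert_triangle_new_vertex (b := C 0) (hP 0) (hed 0 (by omega))
        (fun t ht => hGC t ht 0)
      convert h1 using 3
      simp [ht1]
    | succ j ih =>
      intro hj
      have h1 := (ih (by omega)).insert_triangle_new_vertex (v := P (j + 1)) (a := P (j + 2))
        (b := C (j + 1)) (hP _) (by
          obtain ⟨t, ht, h⟩ := hed (j + 1) (by omega)
          exact ⟨t, Or.inl (Or.inl ht), h⟩)
        (by
          rintro t ((ht | ⟨i, hi, rfl⟩) | ⟨i, hi, rfl⟩)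
          · exact hGC t ht _
          · simp only [Set.mem_Iio] at hi
            simp only [ht1, Finset.mem_insert, Finset.mem_singleton]
            rintro (h | h | h)
            · exact hCP _ _ h
            · exact hCP _ _ h
            · have := hC _ (by omega) _ (by omega) h; omega
          · simp only [Set.mem_Iio] at hi
            simp only [ht2, Finset.mem_insert, Finset.mem_singleton]
            rintro (h | h | h)
            · exact hCP _ _ h
            · have := hC _ (by omega) _ (by omega) h; omega
            · have := hC _ (by omega) _ (by omega) h; omega)
      have h2 := h1.insert_triangle (v := P (j + 1)) (a := C j) (b := C (j + 1)) (hCP _ _).symm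
        (hCP _ _).symm (hC' j (by omega))
        ⟨t1 j, Or.inr (Or.inl (Or.inr ⟨j, by simp, rfl⟩)), by simp [ht1], by simp [ht1]⟩
        ⟨_, Or.inl rfl, by simp, by simp⟩
        (by
          rintro t (rfl | ((ht | ⟨i, hi, rfl⟩) | ⟨i, hi, rfl⟩))
          · simp only [Finset.mem_insert, Finset.mem_singleton]
            rintro (h | h | h)
            · exact absurd h (hCP _ _)
            · exact absurd h (hCP _ _)
            · exact absurd h (hC' j (by omega))
          · exact fun h => absurd h (hGC t ht _)
          · simp only [Set.mem_Iio] at hi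
            simp only [ht1, Finset.mem_insert, Finset.mem_singleton]
            rintro - (h | h | h)
            · exact hCP _ _ h
            · exact hCP _ _ h
            · have := hC _ (by omega) _ (by omega) h; omega
          · simp only [Set.mem_Iio] at hi
            simp only [ht2, Finset.mem_insert, Finset.mem_singleton]
            rintro - (h | h | h)
            · exact hCP _ _ h
            · have := hC _ (by omega) _ (by omega) h; omega
            · have := hC _ (by omega) _ (by omega) h; omega)
      convert h2 using 3
      rw [image_Iio_succ t1 (j + 1), image_Iio_succ t2 j]
      ext x; simp only [ht1, ht2, Set.mem_union, Set.mem_insert_iff]; tauto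
  -- The edge from `P (M + 2)` to `P 0` is not available, so `C (M + 2)` enters through a triangle
  -- of the second kind, attached along one edge.
  have hA' : Good (generatedComplex (G ∪ t1 '' Set.Iio (M + 2) ∪ t2 '' Set.Iio (M + 2))).faces := by
    have h1 := (hA (M + 1) le_rfl).insert_triangle_new_vertex (v := P (M + 2)) (a := C (M + 1))
      (b := C (M + 2)) (hCP _ _).symm
      ⟨t1 (M + 1), Or.inl (Or.inr ⟨M + 1, by simp, rfl⟩), by simp [ht1], by simp [ht1]⟩
      (by
        rintro t ((ht | ⟨i, hi, rfl⟩) | ⟨i, hi, rfl⟩)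
        · exact hGC t ht _
        · simp only [Set.mem_Iio] at hi
          simp only [ht1, Finset.mem_insert, Finset.mem_singleton]
          rintro (h | h | h)
          · exact hCP _ _ h
          · exact hCP _ _ h
          · have := hC _ (by omega) _ (by omega) h; omega
        · simp only [Set.mem_Iio] at hi
          simp only [ht2, Finset.mem_insert, Finset.mem_singleton]
          rintro (h | h | h)
          · exact hCP _ _ h
          · have := hC _ (by omega) _ (by omega) h; omega
          · have := hC _ (by omega) _ (by omega) h; omega)
    convert h1 using 3
    rw [image_Iio_succ t2 (M + 1)]
    ext x; simp only [ht2, Set.mem_union, Set.mem_insert_iff]; tauto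
  -- The first triangle of the cone brings in `cen`; each later one has its two edges at `C (j + 1)`
  -- already present.
  have hB : ∀ j ≤ M + 1, Good (generatedComplex (G ∪ t1 '' Set.Iio (M + 2) ∪
      t2 '' Set.Iio (M + 2) ∪ t3 '' Set.Iio (j + 1))).faces := by
    intro j
    induction j with
    | zero =>
      intro _
      have h1 := hA'.insert_triangle_new_vertex (v := C 0) (a := C 1) (b := cen)
        (hC' 0 (by omega)) ⟨t2 0, Or.inr ⟨0, by simp, rfl⟩, by simp [ht2], by simp [ht2]⟩
        (by
          rintro t ((ht | ⟨i, hi, rfl⟩) | ⟨i, hi, rfl⟩)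
          · exact hGc t ht
          · simp [ht1, (hcP _).symm, (hcC _).symm]
          · simp [ht2, (hcP _).symm, (hcC _).symm])
      convert h1 using 3
      rw [image_Iio_succ t3 0]
      ext x; simp only [ht3, Set.mem_union, Set.mem_insert_iff]; simp; exact or_comm
    | succ j ih =>
      intro hj
      have h1 := (ih (by omega)).insert_triangle (v := C (j + 1)) (a := C (j + 2)) (b := cen)
        (hC' _ (by omega)) (hcC _) (hcC _)
        ⟨t2 (j + 1), Or.inl (Or.inr ⟨j + 1, by simp; omega, rfl⟩), by simp [ht2], by simp [ht2]⟩
        ⟨t3 j, Or.inr ⟨j, by simp, rfl⟩, by simp [ht3], by simp [ht3]⟩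
        (by
          rintro t (((ht | ⟨i, hi, rfl⟩) | ⟨i, hi, rfl⟩) | ⟨i, hi, rfl⟩)
          · exact fun _ => hGc t ht
          · simp [ht1, (hcP _).symm, (hcC _).symm]
          · simp [ht2, (hcP _).symm, (hcC _).symm]
          · simp only [Set.mem_Iio] at hi
            simp only [ht3, Finset.mem_insert, Finset.mem_singleton]
            rintro (h | h | h)
            · have := hC _ (by omega) _ (by omega) h; omega
            · have := hC _ (by omega) _ (by omega) h; omega
            · exact absurd h (hcC _))
      convert h1 using 3
      rw [image_Iio_succ t3 (j + 1)]
      ext x; simp only [ht3, Set.mem_union, Set.mem_insert_iff]; tauto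
  -- Three triangles are left. Attached in this order, each has two old edges; the new edges are `C
  -- (M + 2)`–`C 0`, `C (M + 2)`–`P 0` and finally the missing edge `P (M + 2)`–`P 0`.
  have h1 := (hB (M + 1) le_rfl).insert_triangle (v := cen) (a := C (M + 2)) (b := C 0)
    (hcC _).symm (hcC _).symm (fun h => by have := hC _ le_rfl _ (by omega) h; omega)
    ⟨t3 (M + 1), Or.inr ⟨M + 1, by simp, rfl⟩, by simp [ht3], by simp [ht3]⟩
    ⟨t3 0, Or.inr ⟨0, by simp, rfl⟩, by simp [ht3], by simp [ht3]⟩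
    (by
      rintro t (((ht | ⟨i, hi, rfl⟩) | ⟨i, hi, rfl⟩) | ⟨i, hi, rfl⟩)
      · exact fun h => absurd h (hGC t ht _)
      · simp only [Set.mem_Iio] at hi
        simp only [ht1, Finset.mem_insert, Finset.mem_singleton]
        rintro (h | h | h)
        · exact absurd h (hCP _ _)
        · exact absurd h (hCP _ _)
        · have := hC _ (by omega) _ (by omega) h; omega
      · simp only [Set.mem_Iio] at hi
        simp only [ht2, Finset.mem_insert, Finset.mem_singleton]
        rintro (h | h | h)
        · exact absurd h (hCP _ _)
        · have := hC _ (by omega) _ (by omega) h; omega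
        · have := hC _ (by omega) _ (by omega) h
          rintro (h | h | h)
          · exact absurd h (hCP _ _)
          · have := hC _ (by omega) _ (by omega) h; omega
          · have := hC _ (by omega) _ (by omega) h; omega
      · simp only [Set.mem_Iio] at hi
        simp only [ht3, Finset.mem_insert, Finset.mem_singleton]
        rintro (h | h | h)
        · have := hC _ (by omega) _ (by omega) h; omega
        · have := hC _ (by omega) _ (by omega) h
          rintro (h | h | h)
          · have := hC _ (by omega) _ (by omega) h; omega
          · have := hC _ (by omega) _ (by omega) h; omega
          · exact absurd h (hcC _)
        · exact absurd h (hcC _))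
  have h2 := h1.insert_triangle (v := C 0) (a := C (M + 2)) (b := P 0)
    (fun h => by have := hC _ (by omega) _ le_rfl h; omega) (hCP _ _) (hCP _ _)
    ⟨_, Or.inl rfl, by simp, by simp⟩
    ⟨t1 0, Or.inr (Or.inl (Or.inl (Or.inr ⟨0, by simp, rfl⟩))), by simp [ht1], by simp [ht1]⟩
    (by
      rintro t (rfl | ((ht | ⟨i, hi, rfl⟩) | ⟨i, hi, rfl⟩) | ⟨i, hi, rfl⟩)
      · simp [hcP, (hCP _ _).symm]
      · exact fun h => absurd h (hGC t ht _)
      · simp only [Set.mem_Iio] at hi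
        simp only [ht1, Finset.mem_insert, Finset.mem_singleton]
        rintro (h | h | h)
        · exact absurd h (hCP _ _)
        · exact absurd h (hCP _ _)
        · have := hC _ (by omega) _ (by omega) h; omega
      · simp only [Set.mem_Iio] at hi
        simp only [ht2, Finset.mem_insert, Finset.mem_singleton]
        rintro (h | h | h)
        · exact absurd h (hCP _ _)
        · have := hC _ (by omega) _ (by omega) h; omega
        · have := hC _ (by omega) _ (by omega) h
          obtain rfl : i = M + 1 := by omega
          rintro (h | h | h)
          · exact hlast h.symm
          · exact absurd h.symm (hCP _ _)
          · exact absurd h.symm (hCP _ _)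
      · simp [ht3, hcP, (hCP _ _).symm])
  exact h2.insert_triangle (v := C (M + 2)) (a := P (M + 2)) (b := P 0) (hCP _ _) (hCP _ _) hlast
    ⟨t2 (M + 1), Or.inr (Or.inr (Or.inl (Or.inr ⟨M + 1, by simp, rfl⟩))), by simp [ht2],
      by simp [ht2]⟩
    ⟨_, Or.inl rfl, by simp, by simp⟩
    (by
      rintro t (rfl | rfl | ((ht | ⟨i, hi, rfl⟩) | ⟨i, hi, rfl⟩) | ⟨i, hi, rfl⟩)
      · simp [(hCP _ _).symm, hlast]
      · simp [(hCP _ _).symm, hcP]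
      · exact hfree t ht
      · simp only [Set.mem_Iio] at hi
        simp only [ht1, Finset.mem_insert, Finset.mem_singleton]
        rintro (h | h | h)
        · rintro (h' | h' | h')
          · exact hlast (h.trans h'.symm)
          · exact hlast (hfree' i hi _ (by simp) _ (by simp) h.symm h'.symm)
          · exact hCP _ _ h'.symm
        · rintro (h' | h' | h')
          · exact hlast (hfree' i hi _ (by simp) _ (by simp) h'.symm h.symm).symm
          · exact hlast (h.trans h'.symm)
          · exact hCP _ _ h'.symm
        · exact absurd h.symm (hCP _ _)
      · simp only [ht2, Finset.mem_insert, Finset.mem_singleton, (hCP _ _).symm, or_false]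
        exact fun h h' => hlast (h.trans h'.symm)
      · simp [ht3, (hCP _ _).symm, hcP])

end Generated

end PLCover

namespace PLCover

open Geometry

/-! ### Coloured complexes whose triangulation is not subdivided. -/

section Realized

variable {V : Type*} [DecidableEq V]

/-- The faces of the realization of the abstract faces `S`. -/
noncomputable def realFaces (S : Set (Finset V)) : Set (Finset (V →₀ ℝ)) :=
  (fun F : Finset V => F.image fun v => Finsupp.single v (1 : ℝ)) '' S

theorem realFaces_union (S T : Set (Finset V)) :
    realFaces (S ∪ T) = realFaces S ∪ realFaces T := Set.image_union _ _ _

theorem mem_space_of_realFaces {M : SimplicialComplex ℝ (V →₀ ℝ)} {S : Set (Finset V)}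
    (h : M.faces = realFaces S) {x : V →₀ ℝ} : x ∈ M.space ↔ ∃ F ∈ S, x ∈ hull F := by
  rw [SimplicialComplex.mem_space_iff, h]
  simp [realFaces, hull]

theorem singleton_mem_realFaces {S : Set (Finset V)} {v : V} :
    {Finsupp.single v (1 : ℝ)} ∈ realFaces S ↔ {v} ∈ S := by
  constructor
  · rintro ⟨F, hF, h⟩
    have : F = {v} := by
      have h' : F.image (fun v => Finsupp.single v (1 : ℝ)) =
          ({v} : Finset V).image (fun v => Finsupp.single v (1 : ℝ)) := by simpa using h
      exact Finset.image_injective (Finsupp.single_left_injective one_ne_zero) h'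
    rwa [← this]
  · intro h
    exact ⟨_, h, by simp⟩

theorem realFaces_pair (a b : V) : realFaces {{b}, {a, b}} =
    {{Finsupp.single b (1 : ℝ)}, {Finsupp.single a (1 : ℝ), Finsupp.single b 1}} := by
  simp [realFaces, Set.image_pair]

theorem Colored.realFaces_whisker (C : Colored (V →₀ ℝ)) {S : Set (Finset V)}
    (h : C.M.faces = realFaces S) {c : Bool} {a b : V} (hab : a ≠ b)
    (ha : {Finsupp.single a (1 : ℝ)} ∈ (C.c c).faces) (hb : ∀ F ∈ S, b ∉ F) :
    ∃ C' : Colored (V →₀ ℝ), C'.M.faces = realFaces (S ∪ {{b}, {a, b}}) ∧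
      (C'.c c).faces = (C.c c).faces ∪ realFaces {{b}, {a, b}} ∧ C'.c (!c) = C.c (!c) := by
  obtain ⟨C1, h1, h2, h3, h4⟩ := C.attach_whisker c (single_ne hab) ha (by
    intro x hx hxM
    obtain ⟨F, hF, hxF⟩ := (mem_space_of_realFaces h).1 hxM
    rw [← hull_pair] at hx
    have := hull_inter hx hxF
    have hsub : ({a, b} ∩ F : Finset V) ⊆ {a} := by
      intro y hy
      simp only [Finset.mem_inter, Finset.mem_insert, Finset.mem_singleton] at hy ⊢
      rcases hy with ⟨rfl | rfl, hy⟩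
      · rfl
      · exact absurd hy (hb F hF)
    have := hull_mono hsub this
    rwa [hull_singleton] at this)
  exact ⟨C1, by rw [h1, h, realFaces_union, realFaces_pair], by rw [h3, realFaces_pair], h4⟩

theorem Colored.realFaces_edge (C : Colored (V →₀ ℝ)) {S : Set (Finset V)}
    (h : C.M.faces = realFaces S) {c : Bool} {a b : V} (hab : a ≠ b)
    (ha : {Finsupp.single a (1 : ℝ)} ∈ (C.c c).faces) (hb : {b} ∈ S)
    (hb' : {Finsupp.single b (1 : ℝ)} ∉ (C.c c).faces) (hS : ∀ F ∈ S, a ∈ F → b ∉ F) :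
    ∃ C' : Colored (V →₀ ℝ), C'.M.faces = realFaces (S ∪ {{a, b}}) ∧
      (C'.c c).faces = (C.c c).faces ∪ realFaces {{b}, {a, b}} ∧ C'.c (!c) = C.c (!c) := by
  obtain ⟨C1, h1, h3, h4⟩ := C.attach_edge c (single_ne hab) ha
    (by rw [h]; exact singleton_mem_realFaces.2 hb) hb' (by
    intro x hx hxM
    obtain ⟨F, hF, hxF⟩ := (mem_space_of_realFaces h).1 hxM
    rw [← hull_pair] at hx
    have := hull_inter hx hxF
    have hsub : ({a, b} ∩ F : Finset V) ⊆ {a} ∨ ({a, b} ∩ F : Finset V) ⊆ {b} := by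
      by_cases haF : a ∈ F
      · left
        intro y hy
        simp only [Finset.mem_inter, Finset.mem_insert, Finset.mem_singleton] at hy ⊢
        rcases hy with ⟨rfl | rfl, hy⟩
        · rfl
        · exact absurd hy (hS F hF haF)
      · right
        intro y hy
        simp only [Finset.mem_inter, Finset.mem_insert, Finset.mem_singleton] at hy ⊢
        rcases hy with ⟨rfl | rfl, hy⟩
        · exact absurd hy haF
        · rfl
    rcases hsub with hsub | hsub
    · have := hull_mono hsub this
      rw [hull_singleton] at this
      exact Or.inl this
    · have := hull_mono hsub this
      rw [hull_singleton] at this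
      exact Or.inr this)
  refine ⟨C1, ?_, by rw [h3, realFaces_pair], h4⟩
  rw [h1, h, realFaces_union]
  simp [realFaces]

theorem Colored.good {C : Colored (V →₀ ℝ)} {S : Set (Finset V)} (h : C.M.faces = realFaces S) :
    Good S := by
  refine ⟨C, ?_, fun v hv => by rw [h]; exact singleton_mem_realFaces.2 hv, fun a b hab h' => ?_⟩
  · ext x; rw [mem_space_of_realFaces h]; simp
  · refine Chain.edge (single_ne hab) ?_
    rw [h]
    exact ⟨_, h', by simp⟩

theorem exists_colored_singleton (v : V) : ∃ C : Colored (V →₀ ℝ),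
    C.M.faces = realFaces {{v}} ∧ ∀ b, {Finsupp.single v (1 : ℝ)} ∈ (C.c b).faces := by
  let K : SimplicialComplex ℝ (V →₀ ℝ) :=
    { faces := {{Finsupp.single v (1 : ℝ)}}
      isRelLowerSet_faces := by
        rintro s rfl
        refine ⟨by simp, fun t ht hn => ?_⟩
        exact (Finset.subset_singleton_iff.1 ht).resolve_left hn.ne_empty
      indep := by
        rintro s rfl
        have : Subsingleton ({Finsupp.single v (1 : ℝ)} : Finset (V →₀ ℝ)) :=
          ⟨fun a b => Subtype.ext ((Finset.mem_singleton.1 a.2).trans (Finset.mem_singleton.1 b.2).symm)⟩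
        exact affineIndependent_of_subsingleton ℝ _
      inter_subset_convexHull := by
        rintro s t rfl rfl
        simp }
  refine ⟨⟨K, fun _ => K, Set.finite_singleton _, fun _ => le_rfl, fun m hm => ⟨true, hm⟩,
    fun b => ⟨_, K, rfl, Relation.ReflTransGen.refl⟩⟩, ?_, fun b => rfl⟩
  simp [realFaces, K]

end Realized

/-! ### The wedge of circles without one edge as a union of two trees. -/

section Wedge

variable {k : ℕ} (n : ℕ)

/-- The faces of the wedge of the circles in `s`, run through in the direction `b`, where the
last edge of the circle of `x` is left out. -/
def openWedge (b : Bool) (x : Fin k) (s : Finset (Fin k)) : Set (Finset (PresVertex k n)) :=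
  {F | F = {.base} ∨ ∃ y ∈ s, F = {.loop y (if b then 0 else 1)} ∨
    F = {.base, .loop y (if b then 0 else 1)} ∨ F = {.loop y (if b then 1 else 0)} ∨
    F = {.loop y (if b then 0 else 1), .loop y (if b then 1 else 0)} ∨
    (y ≠ x ∧ F = {.base, .loop y (if b then 1 else 0)})}

theorem openWedge_insert (b : Bool) (x y : Fin k) (s : Finset (Fin k)) :
    openWedge n b x (insert y s) = openWedge n b x s ∪ {{.loop y (if b then 0 else 1)},
      {.base, .loop y (if b then 0 else 1)}} ∪ {{.loop y (if b then 1 else 0)},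
      {.loop y (if b then 0 else 1), .loop y (if b then 1 else 0)}} ∪
      {F | y ≠ x ∧ F = {.base, .loop y (if b then 1 else 0)}} := by
  ext F
  simp only [openWedge, Finset.mem_insert, Set.mem_ofPred_eq, exists_eq_or_imp, Set.mem_union,
    Set.mem_insert_iff, Set.mem_singleton_iff]
  have (a b c d e f g : Prop) : (a ∨ (b ∨ c ∨ d ∨ e ∨ f) ∨ g) ↔ (((a ∨ g) ∨ b ∨ c) ∨ d ∨ e) ∨ f := by
    tauto
  exact this _ _ _ _ _ _ _

theorem loop_notMem_openWedge {b : Bool} {x y : Fin k} {s : Finset (Fin k)} (hy : y ∉ s) (j : Fin 2)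
    {F : Finset (PresVertex k n)} (hF : F ∈ openWedge n b x s) : .loop y j ∉ F := by
  rcases hF with rfl | ⟨z, hz, h⟩
  · simp
  · have hyz : y ≠ z := fun h => hy (h ▸ hz)
    rcases h with rfl | rfl | rfl | rfl | ⟨-, rfl⟩ <;> simp [hyz]

/-- Colour `true` takes the first two edges of every circle and colour `false` the third ones. Both
classes are trees containing the wedge point. -/
theorem exists_colored_openWedge (b : Bool) (x : Fin k) (s : Finset (Fin k)) :
    ∃ C : Colored (PresVertex k n →₀ ℝ), C.M.faces = realFaces (openWedge n b x s) ∧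
      ∀ c, {Finsupp.single PresVertex.base (1 : ℝ)} ∈ (C.c c).faces := by
  induction s using Finset.induction_on with
  | empty =>
    obtain ⟨C, h1, h2⟩ := exists_colored_singleton (V := PresVertex k n) .base
    exact ⟨C, by simpa [openWedge] using h1, h2⟩
  | insert y s hy ih =>
    obtain ⟨C, hC, hbase⟩ := ih
    have hne : (if b then (0 : Fin 2) else 1) ≠ (if b then 1 else 0) := by cases b <;> simp
    obtain ⟨C1, h11, h12, h13⟩ := C.realFaces_whisker hC (c := true) (a := .base)
      (b := .loop y (if b then 0 else 1)) (by simp) (hbase true)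
      (fun F hF => loop_notMem_openWedge n hy _ hF)
    obtain ⟨C2, h21, h22, h23⟩ := C1.realFaces_whisker h11 (c := true)
      (a := .loop y (if b then 0 else 1)) (b := .loop y (if b then 1 else 0)) (by simp [hne])
      (by rw [h12]; exact Or.inr (singleton_mem_realFaces.2 (by simp)))
      (by
        rintro F (hF | rfl | rfl)
        · exact loop_notMem_openWedge n hy _ hF
        · simp [hne.symm]
        · simp [hne.symm])
    have hb2 : ∀ c, {Finsupp.single PresVertex.base (1 : ℝ)} ∈ (C2.c c).faces := by
      rintro (_ | _)
      · have := hbase false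
        rw [show C2.c false = C.c false from h23.trans h13]
        exact this
      · rw [h22, h12]; exact Or.inl (Or.inl (hbase true))
    rw [openWedge_insert]
    by_cases hyx : y = x
    · refine ⟨C2, ?_, hb2⟩
      rw [h21]; simp [hyx]
    · obtain ⟨C3, h31, h32, h33⟩ := C2.realFaces_edge h21 (c := false) (a := .base)
        (b := .loop y (if b then 1 else 0)) (by simp) (hb2 false) (Or.inr (by simp))
        (by
          rw [show C2.c false = C.c false from h23.trans h13]
          intro h
          have := C.le _ h
          rw [hC, singleton_mem_realFaces] at this
          exact loop_notMem_openWedge n hy _ this (Finset.mem_singleton_self _))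
        (by
          rintro F ((hF | rfl | rfl) | rfl | rfl)
          · exact fun _ => loop_notMem_openWedge n hy _ hF
          · simp
          · simp [hne.symm]
          · simp
          · simp)
      refine ⟨C3, ?_, ?_⟩
      · rw [h31]; simp [hyx]
      · rintro (_ | _)
        · rw [h32]; exact Or.inl (hb2 false)
        · rw [show C3.c true = C2.c true from h33]; exact hb2 true

end Wedge

end PLCover

namespace PLCover

open Geometry

/-! ### The triangulated presentation complex and its attaching path. -/

section Presentation

variable {k : ℕ}

/-- The edges of a wedge of circles. -/
def wedgeEdges (k n : ℕ) : Set (Finset (PresVertex k n)) :=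
  {t | ∃ x : Fin k,
    t = {.base, .loop x 0} ∨ t = {.loop x 0, .loop x 1} ∨ t = {.loop x 1, .base}}

/-- The attaching path, indexed cyclically. -/
def cyc (r : List (Fin k × Bool)) (i : ZMod (3 * r.length)) : PresVertex k (3 * r.length) :=
  wordVertex _ r i.val

/-- The triangles of the 2-cell of a presentation complex. -/
def cellTriangles (r : List (Fin k × Bool)) : Set (Finset (PresVertex k (3 * r.length))) :=
  {t | ∃ i : ZMod (3 * r.length), t = {cyc r i, cyc r (i + 1), .collar i} ∨
    t = {cyc r (i + 1), .collar i, .collar (i + 1)} ∨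
    t = {.collar i, .collar (i + 1), .centre}}

theorem presentationComplex_faces (r : List (Fin k × Bool)) :
    (presentationComplex r).faces =
      (generatedComplex (wedgeEdges k (3 * r.length) ∪ cellTriangles r)).faces := by
  ext F
  have hmap : F ∈ (presentationComplex r).faces ↔
      F ∈ (wedgeOfCircles k (3 * r.length)).faces ∨
      ∃ F' ∈ (discComplex (3 * r.length)).faces, F'.image (characteristicMap r) = F := Iff.rfl
  rw [hmap, mem_generated]
  constructor
  · rintro (⟨hn, t, ht, hF⟩ | ⟨F', ⟨hn, t, ⟨i, hi⟩, hF⟩, rfl⟩)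
    · exact ⟨hn, t, Or.inl ht, hF⟩
    · refine ⟨hn.image _, t.image (characteristicMap r), Or.inr ⟨i, ?_⟩, Finset.image_subset_image hF⟩
      rcases hi with rfl | rfl | rfl
      · left; simp [characteristicMap, cyc, Finset.image_insert]
      · right; left; simp [characteristicMap, cyc, Finset.image_insert]
      · right; right; simp [characteristicMap, Finset.image_insert]
  · rintro ⟨hn, t, ht | ⟨i, hi⟩, hF⟩
    · exact Or.inl ⟨hn, t, ht, hF⟩
    · right
      have : ∃ t' : Finset (DiscVertex (3 * r.length)), (∃ i : ZMod (3 * r.length),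
          t' = {DiscVertex.boundary i, .boundary (i + 1), .collar i} ∨
          t' = {.boundary (i + 1), .collar i, .collar (i + 1)} ∨
          t' = {.collar i, .collar (i + 1), .centre}) ∧ t'.image (characteristicMap r) = t := by
        rcases hi with rfl | rfl | rfl
        · exact ⟨_, ⟨i, Or.inl rfl⟩, by simp [characteristicMap, cyc, Finset.image_insert]⟩
        · exact ⟨_, ⟨i, Or.inr (Or.inl rfl)⟩, by simp [characteristicMap, cyc, Finset.image_insert]⟩
        · exact ⟨_, ⟨i, Or.inr (Or.inr rfl)⟩, by simp [characteristicMap, Finset.image_insert]⟩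
      obtain ⟨t', ht', rfl⟩ := this
      obtain ⟨F', hF', rfl⟩ := Finset.subset_image_iff.1 hF
      exact ⟨F', ⟨by simpa using hn, t', ht', hF'⟩, rfl⟩

/-- The first subdivision point on the loop of a letter, in the direction of the letter. -/
def fst {k : ℕ} (n : ℕ) (l : Fin k × Bool) : PresVertex k n := .loop l.1 (if l.2 then 0 else 1)

/-- The second subdivision point on the loop of a letter, in the direction of the letter. -/
def snd {k : ℕ} (n : ℕ) (l : Fin k × Bool) : PresVertex k n := .loop l.1 (if l.2 then 1 else 0)

theorem wordVertex_zero (n : ℕ) (r : List (Fin k × Bool)) (j : ℕ) :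
    wordVertex n r (3 * j) = .base := by
  unfold wordVertex
  split
  · simp [letterVertex]
  · rfl

theorem wordVertex_one (n : ℕ) (r : List (Fin k × Bool)) {j : ℕ} (hj : j < r.length) :
    wordVertex n r (3 * j + 1) = fst n r[j] := by
  have h1 : (3 * j + 1) / 3 = j := by omega
  have h2 : (3 * j + 1) % 3 = 1 := by omega
  simp [wordVertex, h1, h2, hj, letterVertex, fst]

theorem wordVertex_two (n : ℕ) (r : List (Fin k × Bool)) {j : ℕ} (hj : j < r.length) :
    wordVertex n r (3 * j + 2) = snd n r[j] := by
  have h1 : (3 * j + 2) / 3 = j := by omega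
  have h2 : (3 * j + 2) % 3 = 2 := by omega
  simp [wordVertex, h1, h2, hj, letterVertex, snd]

theorem cyc_natCast (r : List (Fin k × Bool)) (i : ℕ) (hi : i ≤ 3 * r.length) :
    cyc r (i : ZMod (3 * r.length)) = wordVertex _ r i := by
  rcases hi.lt_or_eq with h | h
  · rw [cyc, ZMod.val_natCast_of_lt h]
  · have : (i : ZMod (3 * r.length)) = 0 := by rw [h]; exact ZMod.natCast_self _
    rw [this, cyc, h, ZMod.val_zero, wordVertex_zero]
    exact wordVertex_zero _ r 0

/-- The three kinds of edges of the attaching path. -/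
theorem cyc_cases {r : List (Fin k × Bool)} (hr : 0 < r.length) (i : ZMod (3 * r.length)) :
    ∃ (j : ℕ) (hj : j < r.length),
      (i = ((3 * j : ℕ) : ZMod (3 * r.length)) ∧ cyc r i = .base ∧ cyc r (i + 1) = fst _ r[j]) ∨
      (i = ((3 * j + 1 : ℕ) : ZMod (3 * r.length)) ∧ cyc r i = fst _ r[j] ∧
        cyc r (i + 1) = snd _ r[j]) ∨
      (i = ((3 * j + 2 : ℕ) : ZMod (3 * r.length)) ∧ cyc r i = snd _ r[j] ∧
        cyc r (i + 1) = .base) := by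
  have : NeZero (3 * r.length) := ⟨by omega⟩
  have hlt := ZMod.val_lt i
  have hi : ((i.val : ℕ) : ZMod (3 * r.length)) = i := ZMod.natCast_zmod_val i
  have h1 : cyc r (i + 1) = wordVertex _ r (i.val + 1) := by
    rw [← cyc_natCast r _ hlt]; push_cast; rw [hi]
  have h0 : cyc r i = wordVertex _ r i.val := rfl
  refine ⟨i.val / 3, by omega, ?_⟩
  have : i.val % 3 = 0 ∨ i.val % 3 = 1 ∨ i.val % 3 = 2 := by omega
  rcases this with h | h | h
  · left
    have e : i.val = 3 * (i.val / 3) := by omega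
    refine ⟨by rw [← e, hi], ?_, ?_⟩
    · rw [h0, e, wordVertex_zero]
    · rw [h1, ← wordVertex_one _ r (by omega), ← e]
  · right; left
    have e : i.val = 3 * (i.val / 3) + 1 := by omega
    refine ⟨by rw [← e, hi], ?_, ?_⟩
    · rw [h0, ← wordVertex_one _ r (by omega), ← e]
    · rw [h1, ← wordVertex_two _ r (by omega)]; congr 1; omega
  · right; right
    have e : i.val = 3 * (i.val / 3) + 2 := by omega
    refine ⟨by rw [← e, hi], ?_, ?_⟩
    · rw [h0, ← wordVertex_two _ r (by omega), ← e]
    · rw [h1, show i.val + 1 = 3 * (i.val / 3 + 1) by omega, wordVertex_zero]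

theorem fst_ne_snd (n : ℕ) (l : Fin k × Bool) : fst n l ≠ snd n l := by
  rcases l with ⟨x, _ | _⟩ <;> simp [fst, snd]

theorem cyc_ne {r : List (Fin k × Bool)} (hr : 0 < r.length) (i : ZMod (3 * r.length)) :
    cyc r i ≠ cyc r (i + 1) := by
  obtain ⟨j, hj, ⟨-, h1, h2⟩ | ⟨-, h1, h2⟩ | ⟨-, h1, h2⟩⟩ := cyc_cases hr i
  · rw [h1, h2]; simp [fst]
  · rw [h1, h2]; exact fst_ne_snd _ _
  · rw [h1, h2]; simp [snd]

theorem cyc_ne_collar (r : List (Fin k × Bool)) (i j : ZMod (3 * r.length)) :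
    cyc r i ≠ .collar j := by
  unfold cyc wordVertex letterVertex
  split
  · split_ifs <;> simp
  · simp

theorem cyc_ne_centre (r : List (Fin k × Bool)) (i : ZMod (3 * r.length)) :
    cyc r i ≠ .centre := by
  unfold cyc wordVertex letterVertex
  split
  · split_ifs <;> simp
  · simp

end Presentation

end PLCover

namespace PLCover

open Geometry

/-! ### Covering the complex when some generator occurs once. -/

section AlgebraicCollapse

variable {k : ℕ}

theorem generatedComplex_openWedge (n : ℕ) (b : Bool) (x : Fin k) :
    (generatedComplex (openWedge n b x Finset.univ)).faces = openWedge n b x Finset.univ := by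
  ext F
  rw [mem_generated]
  constructor
  · rintro ⟨hn, t, rfl | ⟨y, -, rfl | rfl | rfl | rfl | ⟨hy, rfl⟩⟩, hF⟩
    · left; exact (Finset.subset_singleton_iff.1 hF).resolve_left hn.ne_empty
    · right; refine ⟨y, Finset.mem_univ _, ?_⟩
      left; exact (Finset.subset_singleton_iff.1 hF).resolve_left hn.ne_empty
    · rcases subset_pair_cases hF hn with rfl | rfl | rfl
      · exact Or.inl rfl
      · exact Or.inr ⟨y, Finset.mem_univ _, Or.inl rfl⟩
      · exact Or.inr ⟨y, Finset.mem_univ _, Or.inr (Or.inl rfl)⟩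
    · right; refine ⟨y, Finset.mem_univ _, ?_⟩
      right; right; left; exact (Finset.subset_singleton_iff.1 hF).resolve_left hn.ne_empty
    · rcases subset_pair_cases hF hn with rfl | rfl | rfl
      · exact Or.inr ⟨y, Finset.mem_univ _, Or.inl rfl⟩
      · exact Or.inr ⟨y, Finset.mem_univ _, Or.inr (Or.inr (Or.inl rfl))⟩
      · exact Or.inr ⟨y, Finset.mem_univ _, Or.inr (Or.inr (Or.inr (Or.inl rfl)))⟩
    · rcases subset_pair_cases hF hn with rfl | rfl | rfl
      · exact Or.inl rfl
      · exact Or.inr ⟨y, Finset.mem_univ _, Or.inr (Or.inr (Or.inl rfl))⟩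
      · exact Or.inr ⟨y, Finset.mem_univ _, Or.inr (Or.inr (Or.inr (Or.inr ⟨hy, rfl⟩)))⟩
  · intro h
    refine ⟨?_, F, h, subset_rfl⟩
    rcases h with rfl | ⟨y, -, rfl | rfl | rfl | rfl | ⟨hy, rfl⟩⟩ <;> simp

theorem generatedComplex_faces_subset {V : Type*} {G G' : Set (Finset V)}
    (h : ∀ t ∈ G, ∃ t' ∈ G', t ⊆ t') : (generatedComplex G).faces ⊆ (generatedComplex G').faces := by
  rintro F ⟨hn, t, ht, hF⟩
  obtain ⟨t', ht', hs⟩ := h t ht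
  exact ⟨hn, t', ht', hF.trans hs⟩

theorem exists_unique_slot {r : List (Fin k × Bool)} {x : Fin k}
    (h : (r.map Prod.fst).count x = 1) :
    ∃ (j₀ : ℕ) (_ : j₀ < r.length), ∀ (j : ℕ) (hj : j < r.length), (r[j]).1 = x ↔ j = j₀ := by
  induction r with
  | nil => simp at h
  | cons l r ih =>
    rw [List.map_cons, List.count_cons] at h
    by_cases hl : l.1 = x
    · rw [if_pos (by simpa using hl)] at h
      have h0 : x ∉ r.map Prod.fst := List.count_eq_zero.1 (by omega)
      refine ⟨0, by simp, ?_⟩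
      rintro (_ | j) hj
      · simpa using hl
      · simp only [List.getElem_cons_succ, Nat.add_one_ne_zero, iff_false]
        intro h'
        apply h0
        rw [← h']
        exact List.mem_map_of_mem (List.getElem_mem _)
    · rw [if_neg (by simpa using hl)] at h
      obtain ⟨j₀, hj₀, h1⟩ := ih (by omega)
      refine ⟨j₀ + 1, by simpa using hj₀, ?_⟩
      rintro (_ | j) hj
      · simpa using hl
      · simpa using h1 j (by simpa using hj)

-- The last edge of the single occurrence of `x` lies on the attaching path exactly once. With this
-- edge removed the wedge is a union of two trees, and the disc is attached by `Good.attach_disc`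
-- along the rest of its boundary, which starts just after that edge.
set_option maxHeartbeats 1000000 in
theorem covered_of_admitsAlgebraicCollapse {r : List (Fin k × Bool)}
    (h : AdmitsAlgebraicCollapse r) :
    CoveredByTwoPLCollapsibles (presentationPolyhedron r) := by
  obtain ⟨x, hx⟩ := h
  obtain ⟨j₀, hj₀, hslot⟩ := exists_unique_slot hx
  have hn : 0 < r.length := by omega
  have : NeZero (3 * r.length) := ⟨by omega⟩
  set N := 3 * r.length with hN
  obtain ⟨M, hM⟩ : ∃ M, N = M + 3 := ⟨N - 3, by omega⟩
  set i₀ : ZMod N := ((3 * j₀ + 2 : ℕ) : ZMod N) with hi₀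
  -- Running through the circles in the direction `b` of this occurrence makes the edge at `i₀` the
  -- one that `openWedge` omits.
  obtain ⟨b, hb⟩ : ∃ b, (r[j₀]).2 = b := ⟨_, rfl⟩
  have hx0 : (r[j₀]).1 = x := (hslot j₀ hj₀).2 rfl
  have hcyc0 : cyc r i₀ = .loop x (if b then 1 else 0) := by
    rw [hi₀, cyc_natCast r _ (by omega), wordVertex_two _ _ hj₀, snd, hx0, hb]
  have hcyc1 : cyc r (i₀ + 1) = .base := by
    have : i₀ + 1 = ((3 * (j₀ + 1) : ℕ) : ZMod N) := by rw [hi₀]; push_cast; ring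
    rw [this, cyc_natCast r _ (by omega), wordVertex_zero]
  have hlastidx : i₀ + 1 + ((M + 2 : ℕ) : ZMod N) = i₀ := by
    have : ((M + 3 : ℕ) : ZMod N) = 0 := by rw [← hM]; exact ZMod.natCast_self _
    push_cast at this ⊢
    linear_combination this
  have hinj : ∀ i ≤ M + 2, ∀ j ≤ M + 2, (i : ZMod N) = j → i = j := by
    intro i hi j hj h
    have := congrArg ZMod.val h
    rwa [ZMod.val_natCast_of_lt (by omega), ZMod.val_natCast_of_lt (by omega)] at this
  have hsub : ∀ t ∈ openWedge N b x Finset.univ, ∃ t' ∈ wedgeEdges k N, t ⊆ t' := by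
    rintro t (rfl | ⟨y, -, rfl | rfl | rfl | rfl | ⟨hy, rfl⟩⟩)
    · exact ⟨_, ⟨x, Or.inl rfl⟩, by simp⟩
    all_goals cases b
    · exact ⟨_, ⟨y, Or.inr (Or.inl rfl)⟩, by simp⟩
    · exact ⟨_, ⟨y, Or.inr (Or.inl rfl)⟩, by simp⟩
    · exact ⟨_, ⟨y, Or.inr (Or.inr rfl)⟩, by simp [Finset.insert_subset_iff]⟩
    · exact ⟨_, ⟨y, Or.inl rfl⟩, by simp⟩
    · exact ⟨_, ⟨y, Or.inr (Or.inl rfl)⟩, by simp⟩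
    · exact ⟨_, ⟨y, Or.inr (Or.inl rfl)⟩, by simp⟩
    · exact ⟨_, ⟨y, Or.inr (Or.inl rfl)⟩, by simp [Finset.insert_subset_iff]⟩
    · exact ⟨_, ⟨y, Or.inr (Or.inl rfl)⟩, by simp⟩
    · exact ⟨_, ⟨y, Or.inl rfl⟩, by simp⟩
    · exact ⟨_, ⟨y, Or.inr (Or.inr rfl)⟩, by simp [Finset.insert_subset_iff]⟩
  have hwe : ∀ t ∈ wedgeEdges k N, t ∈ openWedge N b x Finset.univ ∨
      t ⊆ {cyc r i₀, cyc r (i₀ + 1)} := by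
    rw [hcyc0, hcyc1]
    rintro t ⟨y, rfl | rfl | rfl⟩ <;> by_cases hy : y = x <;> cases b <;>
      first
      | (refine Or.inl (Or.inr ⟨y, Finset.mem_univ _, ?_⟩); simp [hy, Finset.pair_comm]; done)
      | (refine Or.inr ?_; simp [hy, Finset.insert_subset_iff]; done)
  have hnoloop : ∀ t ∈ openWedge N b x Finset.univ, cyc r i₀ ∈ t → cyc r (i₀ + 1) ∉ t := by
    rw [hcyc0, hcyc1]
    have hne : (if b then (0 : Fin 2) else 1) ≠ (if b then 1 else 0) := by cases b <;> simp
    rintro t (rfl | ⟨y, -, rfl | rfl | rfl | rfl | ⟨hy, rfl⟩⟩)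
    · simp
    · simp
    · simp [hne.symm]
    · simp
    · simp
    · simp [hy.symm]
  have hG0 : ∀ t ∈ openWedge N b x Finset.univ, ∀ i, PresVertex.collar i ∉ t := by
    rintro t (rfl | ⟨y, -, rfl | rfl | rfl | rfl | ⟨hy, rfl⟩⟩) <;> simp
  have hG1 : ∀ t ∈ openWedge N b x Finset.univ, PresVertex.centre ∉ t := by
    rintro t (rfl | ⟨y, -, rfl | rfl | rfl | rfl | ⟨hy, rfl⟩⟩) <;> simp
  -- A letter other than the one in slot `j₀` involves a generator different from `x`, all of whose
  -- edges are present. Inside slot `j₀` only the third edge is omitted.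
  have hedges : ∀ i : ZMod N, i ≠ i₀ → {cyc r i, cyc r (i + 1)} ∈ openWedge N b x Finset.univ := by
    intro i hi
    obtain ⟨j, hj, ⟨h0, h1, h2⟩ | ⟨h0, h1, h2⟩ | ⟨h0, h1, h2⟩⟩ := cyc_cases hn i
    · rw [h1, h2]
      right
      refine ⟨(r[j]).1, Finset.mem_univ _, ?_⟩
      by_cases h : (r[j]).2 = b
      · right; left; simp [fst, h]
      · right; right; right; right
        refine ⟨fun hjx => h ?_, ?_⟩
        · obtain rfl := (hslot j hj).1 hjx; exact hb
        · have h' : (r[j]).2 = !b := Bool.eq_not.2 h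
          rw [fst, h']
          cases b <;> rfl
    · rw [h1, h2]
      right
      refine ⟨(r[j]).1, Finset.mem_univ _, ?_⟩
      right; right; right; left
      cases b <;> cases h : (r[j]).2 <;> simp [fst, snd, h, Finset.pair_comm]
    · rw [h1, h2]
      right
      refine ⟨(r[j]).1, Finset.mem_univ _, ?_⟩
      have hjx : (r[j]).1 ≠ x := fun h => hi (by rw [h0, (hslot j hj).1 h])
      by_cases h : (r[j]).2 = b
      · right; right; right; right
        exact ⟨hjx, by simp [snd, h, Finset.pair_comm]⟩
      · right; left
        have h' : (r[j]).2 = !b := Bool.eq_not.2 h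
        rw [snd, h', Finset.pair_comm]
        cases b <;> rfl
  obtain ⟨C0, hC0, -⟩ := exists_colored_openWedge N b x Finset.univ
  have h0 : Good (generatedComplex (openWedge N b x Finset.univ)).faces := by
    rw [generatedComplex_openWedge]; exact Colored.good hC0
  have hstep : ∀ j : ℕ, i₀ + 1 + ((j + 1 : ℕ) : ZMod N) = i₀ + 1 + (j : ZMod N) + 1 := by
    intro j; push_cast; ring
  have key := h0.attach_disc (M := M) (fun j => cyc r (i₀ + 1 + (j : ZMod N)))
    (fun j => .collar (i₀ + 1 + (j : ZMod N))) .centre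
    (fun j => by simp only [hstep]; exact cyc_ne hn _)
    (by simp only [hlastidx, Nat.cast_zero, add_zero]; exact cyc_ne hn _)
    (by
      intro i hi j hj h
      exact hinj i hi j hj (by simpa using h))
    (fun i j => (cyc_ne_collar r _ _).symm) (by simp) (fun j => cyc_ne_centre r _)
    (fun t ht i => hG0 t ht _) hG1
    (by
      intro j hj
      refine ⟨_, hedges (i₀ + 1 + (j : ZMod N)) ?_, by simp, by simp [add_assoc]⟩
      intro h
      have := hinj j (by omega) (M + 2) le_rfl (by
        have h' := h.trans hlastidx.symm
        exact add_left_cancel h')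
      omega)
    (by
      intro t ht
      simp only [hlastidx, Nat.cast_zero, add_zero]
      exact hnoloop t ht)
  simp only [hlastidx, Nat.cast_zero, add_zero, hstep] at key
  rw [presentationPolyhedron]
  apply Good.covered
  rw [presentationComplex_faces]
  convert key using 1
  apply Set.Subset.antisymm
  · apply generatedComplex_faces_subset
    rintro t (ht | ⟨i, hi⟩)
    · rcases hwe t ht with h | h
      · exact ⟨t, Or.inr (Or.inr (Or.inr (Or.inl (Or.inl (Or.inl h))))), subset_rfl⟩
      · exact ⟨_, Or.inl rfl, h.trans (by simp [Finset.insert_subset_iff])⟩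
    · obtain ⟨j, hj, rfl⟩ : ∃ j : ℕ, j ≤ M + 2 ∧ i = i₀ + 1 + (j : ZMod N) := by
        refine ⟨(i - i₀ - 1).val, ?_, ?_⟩
        · have := ZMod.val_lt (i - i₀ - 1); omega
        · rw [ZMod.natCast_zmod_val]; ring
      rcases hj.lt_or_eq with hj | rfl
      · rcases hi with rfl | rfl | rfl
        · exact ⟨_, Or.inr (Or.inr (Or.inr (Or.inl (Or.inl (Or.inr ⟨j, hj, rfl⟩))))), subset_rfl⟩
        · exact ⟨_, Or.inr (Or.inr (Or.inr (Or.inl (Or.inr ⟨j, hj, rfl⟩)))), subset_rfl⟩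
        · exact ⟨_, Or.inr (Or.inr (Or.inr (Or.inr ⟨j, hj, rfl⟩))), subset_rfl⟩
      · rw [hlastidx] at hi
        rcases hi with rfl | rfl | rfl
        · exact ⟨_, Or.inl rfl, by simp [Finset.insert_subset_iff]⟩
        · exact ⟨_, Or.inr (Or.inl rfl), by simp [Finset.insert_subset_iff]⟩
        · exact ⟨_, Or.inr (Or.inr (Or.inl rfl)), by simp [Finset.insert_subset_iff]⟩
  · apply generatedComplex_faces_subset
    rintro t (rfl | rfl | rfl | (((ht | ⟨j, -, rfl⟩) | ⟨j, -, rfl⟩) | ⟨j, -, rfl⟩))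
    · exact ⟨_, Or.inr ⟨i₀, Or.inl rfl⟩, by simp [Finset.insert_subset_iff]⟩
    · exact ⟨_, Or.inr ⟨i₀, Or.inr (Or.inl rfl)⟩, by simp [Finset.insert_subset_iff]⟩
    · exact ⟨_, Or.inr ⟨i₀, Or.inr (Or.inr rfl)⟩, by simp [Finset.insert_subset_iff]⟩
    · obtain ⟨t', ht', hs⟩ := hsub t ht
      exact ⟨t', Or.inl ht', hs⟩
    · exact ⟨_, Or.inr ⟨_, Or.inl rfl⟩, subset_rfl⟩
    · exact ⟨_, Or.inr ⟨_, Or.inr (Or.inl rfl)⟩, subset_rfl⟩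
    · exact ⟨_, Or.inr ⟨_, Or.inr (Or.inr rfl)⟩, subset_rfl⟩

end AlgebraicCollapse

end PLCover

namespace PLCover

open Geometry

/-! ### The words `x x⁻¹` and `x⁻¹ x`. -/

section Exceptional

variable {V : Type*} [DecidableEq V]

theorem generatedComplex_insert_pair {G : Set (Finset V)} {a b : V}
    (ha : {a} ∈ (generatedComplex G).faces) :
    (generatedComplex (insert {a, b} G)).faces = (generatedComplex G).faces ∪ {{b}, {a, b}} := by
  ext F
  simp only [mem_generated, Set.mem_insert_iff, Set.mem_union, Set.mem_singleton_iff]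
  constructor
  · rintro ⟨hn, t, rfl | ht, hF⟩
    · rcases subset_pair_cases hF hn with rfl | rfl | rfl
      · exact Or.inl ha
      · simp
      · simp
    · exact Or.inl ⟨hn, t, ht, hF⟩
  · rintro (⟨hn, t, ht, hF⟩ | rfl | rfl)
    · exact ⟨hn, t, Or.inr ht, hF⟩
    · exact ⟨by simp, _, Or.inl rfl, by simp⟩
    · exact ⟨by simp, _, Or.inl rfl, Finset.Subset.refl _⟩

/-- The realization of the complex generated by a list of simplices collapses to a vertex. -/
def ListCollapses (L : List (Finset V)) : Prop :=
  ∃ (v : V →₀ ℝ) (K : SimplicialComplex ℝ (V →₀ ℝ)), K.faces = {{v}} ∧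
    Collapses (SimplicialComplex.onFinsupp (𝕜 := ℝ) (generatedComplex {t | t ∈ L})) K

theorem mem_cons_eq {α : Type*} (a : α) (L : List α) : {t | t ∈ a :: L} = insert a {t | t ∈ L} := by
  ext; simp

theorem ListCollapses.singleton (v : V) : ListCollapses [{v}] := by
  refine ⟨Finsupp.single v 1, _, ?_, Relation.ReflTransGen.refl⟩
  have : (generatedComplex {t : Finset V | t ∈ [{v}]}).faces = {{v}} := by
    ext F
    simp only [mem_generated, List.mem_singleton, Set.mem_singleton_iff, Set.mem_ofPred_eq]
    constructor
    · rintro ⟨hn, t, rfl, hF⟩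
      exact (Finset.subset_singleton_iff.1 hF).resolve_left hn.ne_empty
    · rintro rfl
      exact ⟨by simp, _, rfl, subset_rfl⟩
  rw [onFinsupp_faces, this]
  simp

theorem ListCollapses.step {L : List (Finset V)} (h : ListCollapses L) {t σ τ : Finset V}
    (hst : σ ⊂ τ) (hσ : σ.Nonempty)
    (hf : (generatedComplex {t' | t' ∈ t :: L}).faces =
      (generatedComplex {t' | t' ∈ L}).faces ∪ {σ, τ})
    (hL : ∀ F ∈ L, ¬ σ ⊆ F) : ListCollapses (t :: L) := by
  obtain ⟨v, K, hK, hc⟩ := h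
  refine ⟨v, K, hK, Relation.ReflTransGen.head ?_ hc⟩
  have hinj : Function.Injective (fun v : V => Finsupp.single v (1 : ℝ)) :=
    Finsupp.single_left_injective one_ne_zero
  refine elementaryCollapse_of_faces_eq (σ := σ.image fun v => Finsupp.single v (1 : ℝ))
    (τ := τ.image fun v => Finsupp.single v (1 : ℝ)) ?_ ?_ (by simpa using hσ) ?_
  · rw [onFinsupp_faces, onFinsupp_faces, hf, Set.image_union, Set.image_pair]
  · exact (Finset.image_ssubset_image hinj).2 hst
  · rintro ⟨F, ⟨-, F', hF', hFF'⟩, hF⟩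
    have := Finset.image_injective hinj hF
    subst this
    exact hL F' hF' hFF'

/-- The side conditions are bundled into one proposition about the list, so that concrete instances
can be decided. -/
theorem ListCollapses.edge {L : List (Finset V)} (h : ListCollapses L) (a b : V)
    (hab : (∃ t ∈ L, a ∈ t) ∧ ∀ t ∈ L, b ∉ t) : ListCollapses ({a, b} :: L) := by
  obtain ⟨ha, hb⟩ := hab
  obtain ⟨t, ht, hat⟩ := ha
  have hab : a ≠ b := by rintro rfl; exact hb t ht hat
  refine h.step (σ := {b}) (τ := {a, b}) ?_ (by simp) ?_ (by simpa using hb)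
  · refine Finset.ssubset_iff_subset_ne.2 ⟨by simp, fun e => ?_⟩
    have : a ∈ ({b} : Finset V) := by rw [e]; simp
    exact hab (by simpa using this)
  · rw [mem_cons_eq, generatedComplex_insert_pair]
    exact ⟨by simp, t, ht, by simpa using hat⟩

theorem ListCollapses.triangle {L : List (Finset V)} (h : ListCollapses L) (v a b : V)
    (hvab : (∃ t ∈ L, v ∈ t ∧ a ∈ t) ∧ (∃ t ∈ L, v ∈ t ∧ b ∈ t) ∧ v ≠ a ∧ v ≠ b ∧
      ∀ t ∈ L, a ∈ t → b ∉ t) : ListCollapses ({v, a, b} :: L) := by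
  obtain ⟨h1, h2, hva, hvb, hL⟩ := hvab
  obtain ⟨t1, ht1, hv1, ha1⟩ := h1
  obtain ⟨t2, ht2, hv2, hb2⟩ := h2
  refine h.step (σ := {a, b}) (τ := {v, a, b}) ?_ (by simp) ?_ ?_
  · refine Finset.ssubset_iff_subset_ne.2 ⟨by simp, fun e => ?_⟩
    have : v ∈ ({a, b} : Finset V) := by rw [e]; simp
    simp only [Finset.mem_insert, Finset.mem_singleton] at this
    tauto
  · rw [mem_cons_eq, generatedComplex_insert_triangle]
    · exact ⟨by simp, t1, ht1, by simp [Finset.insert_subset_iff, hv1, ha1]⟩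
    · exact ⟨by simp, t2, ht2, by simp [Finset.insert_subset_iff, hv2, hb2]⟩
  · intro t ht hs
    exact hL t ht (hs (by simp)) (hs (by simp))

theorem finite_generatedComplex_faces (L : List (Finset V)) :
    (generatedComplex {t | t ∈ L}).faces.Finite := by
  have : (generatedComplex {t | t ∈ L}).faces ⊆ ⋃ t ∈ L.toFinset, (t.powerset : Set (Finset V)) := by
    rintro F ⟨-, t, ht, hF⟩
    simp only [Set.mem_iUnion]
    exact ⟨t, by simpa using ht, by simpa using hF⟩
  exact Set.Finite.subset (Set.Finite.biUnion (Finset.finite_toSet _) fun t _ => Finset.finite_toSet _) this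

/-- A complex that is the union of two collapsible subcomplexes. -/
theorem covered_of_lists {K : PreAbstractSimplicialComplex V} {A B : List (Finset V)}
    (hA : ListCollapses A) (hB : ListCollapses B)
    (hK : K.faces = (generatedComplex {t | t ∈ A ++ B}).faces) :
    CoveredByTwoPLCollapsibles (SimplicialComplex.onFinsupp (𝕜 := ℝ) K).space := by
  have hKf : K.faces = (generatedComplex {t | t ∈ A}).faces ∪ (generatedComplex {t | t ∈ B}).faces := by
    rw [hK]
    ext F
    simp only [mem_generated, Set.mem_union, List.mem_append, Set.mem_ofPred_eq]
    constructor
    · rintro ⟨hn, t, ht | ht, hF⟩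
      · exact Or.inl ⟨hn, t, ht, hF⟩
      · exact Or.inr ⟨hn, t, ht, hF⟩
    · rintro (⟨hn, t, ht, hF⟩ | ⟨hn, t, ht, hF⟩)
      · exact ⟨hn, t, Or.inl ht, hF⟩
      · exact ⟨hn, t, Or.inr ht, hF⟩
  have hfin : (SimplicialComplex.onFinsupp (𝕜 := ℝ) K).faces.Finite := by
    rw [onFinsupp_faces, hK]
    exact (finite_generatedComplex_faces _).image _
  have key : ∀ L : List (Finset V), ListCollapses L → (generatedComplex {t | t ∈ L}).faces ⊆ K.faces →
      IsSubpolyhedron (SimplicialComplex.onFinsupp (𝕜 := ℝ) (generatedComplex {t | t ∈ L})).space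
        (SimplicialComplex.onFinsupp (𝕜 := ℝ) K).space ∧
      PLCollapsible (SimplicialComplex.onFinsupp (𝕜 := ℝ) (generatedComplex {t | t ∈ L})).space := by
    intro L hL hLK
    have hf : (SimplicialComplex.onFinsupp (𝕜 := ℝ) (generatedComplex {t | t ∈ L})).faces.Finite := by
      rw [onFinsupp_faces]
      exact (finite_generatedComplex_faces _).image _
    refine ⟨⟨_, SimplicialComplex.onFinsupp (𝕜 := ℝ) (generatedComplex {t | t ∈ L}), ⟨hfin, rfl⟩,
      ?_, rfl⟩, _, ⟨hf, rfl⟩, hf, hL⟩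
    exact Set.image_mono hLK
  obtain ⟨a1, a2⟩ := key A hA (by rw [hKf]; exact Set.subset_union_left)
  obtain ⟨b1, b2⟩ := key B hB (by rw [hKf]; exact Set.subset_union_right)
  refine ⟨_, _, a1, b1, a2, b2, ?_⟩
  ext x
  simp only [Set.mem_union, mem_onFinsupp_space, hKf]
  constructor
  · rintro (⟨F, h, hx⟩ | ⟨F, h, hx⟩)
    · exact ⟨F, Or.inl h, hx⟩
    · exact ⟨F, Or.inr h, hx⟩
  · rintro ⟨F, h | h, hx⟩
    · exact Or.inl ⟨F, h, hx⟩
    · exact Or.inr ⟨F, h, hx⟩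

/-- The three triangles next to the edge between `p` and `o`, together with their edges. -/
def cornerList (b : Bool) : List (Finset (PresVertex 1 6)) :=
  [{.base, .loop 0 (if b then 0 else 1), .collar 5}, {.base, .collar 0, .collar 5},
    {.base, .collar 5}, {.base, .loop 0 (if b then 0 else 1), .collar 0}, {.base, .collar 0},
    {.base, .loop 0 (if b then 0 else 1)}, {.base}]

theorem listCollapses_cornerList (b : Bool) : ListCollapses (cornerList b) := by
  cases b <;>
  exact
    ((((((ListCollapses.singleton _).edge _ _ (by decide)).edge _ _ (by decide)).triangle _ _ _
    (by decide)).edge _ _ (by decide)).triangle _ _ _ (by decide)).triangle _ _ _ (by decide)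

/-- The cone over the inner hexagon. -/
def coneList : List (Finset (PresVertex 1 6)) :=
  [{.centre, .collar 5, .collar 0}, {.centre, .collar 4, .collar 5}, {.centre, .collar 5},
    {.centre, .collar 3, .collar 4}, {.centre, .collar 4}, {.centre, .collar 2, .collar 3},
    {.centre, .collar 3}, {.centre, .collar 1, .collar 2}, {.centre, .collar 2},
    {.centre, .collar 0, .collar 1}, {.centre, .collar 1}, {.centre, .collar 0}, {.centre}]

theorem listCollapses_coneList : ListCollapses coneList :=
    ((((((((((((ListCollapses.singleton _).edge _ _ (by decide)).edge _ _ (by decide)).triangle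
    _ _ _ (by decide)).edge _ _ (by decide)).triangle _ _ _ (by decide)).edge _ _ (by
    decide)).triangle _ _ _ (by decide)).edge _ _ (by decide)).triangle _ _ _ (by decide)).edge
    _ _ (by decide)).triangle _ _ _ (by decide)).triangle _ _ _ (by decide)

/-- The part of the exceptional complex that is complementary to the corner. -/
def mainList (b : Bool) : List (Finset (PresVertex 1 6)) :=
  [{.collar 4, .loop 0 (if b then 0 else 1), .collar 5},
    {.loop 0 (if b then 1 else 0), .loop 0 (if b then 0 else 1), .collar 4},
    {.collar 3, .loop 0 (if b then 1 else 0), .collar 4},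
    {.base, .collar 3, .loop 0 (if b then 1 else 0)},
    {.collar 2, .loop 0 (if b then 1 else 0), .base},
    {.collar 2, .collar 3, .base}, {.collar 2, .base},
    {.collar 1, .loop 0 (if b then 0 else 1), .loop 0 (if b then 1 else 0)},
    {.collar 1, .collar 2, .loop 0 (if b then 1 else 0)}, {.collar 1, .loop 0 (if b then 1 else 0)},
    {.collar 0, .collar 1, .loop 0 (if b then 0 else 1)},
    {.collar 0, .loop 0 (if b then 0 else 1)}] ++ coneList

theorem listCollapses_mainList (b : Bool) : ListCollapses (mainList b) := by
  cases b <;>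
  exact
    ((((((((((((listCollapses_coneList).edge _ _ (by decide)).triangle _ _ _ (by decide)).edge
    _ _ (by decide)).triangle _ _ _ (by decide)).triangle _ _ _ (by decide)).edge _ _ (by
    decide)).triangle _ _ _ (by decide)).triangle _ _ _ (by decide)).triangle _ _ _ (by
    decide)).triangle _ _ _ (by decide)).triangle _ _ _ (by decide)).triangle _ _ _ (by decide)

/-- Folding the boundary of the disc gives a sphere with an arc `x` whose two ends are identified.
One piece is a small disc around one end, the other is the complementary disc containing the other
end. Each piece contains only one of the two identified points, so both stay discs. -/
theorem covered_of_isExceptionalPresentation {k : ℕ} {r : List (Fin k × Bool)}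
    (h : IsExceptionalPresentation r) : CoveredByTwoPLCollapsibles (presentationPolyhedron r) := by
  obtain ⟨rfl, x, b, rfl⟩ := h
  obtain rfl : x = 0 := Subsingleton.elim _ _
  refine covered_of_lists (V := PresVertex 1 6) (listCollapses_cornerList b)
    (listCollapses_mainList b) ?_
  rw [presentationComplex_faces]
  have h1 : ∀ b : Bool, ∀ t ∈ ({{.base, .loop 0 0}, {.loop 0 0, .loop 0 1}, {.loop 0 1, .base}} :
      Finset (Finset (PresVertex 1 6))), ∃ t' ∈ cornerList b ++ mainList b, t ⊆ t' := by decide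
  have h2 : ∀ b : Bool, ∀ i : ZMod 6, ∀ t ∈ ({{cyc [((0 : Fin 1), b), (0, !b)] i,
      cyc [((0 : Fin 1), b), (0, !b)] (i + 1 : ZMod 6), .collar i},
      {cyc [((0 : Fin 1), b), (0, !b)] (i + 1 : ZMod 6), .collar i, .collar (i + 1)},
      {.collar i, .collar (i + 1), .centre}} : Finset (Finset (PresVertex 1 6))),
      ∃ t' ∈ cornerList b ++ mainList b, t ⊆ t' := by decide
  have h3 : ∀ b : Bool, ∀ t ∈ cornerList b ++ mainList b, ∃ i : ZMod 6, ∃ t' ∈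
      ({{cyc [((0 : Fin 1), b), (0, !b)] i,
      cyc [((0 : Fin 1), b), (0, !b)] (i + 1 : ZMod 6), .collar i},
      {cyc [((0 : Fin 1), b), (0, !b)] (i + 1 : ZMod 6), .collar i, .collar (i + 1)},
      {.collar i, .collar (i + 1), .centre}} : Finset (Finset (PresVertex 1 6))), t ⊆ t' := by
    decide
  apply Set.Subset.antisymm
  · apply generatedComplex_faces_subset
    rintro t (⟨y, ht⟩ | ⟨i, ht⟩)
    · obtain rfl : y = 0 := Subsingleton.elim _ _
      exact h1 b t (by simpa using ht)
    · exact h2 b i t (by simpa using ht)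
  · apply generatedComplex_faces_subset
    intro t ht
    obtain ⟨i, t', ht', hs⟩ := h3 b t ht
    exact ⟨t', Or.inr ⟨i, by simpa using ht'⟩, hs⟩

end Exceptional

end PLCover

namespace PLCover

open Geometry

/-! ### Continuous logarithms, in place of vanishing first cohomology. -/

section Logarithms

variable {E : Type*} [TopologicalSpace E]

/-- Every nowhere vanishing continuous complex function on `A` has a continuous logarithm. -/
def HasLogs (A : Set E) : Prop :=
  ∀ φ : E → ℂ, ContinuousOn φ A → (∀ x ∈ A, φ x ≠ 0) →
    ∃ ψ : E → ℂ, ContinuousOn ψ A ∧ ∀ x ∈ A, Complex.exp (ψ x) = φ x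

/-- The values lie in the discrete group of periods of the exponential. -/
theorem eq_of_exp_eq_one {S : Set E} (hS : IsPreconnected S) {f : E → ℂ} (hf : ContinuousOn f S)
    (h : ∀ x ∈ S, Complex.exp (f x) = 1) {x y : E} (hx : x ∈ S) (hy : y ∈ S) : f x = f y := by
  refine hS.constant_of_mapsTo (T := (AddSubgroup.zmultiples (2 * Real.pi * Complex.I : ℂ) : Set ℂ))
    ?_ hf ?_ hx hy
  · rw [isDiscrete_iff_discreteTopology]
    exact NormedSpace.discreteTopology_zmultiples _
  · intro z hz
    obtain ⟨n, hn⟩ := Complex.exp_eq_one_iff.1 (h z hz)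
    exact ⟨n, by simp [hn]⟩

theorem eq_of_forall_exists_int {S : Set E} (hS : IsPreconnected S) {f : E → ℝ}
    (hf : ContinuousOn f S) (h : ∀ x ∈ S, ∃ n : ℤ, f x = n) {x y : E} (hx : x ∈ S) (hy : y ∈ S) :
    f x = f y := by
  refine hS.constant_of_mapsTo (T := (AddSubgroup.zmultiples (1 : ℝ) : Set ℝ)) ?_ hf ?_ hx hy
  · rw [isDiscrete_iff_discreteTopology]
    exact NormedSpace.discreteTopology_zmultiples _
  · intro z hz
    obtain ⟨n, hn⟩ := h z hz
    exact ⟨n, by simp [hn]⟩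

/-- Mayer–Vietoris: on the connected intersection two logarithms differ by a constant period, and
shifting one of them by it makes them glue. -/
theorem HasLogs.union {A B : Set E} (hA : HasLogs A) (hB : HasLogs B) (hAc : IsClosed A)
    (hBc : IsClosed B) (h : IsPreconnected (A ∩ B)) : HasLogs (A ∪ B) := by
  classical
  intro φ hφ h0
  obtain ⟨f, hf, hf'⟩ := hA φ (hφ.mono Set.subset_union_left) fun x hx => h0 x (Or.inl hx)
  obtain ⟨g, hg, hg'⟩ := hB φ (hφ.mono Set.subset_union_right) fun x hx => h0 x (Or.inr hx)
  have hc : ∃ c : ℂ, Complex.exp c = 1 ∧ ∀ x ∈ A ∩ B, f x = g x + c := by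
    by_cases hne : (A ∩ B).Nonempty
    · obtain ⟨x₀, hx₀⟩ := hne
      have h1 : ∀ x ∈ A ∩ B, Complex.exp (f x - g x) = 1 := by
        intro x hx
        rw [Complex.exp_sub, hf' x hx.1, hg' x hx.2, div_self (h0 x (Or.inl hx.1))]
      refine ⟨f x₀ - g x₀, h1 x₀ hx₀, fun x hx => ?_⟩
      have := eq_of_exp_eq_one h (f := fun x => f x - g x)
        ((hf.mono Set.inter_subset_left).sub (hg.mono Set.inter_subset_right)) h1 hx hx₀
      rw [← this]; ring
    · exact ⟨0, by simp, fun x hx => absurd ⟨x, hx⟩ hne⟩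
  obtain ⟨c, hc, hfg⟩ := hc
  refine ⟨fun x => if x ∈ A then f x else g x + c, ?_, ?_⟩
  · refine ContinuousOn.union_of_isClosed ?_ ?_ hAc hBc
    · exact hf.congr fun x hx => by simp [hx]
    · refine (hg.add (continuousOn_const (c := c))).congr fun x hx => ?_
      by_cases h : x ∈ A
      · simp [h, hfg x ⟨h, hx⟩]
      · simp [h]
  · intro x hx
    by_cases h : x ∈ A
    · simp [h, hf' x h]
    · simp [h, Complex.exp_add, hc, hg' x (hx.resolve_left h)]

variable [AddCommGroup E] [Module ℝ E] [IsTopologicalAddGroup E] [ContinuousSMul ℝ E]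

/-- Contract `A` to `q` and lift the resulting homotopy through the covering `exp`, starting from a
constant logarithm of `φ q`. -/
theorem HasLogs.of_starConvex {A : Set E} {q : E} (hq : q ∈ A) (h : StarConvex ℝ q A) :
    HasLogs A := by
  classical
  intro φ hφ h0
  have hmem : ∀ (t : unitInterval) (a : A), q + (t : ℝ) • ((a : E) - q) ∈ A := fun t a =>
    h.add_smul_sub_mem a.2 t.2.1 t.2.2
  let H : C(unitInterval × A, {z : ℂ // z ≠ 0}) :=
    ⟨fun p => ⟨φ (q + (p.1 : ℝ) • ((p.2 : E) - q)), h0 _ (hmem _ _)⟩, by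
      refine Continuous.subtype_mk ?_ _
      exact hφ.comp_continuous (by fun_prop) fun p => hmem _ _⟩
  have H0 : ∀ a : A, H (0, a) = (fun z : ℂ => (⟨_, z.exp_ne_zero⟩ : {z : ℂ // z ≠ 0}))
      ((ContinuousMap.const A (Complex.log (φ q))) a) := by
    intro a
    refine Subtype.ext ?_
    simp [H, Complex.exp_log (h0 q hq)]
  have hlift := Complex.isCoveringMap_exp.liftHomotopy_lifts H _ H0
  set G := Complex.isCoveringMap_exp.liftHomotopy H _ H0
  refine ⟨fun x => if hx : x ∈ A then G (1, ⟨x, hx⟩) else 0, ?_, ?_⟩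
  · rw [continuousOn_iff_continuous_domRestrict]
    have : A.domRestrict (fun x => if hx : x ∈ A then G (1, ⟨x, hx⟩) else 0) =
        fun a => G (1, a) := by
      funext a; simp [Set.domRestrict]
    rw [this]
    fun_prop
  · intro x hx
    have := congrArg Subtype.val (congrFun hlift (1, ⟨x, hx⟩))
    simpa [hx, H] using this

variable [T2Space E]

theorem isClosed_space {K : SimplicialComplex ℝ E} (h : K.faces.Finite) : IsClosed K.space :=
  h.isClosed_biUnion fun s _ => s.finite_toSet.isClosed_convexHull ℝ

/-- The simplex `τ` meets the rest in a set that is star-shaped about a vertex `q` of `τ` outside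
`σ`, hence connected, and `HasLogs.union` applies. -/
theorem HasLogs.of_elementaryCollapse {K L : SimplicialComplex ℝ E} (hK : K.faces.Finite)
    (h : ElementaryCollapse K L) (hL : HasLogs L.space) : HasLogs K.space := by
  classical
  obtain ⟨σ, hσ, τ, hτ, hστ, hfree, hf⟩ := h
  obtain ⟨q, hqτ, hqσ⟩ := Finset.exists_of_ssubset hστ
  have hLK : L.faces ⊆ K.faces := by rw [hf]; exact Set.sdiff_subset
  have hmemL : ∀ ρ ∈ K.faces, ¬ σ ⊆ ρ → ρ ∈ L.faces := by
    intro ρ hρ hn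
    rw [hf]
    refine ⟨hρ, ?_⟩
    rintro (rfl | rfl)
    · exact hn subset_rfl
    · exact hn hστ.1
  have hspace : K.space = L.space ∪ convexHull ℝ (τ : Set E) := by
    ext x
    simp only [SimplicialComplex.mem_space_iff, Set.mem_union]
    constructor
    · rintro ⟨s, hs, hx⟩
      by_cases h : s ∈ L.faces
      · exact Or.inl ⟨s, h, hx⟩
      · right
        rw [hf] at h
        have : s = σ ∨ s = τ := by
          by_contra h'
          exact h ⟨hs, by simpa using h'⟩
        rcases this with rfl | rfl
        · exact convexHull_mono (by exact_mod_cast hστ.1) hx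
        · exact hx
    · rintro (⟨s, hs, hx⟩ | hx)
      · exact ⟨s, hLK hs, hx⟩
      · exact ⟨τ, hτ, hx⟩
  have hσne : σ.Nonempty := K.nonempty_of_mem_faces hσ
  have hq : {q} ∈ L.faces := by
    refine hmemL _ (singleton_mem_of_mem hτ hqτ) fun h => ?_
    obtain ⟨v, hv⟩ := hσne
    rw [Finset.mem_singleton.1 (h hv)] at hv
    exact hqσ hv
  have hqmem : q ∈ L.space ∩ convexHull ℝ (τ : Set E) :=
    ⟨L.subset_space hq (by simp), subset_convexHull ℝ _ (by exact_mod_cast hqτ)⟩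
  have hstar : StarConvex ℝ q (L.space ∩ convexHull ℝ (τ : Set E)) := by
    rw [starConvex_iff_segment_subset]
    rintro x ⟨hxL, hxτ⟩
    obtain ⟨s, hs, hx⟩ := SimplicialComplex.mem_space_iff.1 hxL
    have hx' := K.inter_subset_convexHull (hLK hs) hτ ⟨hx, hxτ⟩
    rw [← Finset.coe_inter] at hx'
    -- Adding `q` to a face of `τ` that does not contain `σ` cannot make it contain `σ`, because `q
    -- ∉ σ`.
    have hn : ¬ σ ⊆ insert q (s ∩ τ) := by
      intro h
      have hσs : σ ⊆ s := fun v hv => by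
        rcases Finset.mem_insert.1 (h hv) with rfl | h'
        · exact absurd hv hqσ
        · exact (Finset.mem_inter.1 h').1
      have hs' := hs
      rw [hf] at hs'
      rcases hσs.eq_or_ssubset with rfl | h'
      · exact hs'.2 (Or.inl rfl)
      · exact hs'.2 (Or.inr (hfree s hs'.1 h'))
    have hsub : insert q (s ∩ τ) ⊆ τ := by
      rw [Finset.insert_subset_iff]
      exact ⟨hqτ, Finset.inter_subset_right⟩
    have hface : insert q (s ∩ τ) ∈ L.faces :=
      hmemL _ (K.down_closed hτ hsub (by simp)) hn
    have hseg : segment ℝ q x ⊆ convexHull ℝ ((insert q (s ∩ τ) : Finset E) : Set E) :=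
      (convex_convexHull ℝ _).segment_subset (subset_convexHull ℝ _ (by simp))
        (convexHull_mono (by exact_mod_cast Finset.subset_insert _ _) hx')
    exact fun y hy => ⟨SimplicialComplex.mem_space_iff.2 ⟨_, hface, hseg hy⟩,
      convexHull_mono (by exact_mod_cast hsub) (hseg hy)⟩
  rw [hspace]
  have hτq : q ∈ convexHull ℝ (τ : Set E) := hqmem.2
  refine hL.union (HasLogs.of_starConvex hτq ((convex_convexHull ℝ _).starConvex hτq))
    (isClosed_space (hK.subset hLK)) (τ.finite_toSet.isClosed_convexHull ℝ) ?_
  exact (hstar.isPathConnected hqmem).isConnected.isPreconnected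

theorem HasLogs.of_collapsible {K : SimplicialComplex ℝ E} (h : Collapsible K) :
    HasLogs K.space := by
  obtain ⟨hfin, v, L, hL, hc⟩ := h
  induction hc using Relation.ReflTransGen.head_induction_on with
  | refl =>
    have : L.space = {v} := by simp [SimplicialComplex.space, hL]
    rw [this]
    exact HasLogs.of_starConvex rfl (starConvex_singleton v)
  | head h _ ih =>
    refine HasLogs.of_elementaryCollapse hfin h (ih ?_)
    obtain ⟨σ, hσ, τ, hτ, hστ, hfree, hf⟩ := h
    rw [hf]; exact hfin.sdiff

end Logarithms

end PLCover

namespace PLCover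

/-! ### Functions on the disc and on its image; integer-valued functions. -/

section Counting

variable {E : Type*} [TopologicalSpace E]

/-- A continuous map from the closed unit disc which is injective except on the boundary circle. -/
structure DiscMap (Ψ : ℂ → E) : Prop where
  cont : ContinuousOn Ψ (Metric.closedBall 0 1)
  inj : ∀ z ∈ Metric.ball (0 : ℂ) 1, ∀ z' ∈ Metric.closedBall (0 : ℂ) 1, Ψ z = Ψ z' → z = z'

/-- The part of the closed unit disc that is mapped into `X`. -/
def discPreimage (Ψ : ℂ → E) (X : Set E) : Set ℂ := Metric.closedBall 0 1 ∩ Ψ ⁻¹' X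

theorem DiscMap.isClosed_discPreimage {Ψ : ℂ → E} (hΨ : DiscMap Ψ) {X : Set E} (hX : IsClosed X) :
    IsClosed (discPreimage Ψ X) :=
  hΨ.cont.preimage_isClosed_of_isClosed Metric.isClosed_closedBall hX

theorem mem_ball_or_sphere {z : ℂ} (hz : z ∈ Metric.closedBall (0 : ℂ) 1) :
    z ∈ Metric.ball (0 : ℂ) 1 ∨ z ∈ Metric.sphere (0 : ℂ) 1 := by
  rw [Metric.mem_closedBall] at hz
  exact hz.lt_or_eq

/-- By compactness `Ψ` restricts to a quotient map onto `X`. Its only identifications are on the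
boundary circle, where `hfib` takes care of them. -/
theorem DiscMap.exists_descend [T2Space E] {Ψ : ℂ → E} (hΨ : DiscMap Ψ) {X : Set E}
    (hX : IsClosed X) (hXD : X ⊆ Ψ '' Metric.closedBall 0 1) {φ : ℂ → ℂ}
    (hφ : ContinuousOn φ (discPreimage Ψ X))
    (hfib : ∀ z ∈ Metric.sphere (0 : ℂ) 1, ∀ z' ∈ Metric.sphere (0 : ℂ) 1, Ψ z = Ψ z' → Ψ z ∈ X →
      φ z = φ z') :
    ∃ φ' : E → ℂ, ContinuousOn φ' X ∧ ∀ z ∈ discPreimage Ψ X, φ' (Ψ z) = φ z := by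
  classical
  have hfib' : ∀ z ∈ discPreimage Ψ X, ∀ z' ∈ Metric.closedBall (0 : ℂ) 1, Ψ z = Ψ z' →
      φ z = φ z' := by
    rintro z ⟨hz, hzX⟩ z' hz' h
    rcases mem_ball_or_sphere hz with h1 | h1
    · rw [hΨ.inj z h1 z' hz' h]
    · rcases mem_ball_or_sphere hz' with h2 | h2
      · rw [hΨ.inj z' h2 z hz h.symm]
      · exact hfib z h1 z' h2 h hzX
  refine ⟨fun x => if h : ∃ z ∈ discPreimage Ψ X, Ψ z = x then φ h.choose else 0, ?_, ?_⟩
  · let f : discPreimage Ψ X → X := fun z => ⟨Ψ z, z.2.2⟩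
    have hf : Continuous f := by
      refine Continuous.subtype_mk ?_ _
      exact (hΨ.cont.mono Set.inter_subset_left).domRestrict
    have hs : Function.Surjective f := by
      rintro ⟨x, hx⟩
      obtain ⟨z, hz, rfl⟩ := hXD hx
      exact ⟨⟨z, hz, hx⟩, rfl⟩
    have : CompactSpace (discPreimage Ψ X) := isCompact_iff_compactSpace.1
      ((isCompact_closedBall (0 : ℂ) 1).of_isClosed_subset (hΨ.isClosed_discPreimage hX)
        Set.inter_subset_left)
    have hq := hf.isClosedMap.isQuotientMap hf hs
    rw [continuousOn_iff_continuous_domRestrict, hq.continuous_iff]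
    refine hφ.domRestrict.congr ?_
    rintro ⟨z, hz⟩
    have h : ∃ z' ∈ discPreimage Ψ X, Ψ z' = Ψ z := ⟨z, hz, rfl⟩
    simp only [Set.domRestrict, Function.comp_apply, f]
    rw [dif_pos h]
    exact hfib' _ hz _ h.choose_spec.1.1 h.choose_spec.2.symm
  · intro z hz
    have h : ∃ z' ∈ discPreimage Ψ X, Ψ z' = Ψ z := ⟨z, hz, rfl⟩
    simp only
    rw [dif_pos h]
    exact (hfib' _ hz _ h.choose_spec.1.1 h.choose_spec.2.symm).symm

/-- Continuous integer valued functions on a set. -/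
def IntOn {Z : Type*} [TopologicalSpace Z] (S : Set Z) (f : Z → ℝ) : Prop :=
  ContinuousOn f S ∧ ∀ z ∈ S, ∃ k : ℤ, f z = k

theorem IntOn.const {Z : Type*} [TopologicalSpace Z] (S : Set Z) (k : ℤ) :
    IntOn S fun _ => (k : ℝ) := ⟨continuousOn_const, fun _ _ => ⟨k, rfl⟩⟩

theorem IntOn.add {Z : Type*} [TopologicalSpace Z] {S : Set Z} {f g : Z → ℝ} (hf : IntOn S f)
    (hg : IntOn S g) : IntOn S fun z => f z + g z := by
  refine ⟨hf.1.add hg.1, fun z hz => ?_⟩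
  obtain ⟨a, ha⟩ := hf.2 z hz
  obtain ⟨b, hb⟩ := hg.2 z hz
  exact ⟨a + b, by simp [ha, hb]⟩

theorem IntOn.sub {Z : Type*} [TopologicalSpace Z] {S : Set Z} {f g : Z → ℝ} (hf : IntOn S f)
    (hg : IntOn S g) : IntOn S fun z => f z - g z := by
  refine ⟨hf.1.sub hg.1, fun z hz => ?_⟩
  obtain ⟨a, ha⟩ := hf.2 z hz
  obtain ⟨b, hb⟩ := hg.2 z hz
  exact ⟨a - b, by simp [ha, hb]⟩

theorem IntOn.mul {Z : Type*} [TopologicalSpace Z] {S : Set Z} {f g : Z → ℝ} (hf : IntOn S f)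
    (hg : IntOn S g) : IntOn S fun z => f z * g z := by
  refine ⟨hf.1.mul hg.1, fun z hz => ?_⟩
  obtain ⟨a, ha⟩ := hf.2 z hz
  obtain ⟨b, hb⟩ := hg.2 z hz
  exact ⟨a * b, by simp [ha, hb]⟩

theorem IntOn.mono {Z : Type*} [TopologicalSpace Z] {S T : Set Z} {f : Z → ℝ} (hf : IntOn T f)
    (h : S ⊆ T) : IntOn S f := ⟨hf.1.mono h, fun z hz => hf.2 z (h hz)⟩

/-- `exp (2 π i t)` for real `t`. -/
noncomputable def unitExp (t : ℝ) : ℂ := Complex.exp (2 * Real.pi * Complex.I * t)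

/-- The real number `t` with `z = 2 π i t`, if there is one. -/
noncomputable def turns (z : ℂ) : ℝ := (z / (2 * Real.pi * Complex.I)).re

theorem continuous_unitExp : Continuous unitExp := by unfold unitExp; fun_prop

theorem continuous_turns : Continuous turns := by unfold turns; fun_prop

theorem unitExp_intCast (k : ℤ) : unitExp k = 1 := by
  rw [unitExp, Complex.exp_eq_one_iff]
  exact ⟨k, by push_cast; ring⟩

theorem exists_int_of_exp_eq_unitExp {z : ℂ} {t : ℝ} (h : Complex.exp z = unitExp t) :
    ∃ k : ℤ, t - turns z = k := by
  rw [unitExp, Complex.exp_eq_exp_iff_exists_int] at h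
  obtain ⟨n, hn⟩ := h
  refine ⟨-n, ?_⟩
  have h2 : (2 * Real.pi * Complex.I : ℂ) ≠ 0 := Complex.two_pi_I_ne_zero
  have : z / (2 * Real.pi * Complex.I) = ((t + n : ℝ) : ℂ) := by
    rw [hn]; field_simp; push_cast; ring
  rw [turns, this, Complex.ofReal_re]
  push_cast; ring

/-- The connecting map from locally constant functions on `A ∩ B` vanishes when `A ∪ B` has
logarithms. With `H` a Tietze extension of `h`, the function equal to `exp (2πi H)` on `A` and to
`1` on `B` is continuous. If `ψ` is a logarithm of it, `H - ψ / 2πi` and `-ψ / 2πi` are integer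
valued on `A` and `B`. -/
theorem exists_intOn_sub {A B : Set ℂ} (hA : IsClosed A) (hB : IsClosed B)
    (hAB : HasLogs (A ∪ B)) {h : ℂ → ℝ} (hh : IntOn (A ∩ B) h) :
    ∃ f g : ℂ → ℝ, IntOn A f ∧ IntOn B g ∧ ∀ z ∈ A ∩ B, h z = f z - g z := by
  classical
  obtain ⟨H, hH⟩ := ContinuousMap.exists_restrict_eq (hA.inter hB)
    (⟨(A ∩ B).domRestrict h, hh.1.domRestrict⟩ : C(↑(A ∩ B), ℝ))
  have hH' : ∀ z ∈ A ∩ B, H z = h z := fun z hz => by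
    have := DFunLike.congr_fun hH ⟨z, hz⟩
    simpa using this
  obtain ⟨ψ, hψ, hψ'⟩ := hAB (fun z => if z ∈ A then unitExp (H z) else 1) (by
    refine ContinuousOn.union_of_isClosed ?_ ?_ hA hB
    · refine (continuous_unitExp.comp H.continuous).continuousOn.congr fun z hz => ?_
      simp [hz]
    · refine (continuousOn_const (c := 1)).congr fun z hz => ?_
      by_cases hzA : z ∈ A
      · obtain ⟨k, hk⟩ := hh.2 z ⟨hzA, hz⟩
        simp only [hzA, if_true]
        rw [hH' z ⟨hzA, hz⟩, hk, unitExp_intCast]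
      · simp [hzA])
    (by
      intro z hz
      split_ifs
      · exact Complex.exp_ne_zero _
      · exact one_ne_zero)
  refine ⟨fun z => H z - turns (ψ z), fun z => 0 - turns (ψ z), ⟨?_, fun z hz => ?_⟩,
    ⟨?_, fun z hz => ?_⟩, fun z hz => ?_⟩
  · exact H.continuous.continuousOn.sub
      (continuous_turns.comp_continuousOn (hψ.mono Set.subset_union_left))
  · have := hψ' z (Or.inl hz)
    simp only [hz, if_true] at this
    exact exists_int_of_exp_eq_unitExp this
  · exact continuousOn_const.sub
      (continuous_turns.comp_continuousOn (hψ.mono Set.subset_union_right))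
  · have := hψ' z (Or.inr hz)
    apply exists_int_of_exp_eq_unitExp
    rw [this]
    split_ifs with hzA
    · obtain ⟨k, hk⟩ := hh.2 z ⟨hzA, hz⟩
      rw [hH' z ⟨hzA, hz⟩, hk, unitExp_intCast]
      simpa using (unitExp_intCast 0).symm
    · simpa using (unitExp_intCast 0).symm
  · rw [← hH' z hz]; ring

end Counting

end PLCover

namespace PLCover

/-! ### Coloured arcs on the boundary circle and the isotropy of jumps. -/

section Counting

variable {E : Type*} [TopologicalSpace E]

/-- A cyclic subdivision of the boundary circle of a disc into finitely many arcs, each of which is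
mapped into the member of a closed cover that is given by its colour. Arcs with the same label have
the same colour, and their images meet. Integer valued functions on the set of arcs are realized
as functions on the disc that are locally constant on the part of the circle that is not covered by
the member of the opposite colour. -/
structure CircleData (Ψ : ℂ → E) (X : Bool → Set E) (C Λ : Type*) where
  nxt : Equiv.Perm C
  e : ℝ → ℂ
  lo : C → ℝ
  hi : C → ℝ
  κ : C → Bool
  lab : C → Λ
  continuous_e : Continuous e
  e_mem : ∀ t, e t ∈ Metric.sphere (0 : ℂ) 1
  lo_le_hi : ∀ q, lo q ≤ hi q
  e_hi : ∀ q, e (hi q) = e (lo (nxt q))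
  cell : ∀ q, ∀ t ∈ Set.Icc (lo q) (hi q), Ψ (e t) ∈ X (κ q)
  cover : ∀ z ∈ Metric.sphere (0 : ℂ) 1, ∃ q, ∃ t ∈ Set.Icc (lo q) (hi q), e t = z
  step : ∀ V : C → ℤ, ∃ W : ℂ → ℝ, ContinuousOn W (Metric.closedBall 0 1) ∧
    ∀ q, ∀ t ∈ Set.Icc (lo q) (hi q), (V (nxt.symm q) = V q → W (e t) = V q) ∧
      ((∃ k : ℤ, W (e t) = k) ∨ Ψ (e t) ∉ X (!κ q))
  lab_κ : ∀ q q', lab q = lab q' → κ q = κ q'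
  lab_meet : ∀ q q', lab q = lab q' → ∃ t ∈ Set.Icc (lo q) (hi q),
    ∃ t' ∈ Set.Icc (lo q') (hi q'), Ψ (e t) = Ψ (e t')
  trans : ∀ w : C → ZMod 2, (∀ q, w (nxt q) = w q) → ∀ q q', w q = w q'
  both : ∀ b, ∃ q, κ q = b

/-- A closed cover of the image of the disc by two sets on which logarithms exist. -/
structure LogCover (Ψ : ℂ → E) (X : Bool → Set E) : Prop where
  disc : DiscMap Ψ
  closed : ∀ b, IsClosed (X b)
  sub : ∀ b, X b ⊆ Ψ '' Metric.closedBall 0 1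
  cover : ∀ z ∈ Metric.closedBall (0 : ℂ) 1, ∃ b, Ψ z ∈ X b
  logs : ∀ b, HasLogs (X b)

variable {Ψ : ℂ → E} {X : Bool → Set E} {C Λ : Type*}

theorem CircleData.mem_discPreimage (d : CircleData Ψ X C Λ) (q : C) {t : ℝ}
    (ht : t ∈ Set.Icc (d.lo q) (d.hi q)) : d.e t ∈ discPreimage Ψ (X (d.κ q)) :=
  ⟨Metric.sphere_subset_closedBall (d.e_mem t), d.cell q t ht⟩

theorem CircleData.intOn_const (d : CircleData Ψ X C Λ) (q : C) {f : ℂ → ℝ}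
    (hf : IntOn (discPreimage Ψ (X (d.κ q))) f) {t t' : ℝ} (ht : t ∈ Set.Icc (d.lo q) (d.hi q))
    (ht' : t' ∈ Set.Icc (d.lo q) (d.hi q)) : f (d.e t) = f (d.e t') :=
  eq_of_forall_exists_int isPreconnected_Icc (f := fun t => f (d.e t))
    (hf.1.comp d.continuous_e.continuousOn fun _ h => d.mem_discPreimage q h)
    (fun _ h => hf.2 _ (d.mem_discPreimage q h)) ht ht'

theorem CircleData.lo_mem (d : CircleData Ψ X C Λ) (q : C) : d.lo q ∈ Set.Icc (d.lo q) (d.hi q) :=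
  ⟨le_rfl, d.lo_le_hi q⟩

theorem CircleData.hi_mem (d : CircleData Ψ X C Λ) (q : C) : d.hi q ∈ Set.Icc (d.lo q) (d.hi q) :=
  ⟨d.lo_le_hi q, le_rfl⟩

/-- Here the logarithms on `X b` enter. The values `w` extend to a real function `W` on the disc
that is an integer at every boundary point over `X b`, so `unitExp ∘ W` descends to `X b` and has a
logarithm `ψ` there. Then `W - turns (ψ ∘ Ψ)` is integer valued over `X b`, and `turns ψ` agrees on
arcs with the same label because their images meet. -/
theorem CircleData.exists_decomposition [T2Space E] (d : CircleData Ψ X C Λ) (hX : LogCover Ψ X)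
    (b : Bool) (w : C → ℤ) (hw : ∀ q, d.κ (d.nxt q) = d.κ q → w (d.nxt q) = w q) :
    ∃ f : ℂ → ℝ, IntOn (discPreimage Ψ (X b)) f ∧ ∃ g : Λ → ℤ, ∀ q, d.κ q = b →
      f (d.e (d.lo q)) + g (d.lab q) = w q := by
  classical
  -- On an arc of the other colour `V` anticipates the value of the next arc. So every jump of `W`
  -- happens inside an arc of the other colour, at points outside `X b`.
  set V : C → ℤ := fun q => if d.κ q = b then w q else w (d.nxt q) with hV
  obtain ⟨W, hW, hWq⟩ := d.step V
  have hVq : ∀ q, d.κ q = b → V (d.nxt.symm q) = V q := by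
    intro q hq
    simp only [hV, hq, if_true, Equiv.apply_symm_apply]
    split_ifs with h
    · have := hw (d.nxt.symm q)
      rw [Equiv.apply_symm_apply] at this
      exact (this (hq.trans h.symm)).symm
    · rfl
  have hWb : ∀ q, d.κ q = b → ∀ t ∈ Set.Icc (d.lo q) (d.hi q), W (d.e t) = w q := by
    intro q hq t ht
    rw [(hWq q t ht).1 (hVq q hq)]
    simp [hV, hq]
  have hWint : ∀ z ∈ Metric.sphere (0 : ℂ) 1, Ψ z ∈ X b → ∃ k : ℤ, W z = k := by
    intro z hz hzb
    obtain ⟨q, t, ht, rfl⟩ := d.cover z hz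
    by_cases hq : d.κ q = b
    · exact ⟨w q, hWb q hq t ht⟩
    · refine ((hWq q t ht).2).resolve_right fun h => h ?_
      have : (!d.κ q) = b := by cases b <;> simp_all
      rwa [this]
  have hphi : ∀ z ∈ Metric.sphere (0 : ℂ) 1, Ψ z ∈ X b → unitExp (W z) = 1 := by
    intro z hz hzb
    obtain ⟨k, hk⟩ := hWint z hz hzb
    rw [hk, unitExp_intCast]
  obtain ⟨φ, hφ, hφ'⟩ := hX.disc.exists_descend (hX.closed b) (hX.sub b)
    (φ := fun z => unitExp (W z))
    (continuous_unitExp.comp_continuousOn (hW.mono Set.inter_subset_left))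
    (fun z hz z' hz' h hzb => by rw [hphi z hz hzb, hphi z' hz' (h ▸ hzb)])
  obtain ⟨ψ, hψ, hψ'⟩ := hX.logs b φ hφ (by
    intro x hx
    obtain ⟨z, hz, rfl⟩ := hX.sub b hx
    rw [hφ' z ⟨hz, hx⟩]
    exact Complex.exp_ne_zero _)
  have hψΨ : ContinuousOn (fun z => turns (ψ (Ψ z))) (discPreimage Ψ (X b)) :=
    continuous_turns.comp_continuousOn
      (hψ.comp (hX.disc.cont.mono Set.inter_subset_left) fun z hz => hz.2)
  have hf : IntOn (discPreimage Ψ (X b)) fun z => W z - turns (ψ (Ψ z)) := by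
    refine ⟨(hW.mono Set.inter_subset_left).sub hψΨ, fun z hz => ?_⟩
    apply exists_int_of_exp_eq_unitExp
    rw [hψ' _ hz.2, hφ' z hz]
  have hGint : ∀ q, d.κ q = b → ∃ k : ℤ, turns (ψ (Ψ (d.e (d.lo q)))) = k := by
    rintro q rfl
    obtain ⟨k, hk⟩ := hf.2 _ (d.mem_discPreimage q (d.lo_mem q))
    exact ⟨w q - k, by beta_reduce at hk; rw [hWb q rfl _ (d.lo_mem q)] at hk; push_cast; linarith⟩
  have hGlab : ∀ q q', d.κ q = b → d.lab q = d.lab q' →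
      turns (ψ (Ψ (d.e (d.lo q)))) = turns (ψ (Ψ (d.e (d.lo q')))) := by
    rintro q q' rfl hqq'
    have hκ := d.lab_κ _ _ hqq'
    obtain ⟨t, ht, t', ht', he⟩ := d.lab_meet _ _ hqq'
    have h1 := d.intOn_const q hf (d.lo_mem q) ht
    have h2 := d.intOn_const q' (by rw [← hκ]; exact hf) (d.lo_mem q') ht'
    beta_reduce at h1 h2
    rw [hWb q rfl _ (d.lo_mem q), hWb q rfl t ht] at h1
    rw [hWb q' hκ.symm _ (d.lo_mem q'), hWb q' hκ.symm t' ht', ← he] at h2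
    linarith
  choose! G hG using hGint
  refine ⟨_, hf, fun l => if h : ∃ q, d.κ q = b ∧ d.lab q = l then G h.choose else 0, ?_⟩
  intro q hq
  have h : ∃ q', d.κ q' = b ∧ d.lab q' = d.lab q := ⟨q, hq, rfl⟩
  have hGG : ((G h.choose : ℤ) : ℝ) = turns (ψ (Ψ (d.e (d.lo q)))) := by
    rw [← hG _ h.choose_spec.1]
    exact hGlab _ _ h.choose_spec.1 h.choose_spec.2
  beta_reduce
  rw [dif_pos h, hGG, hWb q hq _ (d.lo_mem q)]
  ring

/-- The functions on arcs that come from locally constant functions on the two members of the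
cover of the disc. -/
def CircleData.liftable (d : CircleData Ψ X C Λ) : Submodule (ZMod 2) (C → ZMod 2) where
  carrier := {u | ∃ f : Bool → ℂ → ℝ, (∀ b, IntOn (discPreimage Ψ (X b)) (f b)) ∧
    ∀ q, ∃ k : ℤ, f (d.κ q) (d.e (d.lo q)) = k ∧ u q = k}
  add_mem' := by
    rintro u v ⟨f, hf, hu⟩ ⟨g, hg, hv⟩
    refine ⟨fun b z => f b z + g b z, fun b => (hf b).add (hg b), fun q => ?_⟩
    obtain ⟨k, h1, h2⟩ := hu q
    obtain ⟨l, h3, h4⟩ := hv q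
    exact ⟨k + l, by simp [h1, h3], by simp [h2, h4]⟩
  zero_mem' := ⟨fun _ _ => ((0 : ℤ) : ℝ), fun b => IntOn.const _ 0, fun q => ⟨0, by simp, by simp⟩⟩
  smul_mem' := by
    rintro c u ⟨f, hf, hu⟩
    refine ⟨fun b z => ((c.val : ℤ) : ℝ) * f b z, fun b => (IntOn.const _ _).mul (hf b), fun q => ?_⟩
    obtain ⟨k, h1, h2⟩ := hu q
    exact ⟨c.val * k, by simp [h1], by simp [h2]⟩

theorem CircleData.liftable_nxt (d : CircleData Ψ X C Λ) {u : C → ZMod 2} (hu : u ∈ d.liftable)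
    {q : C} (hq : d.κ (d.nxt q) = d.κ q) : u (d.nxt q) = u q := by
  obtain ⟨f, hf, hfu⟩ := hu
  obtain ⟨k, h1, h2⟩ := hfu q
  obtain ⟨l, h3, h4⟩ := hfu (d.nxt q)
  have := d.intOn_const q (hf _) (d.lo_mem q) (d.hi_mem q)
  rw [hq, ← d.e_hi, ← this, h1] at h3
  rw [h2, h4, Int.cast_injective h3]

theorem closedBall_hasLogs : HasLogs (Metric.closedBall (0 : ℂ) 1) :=
  HasLogs.of_starConvex (q := 0) (by simp) ((convex_closedBall 0 1).starConvex (by simp))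

/-- The product of the differences of the two lifts is integer valued on the intersection of the two
parts of the disc. By `exists_intOn_sub` it is a difference of integer-valued functions on the two
parts. At a change of colour the product of jumps is therefore, up to sign, a jump of one function
`K` on the arcs; modulo 2 the sum over the circle telescopes. -/
theorem CircleData.sum_mul_eq_zero [Fintype C] (d : CircleData Ψ X C Λ) (hX : LogCover Ψ X)
    {u v : C → ZMod 2} (hu : u ∈ d.liftable) (hv : v ∈ d.liftable) :
    ∑ q, (u (d.nxt q) - u q) * (v (d.nxt q) - v q) = 0 := by
  obtain ⟨f, hf, hfu⟩ := id hu
  obtain ⟨g, hg, hgv⟩ := id hv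
  have hunion : discPreimage Ψ (X true) ∪ discPreimage Ψ (X false) = Metric.closedBall 0 1 := by
    ext z
    constructor
    · rintro (h | h) <;> exact h.1
    · intro hz
      obtain ⟨b, hb⟩ := hX.cover z hz
      cases b
      · exact Or.inr ⟨hz, hb⟩
      · exact Or.inl ⟨hz, hb⟩
  obtain ⟨F, G, hF, hG, hFG⟩ := exists_intOn_sub (hX.disc.isClosed_discPreimage (hX.closed true))
    (hX.disc.isClosed_discPreimage (hX.closed false)) (by rw [hunion]; exact closedBall_hasLogs)
    (h := fun z => (f true z - f false z) * (g true z - g false z))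
    ((((hf true).mono Set.inter_subset_left).sub ((hf false).mono Set.inter_subset_right)).mul
      (((hg true).mono Set.inter_subset_left).sub ((hg false).mono Set.inter_subset_right)))
  set H : Bool → ℂ → ℝ := fun b => if b then F else G with hH
  have hHint : ∀ b, IntOn (discPreimage Ψ (X b)) (H b) := by rintro (_ | _) <;> simpa [hH]
  have hex : ∀ q, ∃ k : ℤ, H (d.κ q) (d.e (d.lo q)) = k := fun q =>
    (hHint _).2 _ (d.mem_discPreimage q (d.lo_mem q))
  choose K hK using hex
  have hterm : ∀ q, (u (d.nxt q) - u q) * (v (d.nxt q) - v q) = (K (d.nxt q) : ZMod 2) - K q := by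
    intro q
    obtain ⟨k, h1, h2⟩ := hfu q
    obtain ⟨k', h3, h4⟩ := hfu (d.nxt q)
    obtain ⟨l, h5, h6⟩ := hgv q
    obtain ⟨l', h7, h8⟩ := hgv (d.nxt q)
    have hK1 := hK q
    have hK2 := hK (d.nxt q)
    have hm1 := d.mem_discPreimage q (d.hi_mem q)
    have hm2 := d.mem_discPreimage _ (d.lo_mem (d.nxt q))
    rw [d.intOn_const q (hf _) (d.lo_mem q) (d.hi_mem q)] at h1
    rw [d.intOn_const q (hg _) (d.lo_mem q) (d.hi_mem q)] at h5
    rw [d.intOn_const q (hHint _) (d.lo_mem q) (d.hi_mem q)] at hK1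
    rw [d.e_hi] at h1 h5 hK1 hm1
    by_cases hq : d.κ (d.nxt q) = d.κ q
    · rw [d.liftable_nxt hu hq, d.liftable_nxt hv hq]
      rw [hq, hK1] at hK2
      rw [Int.cast_injective hK2]
      simp
    -- The sign depends on which colour comes first, which does not matter modulo 2.
    · have hneg : ∀ x : ZMod 2, -x = x := ZMod.neg_eq_self_mod_two
      rw [h2, h4, h6, h8]
      generalize d.e (d.lo (d.nxt q)) = z at *
      cases hb : d.κ q
      · have hb' : d.κ (d.nxt q) = true := by simpa [hb] using hq
        rw [hb] at h1 h5 hK1 hm1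
        rw [hb'] at h3 h7 hK2 hm2
        have := hFG z ⟨hm2, hm1⟩
        simp only [hH, if_true, Bool.false_eq_true, if_false] at hK1 hK2
        rw [h1, h3, h5, h7, hK1, hK2] at this
        have : (k' - k) * (l' - l) = K (d.nxt q) - K q := by exact_mod_cast this
        exact_mod_cast congrArg (Int.cast : ℤ → ZMod 2) this
      · have hb' : d.κ (d.nxt q) = false := by simpa [hb] using hq
        rw [hb] at h1 h5 hK1 hm1
        rw [hb'] at h3 h7 hK2 hm2
        have := hFG z ⟨hm1, hm2⟩
        simp only [hH, if_true, Bool.false_eq_true, if_false] at hK1 hK2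
        rw [h1, h3, h5, h7, hK1, hK2] at this
        have : (k' - k) * (l' - l) = -(K (d.nxt q) - K q) := by
          have h' : (k - k') * (l - l') = K q - K (d.nxt q) := by exact_mod_cast this
          linarith
        have := congrArg (Int.cast : ℤ → ZMod 2) this
        push_cast at this
        rw [this, hneg]
  rw [Finset.sum_congr rfl fun q _ => hterm q, Finset.sum_sub_distrib,
    Equiv.sum_comp d.nxt fun q => (K q : ZMod 2), sub_self]

end Counting

end PLCover

namespace PLCover

/-! ### The dimension count bounding the number of colour changes. -/

section Dimension

open Module

/-- The nondegenerate dot product embeds `W` into its annihilator, whose dimension is the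
codimension of `W`. -/
theorem two_mul_finrank_le_of_isotropic {S : Type*} [Fintype S] {F : Type*} [Field F]
    (W : Submodule F (S → F)) (h : ∀ u ∈ W, ∀ v ∈ W, ∑ s, u s * v s = 0) :
    2 * finrank F W ≤ Fintype.card S := by
  classical
  let T : (S → F) →ₗ[F] Dual F (S → F) := (Pi.basisFun F S).toDual
  have hT : ∀ u v, T u v = ∑ s, u s * v s := by
    intro u v
    have : T u v = ∑ s, ∑ t, u s * v t * (if s = t then 1 else 0) := by
      conv_lhs => rw [← (Pi.basisFun F S).sum_repr u, ← (Pi.basisFun F S).sum_repr v]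
      simp only [map_sum, LinearMap.sum_apply, map_smul, LinearMap.smul_apply, T,
        Basis.toDual_apply, smul_eq_mul, Pi.basisFun_repr]
      rw [Finset.sum_comm]
      simp [mul_comm]
    simp [this]
  have hinj : Function.Injective T := (Pi.basisFun F S).toDual_injective
  have h1 : W.map T ≤ W.dualAnnihilator := by
    rintro _ ⟨u, hu, rfl⟩
    rw [Submodule.mem_dualAnnihilator]
    intro v hv
    rw [hT, h u hu v hv]
  have h2 := Submodule.finrank_mono h1
  rw [← (Submodule.equivMapOfInjective T hinj W).finrank_eq] at h2
  have h3 := Subspace.finrank_add_finrank_dualAnnihilator_eq W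
  rw [finrank_fintype_fun_eq_card] at h3
  omega

variable {E : Type*} [TopologicalSpace E] {Ψ : ℂ → E} {X : Bool → Set E} {C Λ : Type*}

theorem CircleData.indicator_mem_liftable (d : CircleData Ψ X C Λ) (b : Bool) :
    (fun q => if d.κ q = b then 1 else 0) ∈ d.liftable := by
  refine ⟨fun b' _ => ((if b' = b then 1 else 0 : ℤ) : ℝ), fun b' => IntOn.const _ _, fun q => ?_⟩
  exact ⟨if d.κ q = b then 1 else 0, rfl, by by_cases h : d.κ q = b <;> simp [h]⟩

/-- The number of changes of colour along the circle is bounded in terms of the number of labels. -/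
theorem CircleData.card_switches_le [T2Space E] [Fintype C] [Fintype Λ]
    (d : CircleData Ψ X C Λ) (hX : LogCover Ψ X) :
    Fintype.card {q // ¬ d.κ (d.nxt q) = d.κ q} + 2 ≤ 2 * Fintype.card Λ := by
  classical
  -- functions that do not change between arcs of the same colour
  let ρ : (C → (ZMod 2)) →ₗ[(ZMod 2)] ({q // d.κ (d.nxt q) = d.κ q} → (ZMod 2)) :=
    { toFun := fun w q => w (d.nxt q) - w q
      map_add' := fun u v => by ext q; simp; ring
      map_smul' := fun c u => by ext q; simp; ring }
  let δ : (C → (ZMod 2)) →ₗ[(ZMod 2)] ({q // ¬ d.κ (d.nxt q) = d.κ q} → (ZMod 2)) :=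
    { toFun := fun w q => w (d.nxt q) - w q
      map_add' := fun u v => by ext q; simp; ring
      map_smul' := fun c u => by ext q; simp; ring }
  let Θ : Submodule (ZMod 2) (C → (ZMod 2)) := LinearMap.range (LinearMap.funLeft (ZMod 2) (ZMod 2) d.lab)
  have hcard : Fintype.card {q // d.κ (d.nxt q) = d.κ q} +
      Fintype.card {q // ¬ d.κ (d.nxt q) = d.κ q} = Fintype.card C := by
    have h1 := Fintype.card_subtype_compl fun q => d.κ (d.nxt q) = d.κ q
    have h2 := Fintype.card_subtype_le fun q => d.κ (d.nxt q) = d.κ q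
    omega
  -- The kernel of `ρ` is cut out by one linear condition for each junction of equal colours.
  have hSig : Fintype.card {q // ¬ d.κ (d.nxt q) = d.κ q} ≤ finrank (ZMod 2) (LinearMap.ker ρ) := by
    have h1 := LinearMap.finrank_range_add_finrank_ker ρ
    have h2 := Submodule.finrank_le (LinearMap.range ρ)
    rw [finrank_fintype_fun_eq_card] at h1 h2
    omega
  have hΘ : finrank (ZMod 2) Θ ≤ Fintype.card Λ := by
    have := LinearMap.finrank_range_le (LinearMap.funLeft (ZMod 2) (ZMod 2) d.lab)
    rwa [finrank_fintype_fun_eq_card] at this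
  have hUker : ∀ u ∈ d.liftable, δ u = 0 → ∀ q, u (d.nxt q) = u q := by
    intro u hu h q
    by_cases hq : d.κ (d.nxt q) = d.κ q
    · exact d.liftable_nxt hu hq
    · exact sub_eq_zero.1 (congrFun h ⟨q, hq⟩)
  have hiso : 2 * finrank (ZMod 2) (d.liftable.map δ) ≤
      Fintype.card {q // ¬ d.κ (d.nxt q) = d.κ q} := by
    apply two_mul_finrank_le_of_isotropic
    rintro _ ⟨u, hu, rfl⟩ _ ⟨v, hv, rfl⟩
    rw [← d.sum_mul_eq_zero hX hu hv]
    simp only [δ, LinearMap.coe_mk, AddHom.coe_mk]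
    rw [← Finset.sum_filter_of_ne (s := Finset.univ) (p := fun q => ¬ d.κ (d.nxt q) = d.κ q)]
    · exact (Finset.sum_subtype _ (by simp)
        fun q => (u (d.nxt q) - u q) * (v (d.nxt q) - v q)).symm
    · intro q _ h hq
      rw [d.liftable_nxt hu hq, sub_self, zero_mul] at h
      exact h rfl
  -- A liftable function without jumps at colour changes is constant around the circle, so passing
  -- to jumps loses at most one dimension.
  have hU : finrank (ZMod 2) d.liftable ≤ finrank (ZMod 2) (d.liftable.map δ) + 1 := by
    have h1 := LinearMap.finrank_range_add_finrank_ker (δ.domRestrict d.liftable)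
    rw [LinearMap.range_domRestrict] at h1
    have h2 : finrank (ZMod 2) (LinearMap.ker (δ.domRestrict d.liftable)) ≤ 1 := by
      obtain ⟨q₀, -⟩ := d.both true
      have hinj : Function.Injective ((LinearMap.proj q₀ : (C → ZMod 2) →ₗ[ZMod 2] ZMod 2) ∘ₗ
          d.liftable.subtype ∘ₗ (LinearMap.ker (δ.domRestrict d.liftable)).subtype) := by
        rw [injective_iff_map_eq_zero]
        rintro ⟨⟨u, hu⟩, hu'⟩ h
        have h0 : u q₀ = 0 := h
        have := d.trans u (hUker u hu hu')
        ext q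
        exact (this q q₀).trans h0
      have := LinearMap.finrank_le_finrank_of_injective hinj
      simpa using this
    omega
  -- Lift the values to `{0, 1}` in `ℤ`, decompose over each colour separately, and reduce modulo 2.
  -- The two label functions combine into one since a label determines the colour.
  have hle : LinearMap.ker ρ ≤ d.liftable ⊔ Θ := by
    intro w hw
    have hw' : ∀ q, d.κ (d.nxt q) = d.κ q → ((w (d.nxt q)).val : ℤ) = (w q).val := by
      intro q hq
      have := congrFun (LinearMap.mem_ker.1 hw) ⟨q, hq⟩
      rw [sub_eq_zero.1 this]
    choose f hf g hg using fun b => d.exists_decomposition hX b (fun q => ((w q).val : ℤ)) hw'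
    rw [Submodule.mem_sup]
    refine ⟨fun q => w q - g (d.κ q) (d.lab q), ⟨f, hf, fun q => ?_⟩,
      fun q => g (d.κ q) (d.lab q), ?_, by ext q; simp⟩
    · refine ⟨(w q).val - g (d.κ q) (d.lab q), ?_, by simp⟩
      have := hg (d.κ q) q rfl
      push_cast at this ⊢
      linarith
    · refine ⟨fun l => if ∃ q, d.lab q = l ∧ d.κ q = true then g true l else g false l, ?_⟩
      ext q
      simp only [LinearMap.funLeft_apply]
      cases hq : d.κ q
      · rw [if_neg]
        rintro ⟨q', h1, h2⟩
        rw [d.lab_κ _ _ h1, hq] at h2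
        exact absurd h2 (by simp)
      · rw [if_pos ⟨q, rfl, hq⟩]
  -- The indicators of the two colours are liftable, depend only on the label, and are independent
  -- since both colours occur.
  have hinter : 2 ≤ finrank (ZMod 2) ↥(d.liftable ⊓ Θ) := by
    have hmem : ∀ b : Bool, (fun q => if d.κ q = b then (1 : (ZMod 2)) else 0) ∈ d.liftable ⊓ Θ := by
      intro b
      refine ⟨d.indicator_mem_liftable b, fun l => if ∃ q, d.lab q = l ∧ d.κ q = b then 1 else 0, ?_⟩
      ext q
      simp only [LinearMap.funLeft_apply]
      have : (∃ q', d.lab q' = d.lab q ∧ d.κ q' = b) ↔ d.κ q = b := by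
        constructor
        · rintro ⟨q', h1, h2⟩; rw [← d.lab_κ _ _ h1]; exact h2
        · intro h; exact ⟨q, rfl, h⟩
      simp only [this]
    have hli : LinearIndependent (ZMod 2)
        (fun b : Bool => (⟨_, hmem b⟩ : ↥(d.liftable ⊓ Θ))) := by
      rw [Fintype.linearIndependent_iff]
      intro c hc b
      obtain ⟨q, hq⟩ := d.both b
      have := congrFun (congrArg Subtype.val hc) q
      cases b <;> simpa [hq] using this
    have := hli.fintype_card_le_finrank
    simpa using this
  have h1 := Submodule.finrank_sup_add_finrank_inf_eq d.liftable Θ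
  have h2 := Submodule.finrank_mono hle
  omega

end Dimension

end PLCover

namespace PLCover

open Geometry Filter Topology

/-! ### Local geometry of a polyhedron at a free face. -/

section FreeFace

variable {E : Type*} [AddCommGroup E] [Module ℝ E]

/-- The directions in which one can move away from `x` inside `P`. -/
def Feasible (P : Set E) (x e : E) : Prop := ∀ᶠ t : ℝ in 𝓝[>] 0, x + t • e ∈ P

/-- On the simplex, `f - c` is the barycentric coordinate of `v`. -/
theorem exists_barycentric_functional {τ : Finset E} (h : AffineIndependent ℝ ((↑) : τ → E)) {v : E}
    (hv : v ∈ τ) : ∃ (f : E →ₗ[ℝ] ℝ) (c : ℝ), f v = c + 1 ∧ ∀ p ∈ τ, p ≠ v → f p = c := by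
  by_cases hne : ∃ p₀ ∈ τ, p₀ ≠ v
  · obtain ⟨p₀, hp₀, hp₀v⟩ := hne
    have h1 := h.notMem_affineSpan_sdiff ⟨v, hv⟩ Set.univ
    have hset : ((↑) : τ → E) '' (Set.univ \ {⟨v, hv⟩}) = (τ : Set E) \ {v} := by
      ext p; simp [and_comm]
    rw [hset] at h1
    have hp₀' : p₀ ∈ affineSpan ℝ ((τ : Set E) \ {v}) := subset_affineSpan ℝ _ ⟨hp₀, by simpa using hp₀v⟩
    have h2 : v - p₀ ∉ (affineSpan ℝ ((τ : Set E) \ {v})).direction := by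
      intro h'
      exact h1 ((AffineSubspace.vsub_right_mem_direction_iff_mem hp₀' v).1 h')
    obtain ⟨f, hf, hle⟩ := Submodule.exists_le_ker_of_notMem h2
    refine ⟨(f (v - p₀))⁻¹ • f, (f (v - p₀))⁻¹ * f p₀, ?_, ?_⟩
    · simp only [LinearMap.smul_apply, smul_eq_mul]
      have : f v = f (v - p₀) + f p₀ := by rw [map_sub]; ring
      rw [this]; field_simp; ring
    · intro p hp hpv
      have hmem : p - p₀ ∈ (affineSpan ℝ ((τ : Set E) \ {v})).direction :=
        (AffineSubspace.vsub_right_mem_direction_iff_mem hp₀' p).2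
          (subset_affineSpan ℝ _ ⟨hp, by simpa using hpv⟩)
      have := hle hmem
      rw [LinearMap.mem_ker, map_sub, sub_eq_zero] at this
      simp [this]
  · push Not at hne
    exact ⟨0, -1, by simp, fun p hp hpv => absurd (hne p hp) hpv⟩

theorem eq_on_convexHull {f : E →ₗ[ℝ] ℝ} {c : ℝ} {s : Set E} (h : ∀ p ∈ s, f p = c) {x : E}
    (hx : x ∈ convexHull ℝ s) : f x = c := by
  have : convexHull ℝ s ⊆ f ⁻¹' {c} :=
    convexHull_min (fun p hp => h p hp) ((convex_singleton c).linear_preimage f)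
  exact this hx

theorem le_on_convexHull {f : E →ₗ[ℝ] ℝ} {c : ℝ} {s : Set E} (h : ∀ p ∈ s, c ≤ f p) {x : E}
    (hx : x ∈ convexHull ℝ s) : c ≤ f x := by
  have : convexHull ℝ s ⊆ f ⁻¹' Set.Ici c :=
    convexHull_min (fun p hp => h p hp) ((convex_Ici c).linear_preimage f)
  exact this hx

/-- The barycentre has positive coordinates at all vertices of `σ`, so it lies in no proper face of
`σ`. -/
theorem subset_of_centroid_mem {K : SimplicialComplex ℝ E} {σ s : Finset E} (hσ : σ ∈ K.faces)
    (hs : s ∈ K.faces) {x : E} (hx : x = (σ.card : ℝ)⁻¹ • ∑ v ∈ σ, v)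
    (hxσ : x ∈ convexHull ℝ (σ : Set E)) (h : x ∈ convexHull ℝ (s : Set E)) : σ ⊆ s := by
  classical
  intro v hv
  by_contra hvs
  obtain ⟨f, c, hfv, hf⟩ := exists_barycentric_functional (K.indep hσ) hv
  have h1 := K.inter_subset_convexHull hσ hs ⟨hxσ, h⟩
  have h2 : f x = c := eq_on_convexHull (fun p hp => hf p hp.1 fun e => hvs (e ▸ hp.2)) h1
  have hcard : (0 : ℝ) < σ.card := by exact_mod_cast Finset.card_pos.2 ⟨v, hv⟩
  have h3 : f x = (σ.card : ℝ)⁻¹ * ∑ p ∈ σ, (c + if p = v then 1 else 0) := by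
    rw [hx, map_smul, map_sum, smul_eq_mul]
    congr 1
    refine Finset.sum_congr rfl fun p hp => ?_
    split_ifs with hpv
    · rw [hpv, hfv]
    · rw [hf p hp hpv, add_zero]
  rw [h2, Finset.sum_add_distrib, Finset.sum_const, nsmul_eq_mul, Finset.sum_ite_eq', if_pos hv] at h3
  rw [mul_add, ← mul_assoc, inv_mul_cancel₀ hcard.ne', one_mul, mul_one] at h3
  have := inv_pos.2 hcard
  linarith

/-- At the barycentre of a free face, the feasible directions form a half space. -/
theorem exists_halfspace_of_free [TopologicalSpace E] [IsTopologicalAddGroup E]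
    [ContinuousSMul ℝ E] [T2Space E] {K : SimplicialComplex ℝ E} (hK : K.faces.Finite)
    {σ τ : Finset E} (hσ : σ ∈ K.faces) (hτ : τ ∈ K.faces) (hστ : σ ⊂ τ)
    (hfree : ∀ ρ ∈ K.faces, σ ⊂ ρ → ρ = τ) :
    ∃ x ∈ K.space, ∃ (d : E) (f : E →ₗ[ℝ] ℝ), f d = 1 ∧ Feasible K.space x d ∧
      (∀ e, Feasible K.space x e → 0 ≤ f e) ∧
      ∀ e₁ e₂, Feasible K.space x e₁ → Feasible K.space x e₂ → Feasible K.space x (e₁ + e₂) := by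
  have hσne := K.nonempty_of_mem_faces hσ
  have hcard : (0 : ℝ) < σ.card := by exact_mod_cast Finset.card_pos.2 hσne
  obtain ⟨q, hqτ, hqσ⟩ := Finset.exists_of_ssubset hστ
  obtain ⟨x, hx⟩ : ∃ x : E, x = (σ.card : ℝ)⁻¹ • ∑ v ∈ σ, v := ⟨_, rfl⟩
  have hxσ : x ∈ convexHull ℝ (σ : Set E) := by
    rw [hx, Finset.smul_sum]
    refine (convex_convexHull ℝ _).sum_mem (fun _ _ => by positivity) ?_
      (fun v hv => subset_convexHull ℝ _ hv)
    rw [Finset.sum_const, nsmul_eq_mul]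
    field_simp
  have hστ' : convexHull ℝ (σ : Set E) ⊆ convexHull ℝ (τ : Set E) :=
    convexHull_mono (by exact_mod_cast hστ.1)
  have hxτ := hστ' hxσ
  have hτK : convexHull ℝ (τ : Set E) ⊆ K.space := K.convexHull_subset_space hτ
  -- Close to `x` only faces containing `x` matter. These contain `σ`, so they are `σ` or `τ`, and
  -- locally the space is the simplex `τ`.
  have hlocal : ∀ e, Feasible K.space x e →
      ∀ᶠ t : ℝ in 𝓝[>] 0, x + t • e ∈ convexHull ℝ (τ : Set E) := by
    intro e he
    have h1 : ∀ s ∈ K.faces, x ∉ convexHull ℝ (s : Set E) →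
        ∀ᶠ t : ℝ in 𝓝[>] 0, x + t • e ∉ convexHull ℝ (s : Set E) := by
      intro s _ hxs
      have hcont : Tendsto (fun t : ℝ => x + t • e) (𝓝[>] 0) (𝓝 x) := by
        have : Continuous fun t : ℝ => x + t • e := by fun_prop
        have h := this.tendsto 0
        simp only [zero_smul, add_zero] at h
        exact h.mono_left nhdsWithin_le_nhds
      exact hcont.eventually ((s.finite_toSet.isClosed_convexHull ℝ).isOpen_compl.mem_nhds hxs)
    have h2 : ∀ᶠ t : ℝ in 𝓝[>] 0, ∀ s ∈ K.faces, x ∉ convexHull ℝ (s : Set E) →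
        x + t • e ∉ convexHull ℝ (s : Set E) := by
      rw [eventually_all_finite hK]
      intro s hs
      by_cases hxs : x ∈ convexHull ℝ (s : Set E)
      · exact Eventually.of_forall fun t h => absurd hxs h
      · filter_upwards [h1 s hs hxs] with t ht _ using ht
    filter_upwards [he, h2] with t ht ht'
    obtain ⟨s, hs, hts⟩ := SimplicialComplex.mem_space_iff.1 ht
    have hxs : x ∈ convexHull ℝ (s : Set E) := by
      by_contra h
      exact ht' s hs h hts
    rcases (subset_of_centroid_mem hσ hs hx hxσ hxs).eq_or_ssubset with rfl | h
    · exact hστ' hts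
    · rw [← hfree s hs h]; exact hts
  have hshrink : ∀ e (t₀ : ℝ), 0 < t₀ → x + t₀ • e ∈ convexHull ℝ (τ : Set E) →
      ∀ t : ℝ, 0 ≤ t → t ≤ t₀ → x + t • e ∈ convexHull ℝ (τ : Set E) := by
    intro e t₀ h0 h t ht htt
    have := (convex_convexHull ℝ (τ : Set E)).add_smul_mem hxτ h (t := t / t₀)
      ⟨by positivity, (div_le_one h0).2 htt⟩
    rwa [smul_smul, div_mul_cancel₀ _ h0.ne'] at this
  obtain ⟨f, c, hfq, hf⟩ := exists_barycentric_functional (K.indep hτ) hqτ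
  have hfx : f x = c :=
    eq_on_convexHull (fun p hp => hf p (hστ.1 hp) fun e => hqσ (e ▸ hp)) hxσ
  have hfτ : ∀ y ∈ convexHull ℝ (τ : Set E), c ≤ f y := by
    intro y hy
    refine le_on_convexHull (fun p hp => ?_) hy
    by_cases hpq : p = q
    · rw [hpq, hfq]; linarith
    · rw [hf p hp hpq]
  have hpos : ∀ᶠ t : ℝ in 𝓝[>] 0, 0 < t := eventually_mem_nhdsWithin
  refine ⟨x, hτK hxτ, q - x, f, by rw [map_sub, hfq, hfx]; ring, ?_, ?_, ?_⟩
  · have h1 : ∀ᶠ t : ℝ in 𝓝[>] 0, t ≤ 1 := nhdsWithin_le_nhds (Iic_mem_nhds one_pos)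
    filter_upwards [hpos, h1] with t ht ht1
    refine hτK (hshrink _ 1 one_pos ?_ t ht.le ht1)
    rw [one_smul, add_sub_cancel]
    exact subset_convexHull ℝ _ (by exact_mod_cast hqτ)
  · intro e he
    obtain ⟨t, ht, ht0⟩ := ((hlocal e he).and hpos).exists
    have := hfτ _ ht
    rw [map_add, map_smul, hfx, smul_eq_mul] at this
    by_contra hneg
    push Not at hneg
    nlinarith [mul_neg_of_pos_of_neg ht0 hneg]
  · intro e₁ e₂ h₁ h₂
    obtain ⟨t₁, ht₁, ht₁0⟩ := ((hlocal e₁ h₁).and hpos).exists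
    obtain ⟨t₂, ht₂, ht₂0⟩ := ((hlocal e₂ h₂).and hpos).exists
    have h3 : ∀ᶠ t : ℝ in 𝓝[>] 0, t ≤ t₁ / 2 := nhdsWithin_le_nhds (Iic_mem_nhds (by positivity))
    have h4 : ∀ᶠ t : ℝ in 𝓝[>] 0, t ≤ t₂ / 2 := nhdsWithin_le_nhds (Iic_mem_nhds (by positivity))
    filter_upwards [hpos, h3, h4] with t ht ht1 ht2
    -- The point `x + t • (e₁ + e₂)` is the midpoint of `x + 2t • e₁` and `x + 2t • e₂`.
    have a1 := hshrink _ t₁ ht₁0 ht₁ (2 * t) (by positivity) (by linarith)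
    have a2 := hshrink _ t₂ ht₂0 ht₂ (2 * t) (by positivity) (by linarith)
    have := (convex_convexHull ℝ (τ : Set E)) a1 a2 (a := 1 / 2) (b := 1 / 2) (by norm_num)
      (by norm_num) (by norm_num)
    refine hτK ?_
    convert this using 1
    module

end FreeFace

/-! ### A vector space topology on the space of the realization. -/

section FinsuppTopology

variable {V : Type*}

/-- The topology of pointwise convergence. -/
noncomputable instance instTopologicalSpaceFinsupp : TopologicalSpace (V →₀ ℝ) :=
  TopologicalSpace.induced (Finsupp.lcoeFun : (V →₀ ℝ) →ₗ[ℝ] V → ℝ) inferInstance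

instance : IsTopologicalAddGroup (V →₀ ℝ) :=
  topologicalAddGroup_induced (Finsupp.lcoeFun : (V →₀ ℝ) →ₗ[ℝ] V → ℝ)

instance : ContinuousSMul ℝ (V →₀ ℝ) :=
  continuousSMul_induced (Finsupp.lcoeFun : (V →₀ ℝ) →ₗ[ℝ] V → ℝ)

theorem continuous_coeFun : Continuous fun x : V →₀ ℝ => (x : V → ℝ) := continuous_induced_dom

theorem continuous_eval (v : V) : Continuous fun x : V →₀ ℝ => x v :=
  (continuous_apply v).comp continuous_coeFun

instance : T2Space (V →₀ ℝ) :=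
  T2Space.of_injective_continuous DFunLike.coe_injective continuous_coeFun

end FinsuppTopology

end PLCover

namespace PLCover

open Geometry Filter Topology

/-! ### Two-dimensional complexes without free faces. -/

section NotCollapsible

variable {V : Type*} [DecidableEq V]

theorem feasible_single_sub {A : PreAbstractSimplicialComplex V} {x : V →₀ ℝ} {v : V}
    {F : Finset V} (hF : insert v F ∈ A.faces) (hx : x ∈ hull F) :
    Feasible (SimplicialComplex.onFinsupp (𝕜 := ℝ) A).space x (Finsupp.single v 1 - x) := by
  have h1 : ∀ᶠ t : ℝ in 𝓝[>] 0, t ≤ 1 := nhdsWithin_le_nhds (Iic_mem_nhds one_pos)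
  filter_upwards [eventually_mem_nhdsWithin, h1] with t ht ht1
  rw [mem_onFinsupp_space]
  refine ⟨_, hF, ?_⟩
  exact (convex_convexHull ℝ _).add_smul_sub_mem (hull_mono (Finset.subset_insert _ _) hx)
    (single_mem_hull (Finset.mem_insert_self _ _)) ⟨le_of_lt ht, ht1⟩

theorem eventually_pos {x e : V →₀ ℝ} {v : V} (h : 0 < x v ∨ (x v = 0 ∧ 0 < e v)) :
    ∀ᶠ t : ℝ in 𝓝[>] 0, 0 < (x + t • e) v := by
  rcases h with h | ⟨h, h'⟩
  · have hc : Continuous fun t : ℝ => x v + t * e v := by fun_prop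
    have h2 : ∀ᶠ t : ℝ in 𝓝[>] 0, 0 < x v + t * e v :=
      nhdsWithin_le_nhds (hc.continuousAt.eventually (by simpa using lt_mem_nhds h))
    simpa using h2
  · filter_upwards [eventually_mem_nhdsWithin] with t ht
    have ht : 0 < t := ht
    simp only [Finsupp.add_apply, h, Finsupp.smul_apply, smul_eq_mul, zero_add]
    positivity

/-- A two-dimensional complex without free faces is not collapsible, for any triangulation. -/
theorem not_plCollapsible {A : PreAbstractSimplicialComplex V} (hne : A.faces.Nonempty)
    (hcard : ∀ F ∈ A.faces, F.card ≤ 3)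
    (hext : ∀ F ∈ A.faces, F.card ≤ 2 → ∃ G : Finset V, Disjoint F G ∧ 4 ≤ F.card + G.card ∧
      ∀ v ∈ G, insert v F ∈ A.faces) :
    ¬ PLCollapsible (SimplicialComplex.onFinsupp (𝕜 := ℝ) A).space := by
  rintro ⟨K, ⟨-, hsp⟩, hfin, v₀, L, hL, hc⟩
  have hcarrier : ∀ {x : V →₀ ℝ}, x ∈ (SimplicialComplex.onFinsupp (𝕜 := ℝ) A).space →
      x.support ∈ A.faces ∧ x ∈ hull x.support := by
    intro x hx
    obtain ⟨F, hF, hxF⟩ := (mem_onFinsupp_space A).1 hx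
    obtain ⟨h1, h2, h3⟩ := mem_hull_iff.1 hxF
    have hx' : x ∈ hull x.support := mem_hull_iff.2 ⟨h1, subset_rfl, h3⟩
    exact ⟨(A.isRelLowerSet_faces hF).2 h2 (hull_nonempty hx'), hx'⟩
  rcases Relation.ReflTransGen.cases_head hc with rfl | ⟨K', hKK', -⟩
  · have hspace : K.space = {v₀} := by simp [SimplicialComplex.space, hL]
    obtain ⟨F, hF⟩ := hne
    obtain ⟨v, hv⟩ := (A.isRelLowerSet_faces hF).1
    have hv1 : {v} ∈ A.faces := (A.isRelLowerSet_faces hF).2 (by simpa using hv) (by simp)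
    obtain ⟨G, h1, h2, h3⟩ := hext {v} hv1 (by simp)
    obtain ⟨w, hw⟩ : G.Nonempty := by
      rw [← Finset.card_pos]; simp at h2; omega
    have hvw : v ≠ w := by
      rintro rfl
      exact Finset.disjoint_left.1 h1 (by simp) hw
    have hmem : ∀ u ∈ ({w, v} : Finset V), Finsupp.single u (1 : ℝ) = v₀ := by
      intro u hu
      have : Finsupp.single u (1 : ℝ) ∈ K.space := by
        rw [hsp, mem_onFinsupp_space]
        exact ⟨_, h3 w hw, single_mem_hull hu⟩
      rwa [hspace] at this
    exact single_ne hvw ((hmem v (by simp)).trans (hmem w (by simp)).symm)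
  · obtain ⟨σ, hσ, τ, hτ, hστ, hfree, -⟩ := hKK'
    obtain ⟨x, hx, d, f, hfd, hd, hf, hadd⟩ := exists_halfspace_of_free hfin hσ hτ hστ hfree
    rw [hsp] at hx hd hf hadd
    obtain ⟨hF, hxF⟩ := hcarrier hx
    set F := x.support with hFdef
    have hxpos : ∀ v ∈ F, 0 < x v := fun v hv =>
      lt_of_le_of_ne ((mem_hull_iff.1 hxF).1 v) (Ne.symm (Finsupp.mem_support_iff.1 hv))
    have hx0 : ∀ v ∉ F, x v = 0 := fun v hv => by simpa [hFdef] using hv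
    rcases Nat.lt_or_ge F.card 3 with h3 | h3
    -- If the carrier of `x` has dimension at most one, moving towards each vertex of `G` is
    -- feasible, hence so is the sum of these directions. But this sum leads to points with at least
    -- four positive coordinates.
    · obtain ⟨G, hFG, hcardG, hG⟩ := hext F hF (by omega)
      have hsum : Feasible (SimplicialComplex.onFinsupp (𝕜 := ℝ) A).space x
          (∑ v ∈ G, (Finsupp.single v 1 - x)) := by
        have hall : ∀ G' ⊆ G, Feasible (SimplicialComplex.onFinsupp (𝕜 := ℝ) A).space x
            (∑ v ∈ G', (Finsupp.single v 1 - x)) := by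
          intro G'
          induction G' using Finset.induction_on with
          | empty => intro _; exact Eventually.of_forall fun t => by simpa using hx
          | insert v G' hv ih =>
            intro hsub
            rw [Finset.sum_insert hv]
            exact hadd _ _ (feasible_single_sub (hG v (hsub (by simp))) hxF)
              (ih ((Finset.subset_insert _ _).trans hsub))
        exact hall G subset_rfl
      have hpos : ∀ᶠ t : ℝ in 𝓝[>] 0, ∀ v ∈ F ∪ G,
          0 < (x + t • ∑ v ∈ G, (Finsupp.single v 1 - x)) v := by
        rw [eventually_all_finset]
        intro v hv
        apply eventually_pos
        rcases Finset.mem_union.1 hv with hv | hv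
        · exact Or.inl (hxpos v hv)
        · right
          have h0 := hx0 v (fun h => Finset.disjoint_left.1 hFG h hv)
          refine ⟨h0, ?_⟩
          rw [Finset.sum_sub_distrib, Finsupp.sub_apply, Finsupp.finsetSum_apply,
            Finsupp.finsetSum_apply]
          simp [h0, Finsupp.single_apply, hv]
      obtain ⟨t, ht, ht'⟩ := (hsum.and hpos).exists
      have h4 := hcard _ (hcarrier ht).1
      have h5 : F ∪ G ⊆ (x + t • ∑ v ∈ G, (Finsupp.single v 1 - x)).support := fun v hv =>
        Finsupp.mem_support_iff.2 (ht' v hv).ne'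
      have h6 := Finset.card_le_card h5
      rw [Finset.card_union_of_disjoint hFG] at h6
      omega
    · have hF3 : F.card = 3 := le_antisymm (hcard F hF) h3
      -- If the carrier is a triangle, a direction towards a vertex and its opposite are both
      -- feasible, so `f` is constant on the triangle. This contradicts `f d = 1` for the feasible
      -- direction `d`.
      have hconst : ∀ v ∈ F, f (Finsupp.single v 1) = f x := by
        intro v hv
        have h1 := hf _ (feasible_single_sub (v := v) (by rwa [Finset.insert_eq_of_mem hv]) hxF)
        have h2 : Feasible (SimplicialComplex.onFinsupp (𝕜 := ℝ) A).space x
            (x - Finsupp.single v 1) := by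
          have hle : ∀ᶠ t : ℝ in 𝓝[>] 0, t ≤ x v := nhdsWithin_le_nhds (Iic_mem_nhds (hxpos v hv))
          filter_upwards [eventually_mem_nhdsWithin, hle] with t ht htv
          have ht : 0 < t := ht
          rw [mem_onFinsupp_space]
          refine ⟨F, hF, mem_hull_iff.2 ⟨fun w => ?_, fun w hw => ?_, ?_⟩⟩
          · have hw := (mem_hull_iff.1 hxF).1 w
            simp only [Finsupp.add_apply, Finsupp.smul_apply, Finsupp.sub_apply, smul_eq_mul,
              Finsupp.single_apply]
            split_ifs with h
            · subst h; nlinarith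
            · nlinarith [mul_nonneg ht.le hw]
          · by_contra hwF
            have hvw : v ≠ w := fun h => hwF (h ▸ hv)
            simp [hx0 w hwF, hvw] at hw
          · have e : x + t • (x - Finsupp.single v 1) = (1 + t) • x + (-t) • Finsupp.single v 1 := by
              module
            rw [e, Finsupp.sum_add_index' (by simp) (by simp), Finsupp.sum_smul_index (by simp),
              ← Finsupp.mul_sum, (mem_hull_iff.1 hxF).2.2, Finsupp.smul_single,
              Finsupp.sum_single_index rfl]
            simp
        have h2 := hf _ h2
        rw [map_sub] at h1 h2
        linarith
      have hpos : ∀ᶠ t : ℝ in 𝓝[>] 0, ∀ v ∈ F, 0 < (x + t • d) v := by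
        rw [eventually_all_finset]
        exact fun v hv => eventually_pos (Or.inl (hxpos v hv))
      obtain ⟨t, ⟨ht, ht'⟩, ht0⟩ := ((hd.and hpos).and
        (eventually_mem_nhdsWithin (a := (0 : ℝ)) (s := Set.Ioi 0))).exists
      have ht0 : 0 < t := ht0
      obtain ⟨h4, h5⟩ := hcarrier ht
      have h6 : F ⊆ (x + t • d).support := fun v hv => Finsupp.mem_support_iff.2 (ht' v hv).ne'
      have h7 := Finset.eq_of_subset_of_card_le h6 (by rw [hF3]; exact hcard _ h4)
      rw [← h7] at h5
      have h8 : f (x + t • d) = f x := by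
        refine eq_on_convexHull (s := ((F.image fun v => Finsupp.single v (1 : ℝ) :
          Finset (V →₀ ℝ)) : Set (V →₀ ℝ))) ?_ h5
        intro p hp
        simp only [Finset.coe_image, Set.mem_image, Finset.mem_coe] at hp
        obtain ⟨v, hv, rfl⟩ := hp
        exact hconst v hv
      rw [map_add, map_smul, hfd, smul_eq_mul, mul_one] at h8
      linarith

end NotCollapsible

end PLCover

namespace PLCover

open Geometry

/-! ### Without an algebraic collapse the presentation complex has no free face. -/

section NoFreeFace

variable {k : ℕ} {r : List (Fin k × Bool)}

theorem exists_slot (hr : ∀ x : Fin k, ∃ b : Bool, (x, b) ∈ r) (x : Fin k) :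
    ∃ (j : ℕ) (hj : j < r.length), (r[j]).1 = x := by
  obtain ⟨b, hb⟩ := hr x
  obtain ⟨j, hj, h⟩ := List.getElem_of_mem hb
  exact ⟨j, hj, by rw [h]⟩

theorem exists_other_slot (h : ¬ AdmitsAlgebraicCollapse r) {j : ℕ} (hj : j < r.length) :
    ∃ (j' : ℕ) (hj' : j' < r.length), j' ≠ j ∧ (r[j']).1 = (r[j]).1 := by
  have h1 : (r.map Prod.fst).count (r[j]).1 ≠ 1 := fun h' => h ⟨_, h'⟩
  have h2 : 0 < (r.map Prod.fst).count (r[j]).1 :=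
    List.count_pos_iff.2 (List.mem_map_of_mem (List.getElem_mem hj))
  obtain ⟨m, n, hmn, hm, hn⟩ := List.duplicate_iff_exists_distinct_get.1
    (List.duplicate_iff_two_le_count.2 (show 2 ≤ (r.map Prod.fst).count (r[j]).1 by omega))
  have hm' : (m : ℕ) < r.length := by simpa using m.2
  have hn' : (n : ℕ) < r.length := by simpa using n.2
  by_cases hmj : (m : ℕ) = j
  · refine ⟨n, hn', ?_, by simpa using hn.symm⟩
    have : (m : ℕ) < n := hmn
    omega
  · exact ⟨m, hm', hmj, by simpa using hm.symm⟩

theorem cyc_three_mul {j : ℕ} (hj : j ≤ r.length) :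
    cyc r ((3 * j : ℕ) : ZMod (3 * r.length)) = .base := by
  rw [cyc_natCast r _ (by omega), wordVertex_zero]

theorem cyc_three_mul_add_one {j : ℕ} (hj : j < r.length) :
    cyc r ((3 * j + 1 : ℕ) : ZMod (3 * r.length)) = fst _ r[j] := by
  rw [cyc_natCast r _ (by omega), wordVertex_one _ _ hj]

theorem cyc_three_mul_add_two {j : ℕ} (hj : j < r.length) :
    cyc r ((3 * j + 2 : ℕ) : ZMod (3 * r.length)) = snd _ r[j] := by
  rw [cyc_natCast r _ (by omega), wordVertex_two _ _ hj]

theorem fst_eq_or {l l' : Fin k × Bool} (n : ℕ) (h : l'.1 = l.1) :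
    (fst n l' = fst n l ∧ snd n l' = snd n l) ∨ (fst n l' = snd n l ∧ snd n l' = fst n l) := by
  obtain ⟨x, b⟩ := l
  obtain ⟨x', b'⟩ := l'
  obtain rfl : x' = x := h
  cases b <;> cases b' <;> simp [fst, snd]

/-- A second occurrence of the same generator traverses the same edge of the wedge, possibly
backwards. -/
theorem exists_other_edge (hn : 0 < r.length) (h : ¬ AdmitsAlgebraicCollapse r)
    (i : ZMod (3 * r.length)) :
    ∃ i', i' ≠ i ∧ ({cyc r i', cyc r (i' + 1)} : Finset (PresVertex k (3 * r.length))) =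
      {cyc r i, cyc r (i + 1)} := by
  have : NeZero (3 * r.length) := ⟨by omega⟩
  have hne : ∀ a b : ℕ, a < 3 * r.length → b < 3 * r.length → a ≠ b →
      ((a : ℕ) : ZMod (3 * r.length)) ≠ b := by
    intro a b ha hb hab h'
    have := congrArg ZMod.val h'
    rw [ZMod.val_natCast_of_lt ha, ZMod.val_natCast_of_lt hb] at this
    exact hab this
  obtain ⟨j, hj, hi⟩ := cyc_cases hn i
  obtain ⟨j', hj', hjj, hx⟩ := exists_other_slot h hj
  have e0 := cyc_three_mul hj'.le
  have e1 := cyc_three_mul_add_one hj'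
  have e2 := cyc_three_mul_add_two hj'
  have e3 := cyc_three_mul (r := r) (j := j' + 1) hj'
  have s0 : ((3 * j' : ℕ) : ZMod (3 * r.length)) + 1 = ((3 * j' + 1 : ℕ) : ZMod (3 * r.length)) := by
    push_cast; ring
  have s1 : ((3 * j' + 1 : ℕ) : ZMod (3 * r.length)) + 1 =
      ((3 * j' + 2 : ℕ) : ZMod (3 * r.length)) := by push_cast; ring
  have s2 : ((3 * j' + 2 : ℕ) : ZMod (3 * r.length)) + 1 =
      ((3 * (j' + 1) : ℕ) : ZMod (3 * r.length)) := by push_cast; ring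
  rcases hi with ⟨hi, h1, h2⟩ | ⟨hi, h1, h2⟩ | ⟨hi, h1, h2⟩ <;>
    rcases fst_eq_or (3 * r.length) hx with ⟨hf, hs⟩ | ⟨hf, hs⟩ <;> rw [h1, h2, hi]
  · exact ⟨_, hne (3 * j') _ (by omega) (by omega) (by omega), by rw [s0, e0, e1, hf]⟩
  · exact ⟨_, hne (3 * j' + 2) _ (by omega) (by omega) (by omega),
      by rw [s2, e2, e3, hs, Finset.pair_comm]⟩
  · exact ⟨_, hne (3 * j' + 1) _ (by omega) (by omega) (by omega), by rw [s1, e1, e2, hf, hs]⟩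
  · exact ⟨_, hne (3 * j' + 1) _ (by omega) (by omega) (by omega),
      by rw [s1, e1, e2, hf, hs, Finset.pair_comm]⟩
  · exact ⟨_, hne (3 * j' + 2) _ (by omega) (by omega) (by omega), by rw [s2, e2, e3, hs]⟩
  · exact ⟨_, hne (3 * j') _ (by omega) (by omega) (by omega),
      by rw [s0, e0, e1, hf, Finset.pair_comm]⟩

/-- Since every generator occurs in `r`, every edge of the wedge lies on the boundary of the 2-cell.
-/
theorem exists_triangle_of_mem (hr : ∀ x : Fin k, ∃ b : Bool, (x, b) ∈ r)
    {F : Finset (PresVertex k (3 * r.length))} (hF : F ∈ (presentationComplex r).faces) :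
    ∃ t ∈ cellTriangles r, F ⊆ t := by
  rw [presentationComplex_faces] at hF
  obtain ⟨-, t, ⟨x, ht⟩ | ht, hFt⟩ := hF
  · obtain ⟨j, hj, rfl⟩ := exists_slot hr x
    have e0 := cyc_three_mul hj.le
    have e1 := cyc_three_mul_add_one hj
    have e2 := cyc_three_mul_add_two hj
    have e3 := cyc_three_mul (r := r) (j := j + 1) hj
    have s0 : ((3 * j : ℕ) : ZMod (3 * r.length)) + 1 =
        ((3 * j + 1 : ℕ) : ZMod (3 * r.length)) := by push_cast; ring
    have s1 : ((3 * j + 1 : ℕ) : ZMod (3 * r.length)) + 1 =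
        ((3 * j + 2 : ℕ) : ZMod (3 * r.length)) := by push_cast; ring
    have s2 : ((3 * j + 2 : ℕ) : ZMod (3 * r.length)) + 1 =
        ((3 * (j + 1) : ℕ) : ZMod (3 * r.length)) := by push_cast; ring
    have t0 : ({.base, fst _ r[j]} : Finset (PresVertex k (3 * r.length))) ⊆
        {cyc r ((3 * j : ℕ) : ZMod (3 * r.length)), cyc r (((3 * j : ℕ) : ZMod (3 * r.length)) + 1),
          .collar ((3 * j : ℕ) : ZMod (3 * r.length))} := by
      rw [s0, e0, e1]; simp [Finset.insert_subset_iff]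
    have t1 : ({fst _ r[j], snd _ r[j]} : Finset (PresVertex k (3 * r.length))) ⊆
        {cyc r ((3 * j + 1 : ℕ) : ZMod (3 * r.length)),
          cyc r (((3 * j + 1 : ℕ) : ZMod (3 * r.length)) + 1),
          .collar ((3 * j + 1 : ℕ) : ZMod (3 * r.length))} := by
      rw [s1, e1, e2]; simp [Finset.insert_subset_iff]
    have t2 : ({snd _ r[j], .base} : Finset (PresVertex k (3 * r.length))) ⊆
        {cyc r ((3 * j + 2 : ℕ) : ZMod (3 * r.length)),
          cyc r (((3 * j + 2 : ℕ) : ZMod (3 * r.length)) + 1),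
          .collar ((3 * j + 2 : ℕ) : ZMod (3 * r.length))} := by
      rw [s2, e2, e3]; simp [Finset.insert_subset_iff]
    have hb : (r[j]).2 = true ∨ (r[j]).2 = false := by cases (r[j]).2 <;> simp
    rcases hb with hb | hb <;> simp only [fst, snd, hb, if_true, Bool.false_eq_true, if_false] at t0 t1 t2
    · rcases ht with rfl | rfl | rfl
      · exact ⟨_, ⟨_, Or.inl rfl⟩, hFt.trans t0⟩
      · exact ⟨_, ⟨_, Or.inl rfl⟩, hFt.trans t1⟩
      · exact ⟨_, ⟨_, Or.inl rfl⟩, hFt.trans t2⟩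
    · rcases ht with rfl | rfl | rfl
      · rw [Finset.pair_comm] at t2
        exact ⟨_, ⟨_, Or.inl rfl⟩, hFt.trans t2⟩
      · rw [Finset.pair_comm] at t1
        exact ⟨_, ⟨_, Or.inl rfl⟩, hFt.trans t1⟩
      · rw [Finset.pair_comm] at t0
        exact ⟨_, ⟨_, Or.inl rfl⟩, hFt.trans t0⟩
  · exact ⟨t, ht, hFt⟩

theorem exists_extension_vertex {V : Type*} [DecidableEq V] {A : PreAbstractSimplicialComplex V}
    {a b c d : V} (hab : a ≠ b) (hac : a ≠ c) (had : a ≠ d) (hbc : b ≠ c) (hbd : b ≠ d)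
    (hcd : c ≠ d) (h1 : {b, a} ∈ A.faces) (h2 : {c, a} ∈ A.faces) (h3 : {d, a} ∈ A.faces) :
    ∃ G : Finset V, Disjoint {a} G ∧ 4 ≤ ({a} : Finset V).card + G.card ∧
      ∀ v ∈ G, insert v {a} ∈ A.faces := by
  refine ⟨{b, c, d}, by simp [hab, hac, had], ?_, by simp [h1, h2, h3]⟩
  rw [Finset.card_eq_three.2 ⟨b, c, d, hbc, hbd, hcd, rfl⟩]
  simp

theorem exists_extension_edge {V : Type*} [DecidableEq V] {A : PreAbstractSimplicialComplex V}
    {a b c d : V} (hab : a ≠ b) (hac : a ≠ c) (had : a ≠ d) (hbc : b ≠ c) (hbd : b ≠ d)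
    (hcd : c ≠ d) (h1 : {c, a, b} ∈ A.faces) (h2 : {d, a, b} ∈ A.faces) :
    ∃ G : Finset V, Disjoint {a, b} G ∧ 4 ≤ ({a, b} : Finset V).card + G.card ∧
      ∀ v ∈ G, insert v {a, b} ∈ A.faces := by
  refine ⟨{c, d}, by simp [hac.symm, had.symm, hbc.symm, hbd.symm], ?_, by simp [h1, h2]⟩
  rw [Finset.card_pair hab, Finset.card_pair hcd]

/-- Every vertex has three neighbours and every edge lies in two triangles. Only for edges of the
wedge is the absence of an algebraic collapse needed. -/
theorem not_plCollapsible_presentation (hk : 0 < k) (hr : ∀ x : Fin k, ∃ b : Bool, (x, b) ∈ r)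
    (h : ¬ AdmitsAlgebraicCollapse r) : ¬ PLCollapsible (presentationPolyhedron r) := by
  obtain ⟨b₀, hb₀⟩ := hr ⟨0, hk⟩
  have hn : 0 < r.length := List.length_pos_of_mem hb₀
  have hface : ∀ (t : Finset (PresVertex k (3 * r.length))), t ∈ cellTriangles r →
      ∀ F ⊆ t, F.Nonempty → F ∈ (presentationComplex r).faces := by
    intro t ht F hF hFn
    rw [presentationComplex_faces]
    exact ⟨hFn, t, Or.inr ht, hF⟩
  have T1 : ∀ i, ∀ F ⊆ ({cyc r i, cyc r (i + 1), .collar i} : Finset _), F.Nonempty →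
      F ∈ (presentationComplex r).faces := fun i => hface _ ⟨i, Or.inl rfl⟩
  have T2 : ∀ i, ∀ F ⊆ ({cyc r (i + 1), .collar i, .collar (i + 1)} : Finset _), F.Nonempty →
      F ∈ (presentationComplex r).faces := fun i => hface _ ⟨i, Or.inr (Or.inl rfl)⟩
  have T3 : ∀ i, ∀ F ⊆ ({.collar i, .collar (i + 1), .centre} : Finset _), F.Nonempty →
      F ∈ (presentationComplex r).faces := fun i => hface _ ⟨i, Or.inr (Or.inr rfl)⟩
  have hone : (1 : ZMod (3 * r.length)) ≠ 0 := by
    have := ZMod.val_natCast_of_lt (n := 3 * r.length) (a := 1) (by omega)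
    intro h
    rw [Nat.cast_one, h, ZMod.val_zero] at this
    omega
  have htwo : (1 + 1 : ZMod (3 * r.length)) ≠ 0 := by
    have := ZMod.val_natCast_of_lt (n := 3 * r.length) (a := 2) (by omega)
    intro h
    rw [show ((2 : ℕ) : ZMod (3 * r.length)) = 1 + 1 by push_cast; ring, h, ZMod.val_zero] at this
    omega
  have hc : ∀ i : ZMod (3 * r.length),
      (PresVertex.collar i : PresVertex k (3 * r.length)) ≠ .collar (i + 1) := by
    intro i h
    simp only [PresVertex.collar.injEq, left_eq_add] at h
    exact hone h
  have hc2 : ∀ i : ZMod (3 * r.length),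
      (PresVertex.collar i : PresVertex k (3 * r.length)) ≠ .collar (i + 1 + 1) := by
    intro i h
    rw [PresVertex.collar.injEq, add_assoc, left_eq_add] at h
    exact htwo h
  have hwc := cyc_ne_collar r
  have hwz := cyc_ne_centre r
  have hww := cyc_ne hn
  -- the links of the vertices and edges
  have vW : ∀ i, ∃ G : Finset (PresVertex k (3 * r.length)), Disjoint {cyc r i} G ∧
      4 ≤ ({cyc r i} : Finset (PresVertex k (3 * r.length))).card + G.card ∧
      ∀ v ∈ G, insert v {cyc r i} ∈ (presentationComplex r).faces := by
    intro i
    obtain ⟨j, rfl⟩ : ∃ j, i = j + 1 := ⟨i - 1, by ring⟩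
    exact exists_extension_vertex (b := cyc r (j + 1 + 1)) (c := .collar j) (d := .collar (j + 1))
      (hww _) (hwc _ _) (hwc _ _) (hwc _ _) (hwc _ _) (hc j)
      (T1 (j + 1) _ (by simp [Finset.insert_subset_iff]) (by simp))
      (T1 j _ (by simp [Finset.insert_subset_iff]) (by simp))
      (T1 (j + 1) _ (by simp [Finset.insert_subset_iff]) (by simp))
  have vC : ∀ i, ∃ G : Finset (PresVertex k (3 * r.length)), Disjoint {.collar i} G ∧
      4 ≤ ({.collar i} : Finset (PresVertex k (3 * r.length))).card + G.card ∧
      ∀ v ∈ G, insert v {.collar i} ∈ (presentationComplex r).faces := by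
    intro i
    obtain ⟨j, rfl⟩ : ∃ j, i = j + 1 := ⟨i - 1, by ring⟩
    exact exists_extension_vertex (b := .collar j) (c := .collar (j + 1 + 1)) (d := .centre)
      (hc j).symm (hc _) (by simp) (hc2 j) (by simp) (by simp)
      (T3 j _ (by simp [Finset.insert_subset_iff]) (by simp))
      (T3 (j + 1) _ (by simp [Finset.insert_subset_iff]) (by simp))
      (T3 j _ (by simp [Finset.insert_subset_iff]) (by simp))
  have vZ : ∃ G : Finset (PresVertex k (3 * r.length)), Disjoint {.centre} G ∧
      4 ≤ ({.centre} : Finset (PresVertex k (3 * r.length))).card + G.card ∧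
      ∀ v ∈ G, insert v {.centre} ∈ (presentationComplex r).faces :=
    exists_extension_vertex (b := .collar 0) (c := .collar (0 + 1)) (d := .collar (0 + 1 + 1))
      (by simp) (by simp) (by simp) (hc 0) (hc2 0) (hc _)
      (T3 0 _ (by simp [Finset.insert_subset_iff]) (by simp))
      (T3 0 _ (by simp [Finset.insert_subset_iff]) (by simp))
      (T3 (0 + 1) _ (by simp [Finset.insert_subset_iff]) (by simp))
  have eWW : ∀ i, ∃ G : Finset (PresVertex k (3 * r.length)), Disjoint {cyc r i, cyc r (i + 1)} G ∧
      4 ≤ ({cyc r i, cyc r (i + 1)} : Finset (PresVertex k (3 * r.length))).card + G.card ∧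
      ∀ v ∈ G, insert v {cyc r i, cyc r (i + 1)} ∈ (presentationComplex r).faces := by
    intro i
    obtain ⟨i', hi, he⟩ := exists_other_edge hn h i
    refine exists_extension_edge (c := .collar i) (d := .collar i') (hww i) (hwc _ _) (hwc _ _)
      (hwc _ _) (hwc _ _) (by simpa using hi.symm)
      (T1 i _ (by simp [Finset.insert_subset_iff]) (by simp)) ?_
    rw [← he]
    exact T1 i' _ (by simp [Finset.insert_subset_iff]) (by simp)
  have eWC : ∀ i, ∃ G : Finset (PresVertex k (3 * r.length)), Disjoint {cyc r i, .collar i} G ∧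
      4 ≤ ({cyc r i, .collar i} : Finset (PresVertex k (3 * r.length))).card + G.card ∧
      ∀ v ∈ G, insert v {cyc r i, .collar i} ∈ (presentationComplex r).faces := by
    intro i
    obtain ⟨j, rfl⟩ : ∃ j, i = j + 1 := ⟨i - 1, by ring⟩
    exact exists_extension_edge (c := cyc r (j + 1 + 1)) (d := .collar j) (hwc _ _) (hww _) (hwc _ _)
      (hwc _ _).symm (hc j).symm (hwc _ _)
      (T1 (j + 1) _ (by simp [Finset.insert_subset_iff]) (by simp))
      (T2 j _ (by simp [Finset.insert_subset_iff]) (by simp))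
  have eWC' : ∀ i, ∃ G : Finset (PresVertex k (3 * r.length)), Disjoint {cyc r (i + 1), .collar i} G ∧
      4 ≤ ({cyc r (i + 1), .collar i} : Finset (PresVertex k (3 * r.length))).card + G.card ∧
      ∀ v ∈ G, insert v {cyc r (i + 1), .collar i} ∈ (presentationComplex r).faces := by
    intro i
    exact exists_extension_edge (c := cyc r i) (d := .collar (i + 1)) (hwc _ _) (hww _).symm
      (hwc _ _) (hwc _ _).symm (hc i) (hwc _ _)
      (T1 i _ (by simp [Finset.insert_subset_iff]) (by simp))
      (T2 i _ (by simp [Finset.insert_subset_iff]) (by simp))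
  have eCC : ∀ i, ∃ G : Finset (PresVertex k (3 * r.length)), Disjoint {.collar i, .collar (i + 1)} G ∧
      4 ≤ ({.collar i, .collar (i + 1)} : Finset (PresVertex k (3 * r.length))).card + G.card ∧
      ∀ v ∈ G, insert v {.collar i, .collar (i + 1)} ∈ (presentationComplex r).faces := by
    intro i
    exact exists_extension_edge (c := cyc r (i + 1)) (d := .centre) (hc i) (hwc _ _).symm (by simp)
      (hwc _ _).symm (by simp) (hwz _)
      (T2 i _ (by simp [Finset.insert_subset_iff]) (by simp))
      (T3 i _ (by simp [Finset.insert_subset_iff]) (by simp))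
  have eCZ : ∀ i, ∃ G : Finset (PresVertex k (3 * r.length)), Disjoint {.collar i, .centre} G ∧
      4 ≤ ({.collar i, .centre} : Finset (PresVertex k (3 * r.length))).card + G.card ∧
      ∀ v ∈ G, insert v {.collar i, .centre} ∈ (presentationComplex r).faces := by
    intro i
    obtain ⟨j, rfl⟩ : ∃ j, i = j + 1 := ⟨i - 1, by ring⟩
    exact exists_extension_edge (c := .collar j) (d := .collar (j + 1 + 1)) (by simp) (hc j).symm
      (hc _) (by simp) (by simp) (hc2 j)
      (T3 j _ (by simp [Finset.insert_subset_iff]) (by simp))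
      (T3 (j + 1) _ (by simp [Finset.insert_subset_iff]) (by simp))
  refine not_plCollapsible ⟨_, T1 0 {cyc r 0} (by simp) (by simp)⟩ ?_ ?_
  · intro F hF
    obtain ⟨t, ⟨i, rfl | rfl | rfl⟩, hFt⟩ := exists_triangle_of_mem hr hF
    all_goals exact (Finset.card_le_card hFt).trans Finset.card_le_three
  · intro F hF hF2
    obtain ⟨t, ⟨i, rfl | rfl | rfl⟩, hFt⟩ := exists_triangle_of_mem hr hF
    · rcases subset_triple_cases hFt ((presentationComplex r).isRelLowerSet_faces hF).1 with
        rfl | rfl | rfl | rfl | rfl | rfl | rfl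
      · exact vW i
      · exact vW _
      · exact vC i
      · exact eWW i
      · exact eWC' i
      · exact eWC i
      · rw [Finset.card_eq_three.2 ⟨_, _, _, hww i, hwc _ _, hwc _ _, rfl⟩] at hF2; omega
    · rcases subset_triple_cases hFt ((presentationComplex r).isRelLowerSet_faces hF).1 with
        rfl | rfl | rfl | rfl | rfl | rfl | rfl
      · exact vW _
      · exact vC i
      · exact vC _
      · exact eWC' i
      · exact eCC i
      · exact eWC _
      · rw [Finset.card_eq_three.2 ⟨_, _, _, hwc _ _, hwc _ _, hc i, rfl⟩] at hF2; omega
    · rcases subset_triple_cases hFt ((presentationComplex r).isRelLowerSet_faces hF).1 with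
        rfl | rfl | rfl | rfl | rfl | rfl | rfl
      · exact vC i
      · exact vC _
      · exact vZ
      · exact eCC i
      · exact eCZ _
      · exact eCZ i
      · rw [Finset.card_eq_three.2 ⟨_, _, _, hc i, by simp, by simp, rfl⟩] at hF2; omega

end NoFreeFace

end PLCover

namespace PLCover

/-! ### Polar coordinates on the disc and continuous functions defined by sectors. -/

section Polar

/-- On a compact set a continuous map to a Hausdorff space is a quotient map onto its image. -/
theorem exists_factor {X Y Z : Type*} [TopologicalSpace X] [TopologicalSpace Y] [TopologicalSpace Z]
    [T2Space Y] [Nonempty Z] {R : Set X} (hR : IsCompact R) {p : X → Y} (hp : ContinuousOn p R)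
    {f : X → Z} (hf : ContinuousOn f R) (h : ∀ q ∈ R, ∀ q' ∈ R, p q = p q' → f q = f q') :
    ∃ g : Y → Z, ContinuousOn g (p '' R) ∧ ∀ q ∈ R, g (p q) = f q := by
  classical
  let g : Y → Z := fun y => if h : ∃ q ∈ R, p q = y then f h.choose else Classical.arbitrary Z
  have hg : ∀ q ∈ R, g (p q) = f q := by
    intro q hq
    have h' : ∃ q' ∈ R, p q' = p q := ⟨q, hq, rfl⟩
    simp only [g]
    rw [dif_pos h']
    exact h _ h'.choose_spec.1 _ hq h'.choose_spec.2
  refine ⟨g, ?_, hg⟩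
  let p' : R → p '' R := fun q => ⟨p q, q, q.2, rfl⟩
  have hp' : Continuous p' := Continuous.subtype_mk hp.domRestrict _
  have hs : Function.Surjective p' := by
    rintro ⟨_, q, hq, rfl⟩
    exact ⟨⟨q, hq⟩, rfl⟩
  have : CompactSpace R := isCompact_iff_compactSpace.1 hR
  have hq := hp'.isClosedMap.isQuotientMap hp' hs
  rw [continuousOn_iff_continuous_domRestrict, hq.continuous_iff]
  exact hf.domRestrict.congr fun q => (hg q q.2).symm

theorem unitExp_eq_iff {t t' : ℝ} : unitExp t = unitExp t' ↔ ∃ m : ℤ, t = t' + m := by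
  unfold unitExp
  rw [Complex.exp_eq_exp_iff_exists_int]
  have h2 : (2 * Real.pi * Complex.I : ℂ) ≠ 0 := Complex.two_pi_I_ne_zero
  refine exists_congr fun m => ?_
  rw [show (2 * Real.pi * Complex.I * t' + m * (2 * Real.pi * Complex.I) : ℂ) =
    2 * Real.pi * Complex.I * (t' + m) by ring, mul_right_inj' h2]
  exact_mod_cast Iff.rfl

theorem norm_unitExp (t : ℝ) : ‖unitExp t‖ = 1 := by
  unfold unitExp
  rw [show (2 * Real.pi * Complex.I * t : ℂ) = ((2 * Real.pi * t : ℝ) : ℂ) * Complex.I by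
    push_cast; ring, Complex.norm_exp_ofReal_mul_I]

/-- Points of the unit circle, which is divided into `N` arcs of equal length. -/
noncomputable def circlePoint (N : ℕ) (t : ℝ) : ℂ := unitExp (t / N)

theorem circlePoint_mem (N : ℕ) (t : ℝ) : circlePoint N t ∈ Metric.sphere (0 : ℂ) 1 := by
  rw [mem_sphere_zero_iff_norm]
  exact norm_unitExp _

theorem continuous_circlePoint (N : ℕ) : Continuous (circlePoint N) :=
  continuous_unitExp.comp (continuous_id.div_const _)

theorem circlePoint_top {N : ℕ} (hN : 0 < N) : circlePoint N N = circlePoint N 0 := by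
  have : (N : ℝ) ≠ 0 := by positivity
  exact unitExp_eq_iff.2 ⟨1, by simp [this]⟩

theorem circlePoint_eq {N : ℕ} {t t' : ℝ} (ht : t ∈ Set.Icc 0 (N : ℝ))
    (ht' : t' ∈ Set.Icc 0 (N : ℝ)) (h : circlePoint N t = circlePoint N t') :
    t = t' ∨ (t = 0 ∧ t' = N) ∨ (t = N ∧ t' = 0) := by
  rcases Nat.eq_zero_or_pos N with rfl | hN
  · left
    simp only [Nat.cast_zero, Set.Icc_self, Set.mem_singleton_iff] at ht ht'
    rw [ht, ht']
  have hN' : (0 : ℝ) < N := by positivity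
  obtain ⟨m, hm⟩ := unitExp_eq_iff.1 h
  have hm : t = t' + m * N := by field_simp at hm; linarith
  have h1 : (m : ℝ) ≤ 1 := by by_contra hc; push Not at hc; nlinarith [ht.2, ht'.1]
  have h2 : (-1 : ℝ) ≤ m := by by_contra hc; push Not at hc; nlinarith [ht.1, ht'.2]
  have h1 : m ≤ 1 := by exact_mod_cast h1
  have h2 : -1 ≤ m := by exact_mod_cast h2
  obtain rfl | rfl | rfl : m = -1 ∨ m = 0 ∨ m = 1 := by omega
  · refine Or.inr (Or.inl ⟨?_, ?_⟩) <;> push_cast at hm <;> linarith [ht.1, ht.2, ht'.1, ht'.2]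
  · exact Or.inl (by simpa using hm)
  · refine Or.inr (Or.inr ⟨?_, ?_⟩) <;> push_cast at hm <;> linarith [ht.1, ht.2, ht'.1, ht'.2]

theorem exists_circlePoint_eq {N : ℕ} (hN : 0 < N) {z : ℂ} (hz : z ∈ Metric.sphere (0 : ℂ) 1) :
    ∃ i < N, ∃ x ∈ Set.Ico (0 : ℝ) 1, circlePoint N (i + x) = z := by
  have hN' : (0 : ℝ) < N := by positivity
  have hz1 : ‖z‖ = 1 := by simpa using hz
  obtain ⟨t, ht⟩ : ∃ t : ℝ, unitExp t = z := by
    refine ⟨z.arg / (2 * Real.pi), ?_⟩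
    have := Complex.norm_mul_exp_arg_mul_I z
    rw [hz1, Complex.ofReal_one, one_mul] at this
    refine Eq.trans ?_ this
    unfold unitExp
    congr 1
    have : (Real.pi : ℂ) ≠ 0 := by exact_mod_cast Real.pi_ne_zero
    push_cast
    field_simp
  have hf0 := Int.fract_nonneg t
  have hf1 := Int.fract_lt_one t
  have h0 : 0 ≤ Int.fract t * N := by positivity
  refine ⟨⌊Int.fract t * N⌋₊, ?_, Int.fract t * N - ⌊Int.fract t * N⌋₊,
    ⟨by linarith [Nat.floor_le h0], by linarith [Nat.lt_floor_add_one (Int.fract t * N)]⟩, ?_⟩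
  · rw [Nat.floor_lt h0]; nlinarith
  · rw [← ht]
    refine unitExp_eq_iff.2 ⟨-⌊t⌋, ?_⟩
    push_cast
    rw [add_sub_cancel, mul_div_cancel_right₀ _ hN'.ne', Int.fract]
    ring

theorem exists_polar {N : ℕ} (hN : 0 < N) (z : ℂ) :
    ∃ i < N, ∃ x ∈ Set.Ico (0 : ℝ) 1, z = (‖z‖ : ℂ) * circlePoint N (i + x) := by
  obtain ⟨w, hw, hzw⟩ : ∃ w ∈ Metric.sphere (0 : ℂ) 1, z = ‖z‖ * w := by
    by_cases h : z = 0
    · exact ⟨1, by simp, by simp [h]⟩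
    · have hn : (‖z‖ : ℂ) ≠ 0 := by simpa using h
      exact ⟨z / ‖z‖, by simp [h], by field_simp⟩
  obtain ⟨i, hi, x, hx, rfl⟩ := exists_circlePoint_eq hN hw
  exact ⟨i, hi, x, hx, hzw⟩

/-- Maps from the disc in polar coordinates, sector by sector. -/
theorem exists_polar_factor {Z : Type*} [TopologicalSpace Z] [Nonempty Z] {N : ℕ} (hN : 0 < N)
    {f : ℕ → ℝ → ℝ → Z} (hf : ∀ i, Continuous fun q : ℝ × ℝ => f i q.1 q.2)
    (h0 : ∀ i x, f i x 0 = f 0 0 0) (hstep : ∀ i < N, ∀ ρ ∈ Set.Icc (0 : ℝ) 1, f i 1 ρ = f (i + 1) 0 ρ)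
    (htop : ∀ ρ, f N 0 ρ = f 0 0 ρ) :
    ∃ g : ℂ → Z, ContinuousOn g (Metric.closedBall 0 1) ∧
      ∀ i < N, ∀ x ∈ Set.Icc (0 : ℝ) 1, ∀ ρ ∈ Set.Icc (0 : ℝ) 1,
        g (ρ * circlePoint N (i + x)) = f i x ρ := by
  have hN' : (0 : ℝ) < N := by positivity
  set R : Set (Fin N × ℝ × ℝ) := Set.univ ×ˢ (Set.Icc 0 1 ×ˢ Set.Icc 0 1) with hR
  set p : Fin N × ℝ × ℝ → ℂ := fun q => q.2.2 * circlePoint N ((q.1 : ℕ) + q.2.1) with hp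
  have hpc : Continuous p := by
    have : Continuous fun q : Fin N × ℝ × ℝ => ((q.1 : ℕ) : ℝ) :=
      (continuous_of_discreteTopology (f := fun i : Fin N => ((i : ℕ) : ℝ))).comp continuous_fst
    have h2 := (continuous_circlePoint N).comp (this.add (continuous_fst.comp continuous_snd))
    exact (Complex.continuous_ofReal.comp (continuous_snd.comp continuous_snd)).mul h2
  have hfc : Continuous fun q : Fin N × ℝ × ℝ => f q.1 q.2.1 q.2.2 :=
    continuous_prod_of_discrete_left.2 fun i => hf i
  have hball : p '' R = Metric.closedBall 0 1 := by
    ext z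
    constructor
    · rintro ⟨⟨i, x, ρ⟩, ⟨-, hx, hρ⟩, rfl⟩
      simp only [hp, Metric.mem_closedBall, dist_zero_right, norm_mul, Complex.norm_real]
      have := circlePoint_mem N ((i : ℕ) + x)
      rw [mem_sphere_zero_iff_norm] at this
      rw [this, mul_one, Real.norm_eq_abs, abs_of_nonneg hρ.1]
      exact hρ.2
    · intro hz
      obtain ⟨i, hi, x, hx, h⟩ := exists_polar hN z
      exact ⟨(⟨i, hi⟩, x, ‖z‖), ⟨trivial, ⟨hx.1, hx.2.le⟩, norm_nonneg _, by simpa using hz⟩, h.symm⟩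
  have hstep' : ∀ (i i' : ℕ) (x x' ρ : ℝ), ρ ∈ Set.Icc (0 : ℝ) 1 → i < N → i' < N → x ∈ Set.Icc (0 : ℝ) 1 →
      x' ∈ Set.Icc (0 : ℝ) 1 → (i : ℝ) + x = i' + x' → f i x ρ = f i' x' ρ := by
    intro i i' x x' ρ hρ hi hi' hx hx' h
    have hc : i = i' ∨ i' = i + 1 ∨ i = i' + 1 := by
      have h1 : (i : ℝ) ≤ i' + 1 := by linarith [hx.1, hx'.2]
      have h2 : (i' : ℝ) ≤ i + 1 := by linarith [hx'.1, hx.2]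
      have h1 : i ≤ i' + 1 := by exact_mod_cast h1
      have h2 : i' ≤ i + 1 := by exact_mod_cast h2
      omega
    rcases hc with rfl | rfl | rfl
    · rw [add_left_cancel h]
    · push_cast at h
      have e1 : x = 1 := by linarith [hx.2, hx'.1]
      have e2 : x' = 0 := by linarith
      rw [e1, e2, hstep i hi ρ hρ]
    · push_cast at h
      have e1 : x' = 1 := by linarith [hx'.2, hx.1]
      have e2 : x = 0 := by linarith
      rw [e1, e2, hstep i' hi' ρ hρ]
  have hwrap : ∀ (i i' : ℕ) (x x' ρ : ℝ), ρ ∈ Set.Icc (0 : ℝ) 1 → i < N → i' < N → x ∈ Set.Icc (0 : ℝ) 1 →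
      x' ∈ Set.Icc (0 : ℝ) 1 → (i : ℝ) + x = 0 → (i' : ℝ) + x' = N → f i x ρ = f i' x' ρ := by
    intro i i' x x' ρ hρ hi hi' hx hx' h h'
    have hi0 : (i : ℝ) = 0 := by
      have : (0 : ℝ) ≤ i := by positivity
      linarith [hx.1]
    have hx0 : x = 0 := by linarith
    have hi0 : i = 0 := by exact_mod_cast hi0
    have hi1 : i' + 1 = N := by
      have h1 : (N : ℝ) ≤ i' + 1 := by linarith [hx'.2]
      have h1 : N ≤ i' + 1 := by exact_mod_cast h1
      omega
    have hx1 : x' = 1 := by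
      rw [← hi1] at h'; push_cast at h'; linarith
    rw [hi0, hx0, hx1, hstep i' hi' ρ hρ, hi1, htop]
  obtain ⟨g, hg, hg'⟩ := exists_factor (R := R) (isCompact_univ.prod (isCompact_Icc.prod isCompact_Icc))
    hpc.continuousOn (f := fun q => f q.1 q.2.1 q.2.2) hfc.continuousOn (by
      rintro ⟨i, x, ρ⟩ ⟨-, hx, hρ⟩ ⟨i', x', ρ'⟩ ⟨-, hx', hρ'⟩ h
      have hmem : ∀ (i : Fin N) (x : ℝ), x ∈ Set.Icc (0 : ℝ) 1 →
          ((i : ℕ) : ℝ) + x ∈ Set.Icc (0 : ℝ) N := by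
        intro i x hx
        have h1 : ((i : ℕ) : ℝ) + 1 ≤ N := by exact_mod_cast i.2
        have h2 : (0 : ℝ) ≤ (i : ℕ) := by positivity
        exact ⟨by linarith [hx.1], by linarith [hx.2]⟩
      simp only [hp] at h
      have hn := congrArg norm h
      have e1 := circlePoint_mem N ((i : ℕ) + x)
      have e2 := circlePoint_mem N ((i' : ℕ) + x')
      rw [mem_sphere_zero_iff_norm] at e1 e2
      rw [norm_mul, norm_mul, e1, e2, Complex.norm_real, Complex.norm_real, Real.norm_eq_abs,
        Real.norm_eq_abs, abs_of_nonneg hρ.1, abs_of_nonneg hρ'.1, mul_one, mul_one] at hn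
      subst hn
      by_cases hρ0 : ρ = 0
      · subst hρ0
        rw [h0, h0 i']
      have hρc : (ρ : ℂ) ≠ 0 := by exact_mod_cast hρ0
      have hc := mul_left_cancel₀ hρc h
      rcases circlePoint_eq (hmem i x hx) (hmem i' x' hx') hc with h1 | ⟨h1, h2⟩ | ⟨h1, h2⟩
      · exact hstep' _ _ _ _ _ hρ i.2 i'.2 hx hx' h1
      · exact hwrap _ _ _ _ _ hρ i.2 i'.2 hx hx' h1 h2
      · exact (hwrap _ _ _ _ _ hρ i'.2 i.2 hx' hx h2 h1).symm)
  rw [hball] at hg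
  exact ⟨g, hg, fun i hi x hx ρ hρ => hg' (⟨i, hi⟩, x, ρ) ⟨trivial, hx, hρ⟩⟩

end Polar

end PLCover

namespace PLCover

/-! ### The characteristic map of the 2-cell on the round disc. -/

section DiscOfWord

variable {k : ℕ}

/-- The point with barycentric coordinates of the `i`-th sector of the 2-cell at radius `ρ`, where
`x` is the position of the ray in the sector. -/
noncomputable def sectorPoint (r : List (Fin k × Bool)) (i : ℕ) (x ρ : ℝ) :
    PresVertex k (3 * r.length) →₀ ℝ :=
  max (1 - 2 * ρ) 0 • Finsupp.single .centre 1 + (1 - max (1 - 2 * ρ) 0) •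
    (max (max (2 * ρ - 1) 0 - x) 0 • Finsupp.single (cyc r i) 1 +
      min (max (2 * ρ - 1) 0) x • Finsupp.single (cyc r (i + 1)) 1 +
      (1 - max (max (2 * ρ - 1) 0) x) • Finsupp.single (.collar i) 1 +
      max (x - max (2 * ρ - 1) 0) 0 • Finsupp.single (.collar (i + 1)) 1)

theorem continuous_sectorPoint (r : List (Fin k × Bool)) (i : ℕ) :
    Continuous fun q : ℝ × ℝ => sectorPoint r i q.1 q.2 := by
  unfold sectorPoint
  fun_prop

variable {r : List (Fin k × Bool)}

theorem sectorPoint_zero (i : ℕ) (x : ℝ) : sectorPoint r i x 0 = Finsupp.single .centre 1 := by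
  simp [sectorPoint]

theorem sectorPoint_right (i : ℕ) {ρ : ℝ} (hρ : ρ ∈ Set.Icc (0 : ℝ) 1) :
    sectorPoint r i 1 ρ = sectorPoint r (i + 1) 0 ρ := by
  have h1 : max (2 * ρ - 1) 0 ≤ 1 := max_le (by linarith [hρ.2]) zero_le_one
  have h0 : 0 ≤ max (2 * ρ - 1) 0 := le_max_right _ _
  unfold sectorPoint
  rw [max_eq_right (a := max (2 * ρ - 1) 0 - 1) (by linarith), min_eq_left h1, max_eq_right h1,
    max_eq_left (a := 1 - max (2 * ρ - 1) 0) (by linarith),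
    max_eq_left (a := max (2 * ρ - 1) 0 - 0) (by linarith), min_eq_right h0, max_eq_left h0,
    max_eq_right (a := 0 - max (2 * ρ - 1) 0) (by linarith)]
  push_cast
  module

theorem sectorPoint_top (ρ : ℝ) : sectorPoint r (3 * r.length) 0 ρ = sectorPoint r 0 0 ρ := by
  have : ((3 * r.length : ℕ) : ZMod (3 * r.length)) = 0 := ZMod.natCast_self _
  unfold sectorPoint
  rw [this, Nat.cast_zero]

theorem sectorPoint_one (i : ℕ) {x : ℝ} (hx : x ∈ Set.Icc (0 : ℝ) 1) :
    sectorPoint r i x 1 =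
      (1 - x) • Finsupp.single (cyc r i) 1 + x • Finsupp.single (cyc r (i + 1)) 1 := by
  have h1 := hx.1
  have h2 := hx.2
  unfold sectorPoint
  norm_num [h1, h2]

theorem sectorPoint_centre (i : ℕ) (x ρ : ℝ) :
    sectorPoint r i x ρ .centre = max (1 - 2 * ρ) 0 := by
  have h1 : cyc r (i : ZMod (3 * r.length)) ≠ .centre := cyc_ne_centre _ _
  have h2 : cyc r ((i : ZMod (3 * r.length)) + 1) ≠ .centre := cyc_ne_centre _ _
  simp [sectorPoint, h1, h2]

theorem sectorPoint_collar (i : ℕ) (x ρ : ℝ) (m : ZMod (3 * r.length)) :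
    sectorPoint r i x ρ (.collar m) = (1 - max (1 - 2 * ρ) 0) *
      ((if (i : ZMod (3 * r.length)) = m then 1 - max (max (2 * ρ - 1) 0) x else 0) +
      if (i : ZMod (3 * r.length)) + 1 = m then max (x - max (2 * ρ - 1) 0) 0 else 0) := by
  have h1 : cyc r (i : ZMod (3 * r.length)) ≠ .collar m := cyc_ne_collar _ _ _
  have h2 : cyc r ((i : ZMod (3 * r.length)) + 1) ≠ .collar m := cyc_ne_collar _ _ _
  simp only [sectorPoint, Finsupp.add_apply, Finsupp.smul_apply, Finsupp.single_apply, h1, h2,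
    reduceCtorEq, PresVertex.collar.injEq, if_false, smul_eq_mul, mul_zero, zero_add, mul_ite,
    mul_one]

theorem sectorPoint_cyc (hr : 0 < r.length) (i : ℕ) (x ρ : ℝ) :
    sectorPoint r i x ρ (cyc r i) = (1 - max (1 - 2 * ρ) 0) * max (max (2 * ρ - 1) 0 - x) 0 := by
  have h1 := cyc_ne hr (i : ZMod (3 * r.length))
  have h2 : ∀ m, PresVertex.collar m ≠ cyc r (i : ZMod (3 * r.length)) :=
    fun m => (cyc_ne_collar _ _ _).symm
  have h3 := (cyc_ne_centre r (i : ZMod (3 * r.length))).symm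
  simp [sectorPoint, h1.symm, h2, h3]

theorem two_ne_zero_zmod (hr : 0 < r.length) : (1 + 1 : ZMod (3 * r.length)) ≠ 0 := by
  have h : ((2 : ℕ) : ZMod (3 * r.length)) ≠ 0 := by
    rw [Ne, ZMod.natCast_eq_zero_iff]
    intro h
    have := Nat.le_of_dvd (by norm_num) h
    omega
  norm_num at h ⊢
  exact h

theorem one_ne_zero_zmod (hr : 0 < r.length) : (1 : ZMod (3 * r.length)) ≠ 0 := by
  intro h
  exact two_ne_zero_zmod hr (by rw [h, add_zero])

/-- Away from the centre, and with `ρ < 1` and `x < 1`, the coordinate at the `i`-th collar vertex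
is positive. Only the sectors `i` and `i - 1` use this vertex. -/
theorem index_of_sectorPoint_eq {i i' : ℕ} {x x' ρ ρ' : ℝ} (hx : x < 1) (hρ : ρ < 1)
    (hc : max (1 - 2 * ρ) 0 < 1)
    (h : sectorPoint r i x ρ = sectorPoint r i' x' ρ') (hx' : x' ≤ 1) (hρ' : ρ' ≤ 1) :
    ((i' : ZMod (3 * r.length)) = i ∨ (i' : ZMod (3 * r.length)) + 1 = i) ∧ ρ' < 1 := by
  have h1 := DFunLike.congr_fun h (.collar (i : ZMod (3 * r.length)))
  rw [sectorPoint_collar, sectorPoint_collar, if_pos rfl] at h1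
  have h2 : max (max (2 * ρ - 1) 0) x < 1 := max_lt (max_lt (by linarith) one_pos) hx
  have h3 : 0 < (1 - max (1 - 2 * ρ) 0) * ((1 - max (max (2 * ρ - 1) 0) x) +
      if (i : ZMod (3 * r.length)) + 1 = i then max (x - max (2 * ρ - 1) 0) 0 else 0) := by
    apply mul_pos (by linarith)
    split_ifs
    · linarith [le_max_right (x - max (2 * ρ - 1) 0) 0]
    · linarith
  rw [h1] at h3
  constructor
  · by_contra hcon
    push Not at hcon
    simp [hcon.1, hcon.2] at h3
  · rcases hρ'.lt_or_eq with h4 | rfl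
    · exact h4
    · norm_num [hx'] at h3

/-- The attaching path never visits a collar vertex or the centre, so the coordinates there identify
the sector. Together with the coordinate at the path vertex `cyc r i` they recover `ρ` and `x`. -/
theorem sectorPoint_inj (hr : 0 < r.length) {i i' : ℕ} {x x' ρ ρ' : ℝ}
    (hx : x ∈ Set.Ico (0 : ℝ) 1) (hx' : x' ∈ Set.Ico (0 : ℝ) 1) (hρ0 : 0 ≤ ρ) (hρ : ρ < 1)
    (hρ0' : 0 ≤ ρ') (hρ' : ρ' ≤ 1)
    (h : sectorPoint r i x ρ = sectorPoint r i' x' ρ') :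
    ρ = ρ' ∧ (ρ = 0 ∨ ((i : ZMod (3 * r.length)) = i' ∧ x = x')) := by
  have hc := DFunLike.congr_fun h .centre
  rw [sectorPoint_centre, sectorPoint_centre] at hc
  rcases hρ0.eq_or_lt with rfl | hpos
  · refine ⟨?_, Or.inl rfl⟩
    rcases max_cases (1 - 2 * ρ') 0 with h1 | h1 <;> rw [h1.1] at hc <;> norm_num at hc
    linarith
  have hc1 : max (1 - 2 * ρ) 0 < 1 := max_lt (by linarith) one_pos
  obtain ⟨hi, hρ1⟩ := index_of_sectorPoint_eq hx.2 hρ hc1 h hx'.2.le hρ'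
  obtain ⟨hi', -⟩ := index_of_sectorPoint_eq hx'.2 hρ1 (hc ▸ hc1) h.symm hx.2.le hρ.le
  have hii : (i' : ZMod (3 * r.length)) = i := by
    rcases hi with h1 | h1
    · exact h1
    rcases hi' with h2 | h2
    · exact h2.symm
    -- Each sector would be the successor of the other, so `2 = 0` modulo `3 * r.length`.
    · exfalso
      rw [← h1, add_assoc] at h2
      exact two_ne_zero_zmod hr (by simpa using h2)
  have hne : (i : ZMod (3 * r.length)) ≠ i + 1 := by simpa using one_ne_zero_zmod hr
  have e1 := DFunLike.congr_fun h (.collar (i : ZMod (3 * r.length)))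
  have e2 := DFunLike.congr_fun h (.collar ((i : ZMod (3 * r.length)) + 1))
  have e3 := DFunLike.congr_fun h (cyc r i)
  have e4 := sectorPoint_cyc hr i' x' ρ'
  rw [hii] at e4
  rw [sectorPoint_cyc hr, e4] at e3
  rw [sectorPoint_collar, sectorPoint_collar, hii, ← hc] at e1 e2
  rw [← hc] at e3
  have hc2 : 1 - max (1 - 2 * ρ) 0 ≠ 0 := by linarith
  have e1 := mul_left_cancel₀ hc2 e1
  have e2 := mul_left_cancel₀ hc2 e2
  have e3 := mul_left_cancel₀ hc2 e3
  simp only [if_true, hne, hne.symm, if_false, add_zero, zero_add] at e1 e2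
  have hs : max (2 * ρ - 1) 0 = max (2 * ρ' - 1) 0 := by
    generalize max (2 * ρ - 1) 0 = s at *
    generalize max (2 * ρ' - 1) 0 = s' at *
    rcases max_cases s x with h1 | h1 <;> rcases max_cases s' x' with h2 | h2 <;>
      rcases max_cases (x - s) 0 with h3 | h3 <;> rcases max_cases (x' - s') 0 with h4 | h4 <;>
      rw [h1.1, h2.1] at e1 <;> rw [h3.1, h4.1] at e2 <;> linarith
  have hρρ : ρ = ρ' := by
    rcases max_cases (2 * ρ - 1) 0 with h1 | h1 <;> rcases max_cases (2 * ρ' - 1) 0 with h2 | h2 <;>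
      rcases max_cases (1 - 2 * ρ) 0 with h3 | h3 <;> rcases max_cases (1 - 2 * ρ') 0 with h4 | h4 <;>
      rw [h1.1, h2.1] at hs <;> rw [h3.1, h4.1] at hc <;> linarith
  refine ⟨hρρ, Or.inr ⟨hii.symm, ?_⟩⟩
  rw [← hs] at e1 e2 e3
  generalize max (2 * ρ - 1) 0 = s at *
  rcases max_cases s x with h1 | h1 <;> rcases max_cases s x' with h2 | h2 <;>
    rcases max_cases (s - x) 0 with h3 | h3 <;> rcases max_cases (s - x') 0 with h4 | h4 <;>
    rw [h1.1, h2.1] at e1 <;> rw [h3.1, h4.1] at e3 <;> linarith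

theorem sum_three_mem_hull {V : Type*} [DecidableEq V] {a b c : V} {α β γ : ℝ} (hα : 0 ≤ α)
    (hβ : 0 ≤ β) (hγ : 0 ≤ γ) (h : α + β + γ = 1) :
    α • Finsupp.single a (1 : ℝ) + β • Finsupp.single b 1 + γ • Finsupp.single c 1 ∈
      hull {a, b, c} := by
  refine mem_hull_iff.2 ⟨fun v => ?_, fun v hv => ?_, ?_⟩
  · simp only [Finsupp.add_apply, Finsupp.smul_apply, Finsupp.single_apply, smul_eq_mul]
    split_ifs <;> simp <;> positivity
  · by_contra hcon
    simp only [Finset.mem_insert, Finset.mem_singleton, not_or] at hcon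
    simp [Ne.symm hcon.1, Ne.symm hcon.2.1, Ne.symm hcon.2.2] at hv
  · rw [Finsupp.sum_add_index' (by simp) (by simp), Finsupp.sum_add_index' (by simp) (by simp)]
    simpa using h

theorem eq_sum_three_of_mem_hull {V : Type*} [DecidableEq V] {a b c : V} (hab : a ≠ b) (hac : a ≠ c)
    (hbc : b ≠ c) {y : V →₀ ℝ} (hy : y ∈ hull {a, b, c}) : 0 ≤ y a ∧ 0 ≤ y b ∧ 0 ≤ y c ∧
      y a + y b + y c = 1 ∧ y = y a • Finsupp.single a (1 : ℝ) + y b • Finsupp.single b 1 +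
        y c • Finsupp.single c 1 := by
  obtain ⟨h0, hs, h1⟩ := mem_hull_iff.1 hy
  refine ⟨h0 a, h0 b, h0 c, ?_, ?_⟩
  · rw [← h1, Finsupp.sum_of_support_subset _ hs _ (by simp), Finset.sum_insert (by simp [hab, hac]),
      Finset.sum_pair hbc, add_assoc]
  · conv_lhs => rw [← Finsupp.sum_single y]
    rw [Finsupp.sum_of_support_subset _ hs _ (by simp), Finset.sum_insert (by simp [hab, hac]),
      Finset.sum_pair hbc, add_assoc]
    simp

theorem sectorPoint_mem (i : ℕ) {x ρ : ℝ} (hx : x ∈ Set.Icc (0 : ℝ) 1) (hρ : ρ ∈ Set.Icc (0 : ℝ) 1) :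
    sectorPoint r i x ρ ∈ presentationPolyhedron r := by
  have hface : ∀ t ∈ cellTriangles r, t.Nonempty → t ∈ (presentationComplex r).faces := by
    intro t ht hn
    rw [presentationComplex_faces]
    exact ⟨hn, t, Or.inr ht, subset_rfl⟩
  obtain ⟨hx0, hx1⟩ := hx
  obtain ⟨hρ0, hρ1⟩ := hρ
  rw [presentationPolyhedron, mem_onFinsupp_space]
  unfold sectorPoint
  rcases le_total ρ (1 / 2) with h | h
  · refine ⟨{.collar i, .collar (i + 1), .centre}, hface _ ⟨i, Or.inr (Or.inr rfl)⟩ (by simp), ?_⟩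
    rw [max_eq_right (a := 2 * ρ - 1) (by linarith), max_eq_left (a := 1 - 2 * ρ) (by linarith),
      max_eq_right (a := 0 - x) (by linarith), min_eq_left hx0, max_eq_right hx0,
      max_eq_left (a := x - 0) (by linarith)]
    convert sum_three_mem_hull (α := (1 - (1 - 2 * ρ)) * (1 - x)) (β := (1 - (1 - 2 * ρ)) * x)
      (γ := 1 - 2 * ρ) (by nlinarith) (by nlinarith) (by linarith) (by ring) using 1
    module
  · rw [max_eq_left (a := 2 * ρ - 1) (by linarith), max_eq_right (a := 1 - 2 * ρ) (by linarith)]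
    have hs1 : 2 * ρ - 1 ≤ 1 := by linarith
    have hs0 : 0 ≤ 2 * ρ - 1 := by linarith
    generalize 2 * ρ - 1 = s at *
    rcases le_total x s with hxs | hxs
    · refine ⟨{cyc r i, cyc r (i + 1), .collar i}, hface _ ⟨i, Or.inl rfl⟩ (by simp), ?_⟩
      rw [max_eq_left (a := s - x) (by linarith), min_eq_right hxs, max_eq_left hxs,
        max_eq_right (a := x - s) (by linarith)]
      convert sum_three_mem_hull (α := s - x) (β := x) (γ := 1 - s) (by linarith) (by linarith)
        (by linarith) (by ring) using 1
      module
    · refine ⟨{cyc r (i + 1), .collar i, .collar (i + 1)}, hface _ ⟨i, Or.inr (Or.inl rfl)⟩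
        (by simp), ?_⟩
      rw [max_eq_right (a := s - x) (by linarith), min_eq_left hxs, max_eq_right hxs,
        max_eq_left (a := x - s) (by linarith)]
      convert sum_three_mem_hull (α := s) (β := 1 - x) (γ := x - s) (by linarith) (by linarith)
        (by linarith) (by ring) using 1
      module

theorem exists_sectorPoint_eq (hr : 0 < r.length) {t : Finset (PresVertex k (3 * r.length))}
    (ht : t ∈ cellTriangles r) {y : PresVertex k (3 * r.length) →₀ ℝ} (hy : y ∈ hull t) :
    ∃ i < 3 * r.length, ∃ x ∈ Set.Icc (0 : ℝ) 1, ∃ ρ ∈ Set.Icc (0 : ℝ) 1,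
      sectorPoint r i x ρ = y := by
  have : NeZero (3 * r.length) := ⟨by omega⟩
  obtain ⟨i, hi⟩ := ht
  have hcast : ((i.val : ℕ) : ZMod (3 * r.length)) = i := ZMod.natCast_zmod_val i
  have hw := cyc_ne hr i
  have hwc := fun j => cyc_ne_collar r i j
  have hwc' := fun j => cyc_ne_collar r (i + 1) j
  have hcc : PresVertex.collar (k := k) i ≠ .collar (i + 1) := by
    simpa using one_ne_zero_zmod hr
  refine ⟨i.val, ZMod.val_lt i, ?_⟩
  unfold sectorPoint
  rw [hcast]
  rcases hi with rfl | rfl | rfl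
  · obtain ⟨h1, h2, h3, h4, h5⟩ := eq_sum_three_of_mem_hull hw (hwc _) (hwc' _) hy
    generalize y (cyc r i) = α at *
    generalize y (cyc r (i + 1)) = β at *
    generalize y (.collar i) = γ at *
    -- In the outer triangle the coordinates are `s - x`, `x`, `1 - s` with `s = 2ρ - 1`, so `s = α
    -- + β` and `x = β`.
    refine ⟨β, ⟨h2, by linarith⟩, (α + β + 1) / 2, ⟨by linarith, by linarith⟩, ?_⟩
    rw [h5, max_eq_right (a := 1 - 2 * ((α + β + 1) / 2)) (by linarith),
      max_eq_left (a := 2 * ((α + β + 1) / 2) - 1) (by linarith),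
      show 2 * ((α + β + 1) / 2) - 1 = α + β by ring, max_eq_left (a := α + β - β) (by linarith),
      min_eq_right (by linarith), max_eq_left (by linarith), max_eq_right (by linarith),
      show γ = 1 - (α + β) by linarith]
    module
  · obtain ⟨h1, h2, h3, h4, h5⟩ := eq_sum_three_of_mem_hull (hwc' _) (hwc' _) hcc hy
    generalize y (cyc r (i + 1)) = α at *
    generalize y (.collar i) = β at *
    generalize y (.collar (i + 1)) = γ at *
    -- In the second triangle the coordinates are `s`, `1 - x`, `x - s`, so `s = α` and `x = α + γ`.
    refine ⟨α + γ, ⟨by linarith, by linarith⟩, (α + 1) / 2, ⟨by linarith, by linarith⟩, ?_⟩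
    rw [h5, max_eq_right (a := 1 - 2 * ((α + 1) / 2)) (by linarith),
      max_eq_left (a := 2 * ((α + 1) / 2) - 1) (by linarith),
      show 2 * ((α + 1) / 2) - 1 = α by ring, max_eq_right (a := α - (α + γ)) (by linarith),
      min_eq_left (by linarith), max_eq_right (by linarith), max_eq_left (by linarith),
      show β = 1 - (α + γ) by linarith]
    module
  · obtain ⟨h1, h2, h3, h4, h5⟩ := eq_sum_three_of_mem_hull hcc (by simp) (by simp) hy
    generalize y (.collar i) = α at *
    generalize y (.collar (i + 1)) = β at *
    generalize y .centre = γ at *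
    -- In the cone `2ρ = α + β`, and `x` is the proportion of `β`; at the centre any `x` will do.
    have hx : ∃ x ∈ Set.Icc (0 : ℝ) 1, (α + β) * x = β := by
      rcases (add_nonneg h1 h2).eq_or_lt with h | h
      · exact ⟨0, by simp, by linarith⟩
      · exact ⟨β / (α + β), ⟨by positivity, by rw [div_le_one h]; linarith⟩, by field_simp⟩
    obtain ⟨x, hx, hxβ⟩ := hx
    have hx0 := hx.1
    refine ⟨x, hx, (α + β) / 2, ⟨by linarith, by linarith⟩, ?_⟩
    rw [h5, max_eq_left (a := 1 - 2 * ((α + β) / 2)) (by linarith),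
      max_eq_right (a := 2 * ((α + β) / 2) - 1) (by linarith),
      max_eq_right (a := 0 - x) (by linarith), min_eq_left hx0, max_eq_right hx0,
      max_eq_left (a := x - 0) (by linarith),
      show γ = 1 - (α + β) by linarith]
    have e1 : α = (α + β) * (1 - x) := by linarith
    have e2 : β = (α + β) * x := hxβ.symm
    generalize α + β = δ at *
    rw [e1, e2]
    module

/-- The characteristic map of the 2-cell of a presentation complex, as a map on the round disc. -/
theorem exists_discMap (hn : 0 < r.length) (hr : ∀ x : Fin k, ∃ b : Bool, (x, b) ∈ r) :
    ∃ Ψ : ℂ → PresVertex k (3 * r.length) →₀ ℝ, DiscMap Ψ ∧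
      Ψ '' Metric.closedBall 0 1 = presentationPolyhedron r ∧
      ∀ i < 3 * r.length, ∀ x ∈ Set.Icc (0 : ℝ) 1, Ψ (circlePoint (3 * r.length) (i + x)) =
        (1 - x) • Finsupp.single (cyc r i) 1 + x • Finsupp.single (cyc r (i + 1)) 1 := by
  have : NeZero (3 * r.length) := ⟨by omega⟩
  have hN : 0 < 3 * r.length := by omega
  obtain ⟨Ψ, hΨ, hval⟩ := exists_polar_factor (N := 3 * r.length) hN (f := sectorPoint r)
    (continuous_sectorPoint r) (fun i x => by rw [sectorPoint_zero, sectorPoint_zero])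
    (fun i _ ρ hρ => sectorPoint_right i hρ) sectorPoint_top
  have hzmem : ∀ i x ρ, ρ ∈ Set.Icc (0 : ℝ) 1 →
      (ρ : ℂ) * circlePoint (3 * r.length) ((i : ℕ) + x) ∈ Metric.closedBall (0 : ℂ) 1 := by
    intro i x ρ hρ
    have := circlePoint_mem (3 * r.length) (i + x)
    rw [mem_sphere_zero_iff_norm] at this
    simp only [Metric.mem_closedBall, dist_zero_right, norm_mul, Complex.norm_real, this, mul_one,
      Real.norm_eq_abs, abs_of_nonneg hρ.1]
    exact hρ.2
  refine ⟨Ψ, ⟨hΨ, ?_⟩, ?_, ?_⟩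
  · intro z hz z' hz' h
    have hz1 : ‖z‖ < 1 := by simpa using hz
    have hz1' : ‖z'‖ ≤ 1 := by simpa using hz'
    obtain ⟨i, hi, x, hx, hzx⟩ := exists_polar hN z
    obtain ⟨i', hi', x', hx', hzx'⟩ := exists_polar hN z'
    rw [hzx, hzx', hval i hi x ⟨hx.1, hx.2.le⟩ _ ⟨norm_nonneg _, hz1.le⟩,
      hval i' hi' x' ⟨hx'.1, hx'.2.le⟩ _ ⟨norm_nonneg _, hz1'⟩] at h
    obtain ⟨h1, h2 | ⟨h2, h3⟩⟩ := sectorPoint_inj hn hx hx' (norm_nonneg _) hz1 (norm_nonneg _) hz1' h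
    · rw [hzx, hzx', ← h1, h2]; simp
    · have hii : i = i' := by
        have := congrArg ZMod.val h2
        rwa [ZMod.val_natCast_of_lt hi, ZMod.val_natCast_of_lt hi'] at this
      rw [hzx, hzx', h1, hii, h3]
  · apply Set.Subset.antisymm
    · rintro _ ⟨z, hz, rfl⟩
      have hz1 : ‖z‖ ≤ 1 := by simpa using hz
      obtain ⟨i, hi, x, hx, hzx⟩ := exists_polar hN z
      rw [hzx, hval i hi x ⟨hx.1, hx.2.le⟩ _ ⟨norm_nonneg _, hz1⟩]
      exact sectorPoint_mem i ⟨hx.1, hx.2.le⟩ ⟨norm_nonneg _, hz1⟩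
    · intro y hy
      rw [presentationPolyhedron, mem_onFinsupp_space] at hy
      obtain ⟨F, hF, hyF⟩ := hy
      obtain ⟨t, ht, hFt⟩ := exists_triangle_of_mem hr hF
      obtain ⟨i, hi, x, hx, ρ, hρ, h⟩ := exists_sectorPoint_eq hn ht (hull_mono hFt hyF)
      exact ⟨_, hzmem i x ρ hρ, by rw [hval i hi x hx ρ hρ, h]⟩
  · intro i hi x hx
    have := hval i hi x hx 1 ⟨zero_le_one, le_rfl⟩
    rw [Complex.ofReal_one, one_mul] at this
    rw [this, sectorPoint_one i hx]

end DiscOfWord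

end PLCover

namespace PLCover

/-! ### Retracting the punctured disc to its boundary. -/

section Retraction

/-- Project radially from `p`. The scaling factor is the positive root of `a τ² + 2 b τ = c`, the
equation for `p + τ (z - p)` to have norm one. -/
theorem exists_retraction {p : ℂ} (hp : p ∈ Metric.ball (0 : ℂ) 1) :
    ∃ ret : ℂ → ℂ, ContinuousOn ret {p}ᶜ ∧ (∀ z, z ≠ p → ret z ∈ Metric.sphere (0 : ℂ) 1) ∧
      ∀ z ∈ Metric.sphere (0 : ℂ) 1, ret z = z := by
  set a : ℂ → ℝ := fun z => (z - p).re ^ 2 + (z - p).im ^ 2 with ha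
  set b : ℂ → ℝ := fun z => p.re * (z - p).re + p.im * (z - p).im with hb
  set c : ℝ := 1 - (p.re ^ 2 + p.im ^ 2) with hc
  have hnorm : ∀ w : ℂ, ‖w‖ ^ 2 = w.re ^ 2 + w.im ^ 2 := by
    intro w; rw [← Complex.normSq_eq_norm_sq, Complex.normSq_apply]; ring
  have hcpos : 0 < c := by
    have h1 : ‖p‖ < 1 := by simpa using hp
    have := hnorm p
    have h2 := norm_nonneg p
    nlinarith
  have hapos : ∀ z, z ≠ p → 0 < a z := by
    intro z hz
    have h := hnorm (z - p)
    have h1 : 0 < ‖z - p‖ := norm_pos_iff.2 (sub_ne_zero.2 hz)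
    simp only [ha]
    rw [← h]
    positivity
  refine ⟨fun z => p + ((-b z + √(b z ^ 2 + a z * c)) / a z : ℝ) * (z - p), ?_, ?_, ?_⟩
  · have hac : Continuous a := by fun_prop
    have hbc : Continuous b := by fun_prop
    refine continuousOn_const.add (ContinuousOn.mul ?_ (by fun_prop))
    refine Complex.continuous_ofReal.comp_continuousOn
      (ContinuousOn.div (by fun_prop) hac.continuousOn fun z hz => (hapos z hz).ne')
  · intro z hz
    have h1 := hapos z hz
    have hS : √(b z ^ 2 + a z * c) ^ 2 = b z ^ 2 + a z * c := Real.sq_sqrt (by positivity)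
    set S := √(b z ^ 2 + a z * c)
    set τ := (-b z + S) / a z with hτ
    have hτa : a z * τ = S - b z := by rw [hτ]; field_simp; ring
    rw [mem_sphere_zero_iff_norm, ← sq_eq_sq₀ (norm_nonneg _) zero_le_one, hnorm]
    have e1 : (p + (τ : ℂ) * (z - p)).re = p.re + τ * (z - p).re := by simp
    have e2 : (p + (τ : ℂ) * (z - p)).im = p.im + τ * (z - p).im := by simp
    rw [e1, e2]
    have h2 : a z * (2 * τ * b z + τ ^ 2 * a z - c) = 0 := by
      have : a z * (2 * τ * b z + τ ^ 2 * a z - c) =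
        2 * b z * (a z * τ) + (a z * τ) ^ 2 - a z * c := by ring
      rw [this, hτa]
      linear_combination hS
    have h3 := (mul_eq_zero.1 h2).resolve_left h1.ne'
    simp only [ha, hb, hc] at h3
    linear_combination h3
  · intro z hz
    have hz1 : ‖z‖ = 1 := by simpa using hz
    have hzp : z ≠ p := by
      rintro rfl
      have : ‖z‖ < 1 := by simpa using hp
      linarith
    have h1 := hapos z hzp
    have hz2 := hnorm z
    rw [hz1] at hz2
    have h2 : c = 2 * b z + a z := by
      simp only [ha, hb, hc, Complex.sub_re, Complex.sub_im]
      linear_combination hz2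
    have h3 : b z ^ 2 + a z * c = (a z + b z) ^ 2 := by rw [h2]; ring
    have h4 : 0 ≤ a z + b z := by linarith
    have h5 : (-b z + √(b z ^ 2 + a z * c)) / a z = 1 := by
      rw [h3, Real.sqrt_sq h4]; field_simp; ring
    beta_reduce
    rw [h5]
    simp

/-- If `A` misses a point of the open disc, then nowhere vanishing functions on the image of the
boundary circle have logarithms on the part of the boundary in `A`. -/
theorem exists_log_on_boundary {E : Type*} [TopologicalSpace E] [T2Space E] {Ψ : ℂ → E}
    (hΨ : DiscMap Ψ) {A : Set E} (hA : IsClosed A) (hAD : A ⊆ Ψ '' Metric.closedBall 0 1)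
    (hlog : HasLogs A) (hne : A ≠ Ψ '' Metric.closedBall 0 1) {ζ : E → ℂ} (hζ : Continuous ζ)
    (h0 : ∀ z ∈ Metric.sphere (0 : ℂ) 1, ζ (Ψ z) ≠ 0) :
    ∃ ψ : E → ℂ, ContinuousOn ψ A ∧
      ∀ z ∈ Metric.sphere (0 : ℂ) 1, Ψ z ∈ A → Complex.exp (ψ (Ψ z)) = ζ (Ψ z) := by
  -- A closed set containing the image of the open disc contains the image of its closure.
  have hp : ∃ p ∈ Metric.ball (0 : ℂ) 1, Ψ p ∉ A := by
    by_contra hcon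
    push Not at hcon
    apply hne (Set.Subset.antisymm hAD _)
    have h1 : Metric.closedBall (0 : ℂ) 1 ⊆ discPreimage Ψ A := by
      rw [← closure_ball (0 : ℂ) one_ne_zero]
      refine closure_minimal (fun z hz => ⟨Metric.ball_subset_closedBall hz, hcon z hz⟩)
        (hΨ.isClosed_discPreimage hA)
    rintro _ ⟨z, hz, rfl⟩
    exact (h1 hz).2
  obtain ⟨p, hp, hpA⟩ := hp
  obtain ⟨ret, hret, hmem, hid⟩ := exists_retraction hp
  have hzp : ∀ z ∈ discPreimage Ψ A, z ≠ p := by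
    rintro z hz rfl
    exact hpA hz.2
  obtain ⟨φ, hφ, hφ'⟩ := hΨ.exists_descend hA hAD (φ := fun z => ζ (Ψ (ret z)))
    (hζ.comp_continuousOn (hΨ.cont.comp (hret.mono fun z hz => hzp z hz)
      fun z hz => Metric.sphere_subset_closedBall (hmem z (hzp z hz))))
    (fun z hz z' hz' h _ => by rw [hid z hz, hid z' hz', h])
  obtain ⟨ψ, hψ, hψ'⟩ := hlog φ hφ (by
    intro y hy
    obtain ⟨z, hz, rfl⟩ := hAD hy
    rw [hφ' z ⟨hz, hy⟩]
    exact h0 _ (hmem z (hzp z ⟨hz, hy⟩)))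
  refine ⟨ψ, hψ, fun z hz hzA => ?_⟩
  rw [hψ' _ hzA, hφ' z ⟨Metric.sphere_subset_closedBall hz, hzA⟩, hid z hz]

end Retraction

/-! ### The loops of the generators on the boundary circle. -/

section Loops

variable {k n : ℕ}

/-- The loop of a generator, parametrized by `[0, 3]`. -/
noncomputable def loopPoint (n : ℕ) (x : Fin k) (u : ℝ) : PresVertex k n →₀ ℝ :=
  (1 - max 0 (min u (2 - u)) - max 0 (min (u - 1) (3 - u))) • Finsupp.single .base 1 +
    max 0 (min u (2 - u)) • Finsupp.single (.loop x 0) 1 +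
    max 0 (min (u - 1) (3 - u)) • Finsupp.single (.loop x 1) 1

theorem continuous_loopPoint (n : ℕ) (x : Fin k) : Continuous (loopPoint n x) := by
  unfold loopPoint
  fun_prop

theorem loopPoint_first (x : Fin k) {v : ℝ} (hv : v ∈ Set.Icc (0 : ℝ) 1) : loopPoint n x v =
    (1 - v) • Finsupp.single .base 1 + v • Finsupp.single (.loop x 0) 1 := by
  obtain ⟨h0, h1⟩ := hv
  unfold loopPoint
  rw [min_eq_left (by linarith), max_eq_right h0, min_eq_left (by linarith),
    max_eq_left (by linarith)]
  module

theorem loopPoint_second (x : Fin k) {v : ℝ} (hv : v ∈ Set.Icc (0 : ℝ) 1) : loopPoint n x (1 + v) =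
    (1 - v) • Finsupp.single (.loop x 0) 1 + v • Finsupp.single (.loop x 1) 1 := by
  obtain ⟨h0, h1⟩ := hv
  unfold loopPoint
  rw [min_eq_right (by linarith), max_eq_right (by linarith), min_eq_left (by linarith),
    max_eq_right (by linarith)]
  module

theorem loopPoint_third (x : Fin k) {v : ℝ} (hv : v ∈ Set.Icc (0 : ℝ) 1) : loopPoint n x (2 + v) =
    (1 - v) • Finsupp.single (.loop x 1) 1 + v • Finsupp.single .base 1 := by
  obtain ⟨h0, h1⟩ := hv
  unfold loopPoint
  rw [min_eq_right (by linarith), max_eq_left (by linarith), min_eq_right (by linarith),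
    max_eq_right (by linarith)]
  module

theorem loopPoint_zero (x : Fin k) : loopPoint n x 0 = Finsupp.single .base 1 := by
  rw [loopPoint_first x ⟨le_rfl, zero_le_one⟩]; simp

theorem loopPoint_three (x : Fin k) : loopPoint n x 3 = Finsupp.single .base 1 := by
  have := loopPoint_third (n := n) x (v := 1) ⟨zero_le_one, le_rfl⟩
  norm_num at this
  exact this

theorem exists_third {u : ℝ} (hu : u ∈ Set.Icc (0 : ℝ) 3) :
    ∃ v ∈ Set.Icc (0 : ℝ) 1, u = v ∨ u = 1 + v ∨ u = 2 + v := by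
  obtain ⟨h0, h3⟩ := hu
  rcases le_total u 1 with h | h
  · exact ⟨u, ⟨h0, h⟩, Or.inl rfl⟩
  rcases le_total u 2 with h' | h'
  · exact ⟨u - 1, ⟨by linarith, by linarith⟩, Or.inr (Or.inl (by ring))⟩
  · exact ⟨u - 2, ⟨by linarith, by linarith⟩, Or.inr (Or.inr (by ring))⟩

/-- The position on the boundary circle of the point with parameter `u` on the `j`-th letter. -/
def slotPosition (r : List (Fin k × Bool)) (j : Fin r.length) (u : ℝ) : ℝ :=
  3 * (j : ℕ) + if (r[(j : ℕ)]).2 then u else 3 - u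

theorem boundary_slotPosition {r : List (Fin k × Bool)}
    {Ψ : ℂ → PresVertex k (3 * r.length) →₀ ℝ}
    (hΨ : ∀ i < 3 * r.length, ∀ x ∈ Set.Icc (0 : ℝ) 1, Ψ (circlePoint (3 * r.length) (i + x)) =
        (1 - x) • Finsupp.single (cyc r i) 1 + x • Finsupp.single (cyc r (i + 1)) 1)
    (j : Fin r.length) {u : ℝ} (hu : u ∈ Set.Icc (0 : ℝ) 3) :
    Ψ (circlePoint (3 * r.length) (slotPosition r j u)) = loopPoint _ (r[(j : ℕ)]).1 u := by
  have hj := j.2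
  have e0 := cyc_three_mul (r := r) hj.le
  have e1 := cyc_three_mul_add_one hj
  have e2 := cyc_three_mul_add_two hj
  have e3 := cyc_three_mul (r := r) (j := j + 1) hj
  have s0 : ((3 * (j : ℕ) : ℕ) : ZMod (3 * r.length)) + 1 =
      ((3 * (j : ℕ) + 1 : ℕ) : ZMod (3 * r.length)) := by push_cast; ring
  have s1 : ((3 * (j : ℕ) + 1 : ℕ) : ZMod (3 * r.length)) + 1 =
      ((3 * (j : ℕ) + 2 : ℕ) : ZMod (3 * r.length)) := by push_cast; ring
  have s2 : ((3 * (j : ℕ) + 2 : ℕ) : ZMod (3 * r.length)) + 1 =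
      ((3 * ((j : ℕ) + 1) : ℕ) : ZMod (3 * r.length)) := by push_cast; ring
  have h0 : ∀ v ∈ Set.Icc (0 : ℝ) 1, Ψ (circlePoint (3 * r.length) (3 * (j : ℕ) + v)) =
      (1 - v) • Finsupp.single .base 1 + v • Finsupp.single (fst _ r[(j : ℕ)]) 1 := by
    intro v hv
    have := hΨ (3 * j) (by omega) v hv
    rw [s0, e0, e1] at this
    push_cast at this
    exact this
  have h1 : ∀ v ∈ Set.Icc (0 : ℝ) 1, Ψ (circlePoint (3 * r.length) (3 * (j : ℕ) + (1 + v))) =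
      (1 - v) • Finsupp.single (fst _ r[(j : ℕ)]) 1 + v • Finsupp.single (snd _ r[(j : ℕ)]) 1 := by
    intro v hv
    have := hΨ (3 * j + 1) (by omega) v hv
    rw [s1, e1, e2] at this
    push_cast at this
    rw [← add_assoc]
    exact this
  have h2 : ∀ v ∈ Set.Icc (0 : ℝ) 1, Ψ (circlePoint (3 * r.length) (3 * (j : ℕ) + (2 + v))) =
      (1 - v) • Finsupp.single (snd _ r[(j : ℕ)]) 1 + v • Finsupp.single .base 1 := by
    intro v hv
    have := hΨ (3 * j + 2) (by omega) v hv
    rw [s2, e2, e3] at this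
    push_cast at this
    rw [← add_assoc]
    exact this
  have hsymm : ∀ v ∈ Set.Icc (0 : ℝ) 1, 1 - v ∈ Set.Icc (0 : ℝ) 1 :=
    fun v hv => ⟨by linarith [hv.2], by linarith [hv.1]⟩
  obtain ⟨v, hv, hu⟩ := exists_third hu
  unfold slotPosition
  have hb : (r[(j : ℕ)]).2 = true ∨ (r[(j : ℕ)]).2 = false := by cases (r[(j : ℕ)]).2 <;> simp
  rcases hb with hb | hb
  · have hf : fst (3 * r.length) r[(j : ℕ)] = .loop (r[(j : ℕ)]).1 0 := by simp [fst, hb]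
    have hs : snd (3 * r.length) r[(j : ℕ)] = .loop (r[(j : ℕ)]).1 1 := by simp [snd, hb]
    rw [if_pos hb]
    rcases hu with rfl | rfl | rfl
    · rw [h0 _ hv, loopPoint_first _ hv, hf]
    · rw [h1 _ hv, loopPoint_second _ hv, hf, hs]
    · rw [h2 _ hv, loopPoint_third _ hv, hs]
  · have hf : fst (3 * r.length) r[(j : ℕ)] = .loop (r[(j : ℕ)]).1 1 := by simp [fst, hb]
    have hs : snd (3 * r.length) r[(j : ℕ)] = .loop (r[(j : ℕ)]).1 0 := by simp [snd, hb]
    rw [if_neg (by simp [hb])]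
    rcases hu with rfl | rfl | rfl
    · rw [show 3 - u = 2 + (1 - u) by ring, h2 _ (hsymm _ hv), loopPoint_first _ hv, sub_sub_cancel,
        add_comm, hs]
    · rw [show 3 - (1 + v) = 1 + (1 - v) by ring, h1 _ (hsymm _ hv), loopPoint_second _ hv,
        sub_sub_cancel, add_comm, hf, hs]
    · rw [show 3 - (2 + v) = 1 - v by ring, h0 _ (hsymm _ hv), loopPoint_third _ hv,
        sub_sub_cancel, add_comm, hf]

theorem exists_slotPosition_eq {r : List (Fin k × Bool)} (hn : 0 < r.length) {z : ℂ}
    (hz : z ∈ Metric.sphere (0 : ℂ) 1) : ∃ j : Fin r.length, ∃ u ∈ Set.Icc (0 : ℝ) 3,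
      circlePoint (3 * r.length) (slotPosition r j u) = z := by
  obtain ⟨i, hi, x, hx, rfl⟩ := exists_circlePoint_eq (N := 3 * r.length) (by omega) hz
  have h1 : ∃ v ∈ Set.Icc (0 : ℝ) 3, (i : ℝ) + x = 3 * (i / 3 : ℕ) + v := by
    have h2 : (i : ℝ) = 3 * (i / 3 : ℕ) + (i % 3 : ℕ) := by
      exact_mod_cast (Nat.div_add_mod i 3).symm
    have h3 : ((i % 3 : ℕ) : ℝ) ≤ 2 := by
      have : i % 3 ≤ 2 := by omega
      exact_mod_cast this
    have h4 : (0 : ℝ) ≤ (i % 3 : ℕ) := by positivity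
    exact ⟨(i % 3 : ℕ) + x, ⟨by linarith [hx.1], by linarith [hx.2]⟩, by rw [h2]; ring_nf⟩
  obtain ⟨v, hv, hiv⟩ := h1
  set j : Fin r.length := ⟨i / 3, by omega⟩ with hj
  have hb : (r[(j : ℕ)]).2 = true ∨ (r[(j : ℕ)]).2 = false := by cases (r[(j : ℕ)]).2 <;> simp
  rcases hb with hb | hb
  · exact ⟨j, v, hv, by rw [slotPosition, if_pos hb, hiv]⟩
  · exact ⟨j, 3 - v, ⟨by linarith [hv.2], by linarith [hv.1]⟩, by
      rw [slotPosition, if_neg (by simp [hb]), hiv, sub_sub_cancel]⟩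

/-- The function `ζ` carries the loop of `x` once around the triangle of cube roots of unity and
sends all other loops to `1`. If `A` contained the loop, `exists_log_on_boundary` would give a
logarithm along it. That logarithm grows by `θ = 2πi / 3` on each third and yet returns to its
initial value. -/
theorem exists_loopPoint_notMem {Ψ : ℂ → PresVertex k n →₀ ℝ} (hΨ : DiscMap Ψ)
    (hb : ∀ z ∈ Metric.sphere (0 : ℂ) 1, ∃ x : Fin k, ∃ u ∈ Set.Icc (0 : ℝ) 3,
      Ψ z = loopPoint n x u) {x : Fin k}
    (hx : ∀ u ∈ Set.Icc (0 : ℝ) 3, ∃ z ∈ Metric.sphere (0 : ℂ) 1, Ψ z = loopPoint n x u)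
    {A : Set (PresVertex k n →₀ ℝ)} (hA : IsClosed A) (hAD : A ⊆ Ψ '' Metric.closedBall 0 1)
    (hlog : HasLogs A) (hne : A ≠ Ψ '' Metric.closedBall 0 1) :
    ∃ u ∈ Set.Icc (0 : ℝ) 3, loopPoint n x u ∉ A := by
  by_contra hcon
  push Not at hcon
  set θ : ℂ := ((2 * Real.pi / 3 : ℝ) : ℂ) * Complex.I with hθ
  set a : ℂ := Complex.exp θ with ha
  have ha3 : a ^ 3 = 1 := by
    rw [ha, ← Complex.exp_nat_mul, hθ, Complex.exp_eq_one_iff]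
    exact ⟨1, by push_cast; ring⟩
  have haim : 0 < a.im := by
    rw [ha, Complex.exp_ofReal_mul_I_im]
    apply Real.sin_pos_of_pos_of_lt_pi <;> linarith [Real.pi_pos]
  have hloga : Complex.log a = θ := by
    apply Complex.log_exp <;> simp [hθ] <;> linarith [Real.pi_pos]
  -- The segment from `1` to `a` avoids the cut of the principal logarithm.
  have hslit : ∀ v ∈ Set.Icc (0 : ℝ) 1, (1 - v + v * a : ℂ) ∈ Complex.slitPlane := by
    intro v hv
    rcases hv.1.eq_or_lt with rfl | h
    · simp
    · right
      simp [h.ne', haim.ne']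
  set ζ : (PresVertex k n →₀ ℝ) → ℂ := fun y =>
    1 + (y (.loop x 0) : ℝ) * (a - 1) + (y (.loop x 1) : ℝ) * (a ^ 2 - 1) with hζ
  have hζc : Continuous ζ := by
    have h1 := Complex.continuous_ofReal.comp (continuous_eval (PresVertex.loop (n := n) x 0))
    have h2 := Complex.continuous_ofReal.comp (continuous_eval (PresVertex.loop (n := n) x 1))
    exact (continuous_const.add (h1.mul continuous_const)).add (h2.mul continuous_const)
  have hζ0 : ∀ v ∈ Set.Icc (0 : ℝ) 1, ζ (loopPoint n x v) = 1 - v + v * a := by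
    intro v hv
    rw [loopPoint_first x hv]
    simp [hζ]
    ring
  have hζ1 : ∀ v ∈ Set.Icc (0 : ℝ) 1, ζ (loopPoint n x (1 + v)) = a * (1 - v + v * a) := by
    intro v hv
    rw [loopPoint_second x hv]
    simp [hζ]
    ring
  have hζ2 : ∀ v ∈ Set.Icc (0 : ℝ) 1, ζ (loopPoint n x (2 + v)) = a ^ 2 * (1 - v + v * a) := by
    intro v hv
    rw [loopPoint_third x hv]
    simp [hζ]
    linear_combination (-v : ℂ) * ha3
  have hζy : ∀ (y : Fin k) (u : ℝ), y ≠ x → ζ (loopPoint n y u) = 1 := by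
    intro y u hy
    simp [hζ, loopPoint, hy]
  have hζne : ∀ z ∈ Metric.sphere (0 : ℂ) 1, ζ (Ψ z) ≠ 0 := by
    intro z hz
    obtain ⟨y, u, hu, h⟩ := hb z hz
    rw [h]
    by_cases hy : y = x
    · subst hy
      obtain ⟨v, hv, rfl | rfl | rfl⟩ := exists_third hu
      · rw [hζ0 _ hv]; exact Complex.slitPlane_ne_zero (hslit _ hv)
      · rw [hζ1 _ hv]; exact mul_ne_zero (Complex.exp_ne_zero _) (Complex.slitPlane_ne_zero (hslit _ hv))
      · rw [hζ2 _ hv]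
        exact mul_ne_zero (pow_ne_zero _ (Complex.exp_ne_zero _))
          (Complex.slitPlane_ne_zero (hslit _ hv))
    · rw [hζy y u hy]; exact one_ne_zero
  obtain ⟨ψ, hψ, hψ'⟩ := exists_log_on_boundary hΨ hA hAD hlog hne hζc hζne
  have hψx : ∀ u ∈ Set.Icc (0 : ℝ) 3, Complex.exp (ψ (loopPoint n x u)) = ζ (loopPoint n x u) := by
    intro u hu
    obtain ⟨z, hz, h⟩ := hx u hu
    rw [← h]
    exact hψ' z hz (h ▸ hcon u hu)
  -- On a third of the loop `ψ` differs from the principal logarithm by a constant, and the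
  -- principal logarithm runs from `0` to `θ`.
  have key : ∀ (c : ℝ) (m : ℕ), (∀ v ∈ Set.Icc (0 : ℝ) 1, c + v ∈ Set.Icc (0 : ℝ) 3) →
      (∀ v ∈ Set.Icc (0 : ℝ) 1, ζ (loopPoint n x (c + v)) = a ^ m * (1 - v + v * a)) →
      ψ (loopPoint n x (c + 1)) = ψ (loopPoint n x c) + θ := by
    intro c m hc hcζ
    have h := eq_of_exp_eq_one (isPreconnected_Icc (a := (0 : ℝ)) (b := 1))
      (f := fun v : ℝ => ψ (loopPoint n x (c + v)) - Complex.log (1 - v + v * a) - m * θ) (by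
        refine ((hψ.comp (((continuous_loopPoint n x).comp (by fun_prop)).continuousOn)
          fun v hv => hcon _ (hc v hv)).sub ?_).sub continuousOn_const
        exact ContinuousOn.clog (by fun_prop) hslit) (by
        intro v hv
        have hs := Complex.slitPlane_ne_zero (hslit v hv)
        rw [Complex.exp_sub, Complex.exp_sub, hψx _ (hc v hv), hcζ v hv, Complex.exp_log hs,
          Complex.exp_nat_mul, ← ha]
        have ham : a ^ m ≠ 0 := pow_ne_zero _ (Complex.exp_ne_zero _)
        rw [mul_div_assoc, div_self hs, mul_one, div_self ham])
      (x := 0) (y := 1) (by simp) (by simp)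
    simp [hloga] at h
    linear_combination -h
  have k0 := key 0 0 (fun v hv => ⟨by linarith [hv.1], by linarith [hv.2]⟩)
    (fun v hv => by rw [zero_add, hζ0 v hv]; ring)
  have k1 := key 1 1 (fun v hv => ⟨by linarith [hv.1], by linarith [hv.2]⟩)
    (fun v hv => by rw [hζ1 v hv]; ring)
  have k2 := key 2 2 (fun v hv => ⟨by linarith [hv.1], by linarith [hv.2]⟩)
    (fun v hv => hζ2 v hv)
  norm_num at k0 k1 k2
  rw [loopPoint_three, k1, k0, loopPoint_zero] at k2
  have h3 : θ = 0 := by linear_combination (-1 / 3 : ℂ) * k2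
  have h4 : θ.im = 0 := by rw [h3]; simp
  simp [hθ, Real.pi_ne_zero] at h4

end Loops

end PLCover

namespace PLCover

/-! ### Cutting an interval into pieces of alternating colours. -/

section Cuts

/-- `[a, b]` is divided into `M` consecutive intervals, each of which is contained in a member of
the cover `Y`. -/
def HasCuts (Y : Bool → Set ℝ) (a b : ℝ) (M : ℕ) : Prop :=
  ∃ (s : ℕ → ℝ) (c : ℕ → Bool), s 0 = a ∧ s M = b ∧ (∀ j < M, s j ≤ s (j + 1)) ∧
    ∀ j < M, Set.Icc (s j) (s (j + 1)) ⊆ Y (c j)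

variable {Y : Bool → Set ℝ} {a b : ℝ} {M : ℕ}

theorem HasCuts.cons {a' : ℝ} (h : HasCuts Y a' b M) (haa' : a ≤ a') {β : Bool}
    (hY : Set.Icc a a' ⊆ Y β) : HasCuts Y a b (M + 1) := by
  obtain ⟨s, c, h0, hM, hle, hcell⟩ := h
  refine ⟨fun j => if j = 0 then a else s (j - 1), fun j => if j = 0 then β else c (j - 1),
    by simp, by simp [hM], ?_, ?_⟩
  · rintro (_ | j) hj
    · simpa [h0] using haa'
    · simpa using hle j (by omega)
  · rintro (_ | j) hj
    · simpa [h0] using hY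
    · simpa using hcell j (by omega)

/-- Greedy choice: follow an interval containing `a` to its last point in `[a, b]`. Beyond that
point it is never needed again, and taking closures shows that the remaining intervals cover the
rest. -/
theorem exists_hasCuts {ι : Type*} [DecidableEq ι] {I : ι → Set ℝ} {β : ι → Bool} (F : Finset ι)
    (hI : ∀ i ∈ F, IsClosed (I i)) (hI' : ∀ i ∈ F, (I i).OrdConnected)
    (hY : ∀ i ∈ F, I i ⊆ Y (β i)) (hab : a ≤ b) (hcov : Set.Icc a b ⊆ ⋃ i ∈ F, I i) :
    ∃ M, HasCuts Y a b M := by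
  induction F using Finset.strongInduction generalizing a with
  | H F ih =>
    obtain ⟨i, hi, ha⟩ := Set.mem_iUnion₂.1 (hcov ⟨le_rfl, hab⟩)
    have hT : IsCompact (I i ∩ Set.Icc a b) := isCompact_Icc.inter_left (hI i hi)
    have hTn : (I i ∩ Set.Icc a b).Nonempty := ⟨a, ha, le_rfl, hab⟩
    have hmem := hT.sSup_mem hTn
    set a' := sSup (I i ∩ Set.Icc a b)
    have hsub : Set.Icc a a' ⊆ Y (β i) := ((hI' i hi).out ha hmem.1).trans (hY i hi)
    rcases hmem.2.2.eq_or_lt with h | h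
    · refine ⟨1, fun j => if j = 0 then a else b, fun _ => β i, by simp, by simp, ?_, ?_⟩
      · intro j hj
        obtain rfl : j = 0 := by omega
        simpa using hab
      · intro j hj
        obtain rfl : j = 0 := by omega
        simpa [← h] using hsub
    · have hcov' : Set.Icc a' b ⊆ ⋃ j ∈ F.erase i, I j := by
        rw [← closure_Ioc h.ne]
        refine closure_minimal ?_ ((F.erase i).finite_toSet.isClosed_biUnion
          fun j hj => hI j (Finset.mem_of_mem_erase hj))
        intro u hu
        obtain ⟨j, hj, huj⟩ := Set.mem_iUnion₂.1 (hcov ⟨hmem.2.1.trans hu.1.le, hu.2⟩)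
        refine Set.mem_iUnion₂.2 ⟨j, Finset.mem_erase.2 ⟨?_, hj⟩, huj⟩
        rintro rfl
        exact absurd (le_csSup hT.bddAbove ⟨huj, hmem.2.1.trans hu.1.le, hu.2⟩) (not_le.2 hu.1)
      obtain ⟨M, hM⟩ := ih (F.erase i) (Finset.erase_ssubset hi)
        (fun j hj => hI j (Finset.mem_of_mem_erase hj))
        (fun j hj => hI' j (Finset.mem_of_mem_erase hj))
        (fun j hj => hY j (Finset.mem_of_mem_erase hj)) h.le hcov'
      exact ⟨M + 1, hM.cons hmem.2.1 hsub⟩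

/-- A division of `[a, b]` into `M` consecutive intervals in the members of the cover `Y` with
alternating colours, such that the open interval `(p j, q j)` inside the `j`-th interval avoids the
member of the opposite colour. -/
structure AlternatingCuts (Y : Bool → Set ℝ) (a b : ℝ) (M : ℕ) (s : ℕ → ℝ) (c : ℕ → Bool)
    (p q : ℕ → ℝ) : Prop where
  zero : s 0 = a
  top : s M = b
  alternate : ∀ j, j + 1 < M → c (j + 1) = !c j
  cell : ∀ j < M, Set.Icc (s j) (s (j + 1)) ⊆ Y (c j)
  left : ∀ j < M, s j ≤ p j
  gap : ∀ j < M, p j < q j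
  right : ∀ j < M, q j ≤ s (j + 1)
  avoid : ∀ j < M, ∀ t ∈ Set.Ioo (p j) (q j), t ∉ Y (!c j)

theorem hasCuts_merge {s : ℕ → ℝ} {c : ℕ → Bool} (h0 : s 0 = a) (hM : s (M + 1) = b)
    (hle : ∀ j < M + 1, s j ≤ s (j + 1)) (hcell : ∀ j < M + 1, Set.Icc (s j) (s (j + 1)) ⊆ Y (c j))
    {j : ℕ} (hj : j < M) {β : Bool} (h1 : Set.Icc (s j) (s (j + 1)) ⊆ Y β)
    (h2 : Set.Icc (s (j + 1)) (s (j + 2)) ⊆ Y β) : HasCuts Y a b M := by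
  refine ⟨fun i => if i ≤ j then s i else s (i + 1),
    fun i => if i < j then c i else if i = j then β else c (i + 1), by simpa using h0, ?_, ?_, ?_⟩
  · beta_reduce
    rw [if_neg (by omega), hM]
  · intro i hi
    beta_reduce
    rcases lt_trichotomy i j with h | rfl | h
    · rw [if_pos (by omega), if_pos (by omega)]; exact hle i (by omega)
    · rw [if_pos le_rfl, if_neg (by omega)]
      exact (hle i (by omega)).trans (hle (i + 1) (by omega))
    · rw [if_neg (by omega), if_neg (by omega)]; exact hle (i + 1) (by omega)
  · intro i hi
    beta_reduce
    rcases lt_trichotomy i j with h | rfl | h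
    · rw [if_pos (by omega), if_pos (by omega), if_pos h]; exact hcell i (by omega)
    · rw [if_pos le_rfl, if_neg (by omega), if_neg (lt_irrefl _), if_pos rfl]
      intro u hu
      rcases le_total u (s (i + 1)) with h | h
      · exact h1 ⟨hu.1, h⟩
      · exact h2 ⟨h, hu.2⟩
    · rw [if_neg (by omega), if_neg (by omega), if_neg (by omega), if_neg (by omega)]
      exact hcell (i + 1) (by omega)

/-- Take a division with the fewest pieces. If two neighbours lay in the same member, merging them
would give fewer. So colours alternate and no piece lies in the opposite member. As that member is
closed, an open interval inside the piece avoids it. -/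
theorem exists_alternatingCuts (hY : ∀ β, IsClosed (Y β)) (hab : a < b)
    (hne : ∀ β, ¬ Set.Icc a b ⊆ Y β) (h : ∃ M, HasCuts Y a b M) :
    ∃ M s c p q, 2 ≤ M ∧ AlternatingCuts Y a b M s c p q := by
  classical
  obtain ⟨s, c, h0, hM, hle, hcell⟩ := Nat.find_spec h
  have hmin : ∀ m < Nat.find h, ¬ HasCuts Y a b m := fun m hm => Nat.find_min h hm
  set M := Nat.find h
  have hM2 : 2 ≤ M := by
    by_contra hcon
    obtain h | h : M = 0 ∨ M = 1 := by omega
    · rw [h, h0] at hM; exact hab.ne hM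
    · have := hcell 0 (by omega)
      rw [zero_add, h0, ← h, hM] at this
      exact hne _ this
  have hmerge : ∀ j, j + 1 < M → ∀ β, Set.Icc (s j) (s (j + 1)) ⊆ Y β →
      ¬ Set.Icc (s (j + 1)) (s (j + 2)) ⊆ Y β := by
    intro j hj β h1 h2
    obtain ⟨m, hm⟩ : ∃ m, M = m + 1 := ⟨M - 1, by omega⟩
    rw [hm] at hM hle hcell
    exact hmin m (by omega) (hasCuts_merge h0 hM hle hcell (by omega) h1 h2)
  have halt : ∀ j, j + 1 < M → c (j + 1) = !c j := by
    intro j hj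
    have h1 := hcell j (by omega)
    have h2 := hcell (j + 1) hj
    by_contra hcon
    rw [Bool.eq_not, not_not] at hcon
    rw [hcon] at h2
    exact hmerge j hj _ h1 h2
  -- A piece lying in both members could be merged with its right neighbour, or with its left one if
  -- it is the last.
  have hesc : ∀ j < M, ¬ Set.Icc (s j) (s (j + 1)) ⊆ Y (!c j) := by
    intro j hj hsub
    by_cases hj1 : j + 1 < M
    · have h2 := hcell (j + 1) hj1
      rw [halt j hj1] at h2
      exact hmerge j hj1 _ hsub h2
    · obtain ⟨i, rfl⟩ : ∃ i, j = i + 1 := ⟨j - 1, by omega⟩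
      have h2 := hcell i (by omega)
      rw [halt i hj, Bool.not_not] at hsub
      exact hmerge i hj _ h2 hsub
  have hlt : ∀ j < M, s j < s (j + 1) := by
    intro j hj
    refine (hle j hj).lt_of_ne fun he => hesc j hj ?_
    rw [← he, Set.Icc_self, Set.singleton_subset_iff]
    by_cases hj1 : j + 1 < M
    · have h2 := hcell (j + 1) hj1
      rw [halt j hj1, ← he] at h2
      exact h2 ⟨le_rfl, he ▸ hle (j + 1) hj1⟩
    · obtain ⟨i, rfl⟩ : ∃ i, j = i + 1 := ⟨j - 1, by omega⟩
      have h2 := hcell i (by omega)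
      rw [halt i hj, Bool.not_not]
      exact h2 ⟨hle i (by omega), le_rfl⟩
  have hgap : ∀ j, ∃ p q : ℝ, j < M → s j ≤ p ∧ p < q ∧ q ≤ s (j + 1) ∧
      ∀ t ∈ Set.Ioo p q, t ∉ Y (!c j) := by
    intro j
    by_cases hj : j < M
    · have h1 : ∃ t ∈ Set.Ioo (s j) (s (j + 1)), t ∉ Y (!c j) := by
        by_contra hcon
        push Not at hcon
        apply hesc j hj
        rw [← closure_Ioo (hlt j hj).ne]
        exact closure_minimal hcon (hY _)
      obtain ⟨t, ht, htY⟩ := h1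
      obtain ⟨p, q, ⟨hp, hq⟩, hpq⟩ := mem_nhds_iff_exists_Ioo_subset.1
        ((isOpen_Ioo.inter (hY (!c j)).isOpen_compl).mem_nhds ⟨ht, htY⟩)
      refine ⟨max p (s j), min q (s (j + 1)), fun _ => ⟨le_max_right _ _, ?_, min_le_right _ _, ?_⟩⟩
      · exact max_lt (lt_min (hp.trans hq) (hp.trans ht.2)) (lt_min (ht.1.trans hq) (hlt j hj))
      · intro u hu
        exact (hpq ⟨(le_max_left _ _).trans_lt hu.1, hu.2.trans_le (min_le_left _ _)⟩).2
    · exact ⟨0, 0, fun h => absurd h hj⟩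
  choose p q hpq using hgap
  exact ⟨M, s, c, p, q, hM2, h0, hM, halt, hcell, fun j hj => (hpq j hj).1,
    fun j hj => (hpq j hj).2.1, fun j hj => (hpq j hj).2.2.1, fun j hj => (hpq j hj).2.2.2⟩

/-- Used for letters with exponent `-1`, which run through their loop backwards. -/
theorem AlternatingCuts.reverse {s : ℕ → ℝ} {c : ℕ → Bool} {p q : ℕ → ℝ}
    (h : AlternatingCuts Y 0 b M s c p q) :
    AlternatingCuts (fun β => {u | b - u ∈ Y β}) 0 b M (fun j => b - s (M - j))
      (fun j => c (M - 1 - j)) (fun j => b - q (M - 1 - j)) (fun j => b - p (M - 1 - j)) := by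
  have hsucc : ∀ j < M, M - 1 - j + 1 = M - j := fun j hj => by omega
  have hpred : ∀ j, M - (j + 1) = M - 1 - j := fun j => by omega
  have hlt : ∀ j < M, M - 1 - j < M := fun j hj => by omega
  refine ⟨by simp [h.top], by simp [h.zero], ?_, ?_, ?_, ?_, ?_, ?_⟩
  · intro j hj
    have := h.alternate (M - 1 - (j + 1)) (by omega)
    rw [show M - 1 - (j + 1) + 1 = M - 1 - j by omega] at this
    rw [this, Bool.not_not]
  · intro j hj u hu
    apply h.cell _ (hlt j hj)
    rw [hsucc j hj]
    rw [hpred j] at hu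
    exact ⟨by linarith [hu.2], by linarith [hu.1]⟩
  · intro j hj
    have := h.right _ (hlt j hj)
    rw [hsucc j hj] at this
    linarith
  · intro j hj
    linarith [h.gap _ (hlt j hj)]
  · intro j hj
    rw [hpred j]
    linarith [h.left _ (hlt j hj)]
  · intro j hj t ht
    exact h.avoid _ (hlt j hj) _ ⟨by linarith [ht.2], by linarith [ht.1]⟩

theorem AlternatingCuts.step {s : ℕ → ℝ} {c : ℕ → Bool} {p q : ℕ → ℝ}
    (h : AlternatingCuts Y a b M s c p q) {j : ℕ} (hj : j < M) : s j < s (j + 1) :=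
  (h.left j hj).trans_lt ((h.gap j hj).trans_le (h.right j hj))

theorem AlternatingCuts.mono {s : ℕ → ℝ} {c : ℕ → Bool} {p q : ℕ → ℝ}
    (h : AlternatingCuts Y a b M s c p q) {i j : ℕ} (hij : i ≤ j) (hj : j ≤ M) : s i ≤ s j := by
  induction j, hij using Nat.le_induction with
  | base => exact le_rfl
  | succ j hij ih => exact (ih (by omega)).trans (h.step (by omega)).le

/-- Integer valued step functions, made continuous by ramps over the intervals `(p j, q j)`. -/
theorem AlternatingCuts.exists_stepFunction {s : ℕ → ℝ} {c : ℕ → Bool} {p q : ℕ → ℝ}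
    (h : AlternatingCuts Y a b M s c p q) (v : ℕ → ℤ) : ∃ w : ℝ → ℝ, Continuous w ∧ w a = v 0 ∧
      w b = v M ∧ ∀ m < M, ∀ u ∈ Set.Icc (s m) (s (m + 1)), (v m = v (m + 1) → w u = v (m + 1)) ∧
        ((∃ k : ℤ, w u = k) ∨ u ∉ Y (!c m)) := by
  suffices H : ∀ L ≤ M, ∃ w : ℝ → ℝ, Continuous w ∧ w a = v 0 ∧ (∀ u, s L ≤ u → w u = v L) ∧
      ∀ m < L, ∀ u ∈ Set.Icc (s m) (s (m + 1)), (v m = v (m + 1) → w u = v (m + 1)) ∧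
        ((∃ k : ℤ, w u = k) ∨ u ∉ Y (!c m)) by
    obtain ⟨w, h1, h2, h3, h4⟩ := H M le_rfl
    exact ⟨w, h1, h2, h3 b h.top.le, h4⟩
  intro L
  induction L with
  | zero => exact fun _ => ⟨fun _ => v 0, continuous_const, rfl, fun _ _ => rfl, by simp⟩
  | succ L ih =>
    intro hL
    obtain ⟨w, hw, hwa, hwL, hwc⟩ := ih (by omega)
    have hlt : L < M := hL
    have h1 := h.left L hlt
    have h2 := h.gap L hlt
    have h3 := h.right L hlt
    have hd : 0 < q L - p L := by linarith
    set ramp : ℝ → ℝ := fun u => max 0 (min 1 ((u - p L) / (q L - p L))) with hramp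
    have hr0 : ∀ u, u ≤ p L → ramp u = 0 := by
      intro u hu
      have : (u - p L) / (q L - p L) ≤ 0 := div_nonpos_of_nonpos_of_nonneg (by linarith) hd.le
      exact max_eq_left ((min_le_right _ _).trans this)
    have hr1 : ∀ u, q L ≤ u → ramp u = 1 := by
      intro u hu
      have : 1 ≤ (u - p L) / (q L - p L) := by rw [le_div_iff₀ hd]; linarith
      simp [hramp, min_eq_left this]
    refine ⟨fun u => w u + (v (L + 1) - v L) * ramp u, by fun_prop, ?_, ?_, ?_⟩
    · have h4 : a ≤ p L := by
        rw [← h.zero]; exact (h.mono (Nat.zero_le L) hlt.le).trans h1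
      beta_reduce
      rw [hwa, hr0 _ h4]; ring
    · intro u hu
      beta_reduce
      rw [hwL u ((h.step hlt).le.trans hu), hr1 u (h3.trans hu)]; ring
    · intro m hm u hu
      beta_reduce
      rcases Nat.lt_succ_iff_lt_or_eq.1 hm with hm | rfl
      · have h4 : u ≤ p L := (hu.2.trans (h.mono hm hlt.le)).trans h1
        rw [hr0 u h4, mul_zero, add_zero]
        exact hwc m hm u hu
      · rw [hwL u hu.1]
        refine ⟨fun he => by rw [he]; ring, ?_⟩
        rcases le_or_gt u (p m) with h4 | h4
        · left; exact ⟨v m, by rw [hr0 u h4]; ring⟩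
        rcases le_or_gt (q m) u with h5 | h5
        · left; exact ⟨v (m + 1), by rw [hr1 u h5]; ring⟩
        · right; exact h.avoid m hlt u ⟨h4, h5⟩

end Cuts

end PLCover

namespace PLCover

/-! ### Assembling the divided slots into a coloured circle. -/

section Slots

theorem AlternatingCuts.exists_cell {Y : Bool → Set ℝ} {a b : ℝ} {M : ℕ} {s : ℕ → ℝ} {c : ℕ → Bool}
    {p q : ℕ → ℝ} (h : AlternatingCuts Y a b M s c p q) (hM : 0 < M) {u : ℝ}
    (hu : u ∈ Set.Icc a b) : ∃ m < M, u ∈ Set.Icc (s m) (s (m + 1)) := by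
  by_contra hcon
  push Not at hcon
  have H : ∀ m ≤ M, s m ≤ u := by
    intro m
    induction m with
    | zero => exact fun _ => h.zero ▸ hu.1
    | succ m ih =>
      intro hm
      by_contra hlt
      exact hcon m hm ⟨ih (by omega), (not_le.1 hlt).le⟩
  obtain ⟨m, rfl⟩ : ∃ m, M = m + 1 := ⟨M - 1, by omega⟩
  exact hcon m (by omega) ⟨H m (by omega), h.top ▸ hu.2⟩

variable {n : ℕ}

/-- The cyclic successor. -/
def slotSucc (i : Fin n) : Fin n := ⟨(i + 1) % n, Nat.mod_lt _ i.pos⟩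

theorem slotSucc_injective : Function.Injective (slotSucc (n := n)) := by
  intro i j h
  have h1 : ((i : ℕ) + 1) ≡ (j : ℕ) + 1 [MOD n] := congrArg Fin.val h
  have h2 := Nat.ModEq.add_right_cancel' 1 h1
  rw [Nat.ModEq, Nat.mod_eq_of_lt i.2, Nat.mod_eq_of_lt j.2] at h2
  exact Fin.ext h2

theorem circlePoint_slotSucc (i : Fin n) : circlePoint (3 * n) (3 * (i : ℕ) + 3) =
    circlePoint (3 * n) (3 * (slotSucc i : ℕ)) := by
  have hi := i.2
  rcases (Nat.succ_le_of_lt hi).lt_or_eq with h | h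
  · have : (slotSucc i : ℕ) = i + 1 := Nat.mod_eq_of_lt h
    rw [this]; push_cast; ring_nf
  · have h0 : (slotSucc i : ℕ) = 0 := by
      simp only [slotSucc]
      rw [show (i : ℕ) + 1 = n from h, Nat.mod_self]
    have hn : ((3 * n : ℕ) : ℝ) = 3 * (i : ℕ) + 3 := by
      have : n = i + 1 := h.symm
      have : 3 * n = 3 * i + 3 := by omega
      exact_mod_cast this
    rw [h0, ← hn, circlePoint_top (by omega)]
    simp

theorem exists_slot_param (hn : 0 < n) {z : ℂ} (hz : z ∈ Metric.sphere (0 : ℂ) 1) :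
    ∃ j : Fin n, ∃ u ∈ Set.Icc (0 : ℝ) 3, circlePoint (3 * n) (3 * (j : ℕ) + u) = z := by
  obtain ⟨i, hi, x, hx, rfl⟩ := exists_circlePoint_eq (N := 3 * n) (by omega) hz
  have h2 : (i : ℝ) = 3 * (i / 3 : ℕ) + (i % 3 : ℕ) := by
    exact_mod_cast (Nat.div_add_mod i 3).symm
  have h3 : ((i % 3 : ℕ) : ℝ) ≤ 2 := by
    have : i % 3 ≤ 2 := by omega
    exact_mod_cast this
  have h4 : (0 : ℝ) ≤ (i % 3 : ℕ) := by positivity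
  exact ⟨⟨i / 3, by omega⟩, (i % 3 : ℕ) + x, ⟨by linarith [hx.1], by linarith [hx.2]⟩,
    by rw [h2]; ring_nf⟩

/-- Extension to the disc of a function on the circle that is given slot by slot. -/
theorem exists_disc_function (hn : 0 < n) {w : Fin n → ℝ → ℝ} (hw : ∀ i, Continuous (w i))
    (hstep : ∀ i, w i 3 = w (slotSucc i) 0) :
    ∃ W : ℂ → ℝ, ContinuousOn W (Metric.closedBall 0 1) ∧ ∀ i : Fin n, ∀ u ∈ Set.Icc (0 : ℝ) 3,
      W (circlePoint (3 * n) (3 * (i : ℕ) + u)) = w i u := by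
  have hN : 0 < 3 * n := by omega
  obtain ⟨W, hW, hval⟩ := exists_polar_factor hN
    -- The extension is linear along the radii; position `i` is part `i % 3` of slot `i / 3`.
    (f := fun i x ρ => ρ * w ⟨(i / 3) % n, Nat.mod_lt _ hn⟩ ((i % 3 : ℕ) + x))
    (fun i => continuous_snd.mul ((hw _).comp (by fun_prop))) (by simp)
    (by
      intro i hi ρ _
      congr 1
      by_cases h : i % 3 = 2
      · have h1 : (i + 1) / 3 = i / 3 + 1 := by omega
        have h2 : (i + 1) % 3 = 0 := by omega
        have h3 := hstep ⟨(i / 3) % n, Nat.mod_lt _ hn⟩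
        simp only [slotSucc, Nat.mod_add_mod] at h3
        simp only [h, h1, h2]
        norm_num
        exact h3
      · have h1 : (i + 1) / 3 = i / 3 := by omega
        have h2 : (i + 1) % 3 = i % 3 + 1 := by omega
        simp only [h1, h2]
        push_cast
        rw [add_zero])
    (by simp)
  refine ⟨W, hW, fun i u hu => ?_⟩
  have key : ∀ m < 3, ∀ v ∈ Set.Icc (0 : ℝ) 1,
      W (circlePoint (3 * n) (3 * (i : ℕ) + ((m : ℕ) + v))) = w i (m + v) := by
    intro m hm v hv
    have hi := i.2
    have h := hval (3 * i + m) (by omega) v hv 1 ⟨zero_le_one, le_rfl⟩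
    have h1 : (3 * (i : ℕ) + m) / 3 = i := by omega
    have h2 : (3 * (i : ℕ) + m) % 3 = m := by omega
    simp only [h1, h2, Nat.mod_eq_of_lt hi] at h
    push_cast at h
    rw [one_mul, one_mul] at h
    rw [← add_assoc]
    exact h
  obtain ⟨v, hv, rfl | rfl | rfl⟩ := exists_third hu
  · simpa using key 0 (by norm_num) u hv
  · simpa using key 1 (by norm_num) v hv
  · simpa using key 2 (by norm_num) v hv

variable {M : Fin n → ℕ}

/-- The cyclic order of the arcs when the `i`-th slot consists of `M i` arcs. -/
def arcNext (hM : ∀ i, 2 ≤ M i) (q : Σ i, Fin (M i)) : Σ i, Fin (M i) :=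
  if h : (q.2 : ℕ) + 1 < M q.1 then ⟨q.1, ⟨q.2 + 1, h⟩⟩
  else ⟨slotSucc q.1, ⟨0, by have := hM (slotSucc q.1); omega⟩⟩

theorem arcNext_of_lt (hM : ∀ i, 2 ≤ M i) {i : Fin n} {m : ℕ} (h : m + 1 < M i) :
    arcNext hM ⟨i, ⟨m, by omega⟩⟩ = ⟨i, ⟨m + 1, h⟩⟩ := by
  rw [arcNext, dif_pos h]

theorem arcNext_last (hM : ∀ i, 2 ≤ M i) {i : Fin n} {m : ℕ} (h : m + 1 = M i) :
    arcNext hM ⟨i, ⟨m, by omega⟩⟩ =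
      ⟨slotSucc i, ⟨0, by have := hM (slotSucc i); omega⟩⟩ := by
  rw [arcNext, dif_neg (by simp only; omega)]

theorem arcNext_injective (hM : ∀ i, 2 ≤ M i) : Function.Injective (arcNext hM) := by
  rintro ⟨i, m, hm⟩ ⟨i', m', hm'⟩ h
  rcases (Nat.succ_le_of_lt hm).lt_or_eq with h1 | h1 <;>
    rcases (Nat.succ_le_of_lt hm').lt_or_eq with h2 | h2
  · rw [arcNext_of_lt hM h1, arcNext_of_lt hM h2] at h
    obtain ⟨rfl, h⟩ := Sigma.mk.inj_iff.1 h
    have := eq_of_heq h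
    simp only [Fin.mk.injEq, Nat.add_right_cancel_iff] at this
    subst this; rfl
  · rw [arcNext_of_lt hM h1, arcNext_last hM h2] at h
    have h3 := (Sigma.mk.inj_iff.1 h)
    obtain ⟨rfl, h⟩ := h3
    have := eq_of_heq h
    simp at this
  · rw [arcNext_last hM h1, arcNext_of_lt hM h2] at h
    have h3 := (Sigma.mk.inj_iff.1 h)
    obtain ⟨rfl, h⟩ := h3
    have := eq_of_heq h
    simp at this
  · rw [arcNext_last hM h1, arcNext_last hM h2] at h
    have h3 := slotSucc_injective (Sigma.mk.inj_iff.1 h).1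
    subst h3
    have : m = m' := by omega
    subst this; rfl

theorem arcNext_transitive (hM : ∀ i, 2 ≤ M i) {T : Type*} {w : (Σ i, Fin (M i)) → T}
    (hw : ∀ q, w (arcNext hM q) = w q) (q q' : Σ i, Fin (M i)) : w q = w q' := by
  have h1 : ∀ (i : Fin n) (m : ℕ) (hm : m < M i),
      w ⟨i, ⟨m, hm⟩⟩ = w ⟨i, ⟨0, by omega⟩⟩ := by
    intro i m
    induction m with
    | zero => exact fun _ => rfl
    | succ m ih =>
      intro hm
      rw [← ih (by omega), ← hw ⟨i, ⟨m, by omega⟩⟩, arcNext_of_lt hM hm]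
  have h2 : ∀ i : Fin n, w ⟨slotSucc i, ⟨0, by have := hM (slotSucc i); omega⟩⟩ =
      w ⟨i, ⟨0, by have := hM i; omega⟩⟩ := by
    intro i
    have h0 := hM i
    rw [← h1 i (M i - 1) (by omega), ← hw ⟨i, ⟨M i - 1, by omega⟩⟩,
      arcNext_last hM (show M i - 1 + 1 = M i by omega)]
  have hcongr : ∀ i j : Fin n, i = j → w ⟨i, ⟨0, by have := hM i; omega⟩⟩ =
      w ⟨j, ⟨0, by have := hM j; omega⟩⟩ := by
    rintro i _ rfl; rfl
  have h3 : ∀ (m : ℕ) (hm : m < n), w ⟨⟨m, hm⟩, ⟨0, by have := hM ⟨m, hm⟩; omega⟩⟩ =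
      w ⟨⟨0, by omega⟩, ⟨0, by have := hM ⟨0, by omega⟩; omega⟩⟩ := by
    intro m
    induction m with
    | zero => exact fun _ => rfl
    | succ m ih =>
      intro hm
      refine Eq.trans (hcongr _ _ ?_) ((h2 ⟨m, by omega⟩).trans (ih (by omega)))
      exact (Fin.ext (Nat.mod_eq_of_lt hm)).symm
  obtain ⟨i, m, hm⟩ := q
  obtain ⟨i', m', hm'⟩ := q'
  rw [h1 i m hm, h1 i' m' hm', h3 i i.2, h3 i' i'.2]

variable {E : Type*} [TopologicalSpace E]

/-- The circle data of a boundary circle that consists of `n` slots, each of which is divided into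
arcs of alternating colours. -/
noncomputable def circleDataOfSlots (hn : 0 < n) {Ψ : ℂ → E} {X : Bool → Set E}
    (hM : ∀ i, 2 ≤ M i) {s : Fin n → ℕ → ℝ} {c : Fin n → ℕ → Bool} {p q : Fin n → ℕ → ℝ}
    (h : ∀ i : Fin n, AlternatingCuts
      (fun β => {u | Ψ (circlePoint (3 * n) (3 * (i : ℕ) + u)) ∈ X β}) 0 3 (M i) (s i) (c i) (p i) (q i))
    {Λ : Type*} (lab : (Σ i, Fin (M i)) → Λ)
    (lab_κ : ∀ x x' : Σ i, Fin (M i), lab x = lab x' → c x.1 x.2 = c x'.1 x'.2)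
    (lab_meet : ∀ x x' : Σ i, Fin (M i), lab x = lab x' →
      ∃ u ∈ Set.Icc (s x.1 x.2) (s x.1 (x.2 + 1)), ∃ u' ∈ Set.Icc (s x'.1 x'.2) (s x'.1 (x'.2 + 1)),
        Ψ (circlePoint (3 * n) (3 * (x.1 : ℕ) + u)) = Ψ (circlePoint (3 * n) (3 * (x'.1 : ℕ) + u'))) :
    CircleData Ψ X (Σ i, Fin (M i)) Λ where
  nxt := Equiv.ofBijective (arcNext hM) (Finite.injective_iff_bijective.1 (arcNext_injective hM))
  e := circlePoint (3 * n)
  lo x := 3 * (x.1 : ℕ) + s x.1 x.2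
  hi x := 3 * (x.1 : ℕ) + s x.1 (x.2 + 1)
  κ x := c x.1 x.2
  lab := lab
  continuous_e := continuous_circlePoint _
  e_mem := circlePoint_mem _
  lo_le_hi x := by
    have := (h x.1).step x.2.2
    linarith
  e_hi := by
    rintro ⟨i, m, hm⟩
    rw [Equiv.ofBijective_apply]
    rcases (Nat.succ_le_of_lt hm).lt_or_eq with h1 | h1
    · rw [arcNext_of_lt hM h1]
    · rw [arcNext_last hM h1]
      simp only [(h (slotSucc i)).zero, add_zero]
      rw [show m + 1 = M i from h1, (h i).top, circlePoint_slotSucc]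
  cell := by
    rintro ⟨i, m, hm⟩ t ht
    have hu : t - 3 * (i : ℕ) ∈ Set.Icc (s i m) (s i (m + 1)) :=
      ⟨by linarith [ht.1], by linarith [ht.2]⟩
    have hc := (h i).cell m hm hu
    rw [Set.mem_ofPred_eq, add_sub_cancel] at hc
    exact hc
  cover := by
    intro z hz
    obtain ⟨i, u, hu, rfl⟩ := exists_slot_param hn hz
    obtain ⟨m, hm, hum⟩ := (h i).exists_cell (by have := hM i; omega) hu
    exact ⟨⟨i, m, hm⟩, _, ⟨by linarith [hum.1], by linarith [hum.2]⟩, rfl⟩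
  step := by
    intro V
    set nxt := Equiv.ofBijective (arcNext hM)
      (Finite.injective_iff_bijective.1 (arcNext_injective hM)) with hnxt
    have hsymm : ∀ x, nxt.symm (arcNext hM x) = x := fun x => nxt.symm_apply_apply x
    -- The index is shifted by one: `v i (m + 1)` is the value on the `m`-th arc of the slot, and `v
    -- i 0` is the value on the arc preceding the slot.
    set v : Fin n → ℕ → ℤ := fun i m => if hm : m = 0 then
        V (nxt.symm ⟨i, ⟨0, by have := hM i; omega⟩⟩)
      else if hm' : m - 1 < M i then V ⟨i, ⟨m - 1, hm'⟩⟩ else 0 with hv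
    have hv1 : ∀ (i : Fin n) (m : ℕ) (hm : m < M i), v i (m + 1) = V ⟨i, ⟨m, hm⟩⟩ := by
      intro i m hm
      simp [hv, hm]
    have hv2 : ∀ (i : Fin n) (m : ℕ) (hm : m < M i), v i m = V (nxt.symm ⟨i, ⟨m, hm⟩⟩) := by
      rintro i (_ | m) hm
      · simp [hv]
      · rw [hv1 i m (by omega), ← arcNext_of_lt hM hm, hsymm]
    have hvM : ∀ i, v i (M i) = v (slotSucc i) 0 := by
      intro i
      have h0 := hM i
      obtain ⟨m, hm⟩ : ∃ m, m + 1 = M i := ⟨M i - 1, by omega⟩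
      rw [← hm, hv1 i m (by omega), hv2 _ 0 (by have := hM (slotSucc i); omega),
        ← arcNext_last hM hm, hsymm]
    choose w hw hw0 hw3 hwc using fun i => (h i).exists_stepFunction (v i)
    obtain ⟨W, hW, hWw⟩ := exists_disc_function hn hw
      (fun i => by rw [hw3, hw0, hvM])
    refine ⟨W, hW, ?_⟩
    rintro ⟨i, m, hm⟩ t ht
    have hu : t - 3 * (i : ℕ) ∈ Set.Icc (s i m) (s i (m + 1)) :=
      ⟨by linarith [ht.1], by linarith [ht.2]⟩
    have hu3 : t - 3 * (i : ℕ) ∈ Set.Icc (0 : ℝ) 3 := by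
      constructor
      · refine le_trans ?_ hu.1
        rw [← (h i).zero]; exact (h i).mono (Nat.zero_le m) hm.le
      · refine hu.2.trans ?_
        rw [← (h i).top]; exact (h i).mono hm le_rfl
    have h1 := hWw i _ hu3
    rw [add_sub_cancel] at h1
    have h2 := hwc i m hm _ hu
    rw [h1, ← hv1 i m hm, ← hv2 i m hm]
    refine ⟨fun he => h2.1 (by exact_mod_cast he), ?_⟩
    simpa using h2.2
  lab_κ := lab_κ
  lab_meet := by
    intro x x' hx
    obtain ⟨u, hu, u', hu', he⟩ := lab_meet x x' hx
    exact ⟨_, ⟨by linarith [hu.1], by linarith [hu.2]⟩, _, ⟨by linarith [hu'.1], by linarith [hu'.2]⟩,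
      he⟩
  trans w hw x x' := arcNext_transitive hM hw x x'
  both := by
    intro b
    have h0 := hM ⟨0, hn⟩
    have h1 := (h ⟨0, hn⟩).alternate 0 (by omega)
    by_cases hb : c ⟨0, hn⟩ 0 = b
    · exact ⟨⟨⟨0, hn⟩, ⟨0, by omega⟩⟩, hb⟩
    · refine ⟨⟨⟨0, hn⟩, ⟨1, by omega⟩⟩, ?_⟩
      simp only
      rw [show (1 : ℕ) = 0 + 1 from rfl, h1]
      cases b <;> simp_all

end Slots

end PLCover

namespace PLCover

/-! ### The final count of arcs. -/

section Count

variable {k : ℕ} {r : List (Fin k × Bool)}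

/-- The colour of the first arc of the slot of a letter, if the loop of the generator `x` is divided
into `M x` arcs with colours `c x`. -/
def firstColour (M : Fin k → ℕ) (c : Fin k → ℕ → Bool) (l : Fin k × Bool) : Bool :=
  if l.2 then c l.1 0 else c l.1 (M l.1 - 1)

/-- The colour of the last arc of the slot of a letter. -/
def lastColour (M : Fin k → ℕ) (c : Fin k → ℕ → Bool) (l : Fin k × Bool) : Bool :=
  if l.2 then c l.1 (M l.1 - 1) else c l.1 0

/-- The colours of arcs next to the wedge point. -/
def endColours (M : Fin k → ℕ) (c : Fin k → ℕ → Bool) : Finset Bool :=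
  Finset.univ.filter fun b => ∃ x, b = c x 0 ∨ b = c x (M x - 1)

theorem two_le_card_occurrences (hr : ∀ x : Fin k, ∃ b : Bool, (x, b) ∈ r)
    (h : ¬ AdmitsAlgebraicCollapse r) (x : Fin k) :
    2 ≤ (Finset.univ.filter fun i : Fin r.length => (r[(i : ℕ)]).1 = x).card := by
  obtain ⟨j, hj, rfl⟩ := exists_slot hr x
  obtain ⟨j', hj', hne, he⟩ := exists_other_slot h hj
  refine Nat.succ_le_of_lt (Finset.one_lt_card.2 ⟨⟨j, hj⟩, ?_, ⟨j', hj'⟩, ?_, ?_⟩)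
  · simp
  · simpa using he
  · simpa using hne.symm

/-- Write `M x = m x + 2`. Every generator occurs at least twice, so the left side is at least `2 *
∑ x, m x + 2 * k + r.length + 2`. There are at most two end colours and `r.length` junctions, so the
right side is at most `2 * ∑ x, m x + 4 + r.length`. Hence `k = 1`, and all these estimates are
nearly sharp. -/
theorem isExceptional_of_count (hk : 0 < k) (hr : ∀ x : Fin k, ∃ b : Bool, (x, b) ∈ r)
    (h : ¬ AdmitsAlgebraicCollapse r) {M : Fin k → ℕ} {c : Fin k → ℕ → Bool} (hM : ∀ x, 2 ≤ M x)
    (hcount : ∑ i : Fin r.length, M (r[(i : ℕ)]).1 + 2 ≤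
      2 * (∑ x, (M x - 2) + (endColours M c).card) +
        Fintype.card {i : Fin r.length // firstColour M c r[(slotSucc i : ℕ)] =
          lastColour M c r[(i : ℕ)]}) : IsExceptionalPresentation r := by
  have hE : (endColours M c).card ≤ 2 := (Finset.card_le_univ _).trans (by simp)
  have hnc : Fintype.card {i : Fin r.length // firstColour M c r[(slotSucc i : ℕ)] =
      lastColour M c r[(i : ℕ)]} ≤ r.length := by
    simpa using Fintype.card_subtype_le fun i : Fin r.length => firstColour M c r[(slotSucc i : ℕ)] =
      lastColour M c r[(i : ℕ)]
  obtain ⟨m, rfl⟩ : ∃ m : Fin k → ℕ, M = fun x => m x + 2 :=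
    ⟨fun x => M x - 2, funext fun x => by have := hM x; beta_reduce; omega⟩
  simp only [Nat.add_sub_cancel] at hcount
  generalize hncd : Fintype.card {i : Fin r.length //
    firstColour (fun x => m x + 2) c r[(slotSucc i : ℕ)] =
      lastColour (fun x => m x + 2) c r[(i : ℕ)]} = nc at hcount hnc
  have hsum : ∑ x, 2 * (m x + 1) ≤ ∑ i : Fin r.length, (m (r[(i : ℕ)]).1 + 1) := by
    rw [← Finset.sum_fiberwise Finset.univ fun i : Fin r.length => (r[(i : ℕ)]).1]
    refine Finset.sum_le_sum fun x _ => ?_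
    have h1 : ∀ i ∈ Finset.univ.filter fun i : Fin r.length => (r[(i : ℕ)]).1 = x,
        m (r[(i : ℕ)]).1 + 1 = m x + 1 := by
      intro i hi
      rw [(Finset.mem_filter.1 hi).2]
    rw [Finset.sum_congr rfl h1, Finset.sum_const, smul_eq_mul]
    exact Nat.mul_le_mul_right _ (two_le_card_occurrences hr h x)
  have e1 : ∑ i : Fin r.length, (m (r[(i : ℕ)]).1 + 2) =
      ∑ i : Fin r.length, (m (r[(i : ℕ)]).1 + 1) + r.length := by
    have : ∑ _i : Fin r.length, 1 = r.length := by simp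
    exact (Finset.sum_add_distrib (f := fun i : Fin r.length => m (r[(i : ℕ)]).1 + 1)
      (g := fun _ => 1)).trans (congrArg _ this)
  have e2 : ∑ x, 2 * (m x + 1) = 2 * ∑ x, m x + 2 * k := by
    rw [← Finset.mul_sum, Finset.sum_add_distrib]
    simp
    ring
  have hk1 : k = 1 := by omega
  refine ⟨hk1, ?_⟩
  subst hk1
  have hx : ∀ x : Fin 1, x = 0 := fun x => Subsingleton.elim _ _
  have e3 : ∑ i : Fin r.length, (m (r[(i : ℕ)]).1 + 2) = r.length * (m 0 + 2) := by
    rw [Finset.sum_congr rfl fun i _ => by rw [hx (r[(i : ℕ)]).1], Finset.sum_const]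
    simp
  have e4 : ∑ x : Fin 1, m x = m 0 := by simp
  have hn2 : 2 ≤ r.length := by
    refine (two_le_card_occurrences hr h 0).trans ((Finset.card_le_univ _).trans ?_)
    simp
  rw [e3, e4] at hcount
  -- With one generator the inequality reduces to `r.length * (m 0 + 1) ≤ 2 * (m 0 + 1)`.
  have hn : r.length = 2 := by
    have h3 : r.length ≤ 2 := by
      by_contra hcon
      have : 3 ≤ r.length := by omega
      nlinarith
    omega
  -- For a word of length two equality must hold, so the colours agree at every junction.
  have hall : ∀ i : Fin r.length, firstColour (fun x => m x + 2) c r[(slotSucc i : ℕ)] =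
      lastColour (fun x => m x + 2) c r[(i : ℕ)] := by
    by_contra hcon
    push Not at hcon
    obtain ⟨i, hi⟩ := hcon
    have hlt := Fintype.card_subtype_lt (p := fun i : Fin r.length =>
      firstColour (fun x => m x + 2) c r[(slotSucc i : ℕ)] =
        lastColour (fun x => m x + 2) c r[(i : ℕ)]) hi
    rw [Fintype.card_fin, hncd] at hlt
    rw [hn] at hcount hlt
    omega
  -- Two letters of the same sign would place the last arc of the loop next to its first arc. These
  -- then have the same colour, leaving one end colour instead of the two that the count needs.
  have hb : (r[1]'(by omega)).2 = !(r[0]'(by omega)).2 := by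
    by_contra hcon
    rw [Bool.eq_not, not_not] at hcon
    have h0 := hall ⟨0, by omega⟩
    have hs : ((slotSucc (⟨0, by omega⟩ : Fin r.length) : Fin r.length) : ℕ) = 1 := by
      simp [slotSucc, hn]
    simp only [hs] at h0
    have hc : c 0 0 = c 0 (m 0 + 1) := by
      simp only [firstColour, lastColour, hcon, hx (r[0]'(by omega)).1, hx (r[1]'(by omega)).1] at h0
      split_ifs at h0
      · simpa using h0
      · simpa using h0.symm
    have hE1 : (endColours (fun x => m x + 2) c).card ≤ 1 := by
      rw [Finset.card_le_one_iff_subset_singleton]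
      refine ⟨c 0 0, fun b hb => ?_⟩
      obtain ⟨x, hx'⟩ := (Finset.mem_filter.1 hb).2
      rw [hx x] at hx'
      rw [Finset.mem_singleton]
      rcases hx' with h' | h'
      · exact h'
      · rw [h', hc]; simp
    rw [hn] at hcount hnc
    omega
  obtain ⟨l₀, l₁, rfl⟩ := List.length_eq_two.1 hn
  refine ⟨0, l₀.2, ?_⟩
  simp only [List.getElem_cons_zero, List.getElem_cons_succ] at hb
  rw [← hb]
  congr
  · exact Prod.ext (hx _) rfl
  · exact Prod.ext (hx _) rfl

end Count

end PLCover

namespace PLCover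

/-! ### Labels of arcs and the resulting inequality. -/

section Arcs

theorem AlternatingCuts.congr {Y Y' : Bool → Set ℝ} {a b : ℝ} {M : ℕ} {s : ℕ → ℝ} {c : ℕ → Bool}
    {p q : ℕ → ℝ} (h : AlternatingCuts Y a b M s c p q)
    (hY : ∀ u ∈ Set.Icc a b, ∀ β, u ∈ Y β ↔ u ∈ Y' β) : AlternatingCuts Y' a b M s c p q := by
  have hsub : ∀ j < M, ∀ u ∈ Set.Icc (s j) (s (j + 1)), u ∈ Set.Icc a b := by
    intro j hj u hu
    have h1 := h.mono (Nat.zero_le j) hj.le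
    have h2 := h.mono (Nat.succ_le_of_lt hj) le_rfl
    rw [h.zero] at h1
    rw [h.top] at h2
    exact ⟨h1.trans hu.1, hu.2.trans h2⟩
  exact ⟨h.zero, h.top, h.alternate, fun j hj u hu => (hY u (hsub j hj u hu) _).1 (h.cell j hj hu),
    h.left, h.gap, h.right, fun j hj t ht ht' => h.avoid j hj t ht ((hY t (hsub j hj t
      ⟨(h.left j hj).trans ht.1.le, ht.2.le.trans (h.right j hj)⟩) _).2 ht')⟩

variable {k : ℕ} {r : List (Fin k × Bool)}

/-- The index, in the direction of the generator, of the `m`-th arc of the slot of a letter. -/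
def arcIndex (M : Fin k → ℕ) (l : Fin k × Bool) (m : ℕ) : ℕ := if l.2 then m else M l.1 - 1 - m

-- The bound of `CircleData.card_switches_le` for the arcs cut out by the loops. Inside a slot the
-- colours alternate, so the colour fails to change only at junctions of two letters.
open Classical in
theorem count_arcs (hn : 0 < r.length) {Ψ : ℂ → PresVertex k (3 * r.length) →₀ ℝ}
    {X : Bool → Set (PresVertex k (3 * r.length) →₀ ℝ)} (hX : LogCover Ψ X)
    (hΨ : ∀ (j : Fin r.length), ∀ u ∈ Set.Icc (0 : ℝ) 3,
      Ψ (circlePoint (3 * r.length) (slotPosition r j u)) = loopPoint _ (r[(j : ℕ)]).1 u)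
    {M : Fin k → ℕ} {s : Fin k → ℕ → ℝ} {c : Fin k → ℕ → Bool} {p q : Fin k → ℕ → ℝ}
    (hM : ∀ x, 2 ≤ M x)
    (h : ∀ x, AlternatingCuts (fun β => {u | loopPoint (3 * r.length) x u ∈ X β}) 0 3 (M x) (s x)
      (c x) (p x) (q x)) :
    ∑ i : Fin r.length, M (r[(i : ℕ)]).1 + 2 ≤
      2 * (∑ x, (M x - 2) + (endColours M c).card) +
        Fintype.card {i : Fin r.length // firstColour M c r[(slotSucc i : ℕ)] =
          lastColour M c r[(i : ℕ)]} := by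
  set S : Fin r.length → ℕ → ℝ := fun i m =>
    if (r[(i : ℕ)]).2 then s (r[(i : ℕ)]).1 m else 3 - s (r[(i : ℕ)]).1 (M (r[(i : ℕ)]).1 - m) with hS
  set C : Fin r.length → ℕ → Bool := fun i m =>
    c (r[(i : ℕ)]).1 (arcIndex M r[(i : ℕ)] m) with hC
  set P : Fin r.length → ℕ → ℝ := fun i m => if (r[(i : ℕ)]).2 then p (r[(i : ℕ)]).1 m else
    3 - q (r[(i : ℕ)]).1 (M (r[(i : ℕ)]).1 - 1 - m) with hP
  set Q : Fin r.length → ℕ → ℝ := fun i m => if (r[(i : ℕ)]).2 then q (r[(i : ℕ)]).1 m else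
    3 - p (r[(i : ℕ)]).1 (M (r[(i : ℕ)]).1 - 1 - m) with hQ
  have hcuts : ∀ i : Fin r.length, AlternatingCuts
      (fun β => {u | Ψ (circlePoint (3 * r.length) (3 * (i : ℕ) + u)) ∈ X β}) 0 3
      (M (r[(i : ℕ)]).1) (S i) (C i) (P i) (Q i) := by
    intro i
    have hb : (r[(i : ℕ)]).2 = true ∨ (r[(i : ℕ)]).2 = false := by cases (r[(i : ℕ)]).2 <;> simp
    rcases hb with hb | hb
    · simp only [hS, hC, hP, hQ, arcIndex, hb, if_true]
      refine (h _).congr fun u hu β => ?_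
      have := hΨ i u hu
      rw [slotPosition, if_pos hb] at this
      rw [Set.mem_ofPred_eq, Set.mem_ofPred_eq, this]
    · simp only [hS, hC, hP, hQ, arcIndex, hb, Bool.false_eq_true, if_false]
      refine (h _).reverse.congr fun u hu β => ?_
      have := hΨ i (3 - u) ⟨by linarith [hu.2], by linarith [hu.1]⟩
      rw [slotPosition, if_neg (by simp [hb]), sub_sub_cancel] at this
      rw [Set.mem_ofPred_eq, Set.mem_ofPred_eq, Set.mem_ofPred_eq, this]
  have hM' : ∀ i : Fin r.length, 2 ≤ M (r[(i : ℕ)]).1 := fun i => hM _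
  have hindex : ∀ (i : Fin r.length) (m : ℕ), m < M (r[(i : ℕ)]).1 →
      arcIndex M r[(i : ℕ)] m < M (r[(i : ℕ)]).1 := by
    intro i m hm
    unfold arcIndex
    split_ifs <;> omega
  -- An interior arc of a loop is its own label. End arcs all contain the wedge point in their
  -- image, so they can be labelled by their colour alone.
  set T : Finset ((Σ _ : Fin k, ℕ) ⊕ Bool) :=
    (Finset.univ.sigma fun x => Finset.Ioo 0 (M x - 1)).disjSum (endColours M c) with hT
  set L : Fin k → ℕ → (Σ _ : Fin k, ℕ) ⊕ Bool := fun x o =>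
    if 0 < o ∧ o < M x - 1 then Sum.inl ⟨x, o⟩ else Sum.inr (c x o) with hL
  have hLT : ∀ x o, o < M x → L x o ∈ T := by
    intro x o ho
    simp only [hL, hT]
    split_ifs with h1
    · simp [h1]
    · have h2 : o = 0 ∨ o = M x - 1 := by omega
      simp only [Finset.inr_mem_disjSum, endColours, Finset.mem_filter, Finset.mem_univ, true_and]
      exact ⟨x, by rcases h2 with rfl | rfl <;> simp⟩
  have hmeet : ∀ (i : Fin r.length) (m : ℕ) (hm : m < M (r[(i : ℕ)]).1) (u : ℝ),
      u ∈ Set.Icc (s (r[(i : ℕ)]).1 (arcIndex M r[(i : ℕ)] m))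
        (s (r[(i : ℕ)]).1 (arcIndex M r[(i : ℕ)] m + 1)) →
      ∃ v ∈ Set.Icc (S i m) (S i (m + 1)),
        Ψ (circlePoint (3 * r.length) (3 * (i : ℕ) + v)) = loopPoint _ (r[(i : ℕ)]).1 u := by
    intro i m hm u hu
    have hi := hindex i m hm
    have hu3 : u ∈ Set.Icc (0 : ℝ) 3 := by
      have h1 := (h (r[(i : ℕ)]).1).mono (Nat.zero_le _) hi.le
      have h2 := (h (r[(i : ℕ)]).1).mono (Nat.succ_le_of_lt hi) le_rfl
      rw [(h _).zero] at h1
      rw [(h _).top] at h2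
      exact ⟨h1.trans hu.1, hu.2.trans h2⟩
    have h1 := hΨ i u hu3
    refine ⟨if (r[(i : ℕ)]).2 then u else 3 - u, ?_, h1⟩
    have hb : (r[(i : ℕ)]).2 = true ∨ (r[(i : ℕ)]).2 = false := by cases (r[(i : ℕ)]).2 <;> simp
    rcases hb with hb | hb
    · simp only [arcIndex, hb, if_true] at hu
      simpa only [hS, hb, if_true] using hu
    · simp only [arcIndex, hb, Bool.false_eq_true, if_false] at hu
      simp only [hS, hb, Bool.false_eq_true, if_false]
      rw [show M (r[(i : ℕ)]).1 - 1 - m + 1 = M (r[(i : ℕ)]).1 - m by omega] at hu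
      rw [show M (r[(i : ℕ)]).1 - (m + 1) = M (r[(i : ℕ)]).1 - 1 - m by omega]
      exact ⟨by linarith [hu.2], by linarith [hu.1]⟩
  have hLmeet : ∀ (x : Fin k) (o : ℕ) (x' : Fin k) (o' : ℕ), o < M x → o' < M x' → L x o = L x' o' →
      c x o = c x' o' ∧ ∃ u ∈ Set.Icc (s x o) (s x (o + 1)), ∃ u' ∈ Set.Icc (s x' o') (s x' (o' + 1)),
        loopPoint (3 * r.length) x u = loopPoint (3 * r.length) x' u' := by
    intro x o x' o' ho ho' he
    have hend : ∀ (x : Fin k) (o : ℕ), o < M x → ¬ (0 < o ∧ o < M x - 1) →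
        ∃ u ∈ Set.Icc (s x o) (s x (o + 1)),
          loopPoint (3 * r.length) x u = Finsupp.single .base 1 := by
      intro x o ho h1
      have h2 : o = 0 ∨ o + 1 = M x := by omega
      rcases h2 with rfl | h2
      · exact ⟨s x 0, ⟨le_rfl, ((h x).step ho).le⟩, by rw [(h x).zero, loopPoint_zero]⟩
      · exact ⟨s x (o + 1), ⟨((h x).step ho).le, le_rfl⟩, by
          rw [h2, (h x).top, loopPoint_three]⟩
    simp only [hL] at he
    split_ifs at he with h1 h2 h2
    · have he := Sum.inl.inj he
      obtain ⟨rfl, hoo⟩ := Sigma.mk.inj_iff.1 he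
      obtain rfl := eq_of_heq hoo
      exact ⟨rfl, s x o, ⟨le_rfl, ((h x).step ho).le⟩, s x o, ⟨le_rfl, ((h x).step ho).le⟩, rfl⟩
    · obtain ⟨u, hu, hu'⟩ := hend x o ho h1
      obtain ⟨v, hv, hv'⟩ := hend x' o' ho' h2
      exact ⟨Sum.inr.inj he, u, hu, v, hv, hu'.trans hv'.symm⟩
  let d : CircleData Ψ X (Σ i : Fin r.length, Fin (M (r[(i : ℕ)]).1)) T :=
    circleDataOfSlots hn hM' hcuts
      (fun x => ⟨L (r[(x.1 : ℕ)]).1 (arcIndex M r[(x.1 : ℕ)] x.2), hLT _ _ (hindex _ _ x.2.2)⟩)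
      (fun x x' he => (hLmeet _ _ _ _ (hindex _ _ x.2.2) (hindex _ _ x'.2.2)
        (Subtype.mk.inj he)).1)
      (fun x x' he => by
        obtain ⟨-, u, hu, u', hu', he⟩ := hLmeet _ _ _ _ (hindex _ _ x.2.2) (hindex _ _ x'.2.2)
          (Subtype.mk.inj he)
        obtain ⟨v, hv, hv'⟩ := hmeet x.1 x.2 x.2.2 u hu
        obtain ⟨w, hw, hw'⟩ := hmeet x'.1 x'.2 x'.2.2 u' hu'
        exact ⟨v, hv, w, hw, by rw [hv', hw', he]⟩)
  have hcount := d.card_switches_le hX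
  have hTcard : Fintype.card T = ∑ x, (M x - 2) + (endColours M c).card := by
    rw [Fintype.card_coe, hT, Finset.card_disjSum, Finset.card_sigma]
    congr 1
    refine Finset.sum_congr rfl fun x _ => ?_
    rw [Nat.card_Ioo]
    omega
  have hcompl := Fintype.card_subtype_compl fun x => d.κ (d.nxt x) = d.κ x
  have hle := Fintype.card_subtype_le fun x => d.κ (d.nxt x) = d.κ x
  have hcard : Fintype.card (Σ i : Fin r.length, Fin (M (r[(i : ℕ)]).1)) =
      ∑ i : Fin r.length, M (r[(i : ℕ)]).1 := by simp
  have hlast : ∀ x, d.κ (d.nxt x) = d.κ x → (x.2 : ℕ) + 1 = M (r[(x.1 : ℕ)]).1 ∧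
      firstColour M c r[(slotSucc x.1 : ℕ)] = lastColour M c r[(x.1 : ℕ)] := by
    rintro ⟨i, m, hm⟩ hx
    change (fun x : Σ i : Fin r.length, Fin (M (r[(i : ℕ)]).1) => C x.1 x.2) (arcNext hM' ⟨i, m, hm⟩) =
      C i m at hx
    rcases (Nat.succ_le_of_lt hm).lt_or_eq with h1 | h1
    · rw [arcNext_of_lt hM' h1] at hx
      have := (hcuts i).alternate m h1
      beta_reduce at hx
      rw [this] at hx
      simp at hx
    · refine ⟨h1, ?_⟩
      rw [arcNext_last hM' h1] at hx
      have h2 : M (r[(i : ℕ)]).1 - 1 = m := by omega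
      simp only [hC, arcIndex] at hx
      unfold firstColour lastColour
      rw [h2]
      rw [h2, Nat.sub_self] at hx
      simpa only [apply_ite (c _), Nat.sub_zero] using hx
  -- A junction without change of colour determines the slot that it ends.
  have hinj : Fintype.card {x // d.κ (d.nxt x) = d.κ x} ≤
      Fintype.card {i : Fin r.length // firstColour M c r[(slotSucc i : ℕ)] =
        lastColour M c r[(i : ℕ)]} := by
    refine Fintype.card_le_of_injective (fun x => ⟨x.1.1, (hlast x.1 x.2).2⟩) ?_
    rintro ⟨⟨i, m, hm⟩, hx⟩ ⟨⟨i', m', hm'⟩, hx'⟩ he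
    obtain rfl : i = i' := congrArg Subtype.val he
    have h1 := (hlast _ hx).1
    have h2 := (hlast _ hx').1
    simp only at h1 h2
    obtain rfl : m = m' := by omega
    rfl
  rw [hTcard] at hcount
  rw [hcard] at hcompl hle
  omega

end Arcs

end PLCover

namespace PLCover

open Geometry

/-! ### Necessity of the two conditions. -/

section Main

variable {k : ℕ} {r : List (Fin k × Bool)}

theorem exists_loopPoint_affine (n : ℕ) (x : Fin k) (m : Fin 3) :
    ∃ A B : PresVertex k n →₀ ℝ, ∀ u ∈ Set.Icc ((m : ℕ) : ℝ) ((m : ℕ) + 1),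
      loopPoint n x u = A + u • B := by
  fin_cases m
  · refine ⟨Finsupp.single .base 1, Finsupp.single (.loop x 0) 1 - Finsupp.single .base 1, ?_⟩
    intro u hu
    simp only [Nat.cast_zero, zero_add] at hu
    rw [loopPoint_first x hu]
    module
  · refine ⟨(2 : ℝ) • Finsupp.single (.loop x 0) 1 - Finsupp.single (.loop x 1) 1,
      Finsupp.single (.loop x 1) 1 - Finsupp.single (.loop x 0) 1, ?_⟩
    intro u hu
    simp only [Nat.cast_one] at hu
    have := loopPoint_second (n := n) x (v := u - 1) ⟨by linarith [hu.1], by linarith [hu.2]⟩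
    rw [add_sub_cancel] at this
    rw [this]
    module
  · refine ⟨(3 : ℝ) • Finsupp.single (.loop x 1) 1 - (2 : ℝ) • Finsupp.single .base 1,
      Finsupp.single .base 1 - Finsupp.single (.loop x 1) 1, ?_⟩
    intro u hu
    simp only [Nat.cast_ofNat] at hu
    have := loopPoint_third (n := n) x (v := u - 2) ⟨by linarith [hu.1], by linarith [hu.2]⟩
    rw [add_sub_cancel] at this
    rw [this]
    module

/-- Each third of the loop is parametrized affinely, so every simplex pulls back to a closed
interval there. The finitely many simplices give a finite cover by intervals. -/
theorem exists_loop_cuts {n : ℕ} (x : Fin k) {K : Bool → SimplicialComplex ℝ (PresVertex k n →₀ ℝ)}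
    (hK : ∀ b, (K b).faces.Finite)
    (hcov : ∀ u ∈ Set.Icc (0 : ℝ) 3, ∃ b, loopPoint n x u ∈ (K b).space) :
    ∃ M, HasCuts (fun b => {u | loopPoint n x u ∈ (K b).space}) 0 3 M := by
  classical
  let F : Finset (Σ _ : Bool, Finset (PresVertex k n →₀ ℝ) × Fin 3) :=
    Finset.univ.sigma fun b => (hK b).toFinset ×ˢ Finset.univ
  refine exists_hasCuts F (I := fun i => Set.Icc ((i.2.2 : ℕ) : ℝ) ((i.2.2 : ℕ) + 1) ∩
    loopPoint n x ⁻¹' convexHull ℝ (i.2.1 : Set (PresVertex k n →₀ ℝ))) (β := fun i => i.1)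
    ?_ ?_ ?_ (by norm_num) ?_
  · intro i _
    exact isClosed_Icc.inter
      ((i.2.1.finite_toSet.isClosed_convexHull ℝ).preimage (continuous_loopPoint n x))
  · rintro ⟨b, σ, m⟩ _
    obtain ⟨A, B, hAB⟩ := exists_loopPoint_affine n x m
    apply Convex.ordConnected
    intro u hu w hw α β hα hβ hαβ
    have hm := convex_Icc _ _ hu.1 hw.1 hα hβ hαβ
    refine ⟨hm, ?_⟩
    have h1 := convex_convexHull ℝ _ hu.2 hw.2 hα hβ hαβ
    rw [Set.mem_preimage, hAB _ hm]
    rw [hAB _ hu.1, hAB _ hw.1] at h1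
    convert h1 using 1
    have : A = (α + β) • A := by rw [hαβ, one_smul]
    conv_lhs => rw [this]
    simp only [smul_eq_mul]
    module
  · rintro ⟨b, σ, m⟩ hi u hu
    simp only [F, Finset.mem_sigma, Finset.mem_product, Set.Finite.mem_toFinset] at hi
    exact SimplicialComplex.mem_space_iff.2 ⟨σ, hi.2.1, hu.2⟩
  · intro u hu
    obtain ⟨b, hb⟩ := hcov u hu
    obtain ⟨σ, hσ, huσ⟩ := SimplicialComplex.mem_space_iff.1 hb
    have hm : ∃ m : Fin 3, u ∈ Set.Icc ((m : ℕ) : ℝ) ((m : ℕ) + 1) := by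
      obtain ⟨v, hv, h⟩ := exists_third hu
      rcases h with rfl | rfl | rfl
      · exact ⟨0, by simpa using hv⟩
      · exact ⟨1, by simp; constructor <;> linarith [hv.1, hv.2]⟩
      · exact ⟨2, by simp; constructor <;> linarith [hv.1, hv.2]⟩
    obtain ⟨m, hm⟩ := hm
    exact Set.mem_iUnion₂.2 ⟨⟨b, σ, m⟩, by simp [F, hσ], hm, huσ⟩

/-- Without an algebraic collapse both members are proper, so no loop lies in one of them and every
loop has at least two alternating arcs. The rest is the count of arcs on the boundary circle. -/
theorem isExceptional_of_covered (hk : 0 < k) (hr : ∀ x : Fin k, ∃ b : Bool, (x, b) ∈ r)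
    (hcov : CoveredByTwoPLCollapsibles (presentationPolyhedron r))
    (h : ¬ AdmitsAlgebraicCollapse r) : IsExceptionalPresentation r := by
  obtain ⟨b₀, hb₀⟩ := hr ⟨0, hk⟩
  have hn : 0 < r.length := List.length_pos_of_mem hb₀
  obtain ⟨Q₁, Q₂, -, -, hQ₁, hQ₂, hunion⟩ := hcov
  have hP := not_plCollapsible_presentation hk hr h
  have hne₁ : Q₁ ≠ presentationPolyhedron r := fun he => hP (he ▸ hQ₁)
  have hne₂ : Q₂ ≠ presentationPolyhedron r := fun he => hP (he ▸ hQ₂)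
  obtain ⟨K₁, ⟨hf₁, rfl⟩, hc₁⟩ := hQ₁
  obtain ⟨K₂, ⟨hf₂, rfl⟩, hc₂⟩ := hQ₂
  set K : Bool → SimplicialComplex ℝ (PresVertex k (3 * r.length) →₀ ℝ) :=
    fun b => if b then K₁ else K₂ with hKdef
  have hK : ∀ b, (K b).faces.Finite := by rintro (_ | _) <;> simpa [hKdef]
  have hne : ∀ b, (K b).space ≠ presentationPolyhedron r := by rintro (_ | _) <;> simpa [hKdef]
  have hlogs : ∀ b, HasLogs (K b).space := by
    rintro (_ | _)
    · simpa [hKdef] using HasLogs.of_collapsible hc₂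
    · simpa [hKdef] using HasLogs.of_collapsible hc₁
  have hsub : ∀ b, (K b).space ⊆ presentationPolyhedron r := by
    rw [← hunion]
    rintro (_ | _)
    · simp [hKdef]
    · simp [hKdef]
  have hmem : ∀ y ∈ presentationPolyhedron r, ∃ b, y ∈ (K b).space := by
    intro y hy
    rw [← hunion] at hy
    rcases hy with hy | hy
    · exact ⟨true, by simpa [hKdef] using hy⟩
    · exact ⟨false, by simpa [hKdef] using hy⟩
  have hclosed : ∀ b, IsClosed (K b).space := fun b => isClosed_space (hK b)
  obtain ⟨Ψ, hΨ, himage, hbd⟩ := exists_discMap hn hr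
  have hslot : ∀ (j : Fin r.length), ∀ u ∈ Set.Icc (0 : ℝ) 3,
      Ψ (circlePoint (3 * r.length) (slotPosition r j u)) = loopPoint _ (r[(j : ℕ)]).1 u :=
    fun j u hu => boundary_slotPosition hbd j hu
  have hX : LogCover Ψ fun b => (K b).space :=
    ⟨hΨ, hclosed, fun b => himage ▸ hsub b, fun z hz => hmem _ (himage ▸ ⟨z, hz, rfl⟩), hlogs⟩
  have hloop : ∀ (x : Fin k), ∀ u ∈ Set.Icc (0 : ℝ) 3, ∃ z ∈ Metric.sphere (0 : ℂ) 1,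
      Ψ z = loopPoint _ x u := by
    intro x u hu
    obtain ⟨j, hj, rfl⟩ := exists_slot hr x
    exact ⟨_, circlePoint_mem _ _, hslot ⟨j, hj⟩ u hu⟩
  have hloop' : ∀ z ∈ Metric.sphere (0 : ℂ) 1, ∃ x : Fin k, ∃ u ∈ Set.Icc (0 : ℝ) 3,
      Ψ z = loopPoint _ x u := by
    intro z hz
    obtain ⟨j, u, hu, rfl⟩ := exists_slotPosition_eq hn hz
    exact ⟨_, u, hu, hslot j u hu⟩
  have hcuts : ∀ x : Fin k, ∃ M s c p q, 2 ≤ M ∧ AlternatingCuts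
      (fun b => {u | loopPoint (3 * r.length) x u ∈ (K b).space}) 0 3 M s c p q := by
    intro x
    refine exists_alternatingCuts
      (fun b => (hclosed b).preimage (continuous_loopPoint _ x)) (by norm_num) ?_ ?_
    · intro b hb
      obtain ⟨u, hu, hu'⟩ := exists_loopPoint_notMem hΨ hloop' (hloop x) (hclosed b)
        (himage ▸ hsub b) (hlogs b) (himage ▸ hne b)
      exact hu' (hb hu)
    · refine exists_loop_cuts x hK fun u hu => hmem _ ?_
      obtain ⟨z, hz, he⟩ := hloop x u hu
      rw [← he, ← himage]
      exact ⟨z, Metric.sphere_subset_closedBall hz, rfl⟩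
  choose M s c p q hM hcut using hcuts
  exact isExceptional_of_count hk hr h hM (count_arcs hn hX hslot hM hcut)

end Main

end PLCover

/-- A one-relator presentation `⟨x₁, …, x_k | r⟩`, `k ≥ 1`, in which every generator appears in
the relator, has a presentation complex that is the union of two PL collapsible subpolyhedra if
and only if `r` admits an algebraic collapse or the presentation is `⟨x | x x⁻¹⟩` or
`⟨x | x⁻¹ x⟩`. -/
theorem theorem3p3 (k : ℕ) (hk : 0 < k) (r : List (Fin k × Bool))
    (hr : ∀ x : Fin k, ∃ b : Bool, (x, b) ∈ r) :
    CoveredByTwoPLCollapsibles (presentationPolyhedron r) ↔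
      AdmitsAlgebraicCollapse r ∨ IsExceptionalPresentation r := by
  constructor
  · intro h
    by_cases ha : AdmitsAlgebraicCollapse r
    · exact Or.inl ha
    · exact Or.inr (PLCover.isExceptional_of_covered hk hr h ha)
  · rintro (h | h)
    · exact PLCover.covered_of_admitsAlgebraicCollapse h
    · exact PLCover.covered_of_isExceptionalPresentation h
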